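/- **Notation.** Put $\langle\xi\rangle=1+|\xi|$ and $\hat u(\xi)=\int e^{-i\xi x}u(x)\,dx$ (similarly $\hat u(\xi,\tau)=\iint e^{-i(\xi x+\tau t)}u(x,t)\,dx\,dt$), extended to tempered distributions. Let $\|u\|_{H^s(\mathbb R)}^2=\int\langle\xi\rangle^{2s}|\hat u(\xi)|^2d\xi$ and $$\|u\|_{X^{s,b}}^2=\iint\langle\xi\rangle^{2s}\langle\tau-\xi^2\rangle^{2b}|\hat u(\xi,\tau)|^2\,d\xi\,d\tau .$$ For $\sigma\in\mathbb R$ let $H_0^\sigma(\mathbb R^+)$ be the space of $u\in H^\sigma(\mathbb R)$ with $\operatorname{supp}u\subset[0,\infty)$, with the norm of $H^\sigma(\mathbb R)$, and let $C_0^\infty(\mathbb R^+)$ be the set of $f\in C^\infty(\mathbb R)$ with $\operatorname{supp}f\subset[0,\infty)$. Fix $\psi\in C^\infty(\mathbb R)$ real-valued with $\psi=1$ on $[-1,1]$ and $\operatorname{supp}\psi\subset[-2,2]$. For $\alpha\in\mathbb R$ and $f\in C_0^\infty(\mathbb R^+)$ let $\mathcal I_\alpha f=\frac{t_+^{\alpha-1}}{\Gamma(\alpha)}*f$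 be the Riemann–Liouville fractional integral, where $\frac{t_+^{\alpha-1}}{\Gamma(\alpha)}=\partial_t^k\frac{t_+^{\alpha+k-1}}{\Gamma(\alpha+k)}$ for $k\in\mathbb N$ with $\alpha+k>0$. Let $$\mathcal Lf(x,t)=\frac1{\sqrt\pi}\int_0^t(t-t')^{-1/2}e^{-\frac{ix^2}{4(t-t')}}\,\mathcal I_{-1/2}f(t')\,dt' ,$$ and for real $\lambda>-1$ $$\mathcal L^\lambda f(x,t)=\Big[\tfrac{x_-^{\lambda-1}}{\Gamma(\lambda)}*\mathcal L(\mathcal I_{-\lambda/2}f)(\cdot,t)\Big](x),$$ which equals $\frac1{\Gamma(\lambda)}\int_x^\infty(y-x)^{\lambda-1}\mathcal L(\mathcal I_{-\lambda/2}f)(y,t)\,dy$ if $\lambda>0$; for $-1<\lambda\le0$, $\frac{x_-^{\lambda-1}}{\Gamma(\lambda)}=-\partial_x\frac{x_-^{\lambda}}{\Gamma(\lambda+1)}$. **Lemma.** Let $s,\lambda\in\mathbb R$ and $\sigma=\frac{2s+1}4$. (a) (Space traces) If $s-\frac32<\lambda<s+\frac12$ and $-1<\lambda<\frac12$, then $f\mapsto\mathcal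 L^\lambda f$, defined for $f\in C_0^\infty(\mathbb R^+)$ with $\operatorname{supp}f\subset[0,1]$, extends to a linear operator from $\{f\in H_0^\sigma(\mathbb R^+):\operatorname{supp}f\subset[0,1]\}$ to $C(\mathbb R_t;H^s(\mathbb R_x))$ with $$\sup_{t\in\mathbb R}\|\mathcal L^\lambda f(\cdot,t)\|_{H^s(\mathbb R_x)}\le c\,\|f\|_{H_0^\sigma(\mathbb R^+)},\qquad c=c(s,\lambda).$$ (b) (Time traces) If $-1<\lambda<1$, then $f\mapsto\psi(t)\mathcal L^\lambda f$, defined for $f\in C_0^\infty(\mathbb R^+)\cap H_0^\sigma(\mathbb R^+)$, extends to a linear operator from $H_0^\sigma(\mathbb R^+)$ to $C(\mathbb R_x;H_0^\sigma(\mathbb R_t^+))$ with $$\sup_{x\in\mathbb R}\|\psi\,\mathcal L^\lambda f(x,\cdot)\|_{H_0^\sigma(\mathbb R_t^+)}\le c\,\|f\|_{H_0^\sigma(\mathbb R^+)},\qquad c=c(s,\lambda,\psi).$$ (c) (Bourgain spaces) If $b<\frac12$, $s-\frac12<\lambda<s+\frac12$ and $-1<\lambda<\frac12$, then $f\mapsto\psi(t)\mathcal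 L^\lambda f$, defined for $f\in C_0^\infty(\mathbb R^+)\cap H_0^\sigma(\mathbb R^+)$, extends to a linear operator from $H_0^\sigma(\mathbb R^+)$ to $X^{s,b}$ with $$\|\psi(t)\mathcal L^\lambda f(x,t)\|_{X^{s,b}}\le c\,\|f\|_{H_0^\sigma(\mathbb R^+)},\qquad c=c(s,b,\lambda,\psi).$$ -/

import Mathlib

open MeasureTheory Filter Topology Set
open scoped SchwartzMap FourierTransform ENNReal NNReal ContDiff

namespace HalfLine

/-! ### The boundary forcing operators on smooth data -/

/-- `C_0^∞(ℝ⁺)`: smooth functions on the line with support in `[0, ∞)`. -/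
structure IsSmoothHalfLine (f : ℝ → ℂ) : Prop where
  contDiff : ContDiff ℝ ∞ f
  support : tsupport f ⊆ Ici 0

/-- A cutoff function: smooth, equal to `1` on `[-1, 1]`, with support in `[-2, 2]`. -/
structure IsCutoff (ψ : ℝ → ℝ) : Prop where
  contDiff : ContDiff ℝ ∞ ψ
  eq_one : ∀ t ∈ Icc (-1 : ℝ) 1, ψ t = 1
  support : tsupport ψ ⊆ Icc (-2) 2

/-- The least natural number `k` with `0 < α + k`: the number of derivatives used to
continue `t_+^{α-1} / Γ(α)` and `x_-^{α-1} / Γ(α)` from positive to arbitrary real `α`. -/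
noncomputable def contOrder (α : ℝ) : ℕ := if 0 < α then 0 else ⌊-α⌋₊ + 1

theorem contOrder_spec (α : ℝ) : 0 < α + contOrder α := by
  unfold contOrder
  split_ifs with h
  · simpa using h
  · have := Nat.lt_floor_add_one (-α)
    push_cast
    linarith

/-- The pairing of the distribution `t_+^{α-1} / Γ(α)` with `φ`, for `φ` smooth with
support bounded above. For `0 < α` it is `(1 / Γ(α)) ∫_0^∞ t^{α-1} φ(t) dt`, and in general
`t_+^{α-1} / Γ(α) = ∂_t^k (t_+^{α+k-1} / Γ(α+k))`. -/
noncomputable def plusPairing (α : ℝ) (φ : ℝ → ℂ) : ℂ :=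
  (-1) ^ contOrder α * (1 / (Real.Gamma (α + contOrder α) : ℂ)) *
    ∫ t in Ioi (0 : ℝ), ((t ^ (α + contOrder α - 1) : ℝ) : ℂ) * iteratedDeriv (contOrder α) φ t

/-- The Riemann-Liouville fractional integral `I_α f = (t_+^{α-1} / Γ(α)) * f` of a function
`f ∈ C_0^∞(ℝ⁺)`, for every real order `α`. -/
noncomputable def fracIntegral (α : ℝ) (f : ℝ → ℂ) (t : ℝ) : ℂ :=
  plusPairing α (fun r => f (t - r))

/-- The Duhamel boundary forcing operator
`L f(x,t) = 2 e^{-iπ/4} ∫_0^t e^{-i(t-t')∂_x²} δ_0(x) I_{-1/2} f(t') dt'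
= π^{-1/2} ∫_0^t (t-t')^{-1/2} e^{-ix²/(4(t-t'))} I_{-1/2} f(t') dt'`. -/
noncomputable def forcing (f : ℝ → ℂ) (x t : ℝ) : ℂ :=
  (1 / (Real.sqrt Real.pi : ℂ)) * ∫ r in (0 : ℝ)..t,
    (((t - r) ^ (-(1 / 2) : ℝ) : ℝ) : ℂ) *
      Complex.exp (-(Complex.I * (x : ℂ) ^ 2 / (4 * ((t - r : ℝ) : ℂ)))) *
      fracIntegral (-(1 / 2)) f r

/-- The convolution `(x_-^{μ-1} / Γ(μ)) * G` with a continuous rapidly decreasing function `G`.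
For `0 < μ` it is `(1 / Γ(μ)) ∫_x^∞ (y-x)^{μ-1} G(y) dy`, and in general
`x_-^{μ-1} / Γ(μ) = (-1)^k ∂_x^k (x_-^{μ+k-1} / Γ(μ+k))`, where the derivatives are taken
of the convolution. -/
noncomputable def minusConv (μ : ℝ) (G : ℝ → ℂ) (x : ℝ) : ℂ :=
  (-1) ^ contOrder μ * iteratedDeriv (contOrder μ)
    (fun z : ℝ => (1 / (Real.Gamma (μ + contOrder μ) : ℂ)) *
      ∫ y in Ioi z, (((y - z) ^ (μ + contOrder μ - 1) : ℝ) : ℂ) * G y) x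

/-- The analytic family
`L^μ f(x,t) = [(x_-^{μ-1} / Γ(μ)) * L(I_{-μ/2} f)(·,t)](x)`, for real `μ > -1`. -/
noncomputable def forcingFamily (μ : ℝ) (f : ℝ → ℂ) (x t : ℝ) : ℂ :=
  minusConv μ (fun y => forcing (fracIntegral (-μ / 2) f) y t) x

/-! ### Function spaces, as spaces of tempered distributions -/

/-- The tempered distribution `T` is (integration against) the function `g`. -/
def IsFunction {E : Type*} [NormedAddCommGroup E] [NormedSpace ℝ E] [MeasureSpace E]
    (T : 𝓢'(E, ℂ)) (g : E → ℂ) : Prop :=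
  ∀ φ : 𝓢(E, ℂ), Integrable (fun x => φ x * g x) ∧ T φ = ∫ x, φ x * g x

/-- The norm of `H^s(ℝ)`, that is `(∫ (1+|ξ|)^{2s} |û(ξ)|² dξ)^{1/2}` with
`û(ξ) = ∫ e^{-iξx} u(x) dx`, written through the Fourier transform `𝓕` with
`û(ξ) = 𝓕 u (ξ / 2π)`; it is `∞` if `u ∉ H^s(ℝ)`, in particular if `û` is not a function. -/
noncomputable def sobolevNorm (s : ℝ) (u : 𝓢'(ℝ, ℂ)) : ℝ≥0∞ :=
  ⨅ (g : ℝ → ℂ) (_ : AEStronglyMeasurable g volume) (_ : IsFunction (𝓕 u) g),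
    (ENNReal.ofReal (2 * Real.pi) *
      ∫⁻ ξ, ENNReal.ofReal ((1 + |2 * Real.pi * ξ|) ^ (2 * s)) * ‖g ξ‖ₑ ^ 2) ^ (1 / 2 : ℝ)

/-- `H_0^s(ℝ⁺)`: the elements of `H^s(ℝ)` with support in `[0, ∞)`, with the norm of `H^s(ℝ)`.
For `s < 0` this is the dual space of `H^{-s}(ℝ⁺)`. -/
def MemHZero (s : ℝ) (u : 𝓢'(ℝ, ℂ)) : Prop :=
  sobolevNorm s u < ⊤ ∧ Distribution.dsupport u ⊆ Ici 0

/-- `u ∈ C(ℝ; H^s(ℝ))`. -/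
def ContinuousIntoSobolev (s : ℝ) (u : ℝ → 𝓢'(ℝ, ℂ)) : Prop :=
  (∀ r, sobolevNorm s (u r) < ⊤) ∧
    ∀ r₀, Tendsto (fun r => sobolevNorm s (u r - u r₀)) (𝓝 r₀) (𝓝 0)

/-- `u ∈ C(ℝ; H_0^s(ℝ⁺))`. -/
def ContinuousIntoHZero (s : ℝ) (u : ℝ → 𝓢'(ℝ, ℂ)) : Prop :=
  (∀ r, MemHZero s (u r)) ∧
    ∀ r₀, Tendsto (fun r => sobolevNorm s (u r - u r₀)) (𝓝 r₀) (𝓝 0)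

/-- The norm of the Bourgain space `X^{s,b}`, that is
`(∫∫ (1+|ξ|)^{2s} (1+|τ-ξ²|)^{2b} |û(ξ,τ)|² dξ dτ)^{1/2}` with
`û(ξ,τ) = ∫ e^{-i(ξx+τt)} u(x,t) dx dt`, for distributions in `(x,t) = (p 0, p 1)`, written
through `𝓕` with `û(ξ,τ) = 𝓕 u (ξ / 2π, τ / 2π)`; it is `∞` if `u ∉ X^{s,b}`. -/
noncomputable def bourgainNorm (s b : ℝ) (u : 𝓢'(EuclideanSpace ℝ (Fin 2), ℂ)) : ℝ≥0∞ :=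
  ⨅ (g : EuclideanSpace ℝ (Fin 2) → ℂ) (_ : AEStronglyMeasurable g volume)
    (_ : IsFunction (𝓕 u) g),
    (ENNReal.ofReal ((2 * Real.pi) ^ 2) *
      ∫⁻ q, ENNReal.ofReal ((1 + |2 * Real.pi * q 0|) ^ (2 * s) *
        (1 + |2 * Real.pi * q 1 - (2 * Real.pi * q 0) ^ 2|) ^ (2 * b)) * ‖g q‖ₑ ^ 2) ^ (1 / 2 : ℝ)

end HalfLine

/-! The Laplace transform in time and the Fourier transform in space diagonalise the operator. On a
vertical line p = γ + 2πiτ with γ > 0, the fractional integral of order α is multiplication by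
p^{-α}, the Schrödinger group has resolvent symbol 1/(p - 4π²iξ²), and convolution with
x_-^{μ-1}/Γ(μ) is multiplication by (-2πiξ)^{-μ}. For compactly supported data this gives
(`forcingFamily_eq_lapInv`) L^μ f(x,t) = ∫ e^{pt} N_μ(x,p) p^{(μ+1)/2} f̃(p) dτ, with N_μ(x,p) =
2e^{-iπ/4} ∫ e^{2πixξ} (-2πiξ)^{-μ} / (p - 4π²iξ²) dξ, where f̃ is the Laplace transform. For μ = 0
the profile is explicit: N_0 = p^{-1/2} e^{-κ|x|} with κ² = ip and Re κ > 0.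

Time traces. The scale invariant bound |N_μ(x,p)| ≤ C |p|^{-(μ+1)/2}, uniform in x
(`norm_kernelN_le_scale`), exactly cancels the factor p^{(μ+1)/2}. So, with γ = 1, the Fourier
transform in t of e^{-t} L^μ f(x,·) is pointwise bounded by |f̃|, and multiplication by the smooth
cutoff ψ(t)e^t is bounded on H^σ for every real σ.

Space traces. Integrating in τ before ξ shows that the spatial Fourier transform of L^μ f(·,t) is a
constant times (-2πiξ)^{-μ} S(2πξ²,t), where S(η,t) is the Cauchy integral of e^{pt} p^{(μ+1)/2}
f̃(p) against 1/(γ + 2πi(τ - η)). The substitution η = 2πξ² turns the H^s norm into an L² norm of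
S(·,t) with weight |η|^{-μ-1/2}(1+|η|)^s. The Cauchy operators are bounded in that weighted space
uniformly in γ (`lintegral_powW_cauchyOp_sq_le`) when the square root of the weight has exponents in
(-1/2, 1/2) both at the origin and at infinity, and this is what the conditions on μ say. Letting γ
tend to 0 removes the factor e^{2γt}, so the bound is uniform over all times, and the exponents add
up to s + 1/2 = 2σ (`lintegral_sobolev_profileG_le`).

Bourgain spaces. Each mode solves S' = g + 2πiηS with g the fractional derivative of f of order
(μ+1)/2. After a cutoff in time its Fourier transform is (1+2πi(τ-η))^{-1} times the sum of the
transform of another cut off mode and that of the cut off g (`modeF_identity`). The former term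
reduces to the space estimate through Plancherel in time. For the latter, the ξ integral of the
weights is at most a constant times ⟨τ⟩^{s-μ-1/2} (`exists_lintegral_profileK_conv_le`), where b <
1/2 and s - 1/2 < μ < s + 1/2 are used.

Data without compact support are handled by causality: ψ L^μ f sees f only on times at most 2, so f
may be multiplied by a wider cutoff. The extension to distributions uses no density of smooth
functions: the operator on smooth data is a bounded linear relation between weighted L² spaces on
the Fourier side, it extends to the closure of its domain, and it is composed with the orthogonal
projection onto that closure (`exists_clm_of_graph`, `exists_extension`). -/

namespace HalfLine

/-! ### Tempered distributions with weighted square integrable Fourier transform -/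

section Distributions

variable {E : Type*} [NormedAddCommGroup E] [InnerProductSpace ℝ E] [FiniteDimensional ℝ E]
  [MeasurableSpace E] [BorelSpace E]

/-- A bump function equal to `1` near the point turns integrability against Schwartz functions into
integrability on a ball. -/
theorem IsFunction.locallyIntegrable {T : 𝓢'(E, ℂ)} {g : E → ℂ} (h : IsFunction T g) :
    LocallyIntegrable g volume := by
  intro x
  let q : ContDiffBump x := ⟨1, 2, one_pos, one_lt_two⟩
  have hg₁ : HasCompactSupport (Complex.ofRealCLM ∘ q) := q.hasCompactSupport.comp_left rfl
  have hg₂ : ContDiff ℝ ∞ (Complex.ofRealCLM ∘ q) :=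
    Complex.ofRealCLM.contDiff.comp q.contDiff
  refine ⟨Metric.closedBall x 1, Metric.closedBall_mem_nhds x one_pos, ?_⟩
  refine ((h (hg₁.toSchwartzMap hg₂)).1.integrableOn (s := Metric.closedBall x 1)).congr_fun
    (fun y hy => ?_) measurableSet_closedBall
  simp [q.one_of_mem_closedBall hy]

theorem IsFunction.aestronglyMeasurable {T : 𝓢'(E, ℂ)} {g : E → ℂ} (h : IsFunction T g) :
    AEStronglyMeasurable g volume :=
  h.locallyIntegrable.aestronglyMeasurable

/-- This makes the infimum in the Sobolev and Bourgain norms run over a single almost everywhere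
class, so any representative computes the norm (`weightedNorm_eq`). -/
theorem IsFunction.ae_eq {T : 𝓢'(E, ℂ)} {g g' : E → ℂ} (h : IsFunction T g)
    (h' : IsFunction T g') : g =ᵐ[volume] g' := by
  have : ∀ᵐ x, (fun x => g x - g' x) x = 0 := by
    apply ae_eq_zero_of_integral_contDiff_smul_eq_zero
    · exact h.locallyIntegrable.sub h'.locallyIntegrable
    · intro q hq hqc
      have hg₁ : HasCompactSupport (Complex.ofRealCLM ∘ q) := hqc.comp_left rfl
      have hg₂ : ContDiff ℝ ∞ (Complex.ofRealCLM ∘ q) := by fun_prop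
      let φ := hg₁.toSchwartzMap hg₂
      have e1 := h φ
      have e2 := h' φ
      have : ∀ x, q x • (g x - g' x) = φ x * g x - φ x * g' x := by
        intro x
        simp [φ, mul_sub]
      simp_rw [this]
      rw [integral_sub e1.1 e2.1, ← e1.2, ← e2.2, sub_self]
  filter_upwards [this] with x hx
  exact sub_eq_zero.1 hx

theorem IsFunction.congr_ae {T : 𝓢'(E, ℂ)} {g g' : E → ℂ} (h : IsFunction T g)
    (hg : g =ᵐ[volume] g') : IsFunction T g' := by
  intro φ
  have : (fun x => φ x * g x) =ᵐ[volume] fun x => φ x * g' x := by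
    filter_upwards [hg] with x hx
    rw [hx]
  exact ⟨(h φ).1.congr this, (h φ).2.trans (integral_congr_ae this)⟩

theorem IsFunction.add {T T' : 𝓢'(E, ℂ)} {g g' : E → ℂ} (h : IsFunction T g)
    (h' : IsFunction T' g') : IsFunction (T + T') (fun x => g x + g' x) := by
  intro φ
  simp only [mul_add]
  refine ⟨(h φ).1.add (h' φ).1, ?_⟩
  rw [integral_add (h φ).1 (h' φ).1, ← (h φ).2, ← (h' φ).2]
  rfl

theorem IsFunction.smul {T : 𝓢'(E, ℂ)} {g : E → ℂ} (c : ℂ) (h : IsFunction T g) :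
    IsFunction (c • T) (fun x => c * g x) := by
  intro φ
  have : ∀ x, φ x * (c * g x) = c * (φ x * g x) := fun x => by ring
  simp only [this]
  refine ⟨(h φ).1.const_mul c, ?_⟩
  rw [integral_const_mul, ← (h φ).2]
  rfl

theorem IsFunction.sub {T T' : 𝓢'(E, ℂ)} {g g' : E → ℂ} (h : IsFunction T g)
    (h' : IsFunction T' g') : IsFunction (T - T') (fun x => g x - g' x) := by
  have h1 := h.add (h'.smul (-1))
  have h2 : T + (-1 : ℂ) • T' = T - T' := by
    ext φ
    change T φ + (-1 : ℂ) * T' φ = T φ - T' φ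
    ring
  rw [h2] at h1
  simpa [sub_eq_add_neg] using h1

theorem IsFunction.unique {T T' : 𝓢'(E, ℂ)} {g : E → ℂ} (h : IsFunction T g)
    (h' : IsFunction T' g) : T = T' := by
  ext φ
  rw [(h φ).2, (h' φ).2]

/-- The Fourier side weighted `L²` norm of a tempered distribution. -/
noncomputable def weightedNorm (k : ℝ≥0∞) (W : E → ℝ≥0∞) (u : 𝓢'(E, ℂ)) : ℝ≥0∞ :=
  ⨅ (g : E → ℂ) (_ : AEStronglyMeasurable g volume) (_ : IsFunction (𝓕 u) g),
    (k * ∫⁻ ξ, W ξ * ‖g ξ‖ₑ ^ 2) ^ (1 / 2 : ℝ)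

theorem weightedNorm_eq {k : ℝ≥0∞} {W : E → ℝ≥0∞} {u : 𝓢'(E, ℂ)} {g : E → ℂ}
    (h : IsFunction (𝓕 u) g) :
    weightedNorm k W u = (k * ∫⁻ ξ, W ξ * ‖g ξ‖ₑ ^ 2) ^ (1 / 2 : ℝ) := by
  apply le_antisymm
  · exact iInf_le_of_le g (iInf_le_of_le h.aestronglyMeasurable (iInf_le_of_le h le_rfl))
  · refine le_iInf fun g' => le_iInf fun _ => le_iInf fun h' => ?_
    have : ∫⁻ ξ, W ξ * ‖g ξ‖ₑ ^ 2 = ∫⁻ ξ, W ξ * ‖g' ξ‖ₑ ^ 2 := by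
      apply lintegral_congr_ae
      filter_upwards [h.ae_eq h'] with x hx
      rw [hx]
    rw [this]

theorem exists_of_weightedNorm_lt_top {k : ℝ≥0∞} (hk : k ≠ 0) {W : E → ℝ≥0∞} {u : 𝓢'(E, ℂ)}
    (h : weightedNorm k W u < ⊤) :
    ∃ g : E → ℂ, IsFunction (𝓕 u) g ∧ ∫⁻ ξ, W ξ * ‖g ξ‖ₑ ^ 2 < ⊤ := by
  unfold weightedNorm at h
  simp only [iInf_lt_iff] at h
  obtain ⟨g, _, hg, hlt⟩ := h
  refine ⟨g, hg, ?_⟩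
  rw [ENNReal.rpow_lt_top_iff_of_pos (by norm_num)] at hlt
  by_contra hc
  rw [not_lt, top_le_iff] at hc
  rw [hc, ENNReal.mul_top hk] at hlt
  exact lt_irrefl _ hlt

/-- A continuous positive weight whose inverse grows at most polynomially. -/
structure IsTemperedWeight (w : E → ℝ) : Prop where
  continuous : Continuous w
  pos : ∀ ξ, 0 < w ξ
  inv_le : ∃ (C : ℝ) (n : ℕ), ∀ ξ, (w ξ)⁻¹ ≤ C * (1 + ‖ξ‖) ^ n

/-- The measure with density `w⁻¹`. -/
noncomputable def invMeasure (w : E → ℝ) : Measure E :=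
  volume.withDensity fun ξ => ENNReal.ofReal (w ξ)⁻¹

instance invMeasure_isLocallyFinite {w : E → ℝ} [hw : Fact (IsTemperedWeight w)] :
    IsLocallyFiniteMeasure (invMeasure w) :=
  IsLocallyFiniteMeasure.withDensity_ofReal (hw.out.continuous.inv₀ fun ξ => (hw.out.pos ξ).ne')

theorem integrable_invMeasure_iff {F : Type*} [NormedAddCommGroup F] [NormedSpace ℝ F] {w : E → ℝ}
    (hw : IsTemperedWeight w) {g : E → F} :
    Integrable g (invMeasure w) ↔ Integrable (fun ξ => (w ξ)⁻¹ • g ξ) volume := by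
  unfold invMeasure
  rw [integrable_withDensity_iff_integrable_smul' (by
      have := hw.continuous.measurable
      fun_prop) (ae_of_all _ fun _ => ENNReal.ofReal_lt_top)]
  refine integrable_congr (ae_of_all _ fun ξ => ?_)
  simp [ENNReal.toReal_ofReal (inv_nonneg.2 (hw.pos ξ).le)]

theorem integral_invMeasure {F : Type*} [NormedAddCommGroup F] [NormedSpace ℝ F] {w : E → ℝ}
    (hw : IsTemperedWeight w) (g : E → F) :
    ∫ ξ, g ξ ∂(invMeasure w) = ∫ ξ, (w ξ)⁻¹ • g ξ := by
  unfold invMeasure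
  rw [integral_withDensity_eq_integral_toReal_smul (by
      have := hw.continuous.measurable
      fun_prop) (ae_of_all _ fun _ => ENNReal.ofReal_lt_top)]
  refine integral_congr_ae (ae_of_all _ fun ξ => ?_)
  simp [ENNReal.toReal_ofReal (inv_nonneg.2 (hw.pos ξ).le)]

/-- The polynomial bound on `w⁻¹` is absorbed by a larger power of `1 + ‖x‖`. This is the condition
under which elements of `L²` of this measure define tempered distributions. -/
instance invMeasure_hasTemperateGrowth {w : E → ℝ} [hw : Fact (IsTemperedWeight w)] :
    (invMeasure w).HasTemperateGrowth := by
  obtain ⟨C, n, hC⟩ := hw.out.inv_le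
  refine ⟨⟨n + (Module.finrank ℝ E + 1), ?_⟩⟩
  rw [integrable_invMeasure_iff hw.out]
  have h1 : Integrable (fun x : E => C * (1 + ‖x‖) ^ (-((Module.finrank ℝ E + 1 : ℕ) : ℝ))) := by
    refine Integrable.const_mul (integrable_one_add_norm ?_) _
    push_cast; linarith
  refine h1.mono' ?_ (ae_of_all _ fun x => ?_)
  · refine Continuous.aestronglyMeasurable ?_
    refine (hw.out.continuous.inv₀ fun ξ => (hw.out.pos ξ).ne').smul ?_
    exact Continuous.rpow_const (by fun_prop) fun x => Or.inl (by positivity)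
  · have h0 : 0 < 1 + ‖x‖ := by positivity
    rw [norm_smul, Real.norm_of_nonneg (inv_nonneg.2 (hw.out.pos x).le),
      Real.norm_of_nonneg (by positivity)]
    calc (w x)⁻¹ * (1 + ‖x‖) ^ (-((n + (Module.finrank ℝ E + 1) : ℕ) : ℝ))
        ≤ (C * (1 + ‖x‖) ^ n) * (1 + ‖x‖) ^ (-((n + (Module.finrank ℝ E + 1) : ℕ) : ℝ)) := by
          gcongr; exact hC x
      _ = C * (1 + ‖x‖) ^ (-((Module.finrank ℝ E + 1 : ℕ) : ℝ)) := by
          rw [mul_assoc, ← Real.rpow_natCast, ← Real.rpow_add h0]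
          congr 2
          push_cast; ring

variable (w : E → ℝ) [hw : Fact (IsTemperedWeight w)]

/-- The embedding of a weighted `L²` space, on the Fourier side, into tempered distributions. -/
noncomputable def ofWeightedL2 : Lp ℂ 2 (invMeasure w) →ₗ[ℂ] 𝓢'(E, ℂ) where
  toFun h := 𝓕⁻ (Lp.toTemperedDistributionCLM ℂ (invMeasure w) 2 h)
  map_add' h h' := by rw [map_add]; exact FourierInvAdd.fourierInv_add _ _
  map_smul' c h := by rw [map_smul]; exact FourierInvSMul.fourierInv_smul _ _

theorem ofWeightedL2_injective : Function.Injective (ofWeightedL2 w) := by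
  have hker := Lp.ker_toTemperedDistributionCLM_eq_bot (E := E) (F := ℂ) (μ := invMeasure w) (p := 2)
  rw [LinearMap.ker_eq_bot] at hker
  intro h h' hh
  apply hker
  have := congrArg (fun u : 𝓢'(E, ℂ) => 𝓕 u) hh
  simpa [ofWeightedL2] using this

variable {w}

/-- An element `h` of `L²(w⁻¹ dξ)` encodes the Fourier side function `w⁻¹ h`: pairing `h` with a
Schwartz function in the measure `w⁻¹ dξ` is pairing `w⁻¹ h` with it in Lebesgue measure. -/
theorem isFunction_fourier_ofWeightedL2 (h : Lp ℂ 2 (invMeasure w)) :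
    IsFunction (𝓕 (ofWeightedL2 w h)) (fun ξ => (w ξ)⁻¹ • h ξ) := by
  intro φ
  have h1 : 𝓕 (ofWeightedL2 w h) = Lp.toTemperedDistribution h := by
    simp [ofWeightedL2]
  have h2 : Integrable (fun ξ => φ ξ * h ξ) (invMeasure w) := by
    have a1 := φ.memLp 2 (invMeasure w)
    have a2 := Lp.memLp h
    exact a1.integrable_mul a2
  have h3 : ∀ ξ, φ ξ * (w ξ)⁻¹ • h ξ = (w ξ)⁻¹ • (φ ξ * h ξ) := fun ξ => by
    rw [mul_smul_comm]
  rw [h1, Lp.toTemperedDistribution_apply]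
  simp only [smul_eq_mul, h3]
  exact ⟨(integrable_invMeasure_iff hw.out).1 h2, integral_invMeasure hw.out _⟩

/-- Since w · w⁻² = w⁻¹, the encoding is an isometry up to the constant `k`, which lets Hilbert
space arguments act on distributions. -/
theorem lintegral_weight_mul_sq (h : E → ℂ) :
    ∫⁻ ξ, ENNReal.ofReal (w ξ) * ‖(w ξ)⁻¹ • h ξ‖ₑ ^ 2 = ∫⁻ ξ, ‖h ξ‖ₑ ^ 2 ∂(invMeasure w) := by
  unfold invMeasure
  rw [lintegral_withDensity_eq_lintegral_mul_non_measurable _ (by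
      have := hw.out.continuous.measurable
      fun_prop) (ae_of_all _ fun _ => ENNReal.ofReal_lt_top)]
  refine lintegral_congr fun ξ => ?_
  have hp := hw.out.pos ξ
  simp only [Pi.mul_apply]
  rw [enorm_smul, mul_pow, ← mul_assoc, Real.enorm_of_nonneg (inv_nonneg.2 hp.le),
    ← ENNReal.ofReal_pow (inv_nonneg.2 hp.le), ← ENNReal.ofReal_mul hp.le]
  congr 2
  field_simp

theorem enorm_sq_eq_lintegral {α : Type*} [MeasurableSpace α] {m : Measure α} (h : Lp ℂ 2 m) :
    ∫⁻ ξ, ‖h ξ‖ₑ ^ 2 ∂m = ‖h‖ₑ ^ 2 := by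
  rw [Lp.enorm_def, eLpNorm_eq_lintegral_rpow_enorm_toReal (by norm_num) (by norm_num)]
  simp only [ENNReal.toReal_ofNat, ENNReal.rpow_ofNat]
  rw [← ENNReal.rpow_natCast, ← ENNReal.rpow_mul]
  norm_num

theorem weightedNorm_ofWeightedL2 (k : ℝ≥0∞) (h : Lp ℂ 2 (invMeasure w)) :
    weightedNorm k (fun ξ => ENNReal.ofReal (w ξ)) (ofWeightedL2 w h) = k ^ (1 / 2 : ℝ) * ‖h‖ₑ := by
  rw [weightedNorm_eq (isFunction_fourier_ofWeightedL2 h), lintegral_weight_mul_sq,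
    enorm_sq_eq_lintegral, ENNReal.mul_rpow_of_nonneg _ _ (by norm_num)]
  congr 1
  rw [← ENNReal.rpow_natCast, ← ENNReal.rpow_mul]
  norm_num

theorem exists_isFunction_fourier {g : E → ℂ} (hg : AEStronglyMeasurable g volume)
    (hlt : ∫⁻ ξ, ENNReal.ofReal (w ξ) * ‖g ξ‖ₑ ^ 2 < ⊤) :
    ∃ h : Lp ℂ 2 (invMeasure w), IsFunction (𝓕 (ofWeightedL2 w h)) g := by
  have hp := hw.out.pos
  have hac : invMeasure w ≪ volume := withDensity_absolutelyContinuous _ _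
  have hm : AEStronglyMeasurable (fun ξ => w ξ • g ξ) (invMeasure w) :=
    (hw.out.continuous.aestronglyMeasurable.smul hg).mono_ac hac
  have hgw : ∀ ξ, (w ξ)⁻¹ • w ξ • g ξ = g ξ := fun ξ => by
    rw [smul_smul, inv_mul_cancel₀ (hp ξ).ne', one_smul]
  have hmem : MemLp (fun ξ => w ξ • g ξ) 2 (invMeasure w) := by
    refine ⟨hm, ?_⟩
    rw [eLpNorm_eq_lintegral_rpow_enorm_toReal (by norm_num) (by norm_num)]
    simp only [ENNReal.toReal_ofNat, ENNReal.rpow_ofNat]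
    rw [ENNReal.rpow_lt_top_iff_of_pos (by norm_num), ← lintegral_weight_mul_sq]
    simpa only [hgw] using hlt
  refine ⟨hmem.toLp, (isFunction_fourier_ofWeightedL2 _).congr_ae ?_⟩
  have h2 := hmem.coeFn_toLp
  unfold invMeasure at h2
  have h3 := (withDensity_absolutelyContinuous' (μ := volume) (f := fun ξ => ENNReal.ofReal (w ξ)⁻¹)
    (by
      have := hw.out.continuous.measurable
      fun_prop)
    (ae_of_all _ fun ξ => by simpa using hp ξ)).ae_eq h2
  filter_upwards [h3] with ξ hξ
  have h4 := hgw ξ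
  rw [← hξ] at h4
  exact h4

theorem exists_ofWeightedL2_eq {k : ℝ≥0∞} (hk : k ≠ 0) {u : 𝓢'(E, ℂ)}
    (hu : weightedNorm k (fun ξ => ENNReal.ofReal (w ξ)) u < ⊤) :
    ∃ h : Lp ℂ 2 (invMeasure w), ofWeightedL2 w h = u := by
  obtain ⟨g, hg, hlt⟩ := exists_of_weightedNorm_lt_top hk hu
  obtain ⟨h, hh⟩ := exists_isFunction_fourier (w := w) hg.aestronglyMeasurable hlt
  have := congrArg (fun u : 𝓢'(E, ℂ) => 𝓕⁻ u) (hh.unique hg)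
  exact ⟨h, by simpa using this⟩

/-- A bounded linear relation between a Hilbert space and a Banach space extends to a bounded
operator. -/
theorem exists_clm_of_graph {H Y : Type*} [NormedAddCommGroup H] [InnerProductSpace ℂ H]
    [CompleteSpace H] [NormedAddCommGroup Y] [NormedSpace ℂ Y] [CompleteSpace Y]
    (Γ : Submodule ℂ (H × Y)) (C : ℝ≥0) (hΓ : ∀ p ∈ Γ, ‖p.2‖ ≤ C * ‖p.1‖) :
    ∃ T : H →L[ℂ] Y, (∀ p ∈ Γ, T p.1 = p.2) ∧ ∀ h, ‖T h‖ ≤ C * ‖h‖ := by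
  -- The relation is extended to the closure `D` of its domain and then to `H` through the
  -- orthogonal projection onto `D`. The domain need not be dense, and the constant `C` is
  -- preserved.
  let D : Submodule ℂ H := (Γ.map (LinearMap.fst ℂ H Y)).topologicalClosure
  have hmem : ∀ p : Γ, p.1.1 ∈ D := fun p =>
    Submodule.le_topologicalClosure _ (Submodule.mem_map.2 ⟨p.1, p.2, rfl⟩)
  let e : Γ →ₗ[ℂ] D := LinearMap.codRestrict D ((LinearMap.fst ℂ H Y).comp Γ.subtype) hmem
  let f : Γ →ₗ[ℂ] Y := (LinearMap.snd ℂ H Y).comp Γ.subtype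
  have hbound : ∀ x : Γ, ‖f x‖ ≤ C * ‖e x‖ := fun x => hΓ x.1 x.2
  have hdense : DenseRange e := by
    rw [DenseRange, Subtype.dense_iff]
    intro x hx
    have hx' : x ∈ closure (Γ.map (LinearMap.fst ℂ H Y) : Set H) := hx
    refine closure_mono ?_ hx'
    rintro _ ⟨p, hp, rfl⟩
    exact ⟨e ⟨p, hp⟩, ⟨⟨p, hp⟩, rfl⟩, rfl⟩
  have hDc : IsClosed (D : Set H) := Submodule.isClosed_topologicalClosure _
  have : CompleteSpace D := hDc.completeSpace_coe
  -- The bound `hbound` forces the second component to vanish wherever the first does, so the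
  -- relation is a function on the range of `e`.
  let T₀ : D →L[ℂ] Y := f.extendOfNorm e
  refine ⟨T₀.comp D.orthogonalProjectionOnto, fun p hp => ?_, fun h => ?_⟩
  · have h1 : D.orthogonalProjectionOnto p.1 = e ⟨p, hp⟩ :=
      Submodule.orthogonalProjectionOnto_mem_subspace_eq_self (K := D) (e ⟨p, hp⟩)
    rw [ContinuousLinearMap.comp_apply, h1]
    exact LinearMap.extendOfNorm_eq hdense ⟨C, hbound⟩ ⟨p, hp⟩
  · rw [ContinuousLinearMap.comp_apply]
    refine (LinearMap.norm_extendOfNorm_apply_le hdense C hbound _).trans ?_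
    gcongr
    exact Submodule.norm_orthogonalProjectionOnto_apply_le D h

end Distributions

/-! ### Fourier inversion and Plancherel for functions and distributions -/

section Fourier

variable {E : Type*} [NormedAddCommGroup E] [InnerProductSpace ℝ E]
  [FiniteDimensional ℝ E] [MeasurableSpace E] [BorelSpace E]

theorem integral_fourier_mul_eq_flip {f g : E → ℂ} (hf : Integrable f) (hg : Integrable g) :
    ∫ x, 𝓕 f x * g x = ∫ x, f x * 𝓕 g x := by
  have h2 := VectorFourier.integral_fourierIntegral_smul_eq_flip (μ := volume) (ν := volume)
    (e := Real.fourierChar) (L := innerₗ E) Real.continuous_fourierChar continuous_inner hf hg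
  rw [flip_innerₗ] at h2
  exact h2

theorem integral_fourierInv_mul_eq_flip {f g : E → ℂ} (hf : Integrable f) (hg : Integrable g) :
    ∫ x, 𝓕⁻ f x * g x = ∫ x, f x * 𝓕⁻ g x := by
  rw [Real.fourierInv_eq_fourier_comp_neg, Real.fourierInv_eq_fourier_comp_neg,
    integral_fourier_mul_eq_flip hf.comp_neg hg,
    ← integral_neg_eq_self (fun x => f x * 𝓕 (fun y => g (-y)) x)]
  refine integral_congr_ae (ae_of_all _ fun x => ?_)
  simp only
  rw [← Real.fourierInv_eq_fourier_comp_neg, Real.fourierInv_eq_fourier_neg, neg_neg]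

theorem integrable_schwartz_mul {G : E → ℂ} (hG : Integrable G) (φ : 𝓢(E, ℂ)) :
    Integrable (fun x => φ x * G x) := by
  obtain ⟨C, -, hC⟩ := φ.decay 0 0
  refine hG.bdd_mul φ.continuous.aestronglyMeasurable (c := C) (ae_of_all _ fun x => ?_)
  simpa using hC x

/-- If `U` is the inverse Fourier transform of an integrable function `G`, then `G` is the Fourier
transform of the tempered distribution `U`. -/
theorem isFunction_fourier_of_integrable {G : E → ℂ} (hG : Integrable G)
    {T : 𝓢'(E, ℂ)} (hT : IsFunction T (𝓕⁻ G)) : IsFunction (𝓕 T) G := by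
  intro φ
  refine ⟨integrable_schwartz_mul hG φ, ?_⟩
  rw [TemperedDistribution.fourier_apply, (hT _).2,
    ← integral_fourierInv_mul_eq_flip (𝓕 φ : 𝓢(E, ℂ)).integrable hG]
  refine integral_congr_ae (ae_of_all _ fun x => ?_)
  simp only
  rw [← SchwartzMap.fourierInv_coe, FourierTransform.fourierInv_fourier_eq]

theorem continuous_fourierInv {G : E → ℂ} (hG : Integrable G) : Continuous (𝓕⁻ G) := by
  rw [Real.fourierInv_eq_fourier_comp_neg]
  exact VectorFourier.fourierIntegral_continuous Real.continuous_fourierChar continuous_inner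
    hG.comp_neg

theorem continuous_fourier {G : E → ℂ} (hG : Integrable G) : Continuous (𝓕 G) :=
  VectorFourier.fourierIntegral_continuous Real.continuous_fourierChar continuous_inner hG

theorem norm_fourierInv_le (G : E → ℂ) (x : E) : ‖𝓕⁻ G x‖ ≤ ∫ ξ, ‖G ξ‖ := by
  rw [Real.fourierInv_eq_fourier_neg]
  exact VectorFourier.norm_fourierIntegral_le_integral_norm _ _ _ _ _

theorem norm_fourier_le (G : E → ℂ) (x : E) : ‖𝓕 G x‖ ≤ ∫ ξ, ‖G ξ‖ :=
  VectorFourier.norm_fourierIntegral_le_integral_norm _ _ _ _ _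

theorem isFunction_of_isFunction_fourier {G : E → ℂ} (hG : Integrable G)
    {T : 𝓢'(E, ℂ)} (hT : IsFunction (𝓕 T) G) : IsFunction T (𝓕⁻ G) := by
  intro φ
  have h1 : T φ = (𝓕 T) (𝓕⁻ φ) := by
    rw [TemperedDistribution.fourier_apply, FourierTransform.fourier_fourierInv_eq]
  refine ⟨φ.integrable.mul_bdd (c := ∫ ξ, ‖G ξ‖) (continuous_fourierInv hG).aestronglyMeasurable
    (ae_of_all _ fun x => norm_fourierInv_le G x), ?_⟩
  rw [h1, (hT _).2, SchwartzMap.fourierInv_coe, integral_fourierInv_mul_eq_flip φ.integrable hG]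

theorem isFunction_toTemperedDistribution (h : Lp ℂ 2 (volume : Measure E)) :
    IsFunction (Lp.toTemperedDistribution h) h := by
  intro φ
  refine ⟨(φ.memLp 2 volume).integrable_mul (Lp.memLp h), ?_⟩
  rw [Lp.toTemperedDistribution_apply]
  rfl

/-- Plancherel's theorem for functions in `L¹ ∩ L²`. -/
theorem lintegral_fourier_sq {h : E → ℂ} (h1 : Integrable h) (h2 : MemLp h 2) :
    ∫⁻ ξ, ‖𝓕 h ξ‖ₑ ^ 2 = ∫⁻ x, ‖h x‖ₑ ^ 2 := by
  -- The Fourier integral of `h` and the `L²` Fourier transform represent the same tempered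
  -- distribution, hence agree almost everywhere, and the isometry of the latter applies.
  have e1 : IsFunction (𝓕 (Lp.toTemperedDistribution h2.toLp)) (𝓕 h) := by
    intro φ
    have hF := (continuous_fourier h1)
    refine ⟨φ.integrable.mul_bdd (c := ∫ ξ, ‖h ξ‖) hF.aestronglyMeasurable
      (ae_of_all _ fun x => norm_fourier_le h x), ?_⟩
    rw [← integral_fourier_mul_eq_flip φ.integrable h1, TemperedDistribution.fourier_apply,
      Lp.toTemperedDistribution_apply]
    refine integral_congr_ae ?_
    filter_upwards [h2.coeFn_toLp] with x hx
    rw [hx, smul_eq_mul, SchwartzMap.fourier_coe]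
  rw [Lp.fourier_toTemperedDistribution_eq] at e1
  have e2 := (isFunction_toTemperedDistribution (𝓕 h2.toLp)).ae_eq e1
  have e3 : ∫⁻ ξ, ‖𝓕 h ξ‖ₑ ^ 2 = ∫⁻ ξ, ‖(𝓕 h2.toLp : Lp ℂ 2 (volume : Measure E)) ξ‖ₑ ^ 2 := by
    refine lintegral_congr_ae ?_
    filter_upwards [e2] with x hx
    rw [hx]
  rw [e3, enorm_sq_eq_lintegral]
  have e4 : ‖(𝓕 h2.toLp : Lp ℂ 2 (volume : Measure E))‖ₑ = ‖h2.toLp‖ₑ := by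
    rw [← ofReal_norm, ← ofReal_norm, Lp.norm_fourier_eq]
  rw [e4, ← enorm_sq_eq_lintegral]
  refine lintegral_congr_ae ?_
  filter_upwards [h2.coeFn_toLp] with x hx
  rw [hx]

theorem lintegral_fourierInv_sq {h : E → ℂ} (h1 : Integrable h) (h2 : MemLp h 2) :
    ∫⁻ ξ, ‖𝓕⁻ h ξ‖ₑ ^ 2 = ∫⁻ x, ‖h x‖ₑ ^ 2 := by
  rw [Real.fourierInv_eq_fourier_comp_neg, lintegral_fourier_sq h1.comp_neg]
  · exact lintegral_neg_eq_self (fun x => ‖h x‖ₑ ^ 2)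
  · exact h2.comp_measurePreserving (Measure.measurePreserving_neg volume)

end Fourier

/-! ### Schur's test and Young's inequality -/

section Schur

/-- Schur's test. -/
theorem schur_test {α β : Type*} [MeasurableSpace α] [MeasurableSpace β] {m : Measure α}
    {n : Measure β} [SFinite m] [SFinite n] {K : α → β → ℝ≥0∞} (hK : Measurable (Function.uncurry K))
    {p : α → ℝ≥0∞} {q : β → ℝ≥0∞} (hp : Measurable p) (hq : Measurable q)
    (hq0 : ∀ᵐ y ∂n, q y ≠ 0) (hqt : ∀ᵐ y ∂n, q y ≠ ⊤)
    {A B : ℝ≥0∞} (hA : ∀ᵐ x ∂m, ∫⁻ y, K x y * q y ∂n ≤ A * p x)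
    (hB : ∀ᵐ y ∂n, ∫⁻ x, K x y * p x ∂m ≤ B * q y) {h : β → ℝ≥0∞} (hh : AEMeasurable h n) :
    ∫⁻ x, (∫⁻ y, K x y * h y ∂n) ^ 2 ∂m ≤ A * B * ∫⁻ y, h y ^ 2 ∂n := by
  have hKx : ∀ x, Measurable (K x) := fun x => hK.comp measurable_prodMk_left
  have key : ∀ᵐ x ∂m, (∫⁻ y, K x y * h y ∂n) ^ 2 ≤
      A * p x * ∫⁻ y, K x y * (h y ^ 2 * (q y)⁻¹) ∂n := by
    filter_upwards [hA] with x hx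
    -- The splitting K h = (K q)^{1/2} (K h²/q)^{1/2} prepares Cauchy–Schwarz; the first factor is
    -- controlled by `hA`, the second by `hB` after exchanging the integrals.
    have h1 : ∫⁻ y, K x y * h y ∂n =
        ∫⁻ y, (K x y * q y) ^ (1 / 2 : ℝ) * (K x y * (h y ^ 2 * (q y)⁻¹)) ^ (1 / 2 : ℝ) ∂n := by
      refine lintegral_congr_ae ?_
      filter_upwards [hq0, hqt] with y hy0 hyt
      rw [← ENNReal.mul_rpow_of_nonneg _ _ (by norm_num)]
      have : K x y * q y * (K x y * (h y ^ 2 * (q y)⁻¹)) = (K x y * h y) ^ 2 := by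
        calc _ = (q y * (q y)⁻¹) * (K x y * h y) ^ 2 := by ring
          _ = _ := by rw [ENNReal.mul_inv_cancel hy0 hyt, one_mul]
      rw [this, ← ENNReal.rpow_natCast, ← ENNReal.rpow_mul]
      norm_num
    have h2 := ENNReal.lintegral_mul_le_Lp_mul_Lq n Real.HolderConjugate.two_two
      (f := fun y => (K x y * q y) ^ (1 / 2 : ℝ))
      (g := fun y => (K x y * (h y ^ 2 * (q y)⁻¹)) ^ (1 / 2 : ℝ))
      (((hKx x).mul hq).pow_const _).aemeasurable
      (AEMeasurable.pow_const (f := fun y => K x y * (h y ^ 2 * (q y)⁻¹))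
        ((hKx x).aemeasurable.mul ((hh.pow_const 2).mul hq.inv.aemeasurable)) _)
    simp only [Pi.mul_apply] at h2
    rw [← h1] at h2
    have h3 : ∀ a : ℝ≥0∞, (a ^ (1 / 2 : ℝ)) ^ (2 : ℝ) = a := fun a => by
      rw [← ENNReal.rpow_mul]; norm_num
    have h4 : ∀ a : ℝ≥0∞, (a ^ (1 / 2 : ℝ)) ^ 2 = a := fun a => by
      rw [← ENNReal.rpow_natCast, ← ENNReal.rpow_mul]; norm_num
    simp only [h3] at h2
    calc (∫⁻ y, K x y * h y ∂n) ^ 2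
        ≤ ((∫⁻ y, K x y * q y ∂n) ^ (1 / 2 : ℝ) *
          (∫⁻ y, K x y * (h y ^ 2 * (q y)⁻¹) ∂n) ^ (1 / 2 : ℝ)) ^ 2 := by gcongr
      _ = (∫⁻ y, K x y * q y ∂n) * ∫⁻ y, K x y * (h y ^ 2 * (q y)⁻¹) ∂n := by
        rw [mul_pow, h4, h4]
      _ ≤ _ := by gcongr
  calc ∫⁻ x, (∫⁻ y, K x y * h y ∂n) ^ 2 ∂m
      ≤ ∫⁻ x, A * p x * ∫⁻ y, K x y * (h y ^ 2 * (q y)⁻¹) ∂n ∂m := lintegral_mono_ae key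
    _ = ∫⁻ x, A * ∫⁻ y, p x * (K x y * (h y ^ 2 * (q y)⁻¹)) ∂n ∂m := by
        refine lintegral_congr fun x => ?_
        rw [mul_assoc, lintegral_const_mul'']
        exact (hKx x).aemeasurable.mul ((hh.pow_const _).mul hq.inv.aemeasurable)
    _ ≤ A * ∫⁻ x, ∫⁻ y, p x * (K x y * (h y ^ 2 * (q y)⁻¹)) ∂n ∂m := by
        rw [lintegral_const_mul'']
        refine AEMeasurable.lintegral_prod_right' (f := fun z : α × β => p z.1 * (K z.1 z.2 * (h z.2 ^ 2 * (q z.2)⁻¹))) ?_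
        exact (hp.comp measurable_fst).aemeasurable.mul (hK.aemeasurable.mul
          (((hh.pow_const _).mul hq.inv.aemeasurable).comp_snd))
    _ = A * ∫⁻ y, ∫⁻ x, p x * (K x y * (h y ^ 2 * (q y)⁻¹)) ∂m ∂n := by
        rw [lintegral_lintegral_swap]
        exact (hp.comp measurable_fst).aemeasurable.mul (hK.aemeasurable.mul
          (((hh.pow_const _).mul hq.inv.aemeasurable).comp_snd))
    _ = A * ∫⁻ y, (∫⁻ x, K x y * p x ∂m) * (h y ^ 2 * (q y)⁻¹) ∂n := by
        congr 1
        refine lintegral_congr fun y => ?_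
        rw [← lintegral_mul_const]
        · refine lintegral_congr fun x => ?_
          ring
        · exact (hK.comp measurable_prodMk_right).mul hp
    _ ≤ A * ∫⁻ y, B * h y ^ 2 ∂n := by
        gcongr 1
        refine lintegral_mono_ae ?_
        filter_upwards [hB, hq0, hqt] with y hy hy0 hyt
        calc _ ≤ B * q y * (h y ^ 2 * (q y)⁻¹) := by gcongr
          _ = B * h y ^ 2 * (q y * (q y)⁻¹) := by ring
          _ = _ := by rw [ENNReal.mul_inv_cancel hy0 hyt, mul_one]
    _ = _ := by
        rw [lintegral_const_mul'' _ (hh.pow_const _), mul_assoc]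

/-- Young's inequality `L¹ * L² ⊆ L²` on the line. -/
theorem lintegral_conv_sq_le {k h : ℝ → ℝ≥0∞} (hk : Measurable k) (hh : AEMeasurable h volume) :
    ∫⁻ x, (∫⁻ y, k (x - y) * h y) ^ 2 ≤ (∫⁻ x, k x) ^ 2 * ∫⁻ y, h y ^ 2 := by
  have h1 := schur_test (m := volume) (n := volume) (K := fun x y : ℝ => k (x - y))
    (hk.comp (measurable_fst.sub measurable_snd)) (p := 1) (q := 1) measurable_const
    measurable_const (by simp) (by simp) (A := ∫⁻ x, k x) (B := ∫⁻ x, k x)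
    (ae_of_all _ fun x => by
      simp only [Pi.one_apply, mul_one]
      exact (lintegral_sub_left_eq_self k x).le)
    (ae_of_all _ fun y => by
      simp only [Pi.one_apply, mul_one]
      exact (lintegral_sub_right_eq_self k y).le) hh
  rwa [← sq] at h1

end Schur

/-! ### The Gamma integral with a complex parameter -/

section GammaIntegral

theorem integrableOn_rpow_mul_cexp {a : ℝ} (ha : 0 < a) {z : ℂ} (hz : 0 < z.re) :
    IntegrableOn (fun u : ℝ => ((u ^ (a - 1) : ℝ) : ℂ) * Complex.exp (-z * u)) (Ioi 0) := by
  have h1 := integrableOn_rpow_mul_exp_neg_mul_rpow (s := a - 1) (p := 1) (b := z.re)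
    (by linarith) one_pos hz
  refine h1.mono' ?_ ?_
  · exact (Measurable.aestronglyMeasurable (by fun_prop))
  · refine (ae_restrict_iff' measurableSet_Ioi).2 (ae_of_all _ fun u hu => ?_)
    rw [norm_mul, Complex.norm_exp, Complex.norm_real, Real.norm_of_nonneg (Real.rpow_nonneg hu.le _)]
    simp

/-- Integration by parts; the boundary terms vanish because `a > 0` and `Re z > 0`. -/
theorem integral_rpow_mul_cexp_succ {a : ℝ} (ha : 0 < a) {z : ℂ} (hz : 0 < z.re) :
    z * ∫ u in Ioi (0 : ℝ), ((u ^ a : ℝ) : ℂ) * Complex.exp (-z * u) =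
      a * ∫ u in Ioi (0 : ℝ), ((u ^ (a - 1) : ℝ) : ℂ) * Complex.exp (-z * u) := by
  have i1 := integrableOn_rpow_mul_cexp ha hz
  have i2 := integrableOn_rpow_mul_cexp (a := a + 1) (by linarith) hz
  simp only [add_sub_cancel_right] at i2
  have hd : ∀ u ∈ Ioi (0 : ℝ), HasDerivAt (fun u : ℝ => ((u ^ a : ℝ) : ℂ) * Complex.exp (-z * u))
      (a * (((u ^ (a - 1) : ℝ) : ℂ) * Complex.exp (-z * u)) -
        z * (((u ^ a : ℝ) : ℂ) * Complex.exp (-z * u))) u := by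
    intro u hu
    have d1 : HasDerivAt (fun u : ℝ => ((u ^ a : ℝ) : ℂ)) ((a * u ^ (a - 1) : ℝ) : ℂ) u :=
      (Real.hasDerivAt_rpow_const (Or.inl (ne_of_gt hu))).ofReal_comp
    have d2 : HasDerivAt (fun u : ℝ => Complex.exp (-z * u)) (Complex.exp (-z * u) * (-z * 1)) u :=
      (((hasDerivAt_id (u : ℂ)).const_mul (-z)).cexp).comp_ofReal
    refine (d1.mul d2).congr_deriv ?_
    push_cast; ring
  have hcont : ContinuousWithinAt (fun u : ℝ => ((u ^ a : ℝ) : ℂ) * Complex.exp (-z * u)) (Ici 0) 0 := by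
    refine ContinuousAt.continuousWithinAt (ContinuousAt.mul ?_ (by fun_prop))
    exact Complex.continuous_ofReal.continuousAt.comp
      (Real.continuousAt_rpow_const _ _ (Or.inr ha.le))
  have hlim1 : Tendsto (fun u : ℝ => ((u ^ a : ℝ) : ℂ) * Complex.exp (-z * u)) atTop (𝓝 0) := by
    rw [tendsto_zero_iff_norm_tendsto_zero]
    refine (tendsto_rpow_mul_exp_neg_mul_atTop_nhds_zero a z.re hz).congr' ?_
    filter_upwards [eventually_ge_atTop 0] with u hu
    rw [norm_mul, Complex.norm_exp, Complex.norm_real, Real.norm_of_nonneg (Real.rpow_nonneg hu _)]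
    simp
  have key := integral_Ioi_of_hasDerivAt_of_tendsto hcont hd
    ((i1.const_mul (a : ℂ)).sub (i2.const_mul z)) hlim1
  rw [integral_sub (i1.const_mul _) (i2.const_mul _), integral_const_mul, integral_const_mul,
    Real.zero_rpow ha.ne'] at key
  simp only [Complex.ofReal_zero, zero_mul, sub_zero] at key
  exact (sub_eq_zero.1 key).symm

/-- No contour is rotated. Along the vertical line Re z = γ the product z^a J(z) has zero
derivative, by the recurrence `integral_rpow_mul_cexp_succ`, so it equals its value at the real
point γ, where the integral is classical. -/
theorem integral_rpow_mul_cexp {a : ℝ} (ha : 0 < a) {z : ℂ} (hz : 0 < z.re) :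
    ∫ u in Ioi (0 : ℝ), ((u ^ (a - 1) : ℝ) : ℂ) * Complex.exp (-z * u) =
      Real.Gamma a * z ^ (-a : ℂ) := by
  set γ := z.re with hγ
  let Z : ℝ → ℂ := fun y => γ + y * Complex.I
  have hZre : ∀ y, (Z y).re = γ := fun y => by simp [Z]
  have hZ0 : ∀ y, Z y ≠ 0 := fun y h => by
    have := hZre y; rw [h] at this; simp at this; linarith
  let J : ℝ → ℂ := fun y => ∫ u in Ioi (0 : ℝ), ((u ^ (a - 1) : ℝ) : ℂ) * Complex.exp (-Z y * u)
  have hZd : ∀ y, HasDerivAt Z Complex.I y := fun y =>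
    (((hasDerivAt_id y).ofReal_comp.mul_const Complex.I).const_add (γ : ℂ)).congr_deriv (by simp)
  have hJ : ∀ y, HasDerivAt J (∫ u in Ioi (0 : ℝ), -Complex.I * (((u ^ a : ℝ) : ℂ) * Complex.exp (-Z y * u))) y := by
    intro y
    have i2 := integrableOn_rpow_mul_exp_neg_mul_rpow (s := a) (p := 1) (b := γ)
      (by linarith) one_pos hz
    refine (hasDerivAt_integral_of_dominated_loc_of_deriv_le (s := univ) (F := fun y (u : ℝ) =>
      ((u ^ (a - 1) : ℝ) : ℂ) * Complex.exp (-Z y * u))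
      (F' := fun y (u : ℝ) => -Complex.I * (((u ^ a : ℝ) : ℂ) * Complex.exp (-Z y * u)))
      (bound := fun u => u ^ a * Real.exp (-γ * u ^ (1 : ℝ))) univ_mem ?_ ?_ ?_ ?_ i2 ?_).2
    · exact Eventually.of_forall fun y => (Measurable.aestronglyMeasurable (by fun_prop))
    · exact integrableOn_rpow_mul_cexp ha (by rw [hZre]; exact hz)
    · exact (Measurable.aestronglyMeasurable (by fun_prop))
    · refine (ae_restrict_iff' measurableSet_Ioi).2 (ae_of_all _ fun u hu y _ => ?_)
      rw [norm_mul, norm_mul, Complex.norm_exp, Complex.norm_real,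
        Real.norm_of_nonneg (Real.rpow_nonneg hu.le _)]
      simp [hZre]
    · refine (ae_restrict_iff' measurableSet_Ioi).2 (ae_of_all _ fun u hu y _ => ?_)
      refine ((((hZd y).neg.mul_const (u : ℂ)).cexp).const_mul ((u ^ (a - 1) : ℝ) : ℂ)).congr_deriv ?_
      have : u ^ a = u ^ (a - 1) * u := by
        rw [← Real.rpow_add_one (ne_of_gt hu)]; congr 1; ring
      rw [this]; push_cast; simp only [Pi.neg_apply]; ring
  have hconst : ∀ y, HasDerivAt (fun y => Z y ^ (a : ℂ) * J y) 0 y := by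
    intro y
    have d2 : HasDerivAt (fun y => Z y ^ (a : ℂ)) ((a : ℂ) * Z y ^ ((a : ℂ) - 1) * Complex.I) y :=
      ((Complex.hasStrictDerivAt_cpow_const
        (Or.inl (by rw [hZre]; exact hz))).hasDerivAt).comp y (hZd y)
    refine (d2.mul (hJ y)).congr_deriv ?_
    rw [integral_const_mul, Complex.cpow_sub _ _ (hZ0 y), Complex.cpow_one]
    have := integral_rpow_mul_cexp_succ ha (z := Z y) (by rw [hZre]; exact hz)
    have h0 := hZ0 y
    have e : ∫ u in Ioi (0 : ℝ), ((u ^ a : ℝ) : ℂ) * Complex.exp (-Z y * u) = (a * J y) / Z y := by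
      rw [eq_div_iff h0, mul_comm]; exact this
    rw [e]
    field_simp
    ring
  have hc := is_const_of_deriv_eq_zero (fun y => (hconst y).differentiableAt)
    (fun y => (hconst y).deriv) z.im 0
  have hz1 : Z z.im = z := Complex.re_add_im z
  have hz0 : Z 0 = (γ : ℂ) := by simp [Z]
  have hr : J 0 = ((1 / γ) ^ a * Real.Gamma a : ℝ) := by
    rw [← Real.integral_rpow_mul_exp_neg_mul_Ioi ha hz, ← integral_complex_ofReal]
    refine setIntegral_congr_fun measurableSet_Ioi fun u hu => ?_
    simp [hz0]
  have hzne : z ≠ 0 := hz1 ▸ hZ0 z.im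
  simp only [hz1, hz0, hr] at hc
  have hJz : J z.im = ∫ u in Ioi (0 : ℝ), ((u ^ (a - 1) : ℝ) : ℂ) * Complex.exp (-z * u) := by
    simp only [J, hz1]
  rw [← hJz, Complex.cpow_neg, eq_comm, mul_comm, inv_mul_eq_iff_eq_mul₀
    (by rw [Ne, Complex.cpow_eq_zero_iff]; tauto), hc, ← Complex.ofReal_cpow hz.le,
    ← Complex.ofReal_mul]
  congr 1
  rw [← mul_assoc, ← Real.mul_rpow hz.le (by positivity), mul_one_div_cancel hz.ne',
    Real.one_rpow, one_mul]

end GammaIntegral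

/-! ### Rapidly decreasing functions -/

section RapidDecay

/-- Continuous functions on the line all of whose moments are bounded. -/
structure RapidDecay (A : ℝ → ℂ) : Prop where
  continuous : Continuous A
  decay : ∀ n : ℕ, ∃ C : ℝ, ∀ τ, (1 + |τ|) ^ n * ‖A τ‖ ≤ C

theorem integrable_one_add_abs_rpow {r : ℝ} (hr : r < -1) :
    Integrable fun τ : ℝ => (1 + |τ|) ^ r := by
  have := integrable_one_add_norm (E := ℝ) (μ := volume) (r := -r) (by simp; linarith)
  simpa using this

theorem RapidDecay.rpow_bound {A : ℝ → ℂ} (hA : RapidDecay A) (r : ℝ) :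
    ∃ C : ℝ, 0 ≤ C ∧ ∀ τ, ‖A τ‖ ≤ C * (1 + |τ|) ^ r := by
  obtain ⟨C, hC⟩ := hA.decay ⌈-r⌉₊
  have hC0 : 0 ≤ C := le_trans (by positivity) (hC 0)
  refine ⟨C, hC0, fun τ => ?_⟩
  have h1 : (1 : ℝ) ≤ 1 + |τ| := by linarith [abs_nonneg τ]
  have h2 : (1 + |τ|) ^ (-r) ≤ (1 + |τ|) ^ ⌈-r⌉₊ := by
    rw [← Real.rpow_natCast]
    exact Real.rpow_le_rpow_of_exponent_le h1 (Nat.le_ceil _)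
  have h3 : (1 + |τ|) ^ (-r) * ‖A τ‖ ≤ C := le_trans (by gcongr) (hC τ)
  rw [Real.rpow_neg (by positivity), inv_mul_le_iff₀ (by positivity)] at h3
  linarith

theorem RapidDecay.integrable_mul {A : ℝ → ℂ} (hA : RapidDecay A) (r : ℝ) :
    Integrable fun τ => (1 + |τ|) ^ r * ‖A τ‖ := by
  obtain ⟨C, hC0, hC⟩ := hA.rpow_bound (-2 - r)
  refine ((integrable_one_add_abs_rpow (r := -2) (by norm_num)).const_mul C).mono' ?_
    (ae_of_all _ fun τ => ?_)
  · refine (Continuous.aestronglyMeasurable ?_)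
    exact (Continuous.rpow_const (by fun_prop) fun x => Or.inl (by positivity)).mul
      hA.continuous.norm
  · have h1 : (0 : ℝ) < 1 + |τ| := by positivity
    rw [Real.norm_of_nonneg (by positivity)]
    calc (1 + |τ|) ^ r * ‖A τ‖ ≤ (1 + |τ|) ^ r * (C * (1 + |τ|) ^ (-2 - r)) := by
          gcongr; exact hC τ
      _ = C * ((1 + |τ|) ^ r * (1 + |τ|) ^ (-2 - r)) := by ring
      _ = C * (1 + |τ|) ^ (-2 : ℝ) := by rw [← Real.rpow_add h1]; congr 2; ring

theorem RapidDecay.integrable {A : ℝ → ℂ} (hA : RapidDecay A) : Integrable A := by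
  have := hA.integrable_mul 0
  simp only [Real.rpow_zero, one_mul] at this
  exact (integrable_norm_iff hA.continuous.aestronglyMeasurable).1 this

theorem RapidDecay.mul_of_le {A B : ℝ → ℂ} (hA : RapidDecay A) (hB : Continuous B) {C r : ℝ}
    (hBC : ∀ τ, ‖B τ‖ ≤ C * (1 + |τ|) ^ r) : RapidDecay fun τ => B τ * A τ := by
  refine ⟨hB.mul hA.continuous, fun n => ?_⟩
  have hC : 0 ≤ C := by
    have := (norm_nonneg _).trans (hBC 0)
    simpa using this
  obtain ⟨D, hD0, hD⟩ := hA.rpow_bound (-n - r)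
  refine ⟨C * D, fun τ => ?_⟩
  have h1 : (0 : ℝ) < 1 + |τ| := by positivity
  rw [norm_mul]
  calc (1 + |τ|) ^ n * (‖B τ‖ * ‖A τ‖)
      ≤ (1 + |τ|) ^ n * ((C * (1 + |τ|) ^ r) * (D * (1 + |τ|) ^ (-n - r))) := by
        gcongr
        · exact hBC τ
        · exact hD τ
    _ = C * D * ((1 + |τ|) ^ (n : ℝ) * (1 + |τ|) ^ r * (1 + |τ|) ^ (-n - r)) := by
        rw [Real.rpow_natCast]; ring
    _ = C * D := by
        rw [← Real.rpow_add h1, ← Real.rpow_add h1]; simp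

theorem rapidDecay_schwartz (φ : 𝓢(ℝ, ℂ)) : RapidDecay φ := by
  refine ⟨φ.continuous, fun n => ?_⟩
  obtain ⟨C1, h1, hC1⟩ := φ.decay 0 0
  obtain ⟨C2, h2, hC2⟩ := φ.decay n 0
  refine ⟨2 ^ n * (C1 + C2), fun τ => ?_⟩
  have e1 : ‖φ τ‖ ≤ C1 := by simpa using hC1 τ
  have e2 : |τ| ^ n * ‖φ τ‖ ≤ C2 := by simpa using hC2 τ
  rcases le_total |τ| 1 with h | h
  · calc (1 + |τ|) ^ n * ‖φ τ‖ ≤ 2 ^ n * C1 := by gcongr; linarith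
      _ ≤ _ := by gcongr; linarith
  · calc (1 + |τ|) ^ n * ‖φ τ‖ ≤ (2 * |τ|) ^ n * ‖φ τ‖ := by gcongr; linarith
      _ = 2 ^ n * (|τ| ^ n * ‖φ τ‖) := by rw [mul_pow]; ring
      _ ≤ _ := by gcongr; linarith

end RapidDecay

/-! ### Inverse Laplace integrals and fractional integration -/

section InverseLaplace

/-- The point `γ + 2πiτ` of the vertical line with abscissa `γ`. -/
noncomputable def linePt (γ τ : ℝ) : ℂ := (γ : ℂ) + 2 * Real.pi * τ * Complex.I

@[simp] theorem linePt_re (γ τ : ℝ) : (linePt γ τ).re = γ := by simp [linePt]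

@[simp] theorem linePt_im (γ τ : ℝ) : (linePt γ τ).im = 2 * Real.pi * τ := by simp [linePt]

theorem continuous_linePt (γ : ℝ) : Continuous (linePt γ) := by
  unfold linePt; fun_prop

theorem linePt_ne_zero {γ : ℝ} (hγ : 0 < γ) (τ : ℝ) : linePt γ τ ≠ 0 := fun h => by
  have := linePt_re γ τ; rw [h] at this; simp at this; linarith

theorem le_norm_linePt {γ : ℝ} (hγ : 0 < γ) (τ : ℝ) : γ ≤ ‖linePt γ τ‖ := by
  have := Complex.abs_re_le_norm (linePt γ τ)
  rw [linePt_re, abs_of_pos hγ] at this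
  exact this

theorem norm_linePt_le {γ : ℝ} (hγ : 0 ≤ γ) (τ : ℝ) :
    ‖linePt γ τ‖ ≤ (γ + 2 * Real.pi) * (1 + |τ|) := by
  have := Complex.norm_le_abs_re_add_abs_im (linePt γ τ)
  rw [linePt_re, linePt_im, abs_of_nonneg hγ, abs_mul, abs_of_pos Real.two_pi_pos] at this
  nlinarith [abs_nonneg τ, Real.two_pi_pos, mul_nonneg hγ (abs_nonneg τ)]

theorem continuous_linePt_cpow {γ : ℝ} (hγ : 0 < γ) (α : ℂ) :
    Continuous fun τ => linePt γ τ ^ α :=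
  (continuous_linePt γ).cpow continuous_const fun τ => Or.inl (by rw [linePt_re]; exact hγ)

theorem norm_linePt_cpow_le {γ : ℝ} (hγ : 0 < γ) (α : ℝ) :
    ∃ C : ℝ, ∀ τ, ‖linePt γ τ ^ (α : ℂ)‖ ≤ C * (1 + |τ|) ^ |α| := by
  refine ⟨γ ^ α + (γ + 2 * Real.pi) ^ α, fun τ => ?_⟩
  rw [Complex.norm_cpow_real]
  have h1 : (1 : ℝ) ≤ 1 + |τ| := by linarith [abs_nonneg τ]
  have hp := Real.two_pi_pos
  have hb := norm_linePt_le hγ.le τ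
  rcases le_total 0 α with h | h
  · calc ‖linePt γ τ‖ ^ α ≤ ((γ + 2 * Real.pi) * (1 + |τ|)) ^ α :=
          Real.rpow_le_rpow (norm_nonneg _) hb h
      _ = (γ + 2 * Real.pi) ^ α * (1 + |τ|) ^ |α| := by
          rw [Real.mul_rpow (by positivity) (by positivity), abs_of_nonneg h]
      _ ≤ _ := by gcongr; linarith [Real.rpow_nonneg hγ.le α]
  · calc ‖linePt γ τ‖ ^ α ≤ γ ^ α :=
          Real.rpow_le_rpow_of_nonpos hγ (le_norm_linePt hγ τ) h
      _ ≤ γ ^ α + (γ + 2 * Real.pi) ^ α := by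
          linarith [Real.rpow_nonneg (by positivity : 0 ≤ γ + 2 * Real.pi) α]
      _ ≤ _ := le_mul_of_one_le_right (by positivity) (Real.one_le_rpow h1 (abs_nonneg _))

theorem RapidDecay.cpow_mul {A : ℝ → ℂ} (hA : RapidDecay A) {γ : ℝ} (hγ : 0 < γ) (α : ℝ) :
    RapidDecay fun τ => linePt γ τ ^ (α : ℂ) * A τ := by
  obtain ⟨C, hC⟩ := norm_linePt_cpow_le hγ α
  exact hA.mul_of_le (continuous_linePt_cpow hγ _) hC

theorem RapidDecay.pow_mul {A : ℝ → ℂ} (hA : RapidDecay A) {γ : ℝ} (hγ : 0 < γ) (k : ℕ) :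
    RapidDecay fun τ => linePt γ τ ^ k * A τ := by
  have := hA.cpow_mul hγ k
  simpa using this

/-- The inverse Laplace integral `∫ e^{(γ+2πiτ)t} A(τ) dτ`. -/
noncomputable def lapInv (γ : ℝ) (A : ℝ → ℂ) (t : ℝ) : ℂ :=
  ∫ τ, Complex.exp (linePt γ τ * t) * A τ

theorem norm_exp_linePt (γ τ t : ℝ) : ‖Complex.exp (linePt γ τ * t)‖ = Real.exp (γ * t) := by
  rw [Complex.norm_exp]; simp

theorem continuous_exp_linePt (γ t : ℝ) : Continuous fun τ => Complex.exp (linePt γ τ * t) := by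
  have := continuous_linePt γ
  fun_prop

theorem lapInv_integrable {A : ℝ → ℂ} (hA : Integrable A) (γ t : ℝ) :
    Integrable fun τ => Complex.exp (linePt γ τ * t) * A τ :=
  hA.bdd_mul (c := Real.exp (γ * t)) (continuous_exp_linePt γ t).aestronglyMeasurable
    (ae_of_all _ fun τ => (norm_exp_linePt γ τ t).le)

theorem norm_lapInv_le (γ : ℝ) (A : ℝ → ℂ) (t : ℝ) :
    ‖lapInv γ A t‖ ≤ Real.exp (γ * t) * ∫ τ, ‖A τ‖ := by
  refine (norm_integral_le_integral_norm _).trans (le_of_eq ?_)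
  simp_rw [norm_mul, norm_exp_linePt]
  rw [integral_const_mul]

theorem lapInv_eq_fourierInv (γ : ℝ) (A : ℝ → ℂ) (t : ℝ) :
    lapInv γ A t = Complex.exp (γ * t) * 𝓕⁻ A t := by
  rw [Real.fourierInv_eq', ← integral_const_mul]
  refine integral_congr_ae (ae_of_all _ fun τ => ?_)
  simp only [smul_eq_mul, ← mul_assoc, ← Complex.exp_add]
  congr 2
  simp only [linePt, RCLike.inner_apply]
  simp
  ring

theorem hasDerivAt_lapInv {A : ℝ → ℂ} (hA : RapidDecay A) {γ : ℝ} (hγ : 0 < γ) (t : ℝ) :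
    HasDerivAt (lapInv γ A) (lapInv γ (fun τ => linePt γ τ * A τ) t) t := by
  have hA1 := hA.pow_mul hγ 1
  simp only [pow_one] at hA1
  refine (hasDerivAt_integral_of_dominated_loc_of_deriv_le (s := Iio (t + 1))
    (F := fun t τ => Complex.exp (linePt γ τ * (t : ℝ)) * A τ)
    (F' := fun t τ => Complex.exp (linePt γ τ * (t : ℝ)) * (linePt γ τ * A τ))
    (bound := fun τ => Real.exp (γ * (t + 1)) * ‖linePt γ τ * A τ‖)
    (Iio_mem_nhds (by linarith)) ?_ ?_ ?_ ?_ ?_ ?_).2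
  · exact Eventually.of_forall fun t =>
      ((continuous_exp_linePt γ t).mul hA.continuous).aestronglyMeasurable
  · exact lapInv_integrable hA.integrable γ t
  · exact ((continuous_exp_linePt γ t).mul hA1.continuous).aestronglyMeasurable
  · refine ae_of_all _ fun τ y hy => ?_
    rw [norm_mul, norm_exp_linePt]
    gcongr
    exact hy.le
  · exact hA1.integrable.norm.const_mul _
  · refine ae_of_all _ fun τ y _ => ?_
    have d1 : HasDerivAt (fun y : ℝ => Complex.exp (linePt γ τ * y))
        (Complex.exp (linePt γ τ * y) * (linePt γ τ * 1)) y :=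
      (((hasDerivAt_id (y : ℂ)).const_mul _).cexp).comp_ofReal
    refine (d1.mul_const (A τ)).congr_deriv ?_
    ring

theorem iteratedDeriv_lapInv {A : ℝ → ℂ} (hA : RapidDecay A) {γ : ℝ} (hγ : 0 < γ) (k : ℕ) :
    iteratedDeriv k (lapInv γ A) = lapInv γ (fun τ => linePt γ τ ^ k * A τ) := by
  induction k with
  | zero => simp
  | succ k ih =>
    rw [iteratedDeriv_succ, ih]
    ext t
    rw [(hasDerivAt_lapInv (hA.pow_mul hγ k) hγ t).deriv]
    congr 1
    ext τ
    ring

/-- Convolution of an inverse Laplace integral with a function on the half line. -/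
theorem integral_mul_lapInv_sub {c : ℝ → ℂ} {γ : ℝ}
    (hc : IntegrableOn (fun u : ℝ => c u * Complex.exp (-(γ : ℂ) * u)) (Ioi 0)) {A : ℝ → ℂ}
    (hA : Integrable A) (t : ℝ) :
    ∫ u in Ioi (0 : ℝ), c u * lapInv γ A (t - u) =
      lapInv γ (fun τ => (∫ u in Ioi (0 : ℝ), c u * Complex.exp (-linePt γ τ * u)) * A τ) t := by
  unfold lapInv
  have e1 : ∀ u : ℝ, c u * ∫ τ, Complex.exp (linePt γ τ * ((t - u : ℝ) : ℂ)) * A τ =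
      ∫ τ, Complex.exp (linePt γ τ * t) * ((c u * Complex.exp (-linePt γ τ * u)) * A τ) := by
    intro u
    rw [← integral_const_mul]
    refine integral_congr_ae (ae_of_all _ fun τ => ?_)
    have : linePt γ τ * ((t - u : ℝ) : ℂ) = linePt γ τ * t + -linePt γ τ * u := by
      push_cast; ring
    simp only
    rw [this, Complex.exp_add]
    ring
  simp_rw [e1]
  rw [integral_integral_swap]
  · refine integral_congr_ae (ae_of_all _ fun τ => ?_)
    simp only
    rw [← integral_mul_const, ← integral_const_mul]
  -- Once e^{-γu} is attached to `c u`, the remaining exponential in `u` is unimodular, so a product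
  -- of integrable functions dominates the double integrand.
  · have h1 : Integrable (fun p : ℝ × ℝ => (c p.1 * Complex.exp (-(γ : ℂ) * p.1)) * A p.2)
        ((volume.restrict (Ioi 0)).prod volume) := Integrable.mul_prod hc hA
    have h2 := h1.bdd_mul (f := fun p : ℝ × ℝ => Complex.exp (linePt γ p.2 * t) *
      Complex.exp (-(2 * Real.pi * p.2 * Complex.I) * p.1)) (c := Real.exp (γ * t)) ?_
      (ae_of_all _ fun p => ?_)
    · refine h2.congr (ae_of_all _ fun p => ?_)
      have : -linePt γ p.2 * p.1 = -(2 * Real.pi * p.2 * Complex.I) * p.1 + -(γ : ℂ) * p.1 := by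
        rw [linePt]; ring
      simp only [Function.uncurry]
      rw [this, Complex.exp_add]
      ring
    · refine Continuous.aestronglyMeasurable ?_
      have := continuous_linePt γ
      fun_prop
    · rw [norm_mul, norm_exp_linePt, Complex.norm_exp]
      simp

/-- The `k` derivatives contribute p^k and the kernel t^{α+k-1}/Γ(α+k) contributes p^{-α-k} by the
Gamma integral. The sign (-1)^k of the distributional derivative cancels the one produced by
differentiating r ↦ f(t - r). -/
theorem fracIntegral_lapInv {A : ℝ → ℂ} (hA : RapidDecay A) {γ : ℝ} (hγ : 0 < γ) (α : ℝ) :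
    fracIntegral α (lapInv γ A) = lapInv γ (fun τ => linePt γ τ ^ (-α : ℂ) * A τ) := by
  ext t
  unfold fracIntegral plusPairing
  set k := contOrder α with hk
  have hα := contOrder_spec α
  rw [← hk] at hα
  rw [iteratedDeriv_comp_const_sub, iteratedDeriv_lapInv hA hγ]
  have e1 : ∀ u : ℝ, ((u ^ (α + k - 1) : ℝ) : ℂ) *
      ((-1 : ℝ) ^ k • lapInv γ (fun τ => linePt γ τ ^ k * A τ) (t - u)) =
      (-1) ^ k * (((u ^ (α + k - 1) : ℝ) : ℂ) *
        lapInv γ (fun τ => linePt γ τ ^ k * A τ) (t - u)) := by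
    intro u
    rw [Complex.real_smul]; push_cast; ring
  simp_rw [e1]
  have hG : ((Real.Gamma (α + k) : ℝ) : ℂ) ≠ 0 := by
    exact_mod_cast (Real.Gamma_pos_of_pos hα).ne'
  rw [integral_const_mul, integral_mul_lapInv_sub (γ := γ) (c := fun u => ((u ^ (α + k - 1) : ℝ) : ℂ))
    (integrableOn_rpow_mul_cexp hα (by simpa using hγ)) (hA.pow_mul hγ k).integrable]
  have e2 : ∀ x : ℂ, (-1 : ℂ) ^ k * (1 / (Real.Gamma (α + k) : ℂ)) * ((-1) ^ k * x) =
      (Real.Gamma (α + k) : ℂ)⁻¹ * x := by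
    intro x
    have : (-1 : ℂ) ^ k * (-1) ^ k = 1 := by rw [← mul_pow]; simp
    calc _ = ((-1 : ℂ) ^ k * (-1) ^ k) * ((Real.Gamma (α + k) : ℂ)⁻¹ * x) := by ring
      _ = _ := by rw [this, one_mul]
  rw [e2]
  unfold lapInv
  rw [← integral_const_mul]
  refine integral_congr_ae (ae_of_all _ fun τ => ?_)
  simp only
  rw [integral_rpow_mul_cexp hα (by simpa using hγ)]
  have e3 : linePt γ τ ^ (-((α + k : ℝ) : ℂ)) * linePt γ τ ^ k = linePt γ τ ^ (-α : ℂ) := by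
    rw [← Complex.cpow_natCast, ← Complex.cpow_add _ _ (linePt_ne_zero hγ τ)]
    congr 1; push_cast; ring
  rw [← e3]
  field_simp

end InverseLaplace

/-! ### Integrability of power weights -/

section PowerWeights

theorem integrable_comp_abs_of_integrableOn {F : Type*} [NormedAddCommGroup F] {g : ℝ → F}
    (hg : IntegrableOn g (Ioi 0)) : Integrable fun x => g |x| := by
  have h1 : IntegrableOn (fun x => g |x|) (Ioi 0) :=
    hg.congr_fun (fun x hx => by simp only [abs_of_pos (show (0 : ℝ) < x from hx)]) measurableSet_Ioi
  have h2 : IntegrableOn (fun x => g |x|) (Iio 0) := by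
    have : IntegrableOn (fun x : ℝ => g |(-x)|) (Iio 0) := by
      have h3 : IntegrableOn (fun x => g |x|) (Ioi (-0)) := by simpa using h1
      exact h3.comp_neg_Iio
    simpa using this
  have h3 := (integrableOn_Iic_iff_integrableOn_Iio).2 h2
  have := h3.union h1
  rwa [Iic_union_Ioi, integrableOn_univ] at this

theorem integrableOn_rpow_mul_one_add_rpow {a b : ℝ} (ha : -1 < a) (hab : a + b < -1) :
    IntegrableOn (fun x : ℝ => x ^ a * (1 + x) ^ b) (Ioi 0) := by
  have hm : ∀ s : Set ℝ, AEStronglyMeasurable (fun x : ℝ => x ^ a * (1 + x) ^ b) (volume.restrict s) :=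
    fun s => (Measurable.aestronglyMeasurable (by fun_prop))
  rw [← Ioc_union_Ioi_eq_Ioi (zero_le_one (α := ℝ))]
  refine IntegrableOn.union ?_ ?_
  · have h1 : IntegrableOn (fun x : ℝ => x ^ a) (Ioc 0 1) :=
      (intervalIntegrable_iff_integrableOn_Ioc_of_le zero_le_one).1
        (intervalIntegral.intervalIntegrable_rpow' ha)
    refine (h1.mul_const (1 + 2 ^ b)).mono' (hm _) ?_
    refine (ae_restrict_iff' measurableSet_Ioc).2 (ae_of_all _ fun x hx => ?_)
    have hx0 : 0 < x := hx.1
    rw [Real.norm_of_nonneg (by positivity)]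
    gcongr
    rcases le_total 0 b with h | h
    · have : (1 + x) ^ b ≤ 2 ^ b := Real.rpow_le_rpow (by positivity) (by linarith [hx.2]) h
      linarith
    · have : (1 + x) ^ b ≤ 1 := Real.rpow_le_one_of_one_le_of_nonpos (by linarith) h
      linarith [Real.rpow_nonneg zero_le_two b]
  · have h1 : IntegrableOn (fun x : ℝ => x ^ (a + b)) (Ioi 1) :=
      integrableOn_Ioi_rpow_of_lt hab one_pos
    refine (h1.mul_const (1 + 2 ^ b)).mono' (hm _) ?_
    refine (ae_restrict_iff' measurableSet_Ioi).2 (ae_of_all _ fun x hx => ?_)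
    have hx1 : 1 < x := hx
    have hx0 : 0 < x := by linarith
    rw [Real.norm_of_nonneg (by positivity), Real.rpow_add hx0, mul_assoc]
    gcongr
    rcases le_total 0 b with h | h
    · calc (1 + x) ^ b ≤ (x * 2) ^ b := Real.rpow_le_rpow (by positivity) (by linarith) h
        _ = x ^ b * 2 ^ b := Real.mul_rpow hx0.le zero_le_two
        _ ≤ _ := by gcongr; linarith
    · calc (1 + x) ^ b ≤ x ^ b := Real.rpow_le_rpow_of_nonpos hx0 (by linarith) h
        _ ≤ x ^ b * (1 + 2 ^ b) := le_mul_of_one_le_right (by positivity)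
          (by linarith [Real.rpow_nonneg zero_le_two b])

theorem integrable_abs_rpow_mul_one_add_rpow {a b : ℝ} (ha : -1 < a) (hab : a + b < -1) :
    Integrable fun x : ℝ => |x| ^ a * (1 + |x|) ^ b :=
  integrable_comp_abs_of_integrableOn (g := fun x : ℝ => x ^ a * (1 + x) ^ b)
    (integrableOn_rpow_mul_one_add_rpow ha hab)

end PowerWeights

/-! ### Lower bounds for the resolvent symbol -/

section Denominators

/-- As `y` is the difference of the imaginary parts, |y| ≤ ‖p‖ + ‖d‖, while Re d ≥ γ keeps `d` away
from 0. With y = 4π²ξ² this yields resolvent decay of order ξ^{-2} at the price of a factor 1 + ‖p‖.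
-/
theorem one_add_abs_le_of_im_eq {p d : ℂ} {γ y : ℝ} (hγ : 0 < γ) (hre : γ ≤ d.re)
    (him : d.im = p.im - y) : 1 + |y| ≤ (1 + 1 / γ) * (1 + ‖p‖) * ‖d‖ := by
  have h1 : γ ≤ ‖d‖ := hre.trans (Complex.re_le_norm d)
  have h2 : |y| ≤ ‖p‖ + ‖d‖ := by
    have : y = p.im - d.im := by linarith
    rw [this]
    exact (abs_sub _ _).trans (add_le_add (Complex.abs_im_le_norm p) (Complex.abs_im_le_norm d))
  have h3 : 1 ≤ ‖d‖ / γ := (one_le_div hγ).2 h1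
  have h4 : 1 + ‖d‖ ≤ (1 + 1 / γ) * ‖d‖ := by
    have : (1 + 1 / γ) * ‖d‖ = ‖d‖ + ‖d‖ / γ := by ring
    linarith
  calc 1 + |y| ≤ (1 + ‖p‖) * (1 + ‖d‖) := by nlinarith [norm_nonneg p, norm_nonneg d]
    _ ≤ (1 + ‖p‖) * ((1 + 1 / γ) * ‖d‖) := by gcongr
    _ = _ := by ring

theorem norm_inv_le_of_im_eq {p d : ℂ} {γ y : ℝ} (hγ : 0 < γ) (hre : γ ≤ d.re)
    (him : d.im = p.im - y) : ‖d⁻¹‖ ≤ (1 + 1 / γ) * (1 + ‖p‖) * (1 + |y|)⁻¹ := by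
  have h1 : 0 < ‖d‖ := lt_of_lt_of_le hγ (hre.trans (Complex.re_le_norm d))
  have := one_add_abs_le_of_im_eq hγ hre him
  rw [norm_inv, ← div_eq_mul_inv, le_div_iff₀ (by positivity), inv_mul_le_iff₀ h1]
  linarith

theorem one_add_sq_inv_le (ξ : ℝ) :
    (1 + |4 * Real.pi ^ 2 * ξ ^ 2|)⁻¹ ≤ 2 * (1 + |ξ|) ^ (-2 : ℝ) := by
  have h0 : (0 : ℝ) < 1 + |ξ| := by positivity
  rw [Real.rpow_neg h0.le, Real.rpow_two, abs_of_nonneg (by positivity), ← div_eq_mul_inv,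
    le_div_iff₀ (by positivity), inv_mul_le_iff₀ (by positivity)]
  have hp : (1 : ℝ) ≤ 4 * Real.pi ^ 2 := by nlinarith [Real.pi_gt_three]
  have : ξ ^ 2 ≤ 4 * Real.pi ^ 2 * ξ ^ 2 := le_mul_of_one_le_left (sq_nonneg ξ) hp
  nlinarith [sq_abs ξ, sq_nonneg (1 - |ξ|)]

/-- The symbol `p - 4π²iξ²` of the heat type operator `p - i(2πξ)²`. -/
noncomputable def symb (p : ℂ) (ξ : ℝ) : ℂ := p - 4 * Real.pi ^ 2 * ξ ^ 2 * Complex.I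

@[simp] theorem symb_re (p : ℂ) (ξ : ℝ) : (symb p ξ).re = p.re := by
  have : (4 * Real.pi ^ 2 * ξ ^ 2 * Complex.I : ℂ) = ((4 * Real.pi ^ 2 * ξ ^ 2 : ℝ) : ℂ) * Complex.I := by
    push_cast; ring
  rw [symb, this, Complex.sub_re, Complex.re_ofReal_mul, Complex.I_re, mul_zero, sub_zero]

@[simp] theorem symb_im (p : ℂ) (ξ : ℝ) : (symb p ξ).im = p.im - 4 * Real.pi ^ 2 * ξ ^ 2 := by
  have : (4 * Real.pi ^ 2 * ξ ^ 2 * Complex.I : ℂ) = ((4 * Real.pi ^ 2 * ξ ^ 2 : ℝ) : ℂ) * Complex.I := by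
    push_cast; ring
  rw [symb, this, Complex.sub_im, Complex.im_ofReal_mul, Complex.I_im, mul_one]

theorem symb_ne_zero {p : ℂ} (hp : 0 < p.re) (ξ : ℝ) : symb p ξ ≠ 0 := fun h => by
  have := symb_re p ξ; rw [h] at this; simp at this; linarith

theorem continuous_symb (p : ℂ) : Continuous (symb p) := by
  unfold symb; fun_prop

theorem norm_symb_inv_le {p : ℂ} {γ : ℝ} (hγ : 0 < γ) (hp : γ ≤ p.re) (ξ : ℝ) :
    ‖(symb p ξ)⁻¹‖ ≤ 2 * (1 + 1 / γ) * (1 + ‖p‖) * (1 + |ξ|) ^ (-2 : ℝ) := by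
  have h1 := norm_inv_le_of_im_eq hγ (p := p) (d := symb p ξ) (by simpa using hp) (symb_im p ξ)
  calc _ ≤ _ := h1
    _ ≤ (1 + 1 / γ) * (1 + ‖p‖) * (2 * (1 + |ξ|) ^ (-2 : ℝ)) := by
        gcongr; exact one_add_sq_inv_le ξ
    _ = _ := by ring

theorem norm_cexp_mul_I_real (x ξ : ℝ) : ‖Complex.exp (2 * Real.pi * x * ξ * Complex.I)‖ = 1 := by
  have : (2 * Real.pi * x * ξ * Complex.I : ℂ) = ((2 * Real.pi * x * ξ : ℝ) : ℂ) * Complex.I := by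
    push_cast; ring
  rw [this, Complex.norm_exp_ofReal_mul_I]

end Denominators

/-! ### The Laplace transform of the Schrödinger kernel -/

section Kernel

/-- The spatial profile `2e^{-iπ/4} ∫ e^{2πixξ} (-2πiξ)^{-μ} / (p - 4π²iξ²) dξ`. -/
noncomputable def kernelN (μ x : ℝ) (p : ℂ) : ℂ :=
  2 * Complex.exp (-(Real.pi / 4 * Complex.I)) * ∫ ξ : ℝ, Complex.exp (2 * Real.pi * x * ξ * Complex.I) *
    (-(2 * Real.pi * ξ * Complex.I)) ^ ((-μ : ℝ) : ℂ) * (symb p ξ)⁻¹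

theorem ofReal_mul_cpow {r : ℝ} (hr : 0 < r) {z : ℂ} (hz : z ≠ 0) (a : ℝ) :
    ((r : ℂ) * z) ^ (a : ℂ) = ((r ^ a : ℝ) : ℂ) * z ^ (a : ℂ) := by
  have hr' : (r : ℂ) ≠ 0 := by exact_mod_cast hr.ne'
  rw [Complex.ofReal_cpow hr.le, Complex.cpow_def_of_ne_zero (mul_ne_zero hr' hz),
    Complex.cpow_def_of_ne_zero hr', Complex.cpow_def_of_ne_zero hz, Complex.log_ofReal_mul hr hz,
    add_mul, Complex.exp_add, Complex.ofReal_log hr.le]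

theorem norm_two_pi_mul_I (ξ : ℝ) : ‖(-(2 * Real.pi * ξ * Complex.I) : ℂ)‖ = 2 * Real.pi * |ξ| := by
  simp [abs_of_pos Real.pi_pos]

/-- The Fourier representation of a Gaussian with complex variance. -/
theorem gaussian_fourier {w : ℂ} (hw : 0 < w.re) {u : ℝ} (hu : 0 < u) (x : ℝ) :
    ∫ ξ : ℝ, Complex.exp (2 * Real.pi * x * ξ * Complex.I) *
      Complex.exp (-(4 * Real.pi ^ 2 * ξ ^ 2 * w) * u) =
    (((4 * Real.pi * u) ^ (-(1 / 2) : ℝ) : ℝ) : ℂ) * (w⁻¹) ^ ((1 / 2 : ℝ) : ℂ) *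
      Complex.exp (-(x ^ 2 * w⁻¹ / (4 * u))) := by
  have hp := Real.pi_pos
  have hw0 : w ≠ 0 := fun h => by rw [h] at hw; simp at hw
  have hb : 0 < (((4 * Real.pi ^ 2 * u : ℝ) : ℂ) * w).re := by
    rw [Complex.re_ofReal_mul]; positivity
  have h1 := fourierIntegral_gaussian hb (2 * Real.pi * x)
  have hu0 : (u : ℂ) ≠ 0 := by exact_mod_cast hu.ne'
  have hp0 : (Real.pi : ℂ) ≠ 0 := by exact_mod_cast hp.ne'
  have h2 : (Real.pi : ℂ) / (((4 * Real.pi ^ 2 * u : ℝ) : ℂ) * w) =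
      (((4 * Real.pi * u)⁻¹ : ℝ) : ℂ) * w⁻¹ := by
    push_cast; field_simp
  have h3 : ((4 * Real.pi * u)⁻¹) ^ (1 / 2 : ℝ) = (4 * Real.pi * u) ^ (-(1 / 2) : ℝ) := by
    rw [Real.inv_rpow (by positivity), Real.rpow_neg (by positivity)]
  have h4 := ofReal_mul_cpow (r := (4 * Real.pi * u)⁻¹) (by positivity) (inv_ne_zero hw0) (1 / 2)
  rw [h3] at h4
  have h5 : ((1 / 2 : ℝ) : ℂ) = 1 / 2 := by push_cast; rfl
  rw [← h4, ← h2, h5]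
  have h6 : (-(x ^ 2 * w⁻¹ / (4 * u)) : ℂ) =
      -(2 * Real.pi * x) ^ 2 / (4 * (((4 * Real.pi ^ 2 * u : ℝ) : ℂ) * w)) := by
    push_cast; field_simp; norm_num
  rw [h6, ← h1]
  refine integral_congr_ae (ae_of_all _ fun ξ => ?_)
  simp only
  congr 2
  · ring
  · push_cast; ring

/-- For Re w > 0 the double integral in `u` and `ξ` converges absolutely and Fubini applies. At the
Schrödinger value w = -i it does not, so that case is reached as a limit in
`integral_laplace_schroedinger`. -/
theorem integral_gaussian_laplace {w p : ℂ} (hw : 0 < w.re) (hp : 0 < p.re) (x : ℝ) :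
    ∫ u in Ioi (0 : ℝ), Complex.exp (-p * u) * ((((4 * Real.pi * u) ^ (-(1 / 2) : ℝ) : ℝ) : ℂ) *
      (w⁻¹) ^ ((1 / 2 : ℝ) : ℂ) * Complex.exp (-(x ^ 2 * w⁻¹ / (4 * u)))) =
    ∫ ξ : ℝ, Complex.exp (2 * Real.pi * x * ξ * Complex.I) * (p + 4 * Real.pi ^ 2 * ξ ^ 2 * w)⁻¹ := by
  have hpi := Real.pi_pos
  have hcast : ∀ ξ : ℝ, (4 * Real.pi ^ 2 * ξ ^ 2 : ℂ) = ((4 * Real.pi ^ 2 * ξ ^ 2 : ℝ) : ℂ) := by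
    intro ξ; push_cast; ring
  have hre : ∀ ξ : ℝ, (p + 4 * Real.pi ^ 2 * ξ ^ 2 * w).re = p.re + 4 * Real.pi ^ 2 * ξ ^ 2 * w.re := by
    intro ξ
    rw [hcast, Complex.add_re, Complex.re_ofReal_mul]
  have hre0 : ∀ ξ : ℝ, 0 < (p + 4 * Real.pi ^ 2 * ξ ^ 2 * w).re := by
    intro ξ; rw [hre]; positivity
  have e1 : ∫ u in Ioi (0 : ℝ), Complex.exp (-p * u) * ((((4 * Real.pi * u) ^ (-(1 / 2) : ℝ) : ℝ) : ℂ) *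
      (w⁻¹) ^ ((1 / 2 : ℝ) : ℂ) * Complex.exp (-(x ^ 2 * w⁻¹ / (4 * u)))) =
      ∫ u in Ioi (0 : ℝ), ∫ ξ : ℝ, Complex.exp (2 * Real.pi * x * ξ * Complex.I) *
        Complex.exp (-(p + 4 * Real.pi ^ 2 * ξ ^ 2 * w) * u) := by
    refine setIntegral_congr_fun measurableSet_Ioi fun u hu => ?_
    rw [← gaussian_fourier hw hu, ← integral_const_mul]
    refine integral_congr_ae (ae_of_all _ fun ξ => ?_)
    simp only
    have : -(p + 4 * Real.pi ^ 2 * ξ ^ 2 * w) * u = -p * u + -(4 * Real.pi ^ 2 * ξ ^ 2 * w) * u := by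
      ring
    rw [this, Complex.exp_add]; ring
  rw [e1, integral_integral_swap]
  · refine integral_congr_ae (ae_of_all _ fun ξ => ?_)
    simp only
    rw [integral_const_mul, integral_exp_mul_complex_Ioi
      (by rw [Complex.neg_re]; linarith [hre0 ξ]), Complex.ofReal_zero, mul_zero, Complex.exp_zero,
      neg_div_neg_eq, one_div]
  · have hm : AEStronglyMeasurable (Function.uncurry fun (u ξ : ℝ) =>
        Complex.exp (2 * Real.pi * x * ξ * Complex.I) *
        Complex.exp (-(p + 4 * Real.pi ^ 2 * ξ ^ 2 * w) * u)) ((volume.restrict (Ioi 0)).prod volume) := by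
      refine Continuous.aestronglyMeasurable ?_
      fun_prop
    rw [integrable_prod_iff' hm]
    have hn : ∀ u ξ : ℝ, ‖Complex.exp (2 * Real.pi * x * ξ * Complex.I) *
        Complex.exp (-(p + 4 * Real.pi ^ 2 * ξ ^ 2 * w) * u)‖ =
        Real.exp (-(p.re + 4 * Real.pi ^ 2 * ξ ^ 2 * w.re) * u) := by
      intro u ξ
      rw [norm_mul, norm_cexp_mul_I_real, one_mul, Complex.norm_exp, Complex.re_mul_ofReal,
        Complex.neg_re, hre]
    refine ⟨ae_of_all _ fun ξ => ?_, ?_⟩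
    · have h3 : (-(p + 4 * Real.pi ^ 2 * ξ ^ 2 * w)).re < 0 := by
        rw [Complex.neg_re]; linarith [hre0 ξ]
      exact (integrableOn_exp_mul_complex_Ioi h3 0).const_mul
        (Complex.exp (2 * Real.pi * x * ξ * Complex.I))
    · simp only [Function.uncurry]
      simp_rw [hn]
      have : ∀ ξ : ℝ, ∫ u in Ioi (0 : ℝ), Real.exp (-(p.re + 4 * Real.pi ^ 2 * ξ ^ 2 * w.re) * u) =
          (p.re + 4 * Real.pi ^ 2 * ξ ^ 2 * w.re)⁻¹ := by
        intro ξ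
        rw [integral_exp_mul_Ioi (by have := hre0 ξ; rw [hre] at this; linarith), mul_zero,
          Real.exp_zero, neg_div_neg_eq, one_div]
      simp_rw [this]
      have hi : Integrable fun ξ : ℝ => ((p.re)⁻¹ + w.re⁻¹) * (2 * (1 + |ξ|) ^ (-2 : ℝ)) :=
        ((integrable_one_add_abs_rpow (by norm_num)).const_mul 2).const_mul _
      refine hi.mono' ?_ (ae_of_all _ fun ξ => ?_)
      · refine Measurable.aestronglyMeasurable ?_
        fun_prop
      · have h0 := hre0 ξ
        rw [hre] at h0
        rw [Real.norm_of_nonneg (by positivity)]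
        refine le_trans ?_ (mul_le_mul_of_nonneg_left (one_add_sq_inv_le ξ) (by positivity))
        rw [abs_of_nonneg (by positivity), ← div_eq_mul_inv, le_div_iff₀ (by positivity),
          inv_mul_le_iff₀ h0]
        have : (p.re + 4 * Real.pi ^ 2 * ξ ^ 2 * w.re) * (p.re⁻¹ + w.re⁻¹) =
          1 + 4 * Real.pi ^ 2 * ξ ^ 2 + p.re * w.re⁻¹ + 4 * Real.pi ^ 2 * ξ ^ 2 * w.re * p.re⁻¹ := by
          field_simp
          ring
        rw [this]
        have : 0 ≤ p.re * w.re⁻¹ := by positivity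
        have : 0 ≤ 4 * Real.pi ^ 2 * ξ ^ 2 * w.re * p.re⁻¹ := by positivity
        linarith

theorem kernelN_zero (x : ℝ) (p : ℂ) :
    kernelN 0 x p = 2 * Complex.exp (-(Real.pi / 4 * Complex.I)) *
      ∫ ξ : ℝ, Complex.exp (2 * Real.pi * x * ξ * Complex.I) * (symb p ξ)⁻¹ := by
  unfold kernelN
  congr 1
  refine integral_congr_ae (ae_of_all _ fun ξ => ?_)
  simp

theorem cpow_half_I : Complex.I ^ ((1 / 2 : ℝ) : ℂ) = Complex.exp (Real.pi / 4 * Complex.I) := by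
  rw [Complex.cpow_def_of_ne_zero Complex.I_ne_zero, Complex.log_I]
  congr 1; push_cast; ring

theorem integrableOn_half_rpow_mul_exp {c : ℝ} (hc : 0 < c) :
    IntegrableOn (fun u : ℝ => u ^ (-(1 / 2) : ℝ) * Real.exp (-c * u)) (Ioi 0) := by
  have h1 := integrableOn_rpow_mul_exp_neg_mul_rpow (s := -(1 / 2)) (p := 1) (b := c)
    (by norm_num) one_pos hc
  simpa using h1

/-- Limit ε → 0+ of the Gaussian identity with w = ε - i. There 1/w tends to i, with |1/w| ≤ 1 and
Re(1/w) ≥ 0, so the time side is dominated by u^{-1/2} e^{-Re(p) u}; the frequency side is dominated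
because Re(p + 4π²ξ²w) stays above Re p. -/
theorem integral_laplace_schroedinger {p : ℂ} (hp : 0 < p.re) (x : ℝ) :
    ∫ u in Ioi (0 : ℝ), ((u ^ (-(1 / 2) : ℝ) : ℝ) : ℂ) * Complex.exp (-(Complex.I * x ^ 2 / (4 * u))) *
      Complex.exp (-p * u) = Real.sqrt Real.pi * kernelN 0 x p := by
  have hpi := Real.pi_pos
  let w : ℝ → ℂ := fun ε => ε - Complex.I
  have hwre : ∀ ε, (w ε).re = ε := fun ε => by simp [w]
  have hw0 : ∀ ε, w ε ≠ 0 := fun ε h => by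
    have : (w ε).im = -1 := by simp [w]
    rw [h] at this; simp at this
  have hwc : Tendsto (fun ε => (w ε)⁻¹) (𝓝[>] 0) (𝓝 Complex.I) := by
    have h1 : Tendsto w (𝓝[>] 0) (𝓝 (w 0)) :=
      ((by fun_prop : Continuous w).tendsto 0).mono_left nhdsWithin_le_nhds
    have h2 := h1.inv₀ (hw0 0)
    have h3 : (w 0)⁻¹ = Complex.I := by simp [w]
    rwa [h3] at h2
  have hwn : ∀ ε, ‖(w ε)⁻¹‖ ≤ 1 := by
    intro ε
    rw [norm_inv]
    refine inv_le_one_of_one_le₀ ?_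
    have := Complex.abs_im_le_norm (w ε)
    have h2 : (w ε).im = -1 := by simp [w]
    rw [h2] at this; simpa using this
  have hwr : ∀ ε > 0, 0 ≤ ((w ε)⁻¹).re := by
    intro ε hε
    rw [Complex.inv_re, hwre]
    exact div_nonneg hε.le (Complex.normSq_nonneg _)
  have hcp : Tendsto (fun ε => ((w ε)⁻¹) ^ ((1 / 2 : ℝ) : ℂ)) (𝓝[>] 0)
      (𝓝 (Complex.exp (Real.pi / 4 * Complex.I))) := by
    rw [← cpow_half_I]
    exact (hwc.cpow tendsto_const_nhds (by simp [Complex.mem_slitPlane_iff]))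
  have lim1 : Tendsto (fun ε => ∫ u in Ioi (0 : ℝ), Complex.exp (-p * u) *
      ((((4 * Real.pi * u) ^ (-(1 / 2) : ℝ) : ℝ) : ℂ) *
      ((w ε)⁻¹) ^ ((1 / 2 : ℝ) : ℂ) * Complex.exp (-(x ^ 2 * (w ε)⁻¹ / (4 * u))))) (𝓝[>] 0)
      (𝓝 (∫ u in Ioi (0 : ℝ), Complex.exp (-p * u) *
      ((((4 * Real.pi * u) ^ (-(1 / 2) : ℝ) : ℝ) : ℂ) *
      Complex.exp (Real.pi / 4 * Complex.I) * Complex.exp (-(x ^ 2 * Complex.I / (4 * u)))))) := by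
    refine tendsto_integral_filter_of_dominated_convergence
      (fun u => (4 * Real.pi) ^ (-(1 / 2) : ℝ) * (u ^ (-(1 / 2) : ℝ) * Real.exp (-p.re * u))) ?_ ?_ ?_ ?_
    · exact Eventually.of_forall fun ε => (Measurable.aestronglyMeasurable (by fun_prop))
    · filter_upwards [self_mem_nhdsWithin] with ε hε
      refine (ae_restrict_iff' measurableSet_Ioi).2 (ae_of_all _ fun u hu => ?_)
      have hu0 : (0 : ℝ) < u := hu
      have e1 : ‖((w ε)⁻¹) ^ ((1 / 2 : ℝ) : ℂ)‖ ≤ 1 := by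
        rw [Complex.norm_cpow_real]
        exact Real.rpow_le_one (norm_nonneg _) (hwn ε) (by norm_num)
      have e2 : ‖Complex.exp (-(x ^ 2 * (w ε)⁻¹ / (4 * u)))‖ ≤ 1 := by
        rw [Complex.norm_exp, Real.exp_le_one_iff]
        have : (-(x ^ 2 * (w ε)⁻¹ / (4 * u)) : ℂ) = ((-(x ^ 2 / (4 * u)) : ℝ) : ℂ) * (w ε)⁻¹ := by
          push_cast; ring
        rw [this, Complex.re_ofReal_mul]
        exact mul_nonpos_of_nonpos_of_nonneg (neg_nonpos.2 (by positivity)) (hwr ε hε)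
      have e3 : ‖Complex.exp (-p * u)‖ = Real.exp (-p.re * u) := by
        rw [Complex.norm_exp, Complex.re_mul_ofReal, Complex.neg_re]
      rw [norm_mul, norm_mul, norm_mul, e3, Complex.norm_real, Real.norm_of_nonneg (by positivity),
        Real.mul_rpow (by positivity) hu0.le]
      calc _ ≤ Real.exp (-p.re * u) * ((4 * Real.pi) ^ (-(1 / 2) : ℝ) * u ^ (-(1 / 2) : ℝ) * 1 * 1) := by
            gcongr
        _ = _ := by ring
    · exact (integrableOn_half_rpow_mul_exp hp).const_mul _
    · refine (ae_restrict_iff' measurableSet_Ioi).2 (ae_of_all _ fun u hu => ?_)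
      refine tendsto_const_nhds.mul ((tendsto_const_nhds.mul hcp).mul ?_)
      exact (((tendsto_const_nhds.mul hwc).div_const _).neg).cexp
  have lim2 : Tendsto (fun ε => ∫ ξ : ℝ, Complex.exp (2 * Real.pi * x * ξ * Complex.I) *
      (p + 4 * Real.pi ^ 2 * ξ ^ 2 * w ε)⁻¹) (𝓝[>] 0)
      (𝓝 (∫ ξ : ℝ, Complex.exp (2 * Real.pi * x * ξ * Complex.I) * (symb p ξ)⁻¹)) := by
    refine tendsto_integral_filter_of_dominated_convergence
      (fun ξ => 2 * (1 + 1 / p.re) * (1 + ‖p‖) * (1 + |ξ|) ^ (-2 : ℝ)) ?_ ?_ ?_ ?_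
    · exact Eventually.of_forall fun ε => (Measurable.aestronglyMeasurable (by fun_prop))
    · filter_upwards [self_mem_nhdsWithin] with ε hε
      refine ae_of_all _ fun ξ => ?_
      have hcast : (4 * Real.pi ^ 2 * ξ ^ 2 : ℂ) = ((4 * Real.pi ^ 2 * ξ ^ 2 : ℝ) : ℂ) := by
        push_cast; ring
      rw [norm_mul, norm_cexp_mul_I_real, one_mul]
      have h1 := norm_inv_le_of_im_eq hp (p := p) (d := p + 4 * Real.pi ^ 2 * ξ ^ 2 * w ε)
        (y := 4 * Real.pi ^ 2 * ξ ^ 2)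
        (by
          rw [hcast, Complex.add_re, Complex.re_ofReal_mul, hwre]
          have : (0 : ℝ) < ε := hε
          have : 0 ≤ 4 * Real.pi ^ 2 * ξ ^ 2 * ε := by positivity
          linarith)
        (by
          rw [hcast, Complex.add_im, Complex.im_ofReal_mul]
          have : (w ε).im = -1 := by simp [w]
          rw [this]; ring)
      calc _ ≤ _ := h1
        _ ≤ (1 + 1 / p.re) * (1 + ‖p‖) * (2 * (1 + |ξ|) ^ (-2 : ℝ)) := by
            gcongr; exact one_add_sq_inv_le ξ
        _ = _ := by ring
    · exact (integrable_one_add_abs_rpow (by norm_num)).const_mul _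
    · refine ae_of_all _ fun ξ => tendsto_const_nhds.mul ?_
      refine Tendsto.inv₀ ?_ (symb_ne_zero hp ξ)
      have h1 : Tendsto w (𝓝[>] 0) (𝓝 (w 0)) :=
        ((by fun_prop : Continuous w).tendsto 0).mono_left nhdsWithin_le_nhds
      have h2 := (h1.const_mul (4 * Real.pi ^ 2 * ξ ^ 2 : ℂ)).const_add p
      have h3 : p + 4 * Real.pi ^ 2 * ξ ^ 2 * w 0 = symb p ξ := by simp [w, symb, sub_eq_add_neg]
      rwa [h3] at h2
  have key := tendsto_nhds_unique (lim2.congr' ?_) lim1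
  · rw [kernelN_zero]
    rw [key, ← integral_const_mul, ← integral_const_mul]
    refine setIntegral_congr_fun measurableSet_Ioi fun u hu => ?_
    have hu0 : (0 : ℝ) < u := hu
    have e4 : (4 * Real.pi * u) ^ (-(1 / 2) : ℝ) =
        (2 * Real.sqrt Real.pi)⁻¹ * u ^ (-(1 / 2) : ℝ) := by
      have : (2 * Real.sqrt Real.pi) = Real.sqrt (4 * Real.pi) := by
        rw [Real.sqrt_mul (by norm_num)]
        congr 1
        rw [show (4 : ℝ) = 2 ^ 2 by norm_num, Real.sqrt_sq (by norm_num)]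
      rw [Real.mul_rpow (by positivity) hu0.le, this, Real.rpow_neg (by positivity),
        Real.sqrt_eq_rpow]
    have e5 : Complex.exp (-(Real.pi / 4 * Complex.I)) * Complex.exp (Real.pi / 4 * Complex.I) = 1 := by
      rw [← Complex.exp_add]; simp
    have hs : (Real.sqrt Real.pi : ℂ) ≠ 0 := by
      exact_mod_cast (Real.sqrt_pos.2 hpi).ne'
    rw [e4]
    push_cast
    have e6 : ∀ A B C D : ℂ, (Real.sqrt Real.pi : ℂ) * (2 * Complex.exp (-(Real.pi / 4 * Complex.I)) *
        (A * ((2 * (Real.sqrt Real.pi : ℂ))⁻¹ * B * Complex.exp (Real.pi / 4 * Complex.I) * C))) =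
        (Complex.exp (-(Real.pi / 4 * Complex.I)) * Complex.exp (Real.pi / 4 * Complex.I)) *
          (B * C * A) := by
      intro A B C D
      field_simp
    rw [e6 _ _ _ 0, e5, one_mul]
    have e7 : (Complex.I * x ^ 2 / (4 * u) : ℂ) = x ^ 2 * Complex.I / (4 * u) := by ring
    rw [e7]
  · filter_upwards [self_mem_nhdsWithin] with ε hε
    exact (integral_gaussian_laplace (by rw [hwre]; exact hε) hp x).symm

end Kernel

/-! ### The explicit profile for order zero -/

section RotatedRoot

/-- The square root `e^{iπ/4} p^{1/2}` of `ip`. -/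
noncomputable def rotSqrt (p : ℂ) : ℂ := Complex.exp (Real.pi / 4 * Complex.I) * p ^ ((1 / 2 : ℝ) : ℂ)

theorem cpow_half_sq (p : ℂ) : (p ^ ((1 / 2 : ℝ) : ℂ)) ^ 2 = p := by
  have : ((1 / 2 : ℝ) : ℂ) = ((2 : ℕ) : ℂ)⁻¹ := by push_cast; norm_num
  rw [this, Complex.cpow_nat_inv_pow p two_ne_zero]

theorem exp_quarter_sq : Complex.exp (Real.pi / 4 * Complex.I) ^ 2 = Complex.I := by
  refine Eq.trans ?_ Complex.exp_pi_div_two_mul_I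
  rw [← Complex.exp_nat_mul]
  congr 1; push_cast; ring

theorem rotSqrt_sq (p : ℂ) : rotSqrt p ^ 2 = Complex.I * p := by
  rw [rotSqrt, mul_pow, cpow_half_sq, exp_quarter_sq]

theorem norm_exp_quarter : ‖Complex.exp (Real.pi / 4 * Complex.I)‖ = 1 := by
  have : (Real.pi / 4 * Complex.I : ℂ) = ((Real.pi / 4 : ℝ) : ℂ) * Complex.I := by push_cast; ring
  rw [this, Complex.norm_exp_ofReal_mul_I]

theorem norm_rotSqrt (p : ℂ) : ‖rotSqrt p‖ = ‖p‖ ^ (1 / 2 : ℝ) := by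
  rw [rotSqrt, norm_mul, Complex.norm_cpow_real, norm_exp_quarter, one_mul]

/-- Since |arg p| < π/2, the argument π/4 + (arg p)/2 of the root lies in (0, π/2). Positivity of
the real part is what selects the decaying exponential. -/
theorem rotSqrt_re_pos {p : ℂ} (hp : 0 < p.re) : 0 < (rotSqrt p).re := by
  have hp0 : p ≠ 0 := fun h => by rw [h] at hp; simp at hp
  have harg := Complex.abs_arg_lt_pi_div_two_iff.2 (Or.inl hp)
  rw [abs_lt] at harg
  have h1 : rotSqrt p = Complex.exp (((Real.log ‖p‖ / 2 : ℝ) : ℂ) +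
      ((Real.pi / 4 + p.arg / 2 : ℝ) : ℂ) * Complex.I) := by
    rw [rotSqrt, Complex.cpow_def_of_ne_zero hp0, ← Complex.exp_add, Complex.log]
    congr 1; push_cast; ring
  rw [h1, Complex.exp_re]
  refine mul_pos (Real.exp_pos _) (Real.cos_pos_of_mem_Ioo ⟨?_, ?_⟩)
  · simp; linarith [Real.pi_pos]
  · simp; linarith [Real.pi_pos]

/-- Write κ for the root. The imaginary part of κ² = ip reads Re p = 2 Re κ Im κ, and Im κ ≤ |κ| =
|p|^{1/2}. This bounds the exponential decay rate from below. -/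
theorem le_rotSqrt_re {p : ℂ} (hp : 0 < p.re) :
    p.re ≤ 2 * ‖p‖ ^ (1 / 2 : ℝ) * (rotSqrt p).re := by
  have h1 := congrArg Complex.im (rotSqrt_sq p)
  have h2 : (Complex.I * p).im = p.re := by simp
  rw [h2, sq, Complex.mul_im] at h1
  have h3 := (le_abs_self _).trans (Complex.abs_im_le_norm (rotSqrt p))
  rw [norm_rotSqrt] at h3
  nlinarith [rotSqrt_re_pos hp]

theorem norm_exp_neg_mul_abs (κ : ℂ) (x : ℝ) :
    ‖Complex.exp (-κ * (|x| : ℝ))‖ = Real.exp (-κ.re * |x|) := by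
  rw [Complex.norm_exp, Complex.re_mul_ofReal, Complex.neg_re]

theorem continuous_exp_neg_mul_abs (κ : ℂ) : Continuous fun x : ℝ => Complex.exp (-κ * (|x| : ℝ)) := by
  fun_prop

theorem integrable_exp_neg_mul_abs {κ : ℂ} (hκ : 0 < κ.re) :
    Integrable fun x : ℝ => Complex.exp (-κ * (|x| : ℝ)) :=
  integrable_comp_abs_of_integrableOn (g := fun x : ℝ => Complex.exp (-κ * x))
    (integrableOn_exp_mul_complex_Ioi (by rw [Complex.neg_re]; linarith) 0)

theorem fourier_exp_neg_mul_abs {κ : ℂ} (hκ : 0 < κ.re) (ξ : ℝ) :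
    𝓕 (fun x : ℝ => Complex.exp (-κ * (|x| : ℝ))) ξ =
      2 * κ * (κ ^ 2 + 4 * Real.pi ^ 2 * ξ ^ 2)⁻¹ := by
  rw [Real.fourier_eq']
  have hI : Integrable fun x : ℝ => Complex.exp ((-2 * Real.pi * (inner ℝ x ξ) : ℝ) * Complex.I) •
      Complex.exp (-κ * (|x| : ℝ)) := by
    refine (integrable_exp_neg_mul_abs hκ).bdd_mul (c := 1) ?_ (ae_of_all _ fun x => ?_)
    · refine Continuous.aestronglyMeasurable ?_
      fun_prop
    · rw [Complex.norm_exp_ofReal_mul_I]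
  have hre1 : (-(κ + 2 * Real.pi * ξ * Complex.I)).re < 0 := by simp; exact hκ
  have hre2 : (-(κ - 2 * Real.pi * ξ * Complex.I)).re < 0 := by simp; exact hκ
  have h1 : ∫ x in Ioi (0 : ℝ), Complex.exp ((-2 * Real.pi * (inner ℝ x ξ) : ℝ) * Complex.I) •
      Complex.exp (-κ * (|x| : ℝ)) = (κ + 2 * Real.pi * ξ * Complex.I)⁻¹ := by
    have := integral_exp_mul_complex_Ioi hre1 0
    rw [Complex.ofReal_zero, mul_zero, Complex.exp_zero, neg_div_neg_eq, one_div] at this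
    rw [← this]
    refine setIntegral_congr_fun measurableSet_Ioi fun x hx => ?_
    have hx0 : (0 : ℝ) < x := hx
    simp only [smul_eq_mul]
    rw [← Complex.exp_add, abs_of_pos hx0]
    congr 1
    simp only [RCLike.inner_apply, conj_trivial]
    push_cast; ring
  have h2 : ∫ x in Iic (0 : ℝ), Complex.exp ((-2 * Real.pi * (inner ℝ x ξ) : ℝ) * Complex.I) •
      Complex.exp (-κ * (|x| : ℝ)) = (κ - 2 * Real.pi * ξ * Complex.I)⁻¹ := by
    have := integral_exp_mul_complex_Ioi hre2 0
    rw [Complex.ofReal_zero, mul_zero, Complex.exp_zero, neg_div_neg_eq, one_div] at this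
    rw [← this]
    have h3 := integral_comp_neg_Ioi (0 : ℝ) (fun x : ℝ =>
      Complex.exp ((-2 * Real.pi * (inner ℝ x ξ) : ℝ) * Complex.I) • Complex.exp (-κ * (|x| : ℝ)))
    rw [neg_zero] at h3
    rw [← h3]
    refine setIntegral_congr_fun measurableSet_Ioi fun x hx => ?_
    have hx0 : (0 : ℝ) < x := hx
    simp only [smul_eq_mul]
    rw [← Complex.exp_add, abs_neg, abs_of_pos hx0]
    congr 1
    simp only [RCLike.inner_apply, conj_trivial]
    push_cast; ring
  rw [← integral_add_compl measurableSet_Ioi hI, compl_Ioi, h1, h2]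
  have n1 : κ + 2 * Real.pi * ξ * Complex.I ≠ 0 := fun h => by
    rw [h] at hre1; simp at hre1
  have n2 : κ - 2 * Real.pi * ξ * Complex.I ≠ 0 := fun h => by
    rw [h] at hre2; simp at hre2
  have n3 : κ ^ 2 + 4 * Real.pi ^ 2 * ξ ^ 2 =
      (κ + 2 * Real.pi * ξ * Complex.I) * (κ - 2 * Real.pi * ξ * Complex.I) := by
    ring_nf; rw [Complex.I_sq]; ring
  rw [n3]
  field_simp
  ring

/-- The Fourier transform of e^{-κ|x|} is 2κ/(κ² + 4π²ξ²), and κ² = ip makes the denominator equal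
to i(p - 4π²iξ²). Fourier inversion at the point `x` gives the profile. -/
theorem kernelN_zero_eq {p : ℂ} (hp : 0 < p.re) (x : ℝ) :
    kernelN 0 x p = p ^ ((-(1 / 2) : ℝ) : ℂ) * Complex.exp (-rotSqrt p * (|x| : ℝ)) := by
  set κ := rotSqrt p with hκdef
  have hκ := rotSqrt_re_pos hp
  rw [← hκdef] at hκ
  have hκ0 : κ ≠ 0 := fun h => by rw [h] at hκ; simp at hκ
  have hp0 : p ≠ 0 := fun h => by rw [h] at hp; simp at hp
  have hF : 𝓕 (fun x : ℝ => Complex.exp (-κ * (|x| : ℝ))) =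
      fun ξ => 2 * κ / Complex.I * (symb p ξ)⁻¹ := by
    ext ξ
    rw [fourier_exp_neg_mul_abs hκ, rotSqrt_sq]
    have : Complex.I * p + 4 * Real.pi ^ 2 * ξ ^ 2 = Complex.I * symb p ξ := by
      rw [symb]; ring_nf; rw [Complex.I_sq]; ring
    rw [this, mul_inv, div_eq_mul_inv]; ring
  have hFI : Integrable (𝓕 (fun x : ℝ => Complex.exp (-κ * (|x| : ℝ)))) := by
    rw [hF]
    refine Integrable.const_mul ?_ _
    refine Integrable.mono' (((integrable_one_add_abs_rpow (r := -2) (by norm_num)).const_mul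
      (2 * (1 + 1 / p.re) * (1 + ‖p‖)))) ?_ (ae_of_all _ fun ξ => norm_symb_inv_le hp le_rfl ξ)
    exact ((continuous_symb p).inv₀ (symb_ne_zero hp)).aestronglyMeasurable
  have hinv := (integrable_exp_neg_mul_abs hκ).fourierInv_fourier_eq hFI
    ((continuous_exp_neg_mul_abs κ).continuousAt (x := x))
  rw [hF, Real.fourierInv_eq'] at hinv
  rw [← hinv, kernelN_zero, ← integral_const_mul, ← integral_const_mul]
  refine integral_congr_ae (ae_of_all _ fun ξ => ?_)
  simp only [smul_eq_mul]
  have e1 : ((2 * Real.pi * (inner ℝ ξ x) : ℝ) : ℂ) * Complex.I = 2 * Real.pi * x * ξ * Complex.I := by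
    simp only [RCLike.inner_apply, conj_trivial]
    push_cast; ring
  rw [e1]
  have e2 : 2 * Complex.exp (-(Real.pi / 4 * Complex.I)) =
      p ^ ((-(1 / 2) : ℝ) : ℂ) * (2 * κ / Complex.I) := by
    have hI := exp_quarter_sq
    rw [hκdef, rotSqrt, Complex.exp_neg]
    have h3 : p ^ ((-(1 / 2) : ℝ) : ℂ) * p ^ ((1 / 2 : ℝ) : ℂ) = 1 := by
      rw [← Complex.cpow_add _ _ hp0]; push_cast; norm_num
    have h4 := Complex.exp_ne_zero (Real.pi / 4 * Complex.I)
    generalize Complex.exp (Real.pi / 4 * Complex.I) = e at hI h4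
    rw [← hI]
    field_simp
    linear_combination -h3
  rw [e2]; ring

/-- The decay rate a = Re κ satisfies γ ≤ 2‖p‖^{1/2} a, so y² e^{-a|y|} is of size a^{-2}, at most a
multiple of ‖p‖/γ². Hence quadratic decay in `y` costs one power of 1 + |τ|, harmless against
rapidly decreasing data. -/
theorem norm_kernelN_zero_le {γ : ℝ} (hγ : 0 < γ) : ∃ C : ℝ, 0 ≤ C ∧ ∀ τ y : ℝ,
    ‖kernelN 0 y (linePt γ τ)‖ ≤ C * (1 + |τ|) * (1 + |y|) ^ (-2 : ℝ) := by
  refine ⟨γ ^ (-(1 / 2) : ℝ) * (2 + 16 / γ ^ 2 * (γ + 2 * Real.pi)), by positivity, fun τ y => ?_⟩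
  have hpi := Real.pi_pos
  set p := linePt γ τ with hp
  have hpre : p.re = γ := linePt_re γ τ
  have hp1 : γ ≤ ‖p‖ := le_norm_linePt hγ τ
  have hp0 : 0 < ‖p‖ := hγ.trans_le hp1
  have hκ := rotSqrt_re_pos (p := p) (by rw [hpre]; exact hγ)
  have hκ2 := le_rotSqrt_re (p := p) (by rw [hpre]; exact hγ)
  rw [hpre] at hκ2
  set a := (rotSqrt p).re
  have hs : (‖p‖ ^ (1 / 2 : ℝ)) ^ 2 = ‖p‖ := by
    rw [← Real.rpow_natCast, ← Real.rpow_mul hp0.le]; norm_num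
  have ha2 : γ ^ 2 ≤ 4 * ‖p‖ * a ^ 2 := by
    calc γ ^ 2 ≤ (2 * ‖p‖ ^ (1 / 2 : ℝ) * a) ^ 2 := by gcongr
      _ = 4 * (‖p‖ ^ (1 / 2 : ℝ)) ^ 2 * a ^ 2 := by ring
      _ = _ := by rw [hs]
  have hexp : (1 + |y|) ^ 2 * Real.exp (-a * |y|) ≤ 2 + 16 * ‖p‖ / γ ^ 2 := by
    have h1 : 1 + (a * |y|) + (a * |y|) ^ 2 / 2 ≤ Real.exp (a * |y|) :=
      Real.quadratic_le_exp_of_nonneg (by positivity)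
    rw [neg_mul, Real.exp_neg, ← div_eq_mul_inv, div_le_iff₀ (Real.exp_pos _)]
    have h2 : 1 ≤ 4 * ‖p‖ / γ ^ 2 * a ^ 2 := by
      rw [div_mul_eq_mul_div, le_div_iff₀ (by positivity)]; linarith
    have h4 : 2 * |y| ^ 2 ≤ 16 * ‖p‖ / γ ^ 2 * ((a * |y|) ^ 2 / 2) := by
      calc 2 * |y| ^ 2 = 2 * |y| ^ 2 * 1 := by ring
        _ ≤ 2 * |y| ^ 2 * (4 * ‖p‖ / γ ^ 2 * a ^ 2) := by gcongr
        _ = _ := by ring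
    have h5 : 0 ≤ 16 * ‖p‖ / γ ^ 2 := by positivity
    have h6 : (1 + |y|) ^ 2 ≤ 2 + 2 * |y| ^ 2 := by nlinarith [sq_nonneg (1 - |y|)]
    have h7 : 0 ≤ a * |y| := by positivity
    calc (1 + |y|) ^ 2 ≤ 2 + 2 * |y| ^ 2 := h6
      _ ≤ 2 * 1 + 16 * ‖p‖ / γ ^ 2 * ((a * |y|) ^ 2 / 2) := by linarith
      _ ≤ 2 * Real.exp (a * |y|) + 16 * ‖p‖ / γ ^ 2 * Real.exp (a * |y|) := by
          gcongr
          · nlinarith [sq_nonneg (a * |y|)]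
          · nlinarith [sq_nonneg (a * |y|)]
      _ = _ := by ring
  have hy : (0 : ℝ) < 1 + |y| := by positivity
  rw [kernelN_zero_eq (by rw [hpre]; exact hγ), norm_mul, norm_exp_neg_mul_abs,
    Complex.norm_cpow_real, Real.rpow_neg hy.le, Real.rpow_two, ← div_eq_mul_inv,
    le_div_iff₀ (by positivity)]
  have hpb := norm_linePt_le hγ.le τ
  calc ‖p‖ ^ (-(1 / 2) : ℝ) * Real.exp (-a * |y|) * (1 + |y|) ^ 2
      = ‖p‖ ^ (-(1 / 2) : ℝ) * ((1 + |y|) ^ 2 * Real.exp (-a * |y|)) := by ring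
    _ ≤ γ ^ (-(1 / 2) : ℝ) * (2 + 16 * ‖p‖ / γ ^ 2) := by
        exact mul_le_mul (Real.rpow_le_rpow_of_nonpos hγ hp1 (by norm_num)) hexp
          (by positivity) (by positivity)
    _ ≤ γ ^ (-(1 / 2) : ℝ) * ((2 + 16 / γ ^ 2 * (γ + 2 * Real.pi)) * (1 + |τ|)) := by
        refine mul_le_mul_of_nonneg_left ?_ (by positivity)
        have h8 : 16 / γ ^ 2 * ‖p‖ ≤ 16 / γ ^ 2 * ((γ + 2 * Real.pi) * (1 + |τ|)) :=
          mul_le_mul_of_nonneg_left hpb (by positivity)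
        have h9 : 16 * ‖p‖ / γ ^ 2 = 16 / γ ^ 2 * ‖p‖ := by ring
        rw [h9]
        nlinarith [abs_nonneg τ]
    _ = _ := by ring

end RotatedRoot

/-! ### Regularity of the profiles and the multiplier of the spatial convolution -/

section KernelProperties

theorem norm_cpow_mul_symb_inv_le {μ γ : ℝ} {p : ℂ} (hγ : 0 < γ) (hp : γ ≤ p.re) (ξ : ℝ) :
    ‖(-(2 * Real.pi * ξ * Complex.I) : ℂ) ^ ((-μ : ℝ) : ℂ) * (symb p ξ)⁻¹‖ ≤
      (2 * Real.pi) ^ (-μ) * (2 * (1 + 1 / γ)) * (1 + ‖p‖) * (|ξ| ^ (-μ) * (1 + |ξ|) ^ (-2 : ℝ)) := by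
  rw [norm_mul, Complex.norm_cpow_real, norm_two_pi_mul_I,
    Real.mul_rpow Real.two_pi_pos.le (abs_nonneg _)]
  calc _ ≤ (2 * Real.pi) ^ (-μ) * |ξ| ^ (-μ) *
        (2 * (1 + 1 / γ) * (1 + ‖p‖) * (1 + |ξ|) ^ (-2 : ℝ)) := by
        gcongr; exact norm_symb_inv_le hγ hp ξ
    _ = _ := by ring

theorem measurable_kernelN_integrand (μ x : ℝ) (p : ℂ) : Measurable fun ξ : ℝ =>
    Complex.exp (2 * Real.pi * x * ξ * Complex.I) *
      (-(2 * Real.pi * ξ * Complex.I)) ^ ((-μ : ℝ) : ℂ) * (symb p ξ)⁻¹ := by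
  have := (continuous_symb p).measurable
  fun_prop

theorem norm_kernelN_integrand_le {μ γ : ℝ} {p : ℂ} (hγ : 0 < γ) (hp : γ ≤ p.re) (x ξ : ℝ) :
    ‖Complex.exp (2 * Real.pi * x * ξ * Complex.I) *
      (-(2 * Real.pi * ξ * Complex.I)) ^ ((-μ : ℝ) : ℂ) * (symb p ξ)⁻¹‖ ≤
      (2 * Real.pi) ^ (-μ) * (2 * (1 + 1 / γ)) * (1 + ‖p‖) * (|ξ| ^ (-μ) * (1 + |ξ|) ^ (-2 : ℝ)) := by
  rw [mul_assoc, norm_mul, norm_cexp_mul_I_real, one_mul]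
  exact norm_cpow_mul_symb_inv_le hγ hp ξ

theorem continuous_kernelN {μ γ : ℝ} (h1 : -1 < μ) (h2 : μ < 1) (hγ : 0 < γ) :
    Continuous fun q : ℝ × ℝ => kernelN μ q.1 (linePt γ q.2) := by
  unfold kernelN
  refine continuous_const.mul ?_
  rw [continuous_iff_continuousAt]
  intro q₀
  have hc := continuous_linePt γ
  refine continuousAt_of_dominated (bound := fun ξ => (2 * Real.pi) ^ (-μ) * (2 * (1 + 1 / γ)) *
    (1 + (‖linePt γ q₀.2‖ + 1)) * (|ξ| ^ (-μ) * (1 + |ξ|) ^ (-2 : ℝ))) ?_ ?_ ?_ ?_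
  · exact Eventually.of_forall fun q => (measurable_kernelN_integrand μ q.1 _).aestronglyMeasurable
  · have : ∀ᶠ q : ℝ × ℝ in 𝓝 q₀, ‖linePt γ q.2‖ < ‖linePt γ q₀.2‖ + 1 :=
      (by fun_prop : Continuous fun q : ℝ × ℝ => ‖linePt γ q.2‖).continuousAt.eventually_lt
        continuousAt_const (by linarith)
    filter_upwards [this] with q hq
    refine ae_of_all _ fun ξ => (norm_kernelN_integrand_le hγ (linePt_re γ q.2).ge q.1 ξ).trans ?_
    gcongr
  · exact (integrable_abs_rpow_mul_one_add_rpow (by linarith) (by linarith)).const_mul _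
  · refine ae_of_all _ fun ξ => ContinuousAt.mul (ContinuousAt.mul (by fun_prop) (by fun_prop)) ?_
    refine ContinuousAt.inv₀ ?_ (symb_ne_zero (by rw [linePt_re]; exact hγ) ξ)
    unfold symb
    fun_prop

theorem continuous_kernelN_comp {X : Type*} [TopologicalSpace X] {μ γ : ℝ} (h1 : -1 < μ)
    (h2 : μ < 1) (hγ : 0 < γ) {f g : X → ℝ} (hf : Continuous f) (hg : Continuous g) :
    Continuous fun u => kernelN μ (f u) (linePt γ (g u)) := by
  have h := Continuous.comp' (continuous_kernelN h1 h2 hγ) (hf.prodMk hg)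
  exact h

theorem norm_kernelN_le {μ γ : ℝ} (h1 : -1 < μ) (h2 : μ < 1) (hγ : 0 < γ) :
    ∃ C : ℝ, 0 ≤ C ∧ ∀ x τ : ℝ, ‖kernelN μ x (linePt γ τ)‖ ≤ C * (1 + |τ|) := by
  set J := ∫ ξ : ℝ, |ξ| ^ (-μ) * (1 + |ξ|) ^ (-2 : ℝ)
  have hJ : 0 ≤ J := integral_nonneg fun ξ => by positivity
  refine ⟨2 * ((2 * Real.pi) ^ (-μ) * (2 * (1 + 1 / γ)) * (1 + (γ + 2 * Real.pi)) * J), by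
    have := Real.pi_pos; positivity, fun x τ => ?_⟩
  unfold kernelN
  have e0 : ‖Complex.exp (-(Real.pi / 4 * Complex.I))‖ = 1 := by
    rw [Complex.exp_neg, norm_inv, norm_exp_quarter, inv_one]
  rw [norm_mul, norm_mul, e0, mul_one, Complex.norm_two]
  have hp := norm_linePt_le hγ.le τ
  have hi : Integrable fun ξ : ℝ => |ξ| ^ (-μ) * (1 + |ξ|) ^ (-2 : ℝ) :=
    integrable_abs_rpow_mul_one_add_rpow (by linarith) (by linarith)
  have hpi := Real.pi_pos
  calc _ ≤ 2 * ∫ ξ : ℝ, (2 * Real.pi) ^ (-μ) * (2 * (1 + 1 / γ)) * (1 + ‖linePt γ τ‖) *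
        (|ξ| ^ (-μ) * (1 + |ξ|) ^ (-2 : ℝ)) := by
        gcongr
        exact norm_integral_le_of_norm_le (hi.const_mul _)
          (ae_of_all _ fun ξ => norm_kernelN_integrand_le hγ (linePt_re γ τ).ge x ξ)
    _ = 2 * ((2 * Real.pi) ^ (-μ) * (2 * (1 + 1 / γ)) * (1 + ‖linePt γ τ‖) * J) := by
        rw [integral_const_mul]
    _ ≤ 2 * ((2 * Real.pi) ^ (-μ) * (2 * (1 + 1 / γ)) *
          ((1 + (γ + 2 * Real.pi)) * (1 + |τ|)) * J) := by
        gcongr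
        nlinarith [abs_nonneg τ]
    _ = _ := by ring

/-- Differentiation brings down 2πiξ, which raises the power of -2πiξ by one with a minus sign. The
range -1 < μ < 0 keeps both the integral and its derivative absolutely convergent at the origin and
at infinity. -/
theorem hasDerivAt_kernelN {μ : ℝ} {p : ℂ} (h1 : -1 < μ) (h2 : μ < 0) (hp : 0 < p.re) (x : ℝ) :
    HasDerivAt (fun x => kernelN (μ + 1) x p) (-kernelN μ x p) x := by
  unfold kernelN
  suffices h : HasDerivAt (fun x : ℝ => ∫ ξ : ℝ, Complex.exp (2 * Real.pi * x * ξ * Complex.I) *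
      (-(2 * Real.pi * ξ * Complex.I)) ^ ((-(μ + 1) : ℝ) : ℂ) * (symb p ξ)⁻¹)
      (∫ ξ : ℝ, -(Complex.exp (2 * Real.pi * x * ξ * Complex.I) *
        (-(2 * Real.pi * ξ * Complex.I)) ^ ((-μ : ℝ) : ℂ) * (symb p ξ)⁻¹)) x by
    rw [integral_neg] at h
    exact (h.const_mul _).congr_deriv (mul_neg _ _)
  refine (hasDerivAt_integral_of_dominated_loc_of_deriv_le (s := univ)
    (F := fun (x ξ : ℝ) => Complex.exp (2 * Real.pi * x * ξ * Complex.I) *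
    (-(2 * Real.pi * ξ * Complex.I)) ^ ((-(μ + 1) : ℝ) : ℂ) * (symb p ξ)⁻¹)
    (F' := fun (x ξ : ℝ) => -(Complex.exp (2 * Real.pi * x * ξ * Complex.I) *
    (-(2 * Real.pi * ξ * Complex.I)) ^ ((-μ : ℝ) : ℂ) * (symb p ξ)⁻¹))
    (bound := fun ξ => (2 * Real.pi) ^ (-μ) * (2 * (1 + 1 / p.re)) * (1 + ‖p‖) *
      (|ξ| ^ (-μ) * (1 + |ξ|) ^ (-2 : ℝ))) univ_mem ?_ ?_ ?_ ?_ ?_ ?_).2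
  · exact Eventually.of_forall fun y => (measurable_kernelN_integrand _ y _).aestronglyMeasurable
  · refine Integrable.mono' (((integrable_abs_rpow_mul_one_add_rpow (a := -(μ + 1)) (b := -2)
      (by linarith) (by linarith)).const_mul _))
      (measurable_kernelN_integrand _ x _).aestronglyMeasurable
      (ae_of_all _ fun ξ => norm_kernelN_integrand_le hp le_rfl x ξ)
  · exact (measurable_kernelN_integrand _ x _).neg.aestronglyMeasurable
  · refine ae_of_all _ fun ξ y _ => ?_
    rw [norm_neg]
    exact norm_kernelN_integrand_le hp le_rfl y ξ
  · exact (integrable_abs_rpow_mul_one_add_rpow (by linarith) (by linarith)).const_mul _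
  · have h0 : ∀ᵐ ξ : ℝ, ξ ≠ 0 := by simp [ae_iff, measure_singleton]
    filter_upwards [h0] with ξ hξ y _
    have d1 : HasDerivAt (fun y : ℝ => Complex.exp (2 * Real.pi * y * ξ * Complex.I))
        (Complex.exp (2 * Real.pi * y * ξ * Complex.I) * (2 * Real.pi * ξ * Complex.I)) y := by
      have h3 : HasDerivAt (fun y : ℝ => (2 * Real.pi * y * ξ * Complex.I : ℂ))
          (2 * Real.pi * ξ * Complex.I) y := by
        have := ((hasDerivAt_id y).ofReal_comp).const_mul (2 * Real.pi * ξ * Complex.I : ℂ)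
        refine (this.congr_deriv (by simp)).congr_of_eventuallyEq
          (Eventually.of_forall fun z => ?_)
        simp; ring
      exact h3.cexp
    refine ((d1.mul_const _).mul_const _).congr_deriv ?_
    have hz : (-(2 * Real.pi * ξ * Complex.I) : ℂ) ≠ 0 := by
      simp [Real.pi_ne_zero, hξ]
    have h4 : (-(2 * Real.pi * ξ * Complex.I) : ℂ) ^ ((-μ : ℝ) : ℂ) =
        (-(2 * Real.pi * ξ * Complex.I) : ℂ) ^ ((-(μ + 1) : ℝ) : ℂ) * (-(2 * Real.pi * ξ * Complex.I)) := by
      nth_rw 3 [← Complex.cpow_one (-(2 * Real.pi * ξ * Complex.I) : ℂ)]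
      rw [← Complex.cpow_add _ _ hz]; congr 1; push_cast; ring
    rw [h4]; ring

theorem integrable_bdd_mul_symb_inv {p : ℂ} (hp : 0 < p.re) :
    Integrable fun ξ : ℝ => (symb p ξ)⁻¹ := by
  refine Integrable.mono' (((integrable_one_add_abs_rpow (r := -2) (by norm_num)).const_mul
    (2 * (1 + 1 / p.re) * (1 + ‖p‖)))) ?_ (ae_of_all _ fun ξ => norm_symb_inv_le hp le_rfl ξ)
  exact ((continuous_symb p).inv₀ (symb_ne_zero hp)).aestronglyMeasurable

/-- The damping e^{-εu} makes the double integral absolutely convergent, and the inner integral is a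
Gamma integral with parameter ε - 2πiξ. The damping is removed in `integral_rpow_mul_kernelN_zero`.
-/
theorem integral_rpow_mul_exp_mul_kernelN_zero {μ ε : ℝ} {p : ℂ} (h1 : 0 < μ) (hp : 0 < p.re)
    (hε : 0 < ε) (x : ℝ) :
    ∫ u in Ioi (0 : ℝ), (((u ^ (μ - 1) : ℝ) : ℂ) * Complex.exp (-(ε : ℂ) * u)) * kernelN 0 (x + u) p =
      Real.Gamma μ * (2 * Complex.exp (-(Real.pi / 4 * Complex.I)) *
        ∫ ξ : ℝ, Complex.exp (2 * Real.pi * x * ξ * Complex.I) *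
          (ε - 2 * Real.pi * ξ * Complex.I) ^ ((-μ : ℝ) : ℂ) * (symb p ξ)⁻¹) := by
  have e1 : ∀ u : ℝ, (((u ^ (μ - 1) : ℝ) : ℂ) * Complex.exp (-(ε : ℂ) * u)) * kernelN 0 (x + u) p =
      2 * Complex.exp (-(Real.pi / 4 * Complex.I)) * ∫ ξ : ℝ,
        Complex.exp (2 * Real.pi * (x + u) * ξ * Complex.I) *
        ((((u ^ (μ - 1) : ℝ) : ℂ) * Complex.exp (-(ε : ℂ) * u)) * (symb p ξ)⁻¹) := by
    intro u
    rw [kernelN_zero, mul_left_comm, ← integral_const_mul]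
    congr 1
    refine integral_congr_ae (ae_of_all _ fun ξ => ?_)
    push_cast; ring
  simp_rw [e1]
  rw [integral_const_mul, integral_integral_swap]
  · rw [mul_left_comm (Real.Gamma μ : ℂ), ← integral_const_mul (Real.Gamma μ : ℂ)]
    congr 1
    refine integral_congr_ae (ae_of_all _ fun ξ => ?_)
    have hre : 0 < (ε - 2 * Real.pi * ξ * Complex.I : ℂ).re := by simpa using hε
    have h3 := integral_rpow_mul_cexp h1 hre
    simp only
    have e2 : ((-μ : ℝ) : ℂ) = (-μ : ℂ) := by push_cast; rfl
    calc _ = ∫ u in Ioi (0 : ℝ), Complex.exp (2 * Real.pi * x * ξ * Complex.I) * (symb p ξ)⁻¹ *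
          (((u ^ (μ - 1) : ℝ) : ℂ) * Complex.exp (-(ε - 2 * Real.pi * ξ * Complex.I) * u)) := by
          refine setIntegral_congr_fun measurableSet_Ioi fun u _ => ?_
          have e3 : (2 * Real.pi * (x + u) * ξ * Complex.I : ℂ) =
            2 * Real.pi * x * ξ * Complex.I + 2 * Real.pi * u * ξ * Complex.I := by ring
          have e4 : (-(ε - 2 * Real.pi * ξ * Complex.I) * u : ℂ) =
            -(ε : ℂ) * u + 2 * Real.pi * u * ξ * Complex.I := by ring
          simp only [e3, e4, Complex.exp_add]
          ring
      _ = _ := by rw [integral_const_mul, h3, e2]; ring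
  · have hI : Integrable (fun q : ℝ × ℝ => (((q.1 ^ (μ - 1) : ℝ) : ℂ) * Complex.exp (-(ε : ℂ) * q.1)) *
        (symb p q.2)⁻¹) ((volume.restrict (Ioi 0)).prod volume) :=
      Integrable.mul_prod (integrableOn_rpow_mul_cexp h1 (by simpa using hε))
        (integrable_bdd_mul_symb_inv hp)
    refine hI.bdd_mul (f := fun q : ℝ × ℝ => Complex.exp (2 * Real.pi * (x + q.1) * q.2 * Complex.I))
      (c := 1) ?_ (ae_of_all _ fun q => ?_)
    · exact Continuous.aestronglyMeasurable (by fun_prop)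
    · have := norm_cexp_mul_I_real (x + q.1) q.2
      push_cast at this
      exact this.le

theorem integrableOn_rpow_mul_shift {μ : ℝ} (h1 : 0 < μ) (h2 : μ < 1) (x : ℝ) :
    IntegrableOn (fun u : ℝ => u ^ (μ - 1) * (1 + |x + u|) ^ (-2 : ℝ)) (Ioi 0) := by
  refine Integrable.mono' (((integrableOn_rpow_mul_one_add_rpow (a := μ - 1) (b := -2)
    (by linarith) (by linarith)).const_mul ((1 + |x|) ^ 2))) ?_
    ((ae_restrict_iff' measurableSet_Ioi).2 (ae_of_all _ fun u hu => ?_))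
  · exact (Measurable.aestronglyMeasurable (by fun_prop))
  · have hu0 : (0 : ℝ) < u := hu
    have h3 : 1 + u ≤ (1 + |x|) * (1 + |x + u|) := by
      have : u ≤ |x + u| + |x| := by
        have := abs_sub (x + u) x
        rw [add_sub_cancel_left, abs_of_pos hu0] at this
        exact this
      nlinarith [abs_nonneg x, abs_nonneg (x + u)]
    rw [Real.norm_of_nonneg (by positivity), mul_left_comm]
    gcongr
    rw [Real.rpow_neg (by positivity), Real.rpow_two, Real.rpow_neg (by positivity), Real.rpow_two,
      ← div_eq_mul_inv, le_div_iff₀ (by positivity), inv_mul_le_iff₀ (by positivity)]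
    nlinarith [pow_le_pow_left₀ (by positivity) h3 2]

theorem tendsto_integral_mul_exp_neg {K : ℝ → ℂ} (hK : IntegrableOn K (Ioi 0)) :
    Tendsto (fun ε : ℝ => ∫ u in Ioi (0 : ℝ), Complex.exp (-(ε : ℂ) * u) * K u) (𝓝[>] 0)
      (𝓝 (∫ u in Ioi (0 : ℝ), K u)) := by
  refine tendsto_integral_filter_of_dominated_convergence (fun u => ‖K u‖) ?_ ?_ hK.norm ?_
  · exact Eventually.of_forall fun ε =>
      AEStronglyMeasurable.mul (Measurable.aestronglyMeasurable (by fun_prop)) hK.aestronglyMeasurable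
  · filter_upwards [self_mem_nhdsWithin] with ε hε
    refine (ae_restrict_iff' measurableSet_Ioi).2 (ae_of_all _ fun u hu => ?_)
    have hu0 : (0 : ℝ) < u := hu
    have hε0 : (0 : ℝ) < ε := hε
    have e1 : ‖Complex.exp (-(ε : ℂ) * u)‖ ≤ 1 := by
      rw [Complex.norm_exp, Real.exp_le_one_iff, Complex.re_mul_ofReal, Complex.neg_re,
        Complex.ofReal_re]
      nlinarith
    rw [norm_mul]
    exact mul_le_of_le_one_left (norm_nonneg _) e1
  · refine ae_of_all _ fun u => ?_
    have h1 : Continuous fun ε : ℝ => Complex.exp (-(ε : ℂ) * u) * K u := by fun_prop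
    have := (h1.tendsto 0).mono_left (nhdsWithin_le_nhds (s := Ioi 0))
    simpa using this

theorem integrableOn_rpow_mul_kernelN_zero {μ γ : ℝ} (h1 : 0 < μ) (h2 : μ < 1)
    (hγ : 0 < γ) (x τ : ℝ) :
    IntegrableOn (fun u : ℝ => ((u ^ (μ - 1) : ℝ) : ℂ) * kernelN 0 (x + u) (linePt γ τ)) (Ioi 0) := by
  obtain ⟨C, hC0, hC⟩ := norm_kernelN_zero_le hγ
  have hck : Continuous fun u : ℝ => kernelN 0 (x + u) (linePt γ τ) := by
    exact continuous_kernelN_comp (by norm_num) one_pos hγ (by fun_prop) continuous_const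
  refine ((integrableOn_rpow_mul_shift h1 h2 x).const_mul (C * (1 + |τ|))).mono' ?_ ?_
  · exact AEStronglyMeasurable.mul (Measurable.aestronglyMeasurable (by fun_prop))
      hck.aestronglyMeasurable
  · refine (ae_restrict_iff' measurableSet_Ioi).2 (ae_of_all _ fun u hu => ?_)
    have hu0 : (0 : ℝ) < u := hu
    rw [norm_mul, Complex.norm_real, Real.norm_of_nonneg (by positivity)]
    calc _ ≤ u ^ (μ - 1) * (C * (1 + |τ|) * (1 + |x + u|) ^ (-2 : ℝ)) := by
          gcongr; exact hC τ (x + u)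
      _ = _ := by ring

theorem tendsto_integral_regularized_cpow {μ γ : ℝ} (h1 : 0 < μ) (h2 : μ < 1)
    (hγ : 0 < γ) (x : ℝ) {p : ℂ} (hp : γ ≤ p.re) :
    Tendsto (fun ε : ℝ => ∫ ξ : ℝ, Complex.exp (2 * Real.pi * x * ξ * Complex.I) *
      (ε - 2 * Real.pi * ξ * Complex.I) ^ ((-μ : ℝ) : ℂ) * (symb p ξ)⁻¹) (𝓝[>] 0)
      (𝓝 (∫ ξ : ℝ, Complex.exp (2 * Real.pi * x * ξ * Complex.I) *
      (-(2 * Real.pi * ξ * Complex.I)) ^ ((-μ : ℝ) : ℂ) * (symb p ξ)⁻¹)) := by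
  have hne : ∀ᵐ ξ : ℝ, ξ ≠ 0 := by simp [ae_iff, measure_singleton]
  refine tendsto_integral_filter_of_dominated_convergence
    (fun ξ => (2 * Real.pi) ^ (-μ) * (2 * (1 + 1 / γ)) * (1 + ‖p‖) *
      (|ξ| ^ (-μ) * (1 + |ξ|) ^ (-2 : ℝ))) ?_ ?_ ?_ ?_
  · have := (continuous_symb p).measurable
    exact Eventually.of_forall fun ε => (Measurable.aestronglyMeasurable (by fun_prop))
  · filter_upwards [self_mem_nhdsWithin] with ε hε
    filter_upwards [hne] with ξ hξ
    refine le_trans ?_ (norm_kernelN_integrand_le hγ hp x ξ)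
    rw [norm_mul, norm_mul, norm_mul, norm_mul]
    gcongr
    rw [Complex.norm_cpow_real, Complex.norm_cpow_real]
    refine Real.rpow_le_rpow_of_nonpos (norm_pos_iff.2 (by simp [Real.pi_ne_zero, hξ])) ?_ (by linarith)
    rw [norm_two_pi_mul_I]
    have := Complex.abs_im_le_norm (ε - 2 * Real.pi * ξ * Complex.I)
    simpa [abs_mul, abs_of_pos Real.pi_pos] using this
  · exact (integrable_abs_rpow_mul_one_add_rpow (by linarith) (by linarith)).const_mul _
  · filter_upwards [hne] with ξ hξ
    refine (tendsto_const_nhds.mul ?_).mul tendsto_const_nhds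
    refine Tendsto.cpow ?_ tendsto_const_nhds
      (Complex.mem_slitPlane_iff.2 (Or.inr (by simp [Real.pi_ne_zero, hξ])))
    have : Tendsto (fun ε : ℝ => (ε - 2 * Real.pi * ξ * Complex.I : ℂ)) (𝓝[>] 0)
        (𝓝 (((0 : ℝ) : ℂ) - 2 * Real.pi * ξ * Complex.I)) :=
      ((by fun_prop : Continuous fun ε : ℝ => (ε - 2 * Real.pi * ξ * Complex.I : ℂ)).tendsto
        0).mono_left nhdsWithin_le_nhds
    simpa using this

/-- Both sides of the damped identity converge as ε → 0+: the left by the quadratic decay of the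
order zero profile, the right because |ε - 2πiξ|^{-μ} ≤ |2πξ|^{-μ} for μ > 0. -/
theorem integral_rpow_mul_kernelN_zero {μ γ : ℝ} (h1 : 0 < μ) (h2 : μ < 1) (hγ : 0 < γ) (x τ : ℝ) :
    ∫ u in Ioi (0 : ℝ), ((u ^ (μ - 1) : ℝ) : ℂ) * kernelN 0 (x + u) (linePt γ τ) =
      Real.Gamma μ * kernelN μ x (linePt γ τ) := by
  set p := linePt γ τ with hpdef
  have hp : 0 < p.re := by rw [hpdef, linePt_re]; exact hγ
  have lim1 := tendsto_integral_mul_exp_neg (integrableOn_rpow_mul_kernelN_zero h1 h2 hγ x τ)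
  have lim2 := tendsto_integral_regularized_cpow h1 h2 hγ x (p := p) (linePt_re γ τ).ge
  refine tendsto_nhds_unique lim1 (((lim2.const_mul _).const_mul _).congr' ?_)
  filter_upwards [self_mem_nhdsWithin] with ε hε
  refine (integral_rpow_mul_exp_mul_kernelN_zero h1 hp hε x).symm.trans ?_
  refine setIntegral_congr_fun measurableSet_Ioi fun u _ => ?_
  ring

end KernelProperties

/-! ### Fractional integrals of functions with small primitives -/

section OscillatoryBound

/-- The integral is split at u = 1/R. Below, the size of the weight suffices; above, summation by
parts against the primitives of `h`, of size K/R, gives a bound of the same order R^{-ν}. -/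
theorem norm_integral_rpow_mul_le_of_oscillating {ν R K : ℝ} (h0 : 0 < ν) (h1 : ν < 1) (hR : 0 < R)
    {h : ℝ → ℂ} (hi : IntegrableOn h (Ioi 0)) (hb : ∀ u, ‖h u‖ ≤ 1)
    (hK : ∀ a b : ℝ, 0 < a → a ≤ b → ‖∫ u in Ioc a b, h u‖ ≤ K / R) :
    ‖∫ u in Ioi (0 : ℝ), ((u ^ (ν - 1) : ℝ) : ℂ) * h u‖ ≤ (1 / ν + K) * R ^ (-ν) := by
  set a := 1 / R with ha
  have ha0 : 0 < a := by positivity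
  have hν : IntegrableOn (fun u : ℝ => u ^ (ν - 1)) (Ioc 0 a) :=
    (intervalIntegrable_iff_integrableOn_Ioc_of_le ha0.le).1
      (intervalIntegral.intervalIntegrable_rpow' (by linarith))
  have hm : AEStronglyMeasurable (fun u : ℝ => ((u ^ (ν - 1) : ℝ) : ℂ) * h u)
      (volume.restrict (Ioi 0)) :=
    AEStronglyMeasurable.mul (Measurable.aestronglyMeasurable (by fun_prop)) hi.aestronglyMeasurable
  have hn1 : ∀ u ∈ Ioc 0 a, ‖((u ^ (ν - 1) : ℝ) : ℂ) * h u‖ ≤ u ^ (ν - 1) := by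
    intro u hu
    have hu0 : 0 < u := hu.1
    rw [norm_mul, Complex.norm_real, Real.norm_of_nonneg (by positivity)]
    exact mul_le_of_le_one_right (by positivity) (hb u)
  have i1 : IntegrableOn (fun u : ℝ => ((u ^ (ν - 1) : ℝ) : ℂ) * h u) (Ioc 0 a) :=
    hν.mono' (hm.mono_measure (Measure.restrict_mono Ioc_subset_Ioi_self le_rfl))
      ((ae_restrict_iff' measurableSet_Ioc).2 (ae_of_all _ hn1))
  have hia : IntegrableOn h (Ioi a) := hi.mono_set (Ioi_subset_Ioi ha0.le)
  have i2 : IntegrableOn (fun u : ℝ => ((u ^ (ν - 1) : ℝ) : ℂ) * h u) (Ioi a) := by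
    refine (hia.norm.const_mul (a ^ (ν - 1))).mono'
      (hm.mono_measure (Measure.restrict_mono (Ioi_subset_Ioi ha0.le) le_rfl))
      ((ae_restrict_iff' measurableSet_Ioi).2 (ae_of_all _ fun u hu => ?_))
    have hu0 : 0 < u := ha0.trans hu
    rw [norm_mul, Complex.norm_real, Real.norm_of_nonneg (by positivity)]
    gcongr ?_ * _
    exact Real.rpow_le_rpow_of_nonpos ha0 (le_of_lt hu) (by linarith)
  rw [← Ioc_union_Ioi_eq_Ioi ha0.le, setIntegral_union (Ioc_disjoint_Ioi le_rfl) measurableSet_Ioi i1 i2]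
  have haR : a ^ ν = R ^ (-ν) := by
    rw [ha, one_div, Real.inv_rpow hR.le, Real.rpow_neg hR.le]
  have b1 : ‖∫ u in Ioc 0 a, ((u ^ (ν - 1) : ℝ) : ℂ) * h u‖ ≤ 1 / ν * R ^ (-ν) := by
    refine (norm_integral_le_of_norm_le hν
      ((ae_restrict_iff' measurableSet_Ioc).2 (ae_of_all _ hn1))).trans (le_of_eq ?_)
    rw [← intervalIntegral.integral_of_le ha0.le, integral_rpow (Or.inl (by linarith))]
    rw [sub_add_cancel, Real.zero_rpow h0.ne', haR]; ring
  have iν : IntegrableOn (fun r : ℝ => (1 - ν) * r ^ (ν - 2)) (Ioi a) :=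
    (integrableOn_Ioi_rpow_of_lt (by linarith) ha0).const_mul _
  -- Writing u^{ν-1} = ∫_u^∞ (1-ν) r^{ν-2} dr and exchanging the integrals performs the integration
  -- by parts using only the bounds on the integrals of `h` over (a, r).
  have e2 : ∀ u ∈ Ioi a, ((u ^ (ν - 1) : ℝ) : ℂ) * h u =
      ∫ r in Ioi a, (Ioi u).indicator (fun r => (((1 - ν) * r ^ (ν - 2) : ℝ) : ℂ)) r * h u := by
    intro u hu
    have hu0 : 0 < u := ha0.trans hu
    rw [integral_mul_const, setIntegral_indicator measurableSet_Ioi, Ioi_inter_Ioi,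
      sup_eq_right.2 (le_of_lt hu), integral_complex_ofReal, integral_const_mul,
      integral_Ioi_rpow_of_lt (by linarith) hu0]
    congr 2
    have h3 : ν - 2 + 1 = ν - 1 := by ring
    have h4 : ν - 1 ≠ 0 := by linarith
    rw [h3]
    field_simp
    ring
  have b2 : ‖∫ u in Ioi a, ((u ^ (ν - 1) : ℝ) : ℂ) * h u‖ ≤ K * R ^ (-ν) := by
    rw [setIntegral_congr_fun measurableSet_Ioi e2, integral_integral_swap]
    · have e3 : ∀ r ∈ Ioi a, ∫ u in Ioi a, (Ioi u).indicator
          (fun r => (((1 - ν) * r ^ (ν - 2) : ℝ) : ℂ)) r * h u =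
          (((1 - ν) * r ^ (ν - 2) : ℝ) : ℂ) * ∫ u in Ioo a r, h u := by
        intro r hr
        have : ∀ u : ℝ, (Ioi u).indicator (fun r => (((1 - ν) * r ^ (ν - 2) : ℝ) : ℂ)) r * h u =
            (Iio r).indicator (fun u => (((1 - ν) * r ^ (ν - 2) : ℝ) : ℂ) * h u) u := by
          intro u
          by_cases hur : u < r
          · rw [indicator_of_mem (by exact hur), indicator_of_mem (by exact hur)]
          · rw [indicator_of_notMem (by exact hur), indicator_of_notMem (by exact hur), zero_mul]
        simp_rw [this]
        rw [setIntegral_indicator measurableSet_Iio, Ioi_inter_Iio, integral_const_mul]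
      rw [setIntegral_congr_fun measurableSet_Ioi e3]
      have h5 : ∫ r in Ioi a, (1 - ν) * r ^ (ν - 2) * (K / R) = K * R ^ (-ν) := by
        rw [integral_mul_const, integral_const_mul, integral_Ioi_rpow_of_lt (by linarith) ha0]
        have h3 : ν - 2 + 1 = ν - 1 := by ring
        have h4 : ν - 1 ≠ 0 := by linarith
        rw [h3, ← haR, Real.rpow_sub_one ha0.ne']
        have : R = 1 / a := by rw [ha]; field_simp
        rw [this]
        field_simp
        ring
      rw [← h5]
      refine norm_integral_le_of_norm_le (iν.mul_const _)
        ((ae_restrict_iff' measurableSet_Ioi).2 (ae_of_all _ fun r hr => ?_))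
      have hr0 : 0 < r := ha0.trans hr
      have h6 : 0 ≤ (1 - ν) * r ^ (ν - 2) := mul_nonneg (by linarith) (by positivity)
      rw [norm_mul, Complex.norm_real, Real.norm_of_nonneg h6, ← integral_Ioc_eq_integral_Ioo]
      gcongr
      exact hK a r ha0 (le_of_lt hr)
    · have hI : Integrable (fun q : ℝ × ℝ => h q.1 * (((1 - ν) * q.2 ^ (ν - 2) : ℝ) : ℂ))
          ((volume.restrict (Ioi a)).prod (volume.restrict (Ioi a))) :=
        Integrable.mul_prod hia iν.ofReal
      refine (hI.indicator (s := {q : ℝ × ℝ | q.1 < q.2})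
        (measurableSet_lt measurable_fst measurable_snd)).congr (ae_of_all _ fun q => ?_)
      by_cases hq : q.1 < q.2
      · rw [indicator_of_mem (by exact hq)]
        simp only [Function.uncurry]
        rw [indicator_of_mem (by exact hq), mul_comm]
      · rw [indicator_of_notMem (by exact hq)]
        simp only [Function.uncurry]
        rw [indicator_of_notMem (by exact hq), zero_mul]
  calc _ ≤ _ := norm_add_le _ _
    _ ≤ 1 / ν * R ^ (-ν) + K * R ^ (-ν) := add_le_add b1 b2
    _ = _ := by ring

end OscillatoryBound

/-! ### The scale invariant bound for the profiles -/

section UniformBound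

/-- The exponential is integrated exactly, so oscillation counts and the bound involves |κ|. The
real part of κ, which can be much smaller, would be too weak for the scaling. -/
theorem norm_integral_exp_neg_mul_abs_zero_le {κ : ℂ} (hκ : 0 < κ.re) (b : ℝ) :
    ‖∫ v in (0 : ℝ)..b, Complex.exp (-κ * (|v| : ℝ))‖ ≤ 2 / ‖κ‖ := by
  have hκ0 : κ ≠ 0 := fun h => by rw [h] at hκ; simp at hκ
  have hκn : 0 < ‖κ‖ := norm_pos_iff.2 hκ0
  have hb1 : ∀ s : ℝ, 0 ≤ s → ‖Complex.exp (-κ * s)‖ ≤ 1 := by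
    intro s hs
    rw [Complex.norm_exp, Real.exp_le_one_iff, Complex.re_mul_ofReal, Complex.neg_re]
    nlinarith
  rcases le_total 0 b with hb | hb
  · have e1 : ∫ v in (0 : ℝ)..b, Complex.exp (-κ * (|v| : ℝ)) =
        ∫ v in (0 : ℝ)..b, Complex.exp (-κ * v) := by
      refine intervalIntegral.integral_congr fun v hv => ?_
      rw [uIcc_of_le hb] at hv
      simp only [abs_of_nonneg hv.1]
    rw [e1, integral_exp_mul_complex (neg_ne_zero.2 hκ0), norm_div, norm_neg]
    gcongr
    refine (norm_sub_le _ _).trans ?_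
    have := hb1 b hb
    have h2 := hb1 0 le_rfl
    linarith
  · have e1 : ∫ v in (0 : ℝ)..b, Complex.exp (-κ * (|v| : ℝ)) =
        ∫ v in (0 : ℝ)..b, Complex.exp (κ * v) := by
      refine intervalIntegral.integral_congr fun v hv => ?_
      rw [uIcc_of_ge hb] at hv
      simp only [abs_of_nonpos hv.2]
      congr 1; push_cast; ring
    rw [e1, integral_exp_mul_complex hκ0, norm_div]
    gcongr
    refine (norm_sub_le _ _).trans ?_
    have h1 := hb1 (-b) (by linarith)
    have h2 := hb1 0 le_rfl
    have e2 : -κ * ((-b : ℝ) : ℂ) = κ * b := by push_cast; ring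
    have e3 : -κ * ((0 : ℝ) : ℂ) = κ * ((0 : ℝ) : ℂ) := by simp
    rw [e2] at h1; rw [e3] at h2
    linarith

theorem norm_integral_exp_neg_mul_abs_le {κ : ℂ} (hκ : 0 < κ.re) (x a b : ℝ) :
    ‖∫ u in a..b, Complex.exp (-κ * (|x + u| : ℝ))‖ ≤ 4 / ‖κ‖ := by
  have hc := continuous_exp_neg_mul_abs κ
  rw [intervalIntegral.integral_comp_add_left (fun v : ℝ => Complex.exp (-κ * (|v| : ℝ))) x,
    ← intervalIntegral.integral_interval_sub_left (a := 0) (hc.intervalIntegrable _ _)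
    (hc.intervalIntegrable _ _)]
  refine (norm_sub_le _ _).trans ?_
  have h1 := norm_integral_exp_neg_mul_abs_zero_le hκ (x + a)
  have h2 := norm_integral_exp_neg_mul_abs_zero_le hκ (x + b)
  have : 4 / ‖κ‖ = 2 / ‖κ‖ + 2 / ‖κ‖ := by ring
  linarith

theorem norm_exp_neg_mul_abs_sub_le {κ : ℂ} (hκ : 0 < κ.re) (s t : ℝ) :
    ‖Complex.exp (-κ * (|s| : ℝ)) - Complex.exp (-κ * (|t| : ℝ))‖ ≤ ‖κ‖ * |s - t| := by
  have hb1 : ∀ s : ℝ, 0 ≤ s → ‖Complex.exp (-κ * s)‖ ≤ 1 := by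
    intro s hs
    rw [Complex.norm_exp, Real.exp_le_one_iff, Complex.re_mul_ofReal, Complex.neg_re]
    nlinarith
  have h := (convex_Ici (0 : ℝ)).norm_image_sub_le_of_norm_hasDerivWithin_le
    (f := fun v : ℝ => Complex.exp (-κ * v)) (f' := fun v : ℝ => Complex.exp (-κ * v) * -κ)
    (C := ‖κ‖) (x := |t|) (y := |s|) (fun v _ => ?_) (fun v hv => ?_) (abs_nonneg t) (abs_nonneg s)
  · refine h.trans ?_
    gcongr
    exact abs_abs_sub_abs_le_abs_sub s t
  · have d2 : HasDerivAt (fun u : ℝ => Complex.exp (-κ * u)) (Complex.exp (-κ * v) * (-κ * 1)) v :=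
      (((hasDerivAt_id (v : ℂ)).const_mul (-κ)).cexp).comp_ofReal
    rw [mul_one] at d2
    exact d2.hasDerivWithinAt
  · rw [norm_mul, norm_neg]
    exact mul_le_of_le_one_left (norm_nonneg _) (hb1 v hv)

theorem rpow_half_weights {r ν : ℝ} (hr : 0 < r) :
    r ^ (ν / 2) * (r ^ (1 / 2 : ℝ)) ^ (-ν) = 1 := by
  rw [← Real.rpow_mul hr.le, ← Real.rpow_add hr]
  have : ν / 2 + 1 / 2 * -ν = 0 := by ring
  rw [this, Real.rpow_zero]

theorem integrable_exp_neg_mul_abs_add {κ : ℂ} (hκ : 0 < κ.re) (x : ℝ) :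
    Integrable fun u : ℝ => Complex.exp (-κ * (|x + u| : ℝ)) :=
  (integrable_exp_neg_mul_abs hκ).comp_add_left x

theorem norm_exp_neg_mul_abs_le_one {κ : ℂ} (hκ : 0 < κ.re) (x : ℝ) :
    ‖Complex.exp (-κ * (|x| : ℝ))‖ ≤ 1 := by
  rw [norm_exp_neg_mul_abs, Real.exp_le_one_iff]
  nlinarith [abs_nonneg x]

/-- The scale invariant bound of the spatial profiles. -/
theorem norm_kernelN_le_scale {μ γ : ℝ} (h1 : -1 < μ) (h2 : μ < 1) (hγ : 0 < γ) : ∃ C : ℝ, 0 ≤ C ∧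
    ∀ x τ : ℝ, ‖linePt γ τ‖ ^ ((μ + 1) / 2) * ‖kernelN μ x (linePt γ τ)‖ ≤ C := by
  have hpre : ∀ τ, 0 < (linePt γ τ).re := fun τ => by rw [linePt_re]; exact hγ
  have hp0 : ∀ τ, 0 < ‖linePt γ τ‖ := fun τ => hγ.trans_le (le_norm_linePt hγ τ)
  have hκ : ∀ τ, 0 < (rotSqrt (linePt γ τ)).re := fun τ => rotSqrt_re_pos (hpre τ)
  rcases lt_trichotomy μ 0 with hμ | rfl | hμ
  -- For μ < 0 the profile is minus the x-derivative of the one of order μ + 1. Difference quotients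
  -- of the latter are bounded uniformly in the step `δ`, and the bound passes to the limit.
  · have hG : 0 < Real.Gamma (μ + 1) := Real.Gamma_pos_of_pos (by linarith)
    refine ⟨(1 / (μ + 1) + 2) / Real.Gamma (μ + 1),
      div_nonneg (by have : 0 < μ + 1 := by linarith
                     positivity) hG.le, fun x τ => ?_⟩
    set p := linePt γ τ with hp
    set κ := rotSqrt p with hκd
    have hk := hκ τ
    rw [← hp, ← hκd] at hk
    have hκn : ‖κ‖ = ‖p‖ ^ (1 / 2 : ℝ) := norm_rotSqrt p
    have hκ0 : 0 < ‖κ‖ := by rw [hκn]; exact Real.rpow_pos_of_pos (hp0 τ) _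
    have hN : ∀ x, kernelN (μ + 1) x p = ((Real.Gamma (μ + 1) : ℂ))⁻¹ * (p ^ ((-(1 / 2) : ℝ) : ℂ) *
        ∫ u in Ioi (0 : ℝ), ((u ^ (μ + 1 - 1) : ℝ) : ℂ) * Complex.exp (-κ * (|x + u| : ℝ))) := by
      intro x
      have := integral_rpow_mul_kernelN_zero (μ := μ + 1) (by linarith) (by linarith) hγ x τ
      rw [← hp] at this
      have hG' : (Real.Gamma (μ + 1) : ℂ) ≠ 0 := by exact_mod_cast hG.ne'
      rw [eq_inv_mul_iff_mul_eq₀ hG', ← this, ← integral_const_mul]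
      refine setIntegral_congr_fun measurableSet_Ioi fun u _ => ?_
      rw [kernelN_zero_eq (hpre τ)]; ring
    have hdiff : ∀ δ : ℝ, 0 < δ → ‖δ⁻¹ • (kernelN (μ + 1) (x + δ) p - kernelN (μ + 1) x p)‖ ≤
        (1 / (μ + 1) + 2) / Real.Gamma (μ + 1) * (‖κ‖ ^ (-(μ + 1))) := by
      intro δ hδ
      have hint : ∀ y : ℝ, IntegrableOn (fun u : ℝ => ((u ^ (μ + 1 - 1) : ℝ) : ℂ) *
          Complex.exp (-κ * (|y + u| : ℝ))) (Ioi 0) := by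
        intro y
        have h5 := (integrableOn_rpow_mul_kernelN_zero (μ := μ + 1) (by linarith) (by linarith) hγ y
          τ).const_mul (p ^ ((1 / 2 : ℝ) : ℂ))
        refine h5.congr (ae_of_all _ fun u => ?_)
        simp only
        rw [kernelN_zero_eq (hpre τ), ← hp]
        have h3 : p ^ ((1 / 2 : ℝ) : ℂ) * p ^ ((-(1 / 2) : ℝ) : ℂ) = 1 := by
          rw [← Complex.cpow_add _ _ (norm_pos_iff.1 (hp0 τ))]; push_cast; norm_num
        linear_combination ((u ^ (μ + 1 - 1) : ℝ) : ℂ) * Complex.exp (-κ * (|y + u| : ℝ)) * h3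
      -- The factor (δ‖κ‖)⁻¹ makes `‖h‖ ≤ 1`, because the exponential is ‖κ‖-Lipschitz. Its
      -- integrals over intervals reduce to two integrals over intervals of length δ, hence are at
      -- most 2/‖κ‖; so R = ‖κ‖ and K = 2.
      set h : ℝ → ℂ := fun u => (δ * ‖κ‖ : ℂ)⁻¹ * (Complex.exp (-κ * (|x + δ + u| : ℝ)) -
        Complex.exp (-κ * (|x + u| : ℝ))) with hh
      have hosc := norm_integral_rpow_mul_le_of_oscillating (ν := μ + 1) (R := ‖κ‖) (K := 2) (h := h)
        (by linarith) (by linarith) hκ0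
        (((integrable_exp_neg_mul_abs_add hk (x + δ)).sub
          (integrable_exp_neg_mul_abs_add hk x)).const_mul _).integrableOn
        (fun u => by
          rw [hh]
          simp only
          rw [norm_mul, norm_inv, norm_mul, Complex.norm_real, Complex.norm_real, norm_norm,
            Real.norm_of_nonneg hδ.le, inv_mul_le_iff₀ (by positivity), mul_one]
          refine (norm_exp_neg_mul_abs_sub_le hk _ _).trans (le_of_eq ?_)
          have : x + δ + u - (x + u) = δ := by ring
          rw [this, abs_of_pos hδ, mul_comm])
        (fun a b ha hab => by
          have hc := continuous_exp_neg_mul_abs κ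
          have hcx : ∀ y : ℝ, Continuous fun u : ℝ => Complex.exp (-κ * (|y + u| : ℝ)) := by
            intro y; fun_prop
          rw [hh, ← intervalIntegral.integral_of_le hab, intervalIntegral.integral_const_mul,
            intervalIntegral.integral_sub ((hcx _).intervalIntegrable _ _)
            ((hcx _).intervalIntegrable _ _),
            intervalIntegral.integral_comp_add_left (fun v : ℝ => Complex.exp (-κ * (|v| : ℝ))),
            intervalIntegral.integral_comp_add_left (fun v : ℝ => Complex.exp (-κ * (|v| : ℝ))),
            intervalIntegral.integral_interval_sub_interval_comm' (hc.intervalIntegrable _ _)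
            (hc.intervalIntegrable _ _) (hc.intervalIntegrable _ _)]
          have b1 : ∀ c : ℝ, ‖∫ v in c..(c + δ), Complex.exp (-κ * (|v| : ℝ))‖ ≤ δ := by
            intro c
            have := intervalIntegral.norm_integral_le_of_norm_le_const (a := c) (b := c + δ)
              (f := fun v : ℝ => Complex.exp (-κ * (|v| : ℝ))) (C := 1)
              (fun v _ => norm_exp_neg_mul_abs_le_one hk v)
            simpa [abs_of_pos hδ] using this
          have e1 : x + δ + b = x + b + δ := by ring
          have e2 : x + δ + a = x + a + δ := by ring
          rw [norm_mul, norm_inv, norm_mul, Complex.norm_real, Complex.norm_real, norm_norm,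
            Real.norm_of_nonneg hδ.le, e1, e2, inv_mul_le_iff₀ (by positivity)]
          have e3 : δ * ‖κ‖ * (2 / ‖κ‖) = δ + δ := by field_simp; norm_num
          rw [e3]
          exact (norm_sub_le _ _).trans (add_le_add (b1 _) (b1 _)))
      have e4 : δ⁻¹ • (kernelN (μ + 1) (x + δ) p - kernelN (μ + 1) x p) =
          ((Real.Gamma (μ + 1) : ℂ))⁻¹ * (p ^ ((-(1 / 2) : ℝ) : ℂ) * (‖κ‖ *
            ∫ u in Ioi (0 : ℝ), ((u ^ (μ + 1 - 1) : ℝ) : ℂ) * h u)) := by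
        have hδ' : (δ : ℂ) ≠ 0 := by exact_mod_cast hδ.ne'
        have hκ' : (‖κ‖ : ℂ) ≠ 0 := by exact_mod_cast hκ0.ne'
        have e5 : ∫ u in Ioi (0 : ℝ), ((u ^ (μ + 1 - 1) : ℝ) : ℂ) * h u = (δ * ‖κ‖ : ℂ)⁻¹ *
            ((∫ u in Ioi (0 : ℝ), ((u ^ (μ + 1 - 1) : ℝ) : ℂ) * Complex.exp (-κ * (|x + δ + u| : ℝ))) -
            ∫ u in Ioi (0 : ℝ), ((u ^ (μ + 1 - 1) : ℝ) : ℂ) * Complex.exp (-κ * (|x + u| : ℝ))) := by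
          rw [← integral_sub (hint _) (hint _), ← integral_const_mul]
          refine setIntegral_congr_fun measurableSet_Ioi fun u _ => ?_
          simp only [hh]; ring
        rw [e5, hN, hN, Complex.real_smul, Complex.ofReal_inv]
        field_simp
      rw [e4, norm_mul, norm_mul, norm_mul, norm_inv, Complex.norm_real, Complex.norm_real,
        Real.norm_of_nonneg hG.le, norm_norm, Complex.norm_cpow_real]
      have e6 : ‖p‖ ^ (-(1 / 2) : ℝ) * ‖κ‖ = 1 := by
        rw [hκn, ← Real.rpow_add (hp0 τ)]; norm_num
      rw [← mul_assoc (‖p‖ ^ (-(1 / 2) : ℝ)), e6, one_mul, div_mul_eq_mul_div, inv_mul_eq_div]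
      gcongr
    have hlim := (hasDerivAt_iff_tendsto_slope_zero.1 (hasDerivAt_kernelN h1 hμ (hpre τ) x)).mono_left
      (nhdsWithin_mono 0 (fun δ (hδ : δ ∈ Ioi (0 : ℝ)) => ne_of_gt hδ))
    have hle := le_of_tendsto hlim.norm (by
      filter_upwards [self_mem_nhdsWithin] with δ hδ using hdiff δ hδ)
    rw [norm_neg] at hle
    calc _ ≤ ‖p‖ ^ ((μ + 1) / 2) * ((1 / (μ + 1) + 2) / Real.Gamma (μ + 1) * (‖κ‖ ^ (-(μ + 1)))) := by
          gcongr
      _ = (1 / (μ + 1) + 2) / Real.Gamma (μ + 1) *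
          (‖p‖ ^ ((μ + 1) / 2) * (‖p‖ ^ (1 / 2 : ℝ)) ^ (-(μ + 1))) := by rw [hκn]; ring
      _ = _ := by rw [rpow_half_weights (hp0 τ), mul_one]
  · refine ⟨1, zero_le_one, fun x τ => ?_⟩
    rw [kernelN_zero_eq (hpre τ), norm_mul, Complex.norm_cpow_real, ← mul_assoc,
      ← Real.rpow_add (hp0 τ)]
    have := norm_exp_neg_mul_abs_le_one (hκ τ) x
    norm_num
    rwa [neg_mul] at this
  -- For μ > 0 the oscillatory bound applies directly with R = ‖κ‖ = ‖p‖^{1/2}. Together with the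
  -- factor p^{-1/2} of the order zero profile it gives ‖p‖^{-(μ+1)/2}.
  · have hG : 0 < Real.Gamma μ := Real.Gamma_pos_of_pos hμ
    refine ⟨(1 / μ + 4) / Real.Gamma μ, by positivity, fun x τ => ?_⟩
    set p := linePt γ τ with hp
    set κ := rotSqrt p with hκd
    have hk := hκ τ
    rw [← hp, ← hκd] at hk
    have hκn : ‖κ‖ = ‖p‖ ^ (1 / 2 : ℝ) := norm_rotSqrt p
    have hκ0 : 0 < ‖κ‖ := by rw [hκn]; exact Real.rpow_pos_of_pos (hp0 τ) _
    have hosc := norm_integral_rpow_mul_le_of_oscillating (ν := μ) (R := ‖κ‖) (K := 4)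
      (h := fun u : ℝ => Complex.exp (-κ * (|x + u| : ℝ))) hμ h2 hκ0
      (integrable_exp_neg_mul_abs_add hk x).integrableOn
      (fun u => norm_exp_neg_mul_abs_le_one hk _)
      (fun a b _ hab => by
        rw [← intervalIntegral.integral_of_le hab]
        exact norm_integral_exp_neg_mul_abs_le hk x a b)
    have hN := integral_rpow_mul_kernelN_zero hμ h2 hγ x τ
    have e1 : ∫ u in Ioi (0 : ℝ), ((u ^ (μ - 1) : ℝ) : ℂ) * kernelN 0 (x + u) (linePt γ τ) =
        p ^ ((-(1 / 2) : ℝ) : ℂ) *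
          ∫ u in Ioi (0 : ℝ), ((u ^ (μ - 1) : ℝ) : ℂ) * Complex.exp (-κ * (|x + u| : ℝ)) := by
      rw [← integral_const_mul]
      refine setIntegral_congr_fun measurableSet_Ioi fun u _ => ?_
      rw [kernelN_zero_eq (hpre τ)]; ring
    rw [e1] at hN
    have hN' := congrArg norm hN
    rw [norm_mul, norm_mul, Complex.norm_real, Real.norm_of_nonneg hG.le, Complex.norm_cpow_real,
      ← hp] at hN'
    rw [le_div_iff₀ hG]
    calc _ = ‖p‖ ^ ((μ + 1) / 2) * (Real.Gamma μ * ‖kernelN μ x p‖) := by ring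
      _ ≤ ‖p‖ ^ ((μ + 1) / 2) * (‖p‖ ^ (-(1 / 2) : ℝ) * ((1 / μ + 4) * ‖κ‖ ^ (-μ))) := by
          rw [← hN']; gcongr
      _ = (1 / μ + 4) * ((‖p‖ ^ ((μ + 1) / 2) * ‖p‖ ^ (-(1 / 2) : ℝ)) *
          (‖p‖ ^ (1 / 2 : ℝ)) ^ (-μ)) := by rw [hκn]; ring
      _ = 1 / μ + 4 := by
          rw [← Real.rpow_add (hp0 τ)]
          have : (μ + 1) / 2 + -(1 / 2) = μ / 2 := by ring
          rw [this, rpow_half_weights (hp0 τ), mul_one]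

end UniformBound

/-! ### Vanishing for negative times -/

section Vanishing

theorem fracIntegral_eq_zero {f : ℝ → ℂ} (hf : ∀ t < 0, f t = 0) (α : ℝ) {t : ℝ} (ht : t < 0) :
    fracIntegral α f t = 0 := by
  unfold fracIntegral plusPairing
  rw [setIntegral_eq_zero_of_forall_eq_zero, mul_zero]
  intro u hu
  have hu0 : (0 : ℝ) < u := hu
  have h1 : (fun r => f (t - r)) =ᶠ[𝓝 u] fun _ => 0 := by
    filter_upwards [Ioi_mem_nhds hu0] with r hr
    exact hf _ (by have : (0 : ℝ) < r := hr
                   linarith)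
  rw [h1.iteratedDeriv_eq]
  simp

theorem IsSmoothHalfLine.eq_zero {f : ℝ → ℂ} (hf : IsSmoothHalfLine f) : ∀ t < 0, f t = 0 := by
  intro t ht
  by_contra h
  have := hf.support (subset_tsupport f h)
  exact absurd this (by simpa using ht)

end Vanishing

/-! ### The forcing operator on the Laplace side -/

section Forcing

theorem contOrder_of_pos {α : ℝ} (h : 0 < α) : contOrder α = 0 := if_pos h

theorem contOrder_of_nonpos {α : ℝ} (h1 : -1 < α) (h2 : α ≤ 0) : contOrder α = 1 := by
  unfold contOrder
  rw [if_neg (not_lt.2 h2), Nat.floor_eq_zero.2 (by linarith)]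

/-- Causality of the data replaces the upper limit `t` by infinity, so the Duhamel integral becomes
a half line convolution to which `integral_mul_lapInv_sub` applies. For t < 0 the oriented integral
vanishes as well. -/
theorem forcing_eq_setIntegral {h : ℝ → ℂ} (hg : ∀ t < 0, fracIntegral (-(1 / 2)) h t = 0) (x t : ℝ) :
    forcing h x t = (1 / (Real.sqrt Real.pi : ℂ)) * ∫ u in Ioi (0 : ℝ),
      (((u ^ (-(1 / 2) : ℝ) : ℝ) : ℂ) * Complex.exp (-(Complex.I * (x : ℂ) ^ 2 / (4 * (u : ℂ))))) *
        fracIntegral (-(1 / 2)) h (t - u) := by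
  unfold forcing
  congr 1
  set F : ℝ → ℂ := fun u => (((u ^ (-(1 / 2) : ℝ) : ℝ) : ℂ) *
    Complex.exp (-(Complex.I * (x : ℂ) ^ 2 / (4 * (u : ℂ))))) * fracIntegral (-(1 / 2)) h (t - u) with hF
  have e1 : ∫ r in (0 : ℝ)..t, (((t - r) ^ (-(1 / 2) : ℝ) : ℝ) : ℂ) *
      Complex.exp (-(Complex.I * (x : ℂ) ^ 2 / (4 * ((t - r : ℝ) : ℂ)))) *
      fracIntegral (-(1 / 2)) h r = ∫ u in (0 : ℝ)..t, F u := by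
    have := intervalIntegral.integral_comp_sub_left (a := 0) (b := t) F t
    rw [sub_self, sub_zero] at this
    rw [← this]
    refine intervalIntegral.integral_congr fun r _ => ?_
    simp only [hF, sub_sub_cancel]
  rw [e1]
  rcases le_or_gt 0 t with ht | ht
  · rw [intervalIntegral.integral_of_le ht]
    refine (setIntegral_eq_of_subset_of_forall_sdiff_eq_zero measurableSet_Ioi
      Ioc_subset_Ioi_self fun u hu => ?_).symm
    have hu0 : t < u := by
      by_contra hc
      exact hu.2 ⟨hu.1, not_lt.1 hc⟩
    change _ * fracIntegral (-(1 / 2)) h (t - u) = 0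
    rw [hg _ (by linarith), mul_zero]
  · rw [intervalIntegral.integral_of_ge ht.le, integral_Ioc_eq_integral_Ioo,
      setIntegral_eq_zero_of_forall_eq_zero, setIntegral_eq_zero_of_forall_eq_zero, neg_zero]
    · intro u hu
      change _ * fracIntegral (-(1 / 2)) h (t - u) = 0
      rw [hg _ (by have : (0 : ℝ) < u := hu
                   linarith), mul_zero]
    · intro u hu
      change _ * fracIntegral (-(1 / 2)) h (t - u) = 0
      rw [hg _ (by linarith [hu.1]), mul_zero]

theorem forcing_lapInv {A : ℝ → ℂ} (hA : RapidDecay A) {γ : ℝ} (hγ : 0 < γ)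
    (hg : ∀ t < 0, fracIntegral (-(1 / 2)) (lapInv γ A) t = 0) (x t : ℝ) :
    forcing (lapInv γ A) x t = lapInv γ (fun τ => kernelN 0 x (linePt γ τ) *
      (linePt γ τ ^ ((1 / 2 : ℝ) : ℂ) * A τ)) t := by
  have hpi := Real.pi_pos
  have hs : (Real.sqrt Real.pi : ℂ) ≠ 0 := by exact_mod_cast (Real.sqrt_pos.2 hpi).ne'
  rw [forcing_eq_setIntegral hg, fracIntegral_lapInv hA hγ]
  have e0 : (-((-(1 / 2) : ℝ) : ℂ)) = ((1 / 2 : ℝ) : ℂ) := by push_cast; ring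
  rw [e0]
  have hm : Measurable fun u : ℝ => ((u ^ (-(1 / 2) : ℝ) : ℝ) : ℂ) *
      Complex.exp (-(Complex.I * (x : ℂ) ^ 2 / (4 * (u : ℂ)))) := by fun_prop
  have hc : IntegrableOn (fun u : ℝ => (((u ^ (-(1 / 2) : ℝ) : ℝ) : ℂ) *
      Complex.exp (-(Complex.I * (x : ℂ) ^ 2 / (4 * (u : ℂ))))) * Complex.exp (-(γ : ℂ) * u)) (Ioi 0) := by
    refine (integrableOn_half_rpow_mul_exp hγ).mono' ?_ ?_
    · exact (hm.mul (by fun_prop)).aestronglyMeasurable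
    · refine (ae_restrict_iff' measurableSet_Ioi).2 (ae_of_all _ fun u hu => ?_)
      have hu0 : (0 : ℝ) < u := hu
      have e2 : (-(Complex.I * (x : ℂ) ^ 2 / (4 * (u : ℂ)))) =
          ((-(x ^ 2 / (4 * u)) : ℝ) : ℂ) * Complex.I := by push_cast; ring
      rw [norm_mul, norm_mul, e2, Complex.norm_exp_ofReal_mul_I, Complex.norm_real,
        Real.norm_of_nonneg (by positivity), mul_one, Complex.norm_exp, Complex.re_mul_ofReal,
        Complex.neg_re, Complex.ofReal_re]
  rw [integral_mul_lapInv_sub hc (hA.cpow_mul hγ (1 / 2)).integrable]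
  unfold lapInv
  rw [← integral_const_mul]
  refine integral_congr_ae (ae_of_all _ fun τ => ?_)
  simp only
  rw [integral_laplace_schroedinger (by rw [linePt_re]; exact hγ)]
  field_simp

end Forcing

/-! ### The spatial convolution on the Laplace side -/

section MinusConv

theorem integral_rpow_mul_lapInv_kernel {ν γ : ℝ} (h1 : 0 < ν) (h2 : ν < 1) (hγ : 0 < γ)
    {B : ℝ → ℂ} (hB : RapidDecay B) (x t : ℝ) :
    ∫ y in Ioi x, (((y - x) ^ (ν - 1) : ℝ) : ℂ) *
      lapInv γ (fun τ => kernelN 0 y (linePt γ τ) * B τ) t =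
    Real.Gamma ν * lapInv γ (fun τ => kernelN ν x (linePt γ τ) * B τ) t := by
  have e1 : ∫ y in Ioi x, (((y - x) ^ (ν - 1) : ℝ) : ℂ) *
      lapInv γ (fun τ => kernelN 0 y (linePt γ τ) * B τ) t =
      ∫ u in Ioi (0 : ℝ), ((u ^ (ν - 1) : ℝ) : ℂ) *
      lapInv γ (fun τ => kernelN 0 (x + u) (linePt γ τ) * B τ) t := by
    have h3 := (measurePreserving_add_left volume x).setIntegral_preimage_emb
      (measurableEmbedding_addLeft x) (fun y => (((y - x) ^ (ν - 1) : ℝ) : ℂ) *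
      lapInv γ (fun τ => kernelN 0 y (linePt γ τ) * B τ) t) (Ioi x)
    rw [← h3, preimage_const_add_Ioi, sub_self]
    simp only [add_sub_cancel_left]
  rw [e1]
  obtain ⟨C, hC0, hC⟩ := norm_kernelN_zero_le hγ
  have e2 : ∀ u : ℝ, ((u ^ (ν - 1) : ℝ) : ℂ) *
      lapInv γ (fun τ => kernelN 0 (x + u) (linePt γ τ) * B τ) t =
      ∫ τ, Complex.exp (linePt γ τ * t) * (((u ^ (ν - 1) : ℝ) : ℂ) *
        kernelN 0 (x + u) (linePt γ τ) * B τ) := by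
    intro u
    unfold lapInv
    rw [← integral_const_mul]
    refine integral_congr_ae (ae_of_all _ fun τ => ?_)
    simp only
    ring
  simp_rw [e2]
  rw [integral_integral_swap]
  · unfold lapInv
    rw [← integral_const_mul]
    refine integral_congr_ae (ae_of_all _ fun τ => ?_)
    simp only
    rw [integral_const_mul, integral_mul_const, integral_rpow_mul_kernelN_zero h1 h2 hγ]
    ring
  · have hI : Integrable (fun q : ℝ × ℝ => (q.1 ^ (ν - 1) * (1 + |x + q.1|) ^ (-2 : ℝ)) *
        (Real.exp (γ * t) * C * ((1 + |q.2|) ^ (1 : ℝ) * ‖B q.2‖)))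
        ((volume.restrict (Ioi 0)).prod volume) :=
      Integrable.mul_prod (integrableOn_rpow_mul_shift h1 h2 x) ((hB.integrable_mul 1).const_mul _)
    refine hI.mono' ?_ ?_
    · have hk : Continuous fun q : ℝ × ℝ => kernelN 0 (x + q.1) (linePt γ q.2) :=
        continuous_kernelN_comp (by norm_num) one_pos hγ (by fun_prop) (by fun_prop)
      have hl := continuous_linePt γ
      have hBc := hB.continuous
      have hE : Continuous fun q : ℝ × ℝ => Complex.exp (linePt γ q.2 * t) := by fun_prop
      have hB2 : Continuous fun q : ℝ × ℝ => B q.2 := by fun_prop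
      have hm : Measurable fun q : ℝ × ℝ => ((q.1 ^ (ν - 1) : ℝ) : ℂ) := by fun_prop
      exact (hE.measurable.mul ((hm.mul hk.measurable).mul hB2.measurable)).aestronglyMeasurable
    · have : ∀ᵐ q : ℝ × ℝ ∂((volume.restrict (Ioi (0 : ℝ))).prod volume), q.1 ∈ Ioi (0 : ℝ) :=
        Measure.quasiMeasurePreserving_fst.ae (ae_restrict_mem measurableSet_Ioi)
      filter_upwards [this] with q hq
      have hu0 : (0 : ℝ) < q.1 := hq
      simp only [Function.uncurry]
      rw [norm_mul, norm_mul, norm_mul, norm_exp_linePt, Complex.norm_real,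
        Real.norm_of_nonneg (by positivity), Real.rpow_one]
      calc _ ≤ Real.exp (γ * t) * (q.1 ^ (ν - 1) * (C * (1 + |q.2|) * (1 + |x + q.1|) ^ (-2 : ℝ)) *
            ‖B q.2‖) := by gcongr; exact hC _ _
        _ = _ := by ring

theorem norm_lapInv_kernel_zero_le {γ : ℝ} (hγ : 0 < γ) {B : ℝ → ℂ} (hB : RapidDecay B) (t : ℝ) :
    ∃ C : ℝ, ∀ y, ‖lapInv γ (fun τ => kernelN 0 y (linePt γ τ) * B τ) t‖ ≤ C * (1 + |y|) ^ (-2 : ℝ) := by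
  obtain ⟨C, hC0, hC⟩ := norm_kernelN_zero_le hγ
  refine ⟨Real.exp (γ * t) * ∫ τ, C * ((1 + |τ|) ^ (1 : ℝ) * ‖B τ‖), fun y => ?_⟩
  refine (norm_lapInv_le _ _ _).trans ?_
  rw [mul_assoc, ← integral_mul_const]
  gcongr Real.exp (γ * t) * ?_
  refine integral_mono_of_nonneg (ae_of_all _ fun τ => norm_nonneg _)
    (((hB.integrable_mul 1).const_mul C).mul_const _) (ae_of_all _ fun τ => ?_)
  simp only
  rw [norm_mul, Real.rpow_one]
  calc _ ≤ (C * (1 + |τ|) * (1 + |y|) ^ (-2 : ℝ)) * ‖B τ‖ := by gcongr; exact hC _ _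
    _ = _ := by ring

theorem continuous_lapInv_kernel {μ γ : ℝ} (h1 : -1 < μ) (h2 : μ < 1) (hγ : 0 < γ)
    {B : ℝ → ℂ} (hB : RapidDecay B) (t : ℝ) :
    Continuous fun y => lapInv γ (fun τ => kernelN μ y (linePt γ τ) * B τ) t := by
  obtain ⟨C, hC0, hC⟩ := norm_kernelN_le h1 h2 hγ
  unfold lapInv
  refine continuous_of_dominated (bound := fun τ => Real.exp (γ * t) * C *
    ((1 + |τ|) ^ (1 : ℝ) * ‖B τ‖)) (fun y => ?_) (fun y => ae_of_all _ fun τ => ?_)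
    ((hB.integrable_mul 1).const_mul _) (ae_of_all _ fun τ => ?_)
  · have hk : Continuous fun τ : ℝ => kernelN μ y (linePt γ τ) :=
      continuous_kernelN_comp h1 h2 hγ continuous_const continuous_id
    exact ((continuous_exp_linePt γ t).mul (hk.mul hB.continuous)).aestronglyMeasurable
  · rw [norm_mul, norm_mul, norm_exp_linePt, Real.rpow_one]
    calc _ ≤ Real.exp (γ * t) * (C * (1 + |τ|) * ‖B τ‖) := by gcongr; exact hC _ _
      _ = _ := by ring
  · have hk : Continuous fun y : ℝ => kernelN μ y (linePt γ τ) :=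
      continuous_kernelN_comp h1 h2 hγ continuous_id continuous_const
    exact continuous_const.mul (hk.mul continuous_const)

theorem hasDerivAt_lapInv_kernel {μ γ : ℝ} (h1 : -1 < μ) (h2 : μ < 0) (hγ : 0 < γ)
    {B : ℝ → ℂ} (hB : RapidDecay B) (x t : ℝ) :
    HasDerivAt (fun y => lapInv γ (fun τ => kernelN (μ + 1) y (linePt γ τ) * B τ) t)
      (-lapInv γ (fun τ => kernelN μ x (linePt γ τ) * B τ) t) x := by
  obtain ⟨C, hC0, hC⟩ := norm_kernelN_le (μ := μ) h1 (by linarith) hγ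
  obtain ⟨C', hC0', hC'⟩ := norm_kernelN_le (μ := μ + 1) (by linarith) (by linarith) hγ
  have hk : ∀ ν : ℝ, -1 < ν → ν < 1 → ∀ y, Continuous fun τ : ℝ => kernelN ν y (linePt γ τ) :=
    fun ν a b y => continuous_kernelN_comp a b hγ continuous_const continuous_id
  have hm : ∀ ν : ℝ, -1 < ν → ν < 1 → ∀ y, AEStronglyMeasurable (fun τ : ℝ =>
      Complex.exp (linePt γ τ * t) * (kernelN ν y (linePt γ τ) * B τ)) volume := fun ν a b y =>
    ((continuous_exp_linePt γ t).mul ((hk ν a b y).mul hB.continuous)).aestronglyMeasurable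
  have hn : ∀ ν D : ℝ, (∀ x τ : ℝ, ‖kernelN ν x (linePt γ τ)‖ ≤ D * (1 + |τ|)) → ∀ y τ : ℝ,
      ‖Complex.exp (linePt γ τ * t) * (kernelN ν y (linePt γ τ) * B τ)‖ ≤
      Real.exp (γ * t) * D * ((1 + |τ|) ^ (1 : ℝ) * ‖B τ‖) := by
    intro ν D hD y τ
    rw [norm_mul, norm_mul, norm_exp_linePt, Real.rpow_one]
    calc _ ≤ Real.exp (γ * t) * (D * (1 + |τ|) * ‖B τ‖) := by gcongr; exact hD _ _
      _ = _ := by ring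
  unfold lapInv
  rw [← integral_neg]
  refine (hasDerivAt_integral_of_dominated_loc_of_deriv_le (s := univ)
    (F := fun (y τ : ℝ) => Complex.exp (linePt γ τ * t) * (kernelN (μ + 1) y (linePt γ τ) * B τ))
    (F' := fun (y τ : ℝ) => -(Complex.exp (linePt γ τ * t) * (kernelN μ y (linePt γ τ) * B τ)))
    (bound := fun τ => Real.exp (γ * t) * C * ((1 + |τ|) ^ (1 : ℝ) * ‖B τ‖))
    univ_mem ?_ ?_ ?_ ?_ ?_ ?_).2
  · exact Eventually.of_forall fun y => hm _ (by linarith) (by linarith) y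
  · exact ((hB.integrable_mul 1).const_mul _).mono' (hm _ (by linarith) (by linarith) x)
      (ae_of_all _ fun τ => hn _ _ hC' x τ)
  · exact (hm _ h1 (by linarith) x).neg
  · refine ae_of_all _ fun τ y _ => ?_
    rw [norm_neg]; exact hn _ _ hC y τ
  · exact (hB.integrable_mul 1).const_mul _
  · refine ae_of_all _ fun τ y _ => ?_
    refine (((hasDerivAt_kernelN h1 h2 (p := linePt γ τ) (by rw [linePt_re]; exact hγ) y).mul_const
      (B τ)).const_mul _).congr_deriv ?_
    ring

/-- For μ > 0 this is Fubini with the multiplier identity of `integral_rpow_mul_kernelN_zero`. For μ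
< 0 the continuation takes one derivative of the case μ + 1, and differentiating the profile of
order μ + 1 gives the profile of order μ up to sign. -/
theorem minusConv_lapInv_kernel {μ γ : ℝ} (h1 : -1 < μ) (h2 : μ < 1) (hγ : 0 < γ)
    {B : ℝ → ℂ} (hB : RapidDecay B) (x t : ℝ) :
    minusConv μ (fun y => lapInv γ (fun τ => kernelN 0 y (linePt γ τ) * B τ) t) x =
      lapInv γ (fun τ => kernelN μ x (linePt γ τ) * B τ) t := by
  unfold minusConv
  rcases lt_trichotomy μ 0 with hμ | rfl | hμ
  · rw [contOrder_of_nonpos h1 hμ.le, Nat.cast_one, iteratedDeriv_one, pow_one]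
    have hG : (Real.Gamma (μ + 1) : ℂ) ≠ 0 := by
      exact_mod_cast (Real.Gamma_pos_of_pos (by linarith)).ne'
    have e1 : (fun z : ℝ => 1 / (Real.Gamma (μ + 1) : ℂ) * ∫ y in Ioi z,
        (((y - z) ^ (μ + 1 - 1) : ℝ) : ℂ) *
        lapInv γ (fun τ => kernelN 0 y (linePt γ τ) * B τ) t) =
        fun z => lapInv γ (fun τ => kernelN (μ + 1) z (linePt γ τ) * B τ) t := by
      ext z
      rw [integral_rpow_mul_lapInv_kernel (by linarith) (by linarith) hγ hB]
      field_simp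
    rw [e1, (hasDerivAt_lapInv_kernel h1 hμ hγ hB x t).deriv]
    ring
  -- At μ = 0 one derivative is still taken, but the profile of order 1 has the non-integrable
  -- singularity |ξ|^{-1}. The fundamental theorem of calculus, applied to the integrable function
  -- `G`, replaces it.
  · rw [contOrder_of_nonpos h1 le_rfl, Nat.cast_one, iteratedDeriv_one, pow_one]
    set G : ℝ → ℂ := fun y => lapInv γ (fun τ => kernelN 0 y (linePt γ τ) * B τ) t with hG
    have hGc : Continuous G := continuous_lapInv_kernel h1 h2 hγ hB t
    obtain ⟨C, hC⟩ := norm_lapInv_kernel_zero_le hγ hB t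
    have hGi : Integrable G := ((integrable_one_add_abs_rpow (r := -2) (by norm_num)).const_mul
      C).mono' hGc.aestronglyMeasurable (ae_of_all _ hC)
    have e1 : (fun z : ℝ => 1 / (Real.Gamma (0 + 1) : ℂ) * ∫ y in Ioi z,
        (((y - z) ^ ((0 : ℝ) + 1 - 1) : ℝ) : ℂ) * G y) =
        fun z => (∫ y in Ioi 0, G y) - ∫ y in (0 : ℝ)..z, G y := by
      ext z
      rw [← intervalIntegral.integral_Ioi_sub_Ioi' hGi.integrableOn hGi.integrableOn]
      simp
    rw [e1, ((hGc.integral_hasStrictDerivAt 0 x).hasDerivAt.const_sub _).deriv]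
    simp only [hG, neg_mul, one_mul, neg_neg]
  · rw [contOrder_of_pos hμ, Nat.cast_zero, iteratedDeriv_zero, pow_zero, add_zero,
      integral_rpow_mul_lapInv_kernel hμ h2 hγ hB]
    have hG : (Real.Gamma μ : ℂ) ≠ 0 := by
      exact_mod_cast (Real.Gamma_pos_of_pos hμ).ne'
    field_simp

end MinusConv

/-! ### The Laplace representation of the family -/

section Representation

/-- The Laplace transform of `f` on the vertical line with abscissa `γ`. -/
noncomputable def lap (f : ℝ → ℂ) (γ : ℝ) : ℝ → ℂ := 𝓕 fun t : ℝ => Complex.exp (-(γ : ℂ) * t) * f t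

theorem exists_schwartz_exp_mul {f : ℝ → ℂ} (hf : ContDiff ℝ ∞ f) (hc : HasCompactSupport f) (z : ℂ) :
    ∃ φ : 𝓢(ℝ, ℂ), ⇑φ = fun t : ℝ => Complex.exp (z * t) * f t := by
  have h1 : HasCompactSupport fun t : ℝ => Complex.exp (z * t) * f t := hc.mul_left
  have h2 : ContDiff ℝ ∞ fun t : ℝ => Complex.exp (z * t) * f t := by
    have : ContDiff ℝ ∞ fun t : ℝ => Complex.exp (z * t) :=
      (contDiff_const.mul Complex.ofRealCLM.contDiff).cexp
    exact this.mul hf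
  exact ⟨h1.toSchwartzMap h2, rfl⟩

theorem rapidDecay_lap {f : ℝ → ℂ} (hf : ContDiff ℝ ∞ f) (hc : HasCompactSupport f) (γ : ℝ) :
    RapidDecay (lap f γ) := by
  obtain ⟨φ, hφ⟩ := exists_schwartz_exp_mul hf hc (-γ)
  have : lap f γ = ⇑(𝓕 φ : 𝓢(ℝ, ℂ)) := by rw [lap, ← hφ, SchwartzMap.fourier_coe]
  rw [this]
  exact rapidDecay_schwartz _

theorem lapInv_lap {f : ℝ → ℂ} (hf : ContDiff ℝ ∞ f) (hc : HasCompactSupport f) (γ : ℝ) :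
    lapInv γ (lap f γ) = f := by
  obtain ⟨φ, hφ⟩ := exists_schwartz_exp_mul hf hc (-γ)
  have h1 : 𝓕⁻ (lap f γ) = φ := by
    rw [lap, ← hφ, ← SchwartzMap.fourier_coe, ← SchwartzMap.fourierInv_coe]
    simp
  ext t
  rw [lapInv_eq_fourierInv, h1, hφ]
  simp only
  rw [← mul_assoc, ← Complex.exp_add]
  simp

/-- The Laplace representation of the forcing family. -/
theorem forcingFamily_eq_lapInv {μ γ : ℝ} (h1 : -1 < μ) (h2 : μ < 1) (hγ : 0 < γ) {f : ℝ → ℂ}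
    (hf : IsSmoothHalfLine f) (hc : HasCompactSupport f) (x t : ℝ) :
    forcingFamily μ f x t = lapInv γ (fun τ => kernelN μ x (linePt γ τ) *
      (linePt γ τ ^ (((μ + 1) / 2 : ℝ) : ℂ) * lap f γ τ)) t := by
  have hA := rapidDecay_lap hf.contDiff hc γ
  have hB := hA.cpow_mul hγ ((μ + 1) / 2)
  unfold forcingFamily
  rw [← minusConv_lapInv_kernel h1 h2 hγ hB]
  congr 1
  ext y
  have e1 : fracIntegral (-μ / 2) f = lapInv γ (fun τ => linePt γ τ ^ ((μ / 2 : ℝ) : ℂ) * lap f γ τ) := by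
    nth_rw 1 [← lapInv_lap hf.contDiff hc γ]
    rw [fracIntegral_lapInv hA hγ]
    congr 1
    ext τ
    congr 2
    push_cast; ring
  rw [e1, forcing_lapInv (hA.cpow_mul hγ (μ / 2)) hγ]
  · congr 1
    ext τ
    rw [← mul_assoc (linePt γ τ ^ ((1 / 2 : ℝ) : ℂ)), ← Complex.cpow_add _ _ (linePt_ne_zero hγ τ)]
    congr 4
    push_cast; ring
  · intro s hs
    rw [← e1]
    exact fracIntegral_eq_zero (fun r hr => fracIntegral_eq_zero hf.eq_zero _ hr) _ hs

end Representation

/-! ### Cauchy integrals in unweighted L² -/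

section CauchyOperator

/-- The Cauchy type integral `∫ h(τ) / (γ + 2πi(τ - η)) dτ`. -/
noncomputable def cauchyOp (γ : ℝ) (h : ℝ → ℂ) (η : ℝ) : ℂ := ∫ τ, (linePt γ (τ - η))⁻¹ * h τ

theorem integral_exp_neg_linePt {γ : ℝ} (hγ : 0 < γ) (τ : ℝ) :
    ∫ u in Ioi (0 : ℝ), Complex.exp (-linePt γ τ * u) = (linePt γ τ)⁻¹ := by
  rw [integral_exp_mul_complex_Ioi (by rw [Complex.neg_re, linePt_re]; linarith), Complex.ofReal_zero,
    mul_zero, Complex.exp_zero, neg_div_neg_eq, one_div]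

theorem integrableOn_exp_neg_real {γ : ℝ} (hγ : 0 < γ) :
    IntegrableOn (fun u : ℝ => Complex.exp (-(γ : ℂ) * u)) (Ioi 0) :=
  integrableOn_exp_mul_complex_Ioi (by simpa using hγ) 0

/-- Writing 1/p = ∫_0^∞ e^{-pu} du exhibits the Cauchy operator as a Fourier multiplier with symbol
e^{-γu} on u > 0. Its modulus is at most 1, whence an L² bound independent of γ. -/
theorem cauchyOp_eq_fourierInv {γ : ℝ} (hγ : 0 < γ) {h : ℝ → ℂ} (h1 : Integrable h) (η : ℝ) :
    cauchyOp γ h η =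
      𝓕⁻ ((Ioi (0 : ℝ)).indicator fun u : ℝ => Complex.exp (-(γ : ℂ) * u) * 𝓕 h u) η := by
  rw [Real.fourierInv_eq']
  have e1 : ∀ u : ℝ, Complex.exp ((2 * Real.pi * (inner ℝ u η) : ℝ) * Complex.I) •
      (Ioi (0 : ℝ)).indicator (fun u : ℝ => Complex.exp (-(γ : ℂ) * u) * 𝓕 h u) u =
      (Ioi (0 : ℝ)).indicator (fun u : ℝ => ∫ τ, Complex.exp (-linePt γ (τ - η) * u) * h τ) u := by
    intro u
    by_cases hu : u ∈ Ioi (0 : ℝ)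
    · rw [indicator_of_mem hu, indicator_of_mem hu, Real.fourier_eq', smul_eq_mul, ← mul_assoc,
        ← integral_const_mul]
      refine integral_congr_ae (ae_of_all _ fun τ => ?_)
      simp only [smul_eq_mul, ← mul_assoc, ← Complex.exp_add]
      congr 2
      simp only [linePt, RCLike.inner_apply, conj_trivial]
      push_cast
      ring
    · rw [indicator_of_notMem hu, indicator_of_notMem hu, smul_zero]
  simp_rw [e1]
  rw [integral_indicator measurableSet_Ioi, integral_integral_swap]
  · unfold cauchyOp
    refine integral_congr_ae (ae_of_all _ fun τ => ?_)
    simp only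
    rw [integral_mul_const, integral_exp_neg_linePt hγ]
  · have hI : Integrable (fun q : ℝ × ℝ => Complex.exp (-(γ : ℂ) * q.1) * h q.2)
        ((volume.restrict (Ioi 0)).prod volume) := Integrable.mul_prod (integrableOn_exp_neg_real hγ) h1
    refine (hI.bdd_mul (f := fun q : ℝ × ℝ => Complex.exp (((-(2 * Real.pi * (q.2 - η) * q.1) : ℝ) : ℂ) *
      Complex.I)) (c := 1) ?_ (ae_of_all _ fun q => (Complex.norm_exp_ofReal_mul_I _).le)).congr
      (ae_of_all _ fun q => ?_)
    · exact Continuous.aestronglyMeasurable (by fun_prop)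
    · simp only [Function.uncurry]
      rw [← mul_assoc, ← Complex.exp_add]
      congr 2
      simp only [linePt]
      push_cast
      ring

theorem continuous_cauchyOp {γ : ℝ} (hγ : 0 < γ) {h : ℝ → ℂ} (h1 : Integrable h) :
    Continuous (cauchyOp γ h) := by
  have hl := continuous_linePt γ
  have hc : Continuous fun q : ℝ × ℝ => (linePt γ (q.2 - q.1))⁻¹ :=
    Continuous.inv₀ (by fun_prop) fun q => linePt_ne_zero hγ _
  unfold cauchyOp
  refine continuous_of_dominated (bound := fun τ => 1 / γ * ‖h τ‖) (fun η => ?_)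
    (fun η => ae_of_all _ fun τ => ?_) (h1.norm.const_mul _) (ae_of_all _ fun τ => ?_)
  · exact (hc.comp (Continuous.prodMk_right η)).aestronglyMeasurable.mul h1.aestronglyMeasurable
  · rw [norm_mul]
    gcongr
    rw [norm_inv, one_div]
    exact inv_anti₀ hγ (le_norm_linePt hγ _)
  · exact (hc.comp (Continuous.prodMk_left τ)).mul continuous_const

theorem ennreal_add_sq_le (u v : ℝ≥0∞) : (u + v) ^ 2 ≤ 4 * u ^ 2 + 4 * v ^ 2 := by
  have h : ∀ u v : ℝ≥0∞, u ≤ v → (u + v) ^ 2 ≤ 4 * u ^ 2 + 4 * v ^ 2 := by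
    intro u v h
    calc (u + v) ^ 2 ≤ (v + v) ^ 2 := by gcongr
      _ = 4 * v ^ 2 := by ring
      _ ≤ _ := le_add_self
  rcases le_total u v with huv | huv
  · exact h u v huv
  · rw [add_comm u, add_comm (4 * u ^ 2)]; exact h v u huv

theorem memLp_two_of_integrable_sq {h : ℝ → ℂ} (hm : AEStronglyMeasurable h volume)
    (h2 : ∫⁻ x, ‖h x‖ₑ ^ 2 < ⊤) : MemLp h 2 := by
  refine ⟨hm, ?_⟩
  rw [eLpNorm_lt_top_iff_lintegral_rpow_enorm_lt_top two_ne_zero ENNReal.ofNat_ne_top]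
  simpa using h2

theorem lintegral_sq_lt_top_of_memLp {h : ℝ → ℂ} (h2 : MemLp h 2) : ∫⁻ x, ‖h x‖ₑ ^ 2 < ⊤ := by
  have := (eLpNorm_lt_top_iff_lintegral_rpow_enorm_lt_top two_ne_zero ENNReal.ofNat_ne_top).1 h2.2
  simpa using this

theorem lintegral_cauchyOp_sq_le {γ : ℝ} (hγ : 0 < γ) {h : ℝ → ℂ} (h1 : Integrable h)
    (h2 : MemLp h 2) : ∫⁻ η, ‖cauchyOp γ h η‖ₑ ^ 2 ≤ ∫⁻ τ, ‖h τ‖ₑ ^ 2 := by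
  simp_rw [cauchyOp_eq_fourierInv hγ h1]
  set G := (Ioi (0 : ℝ)).indicator fun u : ℝ => Complex.exp (-(γ : ℂ) * u) * 𝓕 h u with hG
  have hFc := continuous_fourier h1
  have hi : Integrable G := by
    rw [hG, integrable_indicator_iff measurableSet_Ioi]
    exact Integrable.mul_bdd (c := ∫ ξ, ‖h ξ‖) (integrableOn_exp_neg_real hγ)
      hFc.aestronglyMeasurable (ae_of_all _ fun x => norm_fourier_le h x)
  have hle : ∀ u, ‖G u‖ₑ ^ 2 ≤ ‖𝓕 h u‖ₑ ^ 2 := by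
    intro u
    gcongr
    by_cases hu : u ∈ Ioi (0 : ℝ)
    · have hu0 : (0 : ℝ) < u := hu
      rw [hG, indicator_of_mem hu, enorm_le_iff_norm_le, norm_mul]
      refine mul_le_of_le_one_left (norm_nonneg _) ?_
      rw [Complex.norm_exp, Real.exp_le_one_iff, Complex.re_mul_ofReal, Complex.neg_re,
        Complex.ofReal_re]
      nlinarith
    · rw [hG, indicator_of_notMem hu]; simp
  have hle2 : ∫⁻ u, ‖G u‖ₑ ^ 2 ≤ ∫⁻ τ, ‖h τ‖ₑ ^ 2 :=
    (lintegral_mono hle).trans (lintegral_fourier_sq h1 h2).le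
  rw [lintegral_fourierInv_sq hi (memLp_two_of_integrable_sq hi.aestronglyMeasurable
    (hle2.trans_lt (lintegral_sq_lt_top_of_memLp h2)))]
  exact hle2

end CauchyOperator

/-! ### Comparing power weights at two points -/

section PowerWeightRatio

/-- The weight `|x|^a (1+|x|)^b`. -/
noncomputable def powW (a b x : ℝ) : ℝ := |x| ^ a * (1 + |x|) ^ b

theorem powW_nonneg (a b x : ℝ) : 0 ≤ powW a b x := by unfold powW; positivity

theorem powW_pos (a b : ℝ) {x : ℝ} (hx : x ≠ 0) : 0 < powW a b x := by
  have := abs_pos.2 hx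
  unfold powW; positivity

theorem measurable_powW (a b : ℝ) : Measurable (powW a b) := by unfold powW; fun_prop

theorem powW_sq (a b x : ℝ) : powW a b x ^ 2 = powW (2 * a) (2 * b) x := by
  unfold powW
  rw [mul_pow, ← Real.rpow_natCast, ← Real.rpow_natCast, ← Real.rpow_mul (abs_nonneg x),
    ← Real.rpow_mul (by positivity)]
  push_cast
  rw [mul_comm a, mul_comm b]

/-- For fixed Q the quantity Q^a q^b is monotone in q, so it lies between its values Q^a at q = 1
and Q^{a+b} at q = Q. The exponents `a` at the origin and `a + b` at infinity are thus the only ones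
that matter. -/
theorem rpow_mul_rpow_mem {a b δ q Q : ℝ} (ha : |a| ≤ δ) (hab : |a + b| ≤ δ) (hq : 1 ≤ q) (hqQ : q ≤ Q) :
    Q ^ (-δ) ≤ Q ^ a * q ^ b ∧ Q ^ a * q ^ b ≤ Q ^ δ := by
  have hQ : 1 ≤ Q := hq.trans hqQ
  have hQ0 : 0 < Q := by linarith
  have hq0 : 0 < q := by linarith
  rw [abs_le] at ha hab
  have m := fun {x y : ℝ} (h : x ≤ y) => Real.rpow_le_rpow_of_exponent_le hQ h
  rcases le_total 0 b with hb | hb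
  · constructor
    · calc Q ^ (-δ) ≤ Q ^ a := m ha.1
        _ ≤ Q ^ a * q ^ b := le_mul_of_one_le_right (by positivity) (Real.one_le_rpow hq hb)
    · calc Q ^ a * q ^ b ≤ Q ^ a * Q ^ b := by gcongr
        _ = Q ^ (a + b) := (Real.rpow_add hQ0 _ _).symm
        _ ≤ Q ^ δ := m hab.2
  · constructor
    · calc Q ^ (-δ) ≤ Q ^ (a + b) := m hab.1
        _ = Q ^ a * Q ^ b := Real.rpow_add hQ0 _ _
        _ ≤ Q ^ a * q ^ b := by
            gcongr ?_ * ?_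
            exact Real.rpow_le_rpow_of_nonpos hq0 hqQ hb
    · calc Q ^ a * q ^ b ≤ Q ^ a :=
            mul_le_of_le_one_right (by positivity) (Real.rpow_le_one_of_one_le_of_nonpos hq hb)
        _ ≤ Q ^ δ := m ha.2

/-- The Hardy type kernel `max(|x|,|y|)^{δ-1} min(|x|,|y|)^{-δ}`. -/
noncomputable def hardyK (δ x y : ℝ) : ℝ := max |x| |y| ^ (δ - 1) * min |x| |y| ^ (-δ)

theorem hardyK_comm (δ x y : ℝ) : hardyK δ x y = hardyK δ y x := by
  unfold hardyK; rw [max_comm, min_comm]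

theorem powW_div_powW {a b x y : ℝ} (hx : x ≠ 0) (hy : y ≠ 0) :
    powW a b x / powW a b y = (|x| / |y|) ^ a * ((1 + |x|) / (1 + |y|)) ^ b := by
  have := abs_pos.2 hx
  have := abs_pos.2 hy
  unfold powW
  rw [Real.div_rpow (by positivity) (by positivity), Real.div_rpow (by positivity) (by positivity)]
  field_simp

/-- The ratio of the two weights lies between Q^{-δ} and Q^δ with Q = |y|/|x|, so their difference
is at most (Q^δ - 1) times the smaller one. Writing K for the Hardy kernel, Q^δ = |y|K and |x|K ≤ 1,
hence Q^δ - 1 ≤ (|y| - |x|)K ≤ |x - y|K. -/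
theorem abs_powW_sub_le_of_le {a b δ x y : ℝ} (h0 : 0 ≤ δ) (h1 : δ < 1) (ha : |a| ≤ δ)
    (hab : |a + b| ≤ δ) (hx : x ≠ 0) (hxy : |x| ≤ |y|) :
    |powW a b x - powW a b y| ≤ |x - y| * hardyK δ x y * min (powW a b x) (powW a b y) := by
  have hx0 := abs_pos.2 hx
  have hy0 : 0 < |y| := hx0.trans_le hxy
  have hy : y ≠ 0 := abs_pos.1 hy0
  set Q := |y| / |x| with hQ
  have hQ1 : 1 ≤ Q := (one_le_div hx0).2 hxy
  have hq1 : 1 ≤ (1 + |y|) / (1 + |x|) := (one_le_div (by positivity)).2 (by linarith)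
  have hqQ : (1 + |y|) / (1 + |x|) ≤ Q := by
    rw [hQ, div_le_div_iff₀ (by positivity) hx0]; nlinarith
  obtain ⟨l, u⟩ := rpow_mul_rpow_mem ha hab hq1 hqQ
  rw [hQ, ← powW_div_powW hy hx, ← hQ] at l u
  have hX := powW_pos a b hx
  have hY := powW_pos a b hy
  rw [le_div_iff₀ hX] at l
  rw [div_le_iff₀ hX] at u
  have hQδ : 1 ≤ Q ^ δ := Real.one_le_rpow hQ1 h0
  have hneg : Q ^ (-δ) * Q ^ δ = 1 := by
    rw [← Real.rpow_add (by linarith)]; simp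
  have hkey : Q ^ δ - 1 ≤ |x - y| * hardyK δ x y := by
    unfold hardyK
    rw [max_eq_right hxy, min_eq_left hxy]
    have e1 : Q ^ δ = |y| * (|y| ^ (δ - 1) * |x| ^ (-δ)) := by
      rw [hQ, Real.div_rpow hy0.le hx0.le, Real.rpow_sub_one hy0.ne', Real.rpow_neg hx0.le]
      field_simp
    have e2 : |x| * (|y| ^ (δ - 1) * |x| ^ (-δ)) ≤ 1 := by
      calc |x| * (|y| ^ (δ - 1) * |x| ^ (-δ)) ≤ |x| * (|x| ^ (δ - 1) * |x| ^ (-δ)) := by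
            gcongr ?_ * (?_ * ?_)
            exact Real.rpow_le_rpow_of_nonpos hx0 hxy (by linarith)
        _ = 1 := by
            rw [← Real.rpow_add hx0]
            have : δ - 1 + -δ = -1 := by ring
            rw [this, Real.rpow_neg_one, mul_inv_cancel₀ hx0.ne']
    have e3 : |y| - |x| ≤ |x - y| := by
      rw [abs_sub_comm]; exact abs_sub_abs_le_abs_sub y x
    have e4 : 0 ≤ |y| ^ (δ - 1) * |x| ^ (-δ) := by positivity
    nlinarith
  rcases le_total (powW a b x) (powW a b y) with h | h
  · rw [min_eq_left h, abs_sub_comm, abs_of_nonneg (by linarith)]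
    nlinarith
  · rw [min_eq_right h, abs_of_nonneg (by linarith)]
    have : powW a b x ≤ Q ^ δ * powW a b y := by
      calc powW a b x = Q ^ δ * (Q ^ (-δ) * powW a b x) := by
            rw [← mul_assoc, mul_comm (Q ^ δ), hneg, one_mul]
        _ ≤ _ := by gcongr
    nlinarith

theorem abs_powW_sub_le {a b δ x y : ℝ} (h0 : 0 ≤ δ) (h1 : δ < 1) (ha : |a| ≤ δ)
    (hab : |a + b| ≤ δ) (hx : x ≠ 0) (hy : y ≠ 0) :
    |powW a b x - powW a b y| ≤ |x - y| * hardyK δ x y * powW a b y := by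
  have hK : 0 ≤ |x - y| * hardyK δ x y := by unfold hardyK; positivity
  rcases le_total |x| |y| with h | h
  · exact (abs_powW_sub_le_of_le h0 h1 ha hab hx h).trans
      (mul_le_mul_of_nonneg_left (min_le_right _ _) hK)
  · rw [abs_sub_comm, abs_sub_comm x y, hardyK_comm]
    rw [abs_sub_comm x y, hardyK_comm] at hK
    exact (abs_powW_sub_le_of_le h0 h1 ha hab hy h).trans
      (mul_le_mul_of_nonneg_left (min_le_left _ _) hK)

/-- The kernel is homogeneous of degree -1, so |y|^{-1/2} is an eigenfunction; the condition δ < 1/2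
makes the integral converge both at 0 and at infinity. This is the test function for Schur's test.
-/
theorem lintegral_hardyK {δ x : ℝ} (h1 : δ < 1 / 2) (hx : x ≠ 0) :
    ∫⁻ y, ENNReal.ofReal (hardyK δ x y) * ENNReal.ofReal (|y| ^ (-(1 / 2) : ℝ)) =
      ENNReal.ofReal (4 / (1 / 2 - δ)) * ENNReal.ofReal (|x| ^ (-(1 / 2) : ℝ)) := by
  have hx0 := abs_pos.2 hx
  set X := |x| with hX
  have hd : 0 < 1 / 2 - δ := by linarith
  let g : ℝ → ℝ := fun y => max X y ^ (δ - 1) * min X y ^ (-δ) * y ^ (-(1 / 2) : ℝ)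
  have e1 : ∀ y ∈ Ioc 0 X, X ^ (δ - 1) * y ^ (-δ - 1 / 2) = g y := by
    intro y hy
    have hy0 : 0 < y := hy.1
    simp only [g]
    rw [max_eq_left hy.2, min_eq_right hy.2, sub_eq_add_neg (-δ), Real.rpow_add hy0, mul_assoc]
  have e2 : ∀ y ∈ Ioi X, X ^ (-δ) * y ^ (δ - 3 / 2) = g y := by
    intro y hy
    have hy1 : X ≤ y := le_of_lt hy
    have hy0 : 0 < y := hx0.trans_le hy1
    simp only [g]
    rw [max_eq_right hy1, min_eq_left hy1]
    have : δ - 3 / 2 = (δ - 1) + -(1 / 2) := by ring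
    rw [this, Real.rpow_add hy0]; ring
  have i1 : IntegrableOn g (Ioc 0 X) := by
    refine IntegrableOn.congr_fun ?_ e1 measurableSet_Ioc
    exact ((intervalIntegrable_iff_integrableOn_Ioc_of_le hx0.le).1
      (intervalIntegral.intervalIntegrable_rpow' (by linarith))).const_mul _
  have i2 : IntegrableOn g (Ioi X) := by
    refine IntegrableOn.congr_fun ?_ e2 measurableSet_Ioi
    exact (integrableOn_Ioi_rpow_of_lt (by linarith) hx0).const_mul _
  have i3 : IntegrableOn g (Ioi 0) := by
    rw [← Ioc_union_Ioi_eq_Ioi hx0.le]; exact i1.union i2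
  have v1 : ∫ y in Ioc 0 X, g y = X ^ (-(1 / 2) : ℝ) / (1 / 2 - δ) := by
    rw [← setIntegral_congr_fun measurableSet_Ioc e1, integral_const_mul,
      ← intervalIntegral.integral_of_le hx0.le, integral_rpow (Or.inl (by linarith))]
    have h3 : -δ - 1 / 2 + 1 = 1 / 2 - δ := by ring
    rw [h3, Real.zero_rpow hd.ne', sub_zero, ← mul_div_assoc, ← Real.rpow_add hx0]
    congr 2; ring
  have v2 : ∫ y in Ioi X, g y = X ^ (-(1 / 2) : ℝ) / (1 / 2 - δ) := by
    rw [← setIntegral_congr_fun measurableSet_Ioi e2, integral_const_mul,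
      integral_Ioi_rpow_of_lt (by linarith) hx0]
    have h3 : δ - 3 / 2 + 1 = -(1 / 2 - δ) := by ring
    rw [h3, neg_div_neg_eq, ← mul_div_assoc, ← Real.rpow_add hx0]
    congr 2; ring
  have v3 : ∫ y in Ioi 0, g y = 2 / (1 / 2 - δ) * X ^ (-(1 / 2) : ℝ) := by
    rw [← Ioc_union_Ioi_eq_Ioi hx0.le, setIntegral_union (Ioc_disjoint_Ioi le_rfl) measurableSet_Ioi
      i1 i2, v1, v2]
    ring
  have hgn : ∀ y, 0 ≤ g |y| := fun y => by simp only [g]; positivity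
  have e3 : ∀ y : ℝ, ENNReal.ofReal (hardyK δ x y) * ENNReal.ofReal (|y| ^ (-(1 / 2) : ℝ)) =
      ENNReal.ofReal (g |y|) := by
    intro y
    rw [← ENNReal.ofReal_mul (by unfold hardyK; positivity)]
    rfl
  simp_rw [e3]
  rw [← ofReal_integral_eq_lintegral_ofReal (integrable_comp_abs_of_integrableOn i3) (ae_of_all _ hgn),
    integral_comp_abs, v3, ← ENNReal.ofReal_mul (by positivity)]
  congr 1; ring

end PowerWeightRatio

/-! ### Cauchy integrals in weighted L² -/

section WeightedCauchy

theorem RapidDecay.integrable_powW_mul {h : ℝ → ℂ} (hh : RapidDecay h) {a b : ℝ} (ha : -1 < a) :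
    Integrable fun y => powW a b y * ‖h y‖ := by
  obtain ⟨C, hC0, hC⟩ := hh.rpow_bound (-2 - a - b)
  refine ((integrable_abs_rpow_mul_one_add_rpow (a := a) (b := -2 - a) ha (by linarith)).const_mul
    C).mono' ((measurable_powW a b).aestronglyMeasurable.mul
      hh.continuous.norm.aestronglyMeasurable) (ae_of_all _ fun y => ?_)
  have h1 : (0 : ℝ) < 1 + |y| := by positivity
  rw [Real.norm_of_nonneg (mul_nonneg (powW_nonneg _ _ _) (norm_nonneg _))]
  calc powW a b y * ‖h y‖ ≤ (|y| ^ a * (1 + |y|) ^ b) * (C * (1 + |y|) ^ (-2 - a - b)) := by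
        unfold powW; gcongr; exact hC y
    _ = C * (|y| ^ a * ((1 + |y|) ^ b * (1 + |y|) ^ (-2 - a - b))) := by ring
    _ = _ := by rw [← Real.rpow_add h1]; congr 3; ring

theorem RapidDecay.lintegral_powW_sq_lt_top {h : ℝ → ℂ} (hh : RapidDecay h) {a b : ℝ}
    (ha : -(1 / 2) < a) : ∫⁻ y, ENNReal.ofReal (powW a b y ^ 2) * ‖h y‖ₑ ^ 2 < ⊤ := by
  obtain ⟨C, hC0, hC⟩ := hh.rpow_bound 0
  have h1 := (hh.integrable_powW_mul (a := 2 * a) (b := 2 * b) (by linarith)).const_mul C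
  refine lt_of_le_of_lt (lintegral_mono fun y => ?_) h1.lintegral_lt_top
  rw [powW_sq, ← ofReal_norm, ← ENNReal.ofReal_pow (norm_nonneg _),
    ← ENNReal.ofReal_mul (powW_nonneg _ _ _)]
  refine ENNReal.ofReal_le_ofReal ?_
  have := hC y
  rw [Real.rpow_zero, mul_one] at this
  have h3 := powW_nonneg (2 * a) (2 * b) y
  calc _ = powW (2 * a) (2 * b) y * (‖h y‖ * ‖h y‖) := by ring
    _ ≤ powW (2 * a) (2 * b) y * (C * ‖h y‖) := by gcongr
    _ = _ := by ring

theorem le_norm_linePt_im (γ τ : ℝ) : |τ| ≤ ‖linePt γ τ‖ := by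
  have := Complex.abs_im_le_norm (linePt γ τ)
  rw [linePt_im, abs_mul, abs_of_pos Real.two_pi_pos] at this
  nlinarith [Real.pi_gt_three, abs_nonneg τ]

theorem norm_linePt_inv_le {γ : ℝ} (hγ : 0 < γ) (τ : ℝ) : ‖(linePt γ τ)⁻¹‖ ≤ 1 / γ := by
  rw [norm_inv, one_div]
  exact inv_anti₀ hγ (le_norm_linePt hγ τ)

theorem integrable_linePt_inv_mul {γ : ℝ} (hγ : 0 < γ) {h : ℝ → ℂ} (h1 : Integrable h) (η : ℝ) :
    Integrable fun τ => (linePt γ (τ - η))⁻¹ * h τ := by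
  refine h1.bdd_mul (c := 1 / γ) ?_ (ae_of_all _ fun τ => norm_linePt_inv_le hγ _)
  have := continuous_linePt γ
  exact Continuous.aestronglyMeasurable (Continuous.inv₀ (by fun_prop) fun τ => linePt_ne_zero hγ _)

/-- The weight W is commuted past the operator. The commutator has kernel (W(x) - W(y))/(γ + 2πi(y -
x)), where the difference of weights supplies a factor |x - y| that cancels the singularity and
leaves the Hardy kernel times W(y), without dependence on γ. -/
theorem enorm_powW_mul_cauchyOp_le {a b δ γ : ℝ} (h0 : 0 ≤ δ) (h1 : δ < 1 / 2) (ha : |a| ≤ δ)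
    (hab : |a + b| ≤ δ) (hγ : 0 < γ) {h : ℝ → ℂ} (hh : RapidDecay h) {x : ℝ} (hx : x ≠ 0) :
    ‖(powW a b x : ℂ) * cauchyOp γ h x‖ₑ ≤ ‖cauchyOp γ (fun y => powW a b y * h y) x‖ₑ +
      ∫⁻ y, ENNReal.ofReal (hardyK δ x y) * (ENNReal.ofReal (powW a b y) * ‖h y‖ₑ) := by
  have ha' := (abs_le.1 ha).1
  have hi : Integrable fun y => (powW a b y : ℂ) * h y := by
    refine (integrable_norm_iff ?_).1 ?_
    · exact (Complex.measurable_ofReal.comp (measurable_powW a b)).aestronglyMeasurable.mul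
        hh.continuous.aestronglyMeasurable
    · refine (hh.integrable_powW_mul (a := a) (b := b) (by linarith)).congr (ae_of_all _ fun y => ?_)
      simp only
      rw [norm_mul, Complex.norm_real, Real.norm_of_nonneg (powW_nonneg _ _ _)]
  have e1 : (powW a b x : ℂ) * cauchyOp γ h x = cauchyOp γ (fun y => powW a b y * h y) x +
      ∫ y, ((powW a b x - powW a b y : ℝ) : ℂ) * ((linePt γ (y - x))⁻¹ * h y) := by
    unfold cauchyOp
    rw [← integral_const_mul, ← sub_eq_iff_eq_add', ← integral_sub
      ((integrable_linePt_inv_mul hγ hh.integrable x).const_mul _) (integrable_linePt_inv_mul hγ hi x)]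
    refine integral_congr_ae (ae_of_all _ fun y => ?_)
    push_cast; ring
  rw [e1]
  refine (enorm_add_le _ _).trans (add_le_add le_rfl ((enorm_integral_le_lintegral_enorm _).trans ?_))
  have hne : ∀ᵐ y : ℝ, y ≠ 0 ∧ y ≠ x := by
    rw [ae_iff]
    refine measure_mono_null (t := {0, x}) (fun y hy => ?_) (Set.Finite.measure_zero (by simp) _)
    simp only [mem_ofPred_eq, not_and_or, not_not] at hy
    exact hy
  refine lintegral_mono_ae ?_
  filter_upwards [hne] with y hy
  rw [enorm_mul, enorm_mul, ← mul_assoc, ← mul_assoc]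
  refine mul_le_mul_left ?_ _
  rw [← ofReal_norm, ← ofReal_norm, Complex.norm_real, Real.norm_eq_abs, norm_inv,
    ← ENNReal.ofReal_mul (abs_nonneg _), ← ENNReal.ofReal_mul (by unfold hardyK; positivity)]
  refine ENNReal.ofReal_le_ofReal ?_
  have hyx : 0 < |y - x| := abs_pos.2 (sub_ne_zero.2 hy.2)
  have b1 := abs_powW_sub_le h0 (by linarith) ha hab hx hy.1
  have b2 := le_norm_linePt_im γ (y - x)
  rw [← div_eq_mul_inv, div_le_iff₀ (hyx.trans_le b2)]
  have hK : 0 ≤ hardyK δ x y * powW a b y :=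
    mul_nonneg (by unfold hardyK; positivity) (powW_nonneg _ _ _)
  rw [abs_sub_comm x y] at b1
  calc _ ≤ |y - x| * hardyK δ x y * powW a b y := b1
    _ = hardyK δ x y * powW a b y * |y - x| := by ring
    _ ≤ _ := by gcongr

theorem measurable_hardyK (δ : ℝ) : Measurable (Function.uncurry fun x y : ℝ =>
    ENNReal.ofReal (hardyK δ x y)) := by
  unfold hardyK Function.uncurry
  fun_prop

/-- The Cauchy operators are bounded in weighted `L²`, uniformly in `γ`. -/
theorem lintegral_powW_cauchyOp_sq_le {a b δ : ℝ} (h0 : 0 ≤ δ) (h1 : δ < 1 / 2) (ha : |a| ≤ δ)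
    (hab : |a + b| ≤ δ) : ∃ C : ℝ≥0, ∀ γ > 0, ∀ h : ℝ → ℂ, RapidDecay h →
    ∫⁻ x, ENNReal.ofReal (powW a b x ^ 2) * ‖cauchyOp γ h x‖ₑ ^ 2 ≤
      C * ∫⁻ y, ENNReal.ofReal (powW a b y ^ 2) * ‖h y‖ₑ ^ 2 := by
  refine ⟨4 + 4 * (Real.toNNReal (4 / (1 / 2 - δ)) * Real.toNNReal (4 / (1 / 2 - δ))),
    fun γ hγ h hh => ?_⟩
  have ha' := (abs_le.1 ha).1
  have hsq : ∀ y : ℝ, ∀ z : ℂ, ENNReal.ofReal (powW a b y ^ 2) * ‖z‖ₑ ^ 2 =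
      ‖(powW a b y : ℂ) * z‖ₑ ^ 2 := by
    intro y z
    rw [enorm_mul, mul_pow, ← ofReal_norm (powW a b y : ℂ), Complex.norm_real,
      Real.norm_of_nonneg (powW_nonneg _ _ _), ENNReal.ofReal_pow (powW_nonneg _ _ _)]
  have hm : AEStronglyMeasurable (fun y => (powW a b y : ℂ) * h y) volume :=
    (Complex.measurable_ofReal.comp (measurable_powW a b)).aestronglyMeasurable.mul
      hh.continuous.aestronglyMeasurable
  have hi : Integrable fun y => (powW a b y : ℂ) * h y := by
    refine (integrable_norm_iff hm).1 ?_
    refine (hh.integrable_powW_mul (a := a) (b := b) (by linarith)).congr (ae_of_all _ fun y => ?_)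
    simp only
    rw [norm_mul, Complex.norm_real, Real.norm_of_nonneg (powW_nonneg _ _ _)]
  have hlt := hh.lintegral_powW_sq_lt_top (a := a) (b := b) (by linarith)
  simp_rw [hsq] at hlt ⊢
  set I := ∫⁻ y, ‖(powW a b y : ℂ) * h y‖ₑ ^ 2 with hI
  have c1 := lintegral_cauchyOp_sq_le hγ hi (memLp_two_of_integrable_sq hm hlt)
  have hxne : ∀ᵐ x : ℝ, x ≠ 0 := by simp [ae_iff, measure_singleton]
  have hp : Measurable fun x : ℝ => ENNReal.ofReal (|x| ^ (-(1 / 2) : ℝ)) := by fun_prop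
  -- The commutator term is handled by Schur's test with |x|^{-1/2} on both sides, the kernel being
  -- symmetric; the main term `c1` is the unweighted bound applied to the weighted function.
  have c2 := schur_test (m := volume) (n := volume) (measurable_hardyK δ) hp hp
    (by filter_upwards [hxne] with x hx
        have := abs_pos.2 hx
        simp only [ne_eq, ENNReal.ofReal_eq_zero, not_le]; positivity)
    (ae_of_all _ fun x => ENNReal.ofReal_ne_top)
    (A := ENNReal.ofReal (4 / (1 / 2 - δ))) (B := ENNReal.ofReal (4 / (1 / 2 - δ)))
    (by filter_upwards [hxne] with x hx using (lintegral_hardyK h1 hx).le)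
    (by
      filter_upwards [hxne] with x hx
      refine le_trans (le_of_eq ?_) (lintegral_hardyK h1 hx).le
      simp_rw [hardyK_comm δ _ x])
    (h := fun y => ENNReal.ofReal (powW a b y) * ‖h y‖ₑ)
    (((measurable_powW a b).ennreal_ofReal).aemeasurable.mul hh.continuous.enorm.measurable.aemeasurable)
  have e5 : ∫⁻ y, (ENNReal.ofReal (powW a b y) * ‖h y‖ₑ) ^ 2 = I := by
    rw [hI]
    refine lintegral_congr fun y => ?_
    rw [enorm_mul, ← ofReal_norm (powW a b y : ℂ), Complex.norm_real,
      Real.norm_of_nonneg (powW_nonneg _ _ _)]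
  rw [e5] at c2
  calc _ ≤ ∫⁻ x, (4 * ‖cauchyOp γ (fun y => powW a b y * h y) x‖ₑ ^ 2 +
        4 * (∫⁻ y, ENNReal.ofReal (hardyK δ x y) * (ENNReal.ofReal (powW a b y) * ‖h y‖ₑ)) ^ 2) := by
        refine lintegral_mono_ae ?_
        filter_upwards [hxne] with x hx
        refine le_trans ?_ (ennreal_add_sq_le _ _)
        gcongr
        exact enorm_powW_mul_cauchyOp_le h0 h1 ha hab hγ hh hx
    _ = 4 * (∫⁻ x, ‖cauchyOp γ (fun y => powW a b y * h y) x‖ₑ ^ 2) + 4 * ∫⁻ x,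
        (∫⁻ y, ENNReal.ofReal (hardyK δ x y) * (ENNReal.ofReal (powW a b y) * ‖h y‖ₑ)) ^ 2 := by
        rw [lintegral_add_left', lintegral_const_mul' _ _ (by simp),
          lintegral_const_mul' _ _ (by simp)]
        exact ((continuous_cauchyOp hγ hi).enorm.measurable.pow_const 2).aemeasurable.const_mul _
    _ ≤ 4 * I + 4 * (ENNReal.ofReal (4 / (1 / 2 - δ)) * ENNReal.ofReal (4 / (1 / 2 - δ)) * I) := by
        gcongr
    _ = _ := by
        push_cast
        simp only [ENNReal.ofReal]
        ring

end WeightedCauchy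

/-! ### Decay of Laplace transforms uniformly up to the imaginary axis -/

section LaplaceDecay

theorem lap_eq_integral (f : ℝ → ℂ) (γ τ : ℝ) :
    lap f γ τ = ∫ t : ℝ, Complex.exp (-linePt γ τ * t) * f t := by
  rw [lap, Real.fourier_eq']
  refine integral_congr_ae (ae_of_all _ fun t => ?_)
  simp only [smul_eq_mul, ← mul_assoc, ← Complex.exp_add]
  congr 2
  simp only [linePt, RCLike.inner_apply, conj_trivial]
  push_cast
  ring

theorem lap_zero (f : ℝ → ℂ) : lap f 0 = 𝓕 f := by
  unfold lap; congr 1; ext t; simp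

theorem integrable_exp_mul {f : ℝ → ℂ} (hf : Continuous f) (hc : HasCompactSupport f) (z : ℂ) :
    Integrable fun t : ℝ => Complex.exp (z * t) * f t :=
  Continuous.integrable_of_hasCompactSupport (by fun_prop) hc.mul_left

theorem lap_add {f g : ℝ → ℂ} (hf : Continuous f) (hfc : HasCompactSupport f) (hg : Continuous g)
    (hgc : HasCompactSupport g) (γ τ : ℝ) : lap (fun t => f t + g t) γ τ = lap f γ τ + lap g γ τ := by
  rw [lap_eq_integral, lap_eq_integral, lap_eq_integral,
    ← integral_add (integrable_exp_mul hf hfc _) (integrable_exp_mul hg hgc _)]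
  simp_rw [mul_add]

theorem lap_const_mul (c : ℂ) (f : ℝ → ℂ) (γ τ : ℝ) :
    lap (fun t => c * f t) γ τ = c * lap f γ τ := by
  rw [lap_eq_integral, lap_eq_integral, ← integral_const_mul]
  refine integral_congr_ae (ae_of_all _ fun t => ?_)
  simp only
  ring

theorem lap_deriv {f : ℝ → ℂ} (hf : ContDiff ℝ ∞ f) (hc : HasCompactSupport f) (γ τ : ℝ) :
    lap (deriv f) γ τ = linePt γ τ * lap f γ τ := by
  set p := linePt γ τ with hp
  have hd : ∀ t, HasDerivAt f (deriv f t) t := fun t =>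
    ((hf.differentiable (by simp)) t).hasDerivAt
  have hdc : Continuous (deriv f) := hf.continuous_deriv (by simp)
  have he : ∀ t : ℝ, HasDerivAt (fun t : ℝ => Complex.exp (-p * t)) (Complex.exp (-p * t) * -p) t := by
    intro t
    have := (((hasDerivAt_id (t : ℂ)).const_mul (-p)).cexp).comp_ofReal
    simpa using this
  have i1 := integrable_exp_mul hdc hc.deriv (-p)
  have i2 := integrable_exp_mul hf.continuous hc (-p)
  have := integral_mul_deriv_eq_deriv_mul_of_integrable (u := fun t : ℝ => Complex.exp (-p * t))
    (v := f) (u' := fun t : ℝ => Complex.exp (-p * t) * -p) (v' := deriv f) (fun t _ => he t) (fun t _ => hd t) i1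
    ((i2.const_mul (-p)).congr (ae_of_all _ fun t => by simp only [Pi.mul_apply]; ring)) i2
  rw [lap_eq_integral, lap_eq_integral, ← hp, this, ← integral_neg, ← integral_const_mul]
  refine integral_congr_ae (ae_of_all _ fun t => ?_)
  simp only
  ring

theorem IsSmoothHalfLine.deriv {f : ℝ → ℂ} (hf : IsSmoothHalfLine f) : IsSmoothHalfLine (deriv f) :=
  ⟨(contDiff_infty_iff_deriv.1 hf.contDiff).2, tsupport_deriv_subset.trans hf.support⟩

/-- The Laplace transform decays rapidly on vertical lines, uniformly in `γ ≥ 0`. -/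
theorem norm_lap_le_uniform (N : ℕ) : ∀ f : ℝ → ℂ, IsSmoothHalfLine f → HasCompactSupport f →
    ∃ C : ℝ, ∀ γ ≥ 0, ∀ τ, (1 + |τ|) ^ N * ‖lap f γ τ‖ ≤ C := by
  induction N with
  | zero =>
    intro f hf hc
    refine ⟨∫ t, ‖f t‖, fun γ hγ τ => ?_⟩
    rw [pow_zero, one_mul, lap_eq_integral]
    refine norm_integral_le_of_norm_le
      (hf.contDiff.continuous.integrable_of_hasCompactSupport hc).norm (ae_of_all _ fun t => ?_)
    rcases lt_or_ge t 0 with ht | ht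
    · rw [hf.eq_zero t ht]; simp
    · rw [norm_mul]
      refine mul_le_of_le_one_left (norm_nonneg _) ?_
      rw [Complex.norm_exp, Real.exp_le_one_iff, Complex.re_mul_ofReal, Complex.neg_re, linePt_re]
      nlinarith
  -- One more power of |τ| is gained from the derivative of `f`, whose transform is p times that of
  -- `f`, as |τ| ≤ ‖p‖.
  | succ N ih =>
    intro f hf hc
    obtain ⟨C1, h1⟩ := ih f hf hc
    obtain ⟨C2, h2⟩ := ih _ hf.deriv hc.deriv
    refine ⟨C1 + C2, fun γ hγ τ => ?_⟩
    have e1 := h1 γ hγ τ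
    have e2 := h2 γ hγ τ
    rw [lap_deriv hf.contDiff hc, norm_mul] at e2
    calc (1 + |τ|) ^ (N + 1) * ‖lap f γ τ‖ = (1 + |τ|) ^ N * ‖lap f γ τ‖ +
          (1 + |τ|) ^ N * (|τ| * ‖lap f γ τ‖) := by ring
      _ ≤ (1 + |τ|) ^ N * ‖lap f γ τ‖ + (1 + |τ|) ^ N * (‖linePt γ τ‖ * ‖lap f γ τ‖) := by
          gcongr; exact le_norm_linePt_im γ τ
      _ ≤ C1 + C2 := add_le_add e1 e2

theorem tendsto_lap_zero {f : ℝ → ℂ} (hf : IsSmoothHalfLine f) (hc : HasCompactSupport f) (τ : ℝ) :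
    Tendsto (fun γ => lap f γ τ) (𝓝[>] 0) (𝓝 (lap f 0 τ)) := by
  simp_rw [lap_eq_integral]
  refine tendsto_integral_filter_of_dominated_convergence (fun t => ‖f t‖) ?_ ?_
    (hf.contDiff.continuous.integrable_of_hasCompactSupport hc).norm ?_
  · have := hf.contDiff.continuous
    exact Eventually.of_forall fun γ => Continuous.aestronglyMeasurable (by fun_prop)
  · filter_upwards [self_mem_nhdsWithin] with γ hγ
    have hγ0 : (0 : ℝ) < γ := hγ
    refine ae_of_all _ fun t => ?_
    rcases lt_or_ge t 0 with ht | ht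
    · rw [hf.eq_zero t ht]; simp
    · rw [norm_mul]
      refine mul_le_of_le_one_left (norm_nonneg _) ?_
      rw [Complex.norm_exp, Real.exp_le_one_iff, Complex.re_mul_ofReal, Complex.neg_re, linePt_re]
      nlinarith
  · refine ae_of_all _ fun t => ?_
    have : Continuous fun γ : ℝ => Complex.exp (-linePt γ τ * t) * f t := by
      unfold linePt; fun_prop
    exact (this.tendsto 0).mono_left nhdsWithin_le_nhds

end LaplaceDecay

/-! ### Spatial Fourier modes of the forcing family -/

section Modes

/-- The Laplace side boundary data `p^{(μ+1)/2} f̃(p)`. -/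
noncomputable def lapB (μ : ℝ) (f : ℝ → ℂ) (γ τ : ℝ) : ℂ :=
  linePt γ τ ^ (((μ + 1) / 2 : ℝ) : ℂ) * lap f γ τ

theorem rapidDecay_lapB {f : ℝ → ℂ} (hf : ContDiff ℝ ∞ f) (hc : HasCompactSupport f) {γ : ℝ}
    (hγ : 0 < γ) (μ : ℝ) : RapidDecay (lapB μ f γ) :=
  (rapidDecay_lap hf hc γ).cpow_mul hγ _

theorem norm_lapB (μ : ℝ) (f : ℝ → ℂ) (γ τ : ℝ) :
    ‖lapB μ f γ τ‖ = ‖linePt γ τ‖ ^ ((μ + 1) / 2) * ‖lap f γ τ‖ := by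
  rw [lapB, norm_mul, Complex.norm_cpow_real]

theorem fracIntegral_eq_lapInv_lapB {f : ℝ → ℂ} (hf : ContDiff ℝ ∞ f) (hc : HasCompactSupport f)
    {γ : ℝ} (hγ : 0 < γ) (μ : ℝ) :
    fracIntegral (-((μ + 1) / 2)) f = lapInv γ (lapB μ f γ) := by
  nth_rw 1 [← lapInv_lap hf hc γ]
  rw [fracIntegral_lapInv (rapidDecay_lap hf hc γ) hγ]
  congr 1
  ext τ
  unfold lapB
  congr 2
  push_cast; ring

/-- The Duhamel integral of the mode with frequency `η`, driven by a fractional derivative of `f`. -/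
noncomputable def modeS (μ : ℝ) (f : ℝ → ℂ) (η t : ℝ) : ℂ :=
  ∫ u in Ioi (0 : ℝ), Complex.exp (2 * Real.pi * η * u * Complex.I) *
    fracIntegral (-((μ + 1) / 2)) f (t - u)

theorem linePt_sub (γ τ η : ℝ) : linePt γ (τ - η) = linePt γ τ - 2 * Real.pi * η * Complex.I := by
  unfold linePt; push_cast; ring

theorem modeS_eq_lapInv {f : ℝ → ℂ} (hf : ContDiff ℝ ∞ f) (hc : HasCompactSupport f)
    {γ : ℝ} (hγ : 0 < γ) (μ η t : ℝ) :
    modeS μ f η t = lapInv γ (fun τ => (linePt γ (τ - η))⁻¹ * lapB μ f γ τ) t := by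
  unfold modeS
  rw [fracIntegral_eq_lapInv_lapB hf hc hγ, integral_mul_lapInv_sub]
  · congr 1
    ext τ
    congr 1
    rw [← integral_exp_neg_linePt hγ (τ - η)]
    refine setIntegral_congr_fun measurableSet_Ioi fun u _ => ?_
    rw [← Complex.exp_add, linePt_sub]
    congr 1; ring
  · refine (integrableOn_exp_neg_real hγ).bdd_mul (c := 1) ?_ (ae_of_all _ fun u => ?_)
    · exact Continuous.aestronglyMeasurable (by fun_prop)
    · exact (norm_cexp_mul_I_real η u).le
  · exact (rapidDecay_lapB hf hc hγ μ).integrable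

theorem RapidDecay.exp_mul {A : ℝ → ℂ} (hA : RapidDecay A) (γ t : ℝ) :
    RapidDecay fun τ => Complex.exp (linePt γ τ * t) * A τ :=
  hA.mul_of_le (continuous_exp_linePt γ t) (C := Real.exp (γ * t)) (r := 0)
    (fun τ => by rw [norm_exp_linePt, Real.rpow_zero, mul_one])

theorem modeS_eq_cauchyOp {f : ℝ → ℂ} (hf : ContDiff ℝ ∞ f) (hc : HasCompactSupport f)
    {γ : ℝ} (hγ : 0 < γ) (μ η t : ℝ) :
    modeS μ f η t = cauchyOp γ (fun τ => Complex.exp (linePt γ τ * t) * lapB μ f γ τ) η := by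
  rw [modeS_eq_lapInv hf hc hγ, lapInv, cauchyOp]
  refine integral_congr_ae (ae_of_all _ fun τ => ?_)
  simp only
  ring

/-- A qualitative bound at abscissa 1, growing with `t`. It serves integrability and continuity
only; the bound uniform in time comes from letting γ tend to 0. -/
theorem norm_modeS_le {f : ℝ → ℂ} (hf : ContDiff ℝ ∞ f) (hc : HasCompactSupport f) (μ : ℝ) :
    ∃ C : ℝ, 0 ≤ C ∧ ∀ η t, ‖modeS μ f η t‖ ≤ C * Real.exp t * (1 + |2 * Real.pi * η|)⁻¹ := by
  have hB := rapidDecay_lapB hf hc one_pos μ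
  refine ⟨∫ τ, (1 + 1 / 1) * (1 + 1 + 2 * Real.pi) * ((1 + |τ|) ^ (1 : ℝ) * ‖lapB μ f 1 τ‖),
    integral_nonneg fun τ => by have := Real.pi_pos; positivity, fun η t => ?_⟩
  rw [modeS_eq_lapInv hf hc one_pos]
  refine (norm_lapInv_le _ _ _).trans ?_
  rw [one_mul, mul_comm _ (Real.exp t), mul_assoc, ← integral_mul_const]
  gcongr Real.exp t * ?_
  refine integral_mono_of_nonneg (ae_of_all _ fun τ => norm_nonneg _)
    (((hB.integrable_mul 1).const_mul _).mul_const _) (ae_of_all _ fun τ => ?_)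
  have h1 := norm_inv_le_of_im_eq one_pos (p := linePt 1 τ) (d := linePt 1 (τ - η))
    (y := 2 * Real.pi * η) (linePt_re _ _).ge (by rw [linePt_im, linePt_im]; ring)
  have h2 := norm_linePt_le (γ := 1) zero_le_one τ
  simp only
  rw [norm_mul, Real.rpow_one]
  calc _ ≤ ((1 + 1 / 1) * (1 + ‖linePt 1 τ‖) * (1 + |2 * Real.pi * η|)⁻¹) * ‖lapB μ f 1 τ‖ := by
        gcongr
    _ ≤ ((1 + 1 / 1) * ((1 + 1 + 2 * Real.pi) * (1 + |τ|)) * (1 + |2 * Real.pi * η|)⁻¹) *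
          ‖lapB μ f 1 τ‖ := by
        gcongr
        nlinarith [abs_nonneg τ]
    _ = _ := by ring

theorem continuous_modeS {f : ℝ → ℂ} (hf : ContDiff ℝ ∞ f) (hc : HasCompactSupport f) (μ : ℝ) :
    Continuous fun q : ℝ × ℝ => modeS μ f q.1 q.2 := by
  have hB := rapidDecay_lapB hf hc one_pos μ
  have hl := continuous_linePt 1
  have hBc := hB.continuous
  simp_rw [modeS_eq_lapInv hf hc one_pos]
  unfold lapInv
  rw [continuous_iff_continuousAt]
  intro q₀
  refine continuousAt_of_dominated (bound := fun τ => Real.exp (1 * (q₀.2 + 1)) *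
    (1 / 1 * ‖lapB μ f 1 τ‖)) ?_ ?_ ((hB.integrable.norm.const_mul _).const_mul _) ?_
  · refine Eventually.of_forall fun q => ?_
    have h1 : Continuous fun τ : ℝ => (linePt 1 (τ - q.1))⁻¹ :=
      Continuous.inv₀ (by fun_prop) fun τ => linePt_ne_zero one_pos _
    exact ((continuous_exp_linePt 1 q.2).mul (h1.mul hBc)).aestronglyMeasurable
  · have : ∀ᶠ q : ℝ × ℝ in 𝓝 q₀, q.2 < q₀.2 + 1 :=
      continuous_snd.continuousAt.eventually_lt continuousAt_const (by linarith)
    filter_upwards [this] with q hq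
    refine ae_of_all _ fun τ => ?_
    rw [norm_mul, norm_mul, norm_exp_linePt]
    gcongr
    exact norm_linePt_inv_le one_pos _
  · refine ae_of_all _ fun τ => Continuous.continuousAt ?_
    have h1 : Continuous fun q : ℝ × ℝ => (linePt 1 (τ - q.1))⁻¹ :=
      Continuous.inv₀ (by fun_prop) fun q => linePt_ne_zero one_pos _
    have h2 : Continuous fun q : ℝ × ℝ => Complex.exp (linePt 1 τ * (q.2 : ℂ)) := by fun_prop
    exact h2.mul (h1.mul continuous_const)

/-- The spatial Fourier transform of the forcing family. -/
noncomputable def profileG (μ : ℝ) (f : ℝ → ℂ) (t ξ : ℝ) : ℂ :=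
  2 * Complex.exp (-(Real.pi / 4 * Complex.I)) *
    ((-(2 * Real.pi * ξ * Complex.I)) ^ ((-μ : ℝ) : ℂ) * modeS μ f (2 * Real.pi * ξ ^ 2) t)

theorem symb_linePt (γ τ ξ : ℝ) : symb (linePt γ τ) ξ = linePt γ (τ - 2 * Real.pi * ξ ^ 2) := by
  rw [linePt_sub, symb]; push_cast; ring

theorem norm_two_exp_quarter : ‖2 * Complex.exp (-(Real.pi / 4 * Complex.I))‖ = 2 := by
  rw [norm_mul, Complex.exp_neg, norm_inv, norm_exp_quarter, inv_one, mul_one, Complex.norm_two]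

theorem norm_profileG (μ : ℝ) (f : ℝ → ℂ) (t ξ : ℝ) : ‖profileG μ f t ξ‖ =
    2 * ((2 * Real.pi) ^ (-μ) * |ξ| ^ (-μ) * ‖modeS μ f (2 * Real.pi * ξ ^ 2) t‖) := by
  rw [profileG, norm_mul, norm_two_exp_quarter, norm_mul, Complex.norm_cpow_real, norm_two_pi_mul_I,
    Real.mul_rpow Real.two_pi_pos.le (abs_nonneg _)]

theorem norm_profileG_le {f : ℝ → ℂ} (hf : ContDiff ℝ ∞ f) (hc : HasCompactSupport f) (μ : ℝ) :
    ∃ C : ℝ, 0 ≤ C ∧ ∀ t ξ, ‖profileG μ f t ξ‖ ≤ C * Real.exp t * (|ξ| ^ (-μ) * (1 + |ξ|) ^ (-2 : ℝ)) := by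
  obtain ⟨C, hC0, hC⟩ := norm_modeS_le hf hc μ
  refine ⟨2 * ((2 * Real.pi) ^ (-μ) * C * 2), by have := Real.pi_pos; positivity, fun t ξ => ?_⟩
  rw [norm_profileG]
  have h1 : 2 * Real.pi * (2 * Real.pi * ξ ^ 2) = 4 * Real.pi ^ 2 * ξ ^ 2 := by ring
  have h2 := hC (2 * Real.pi * ξ ^ 2) t
  rw [h1] at h2
  have hpi := Real.pi_pos
  calc _ ≤ 2 * ((2 * Real.pi) ^ (-μ) * |ξ| ^ (-μ) * (C * Real.exp t *
        (1 + |4 * Real.pi ^ 2 * ξ ^ 2|)⁻¹)) := by gcongr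
    _ ≤ 2 * ((2 * Real.pi) ^ (-μ) * |ξ| ^ (-μ) * (C * Real.exp t *
        (2 * (1 + |ξ|) ^ (-2 : ℝ)))) := by gcongr; exact one_add_sq_inv_le ξ
    _ = _ := by ring

theorem measurable_profileG {f : ℝ → ℂ} (hf : ContDiff ℝ ∞ f) (hc : HasCompactSupport f) (μ : ℝ) :
    Measurable fun q : ℝ × ℝ => profileG μ f q.1 q.2 := by
  have h1 : Measurable fun q : ℝ × ℝ => modeS μ f (2 * Real.pi * q.2 ^ 2) q.1 :=
    ((continuous_modeS hf hc μ).comp'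
      (by fun_prop : Continuous fun q : ℝ × ℝ => (2 * Real.pi * q.2 ^ 2, q.1))).measurable
  unfold profileG
  fun_prop

theorem integrable_profileG {f : ℝ → ℂ} (hf : ContDiff ℝ ∞ f) (hc : HasCompactSupport f) {μ : ℝ}
    (h1 : -1 < μ) (h2 : μ < 1) (t : ℝ) : Integrable (profileG μ f t) := by
  obtain ⟨C, hC0, hC⟩ := norm_profileG_le hf hc μ
  exact ((integrable_abs_rpow_mul_one_add_rpow (a := -μ) (b := -2) (by linarith)
    (by linarith)).const_mul (C * Real.exp t)).mono'
    ((measurable_profileG hf hc μ).comp measurable_prodMk_left).aestronglyMeasurable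
    (ae_of_all _ (hC t))

/-- The Laplace representation is a double integral in ξ and τ. Integrating in ξ first gives the
profile N_μ; integrating in τ first gives the mode at η = 2πξ², since p - 4π²iξ² = γ + 2πi(τ -
2πξ²). -/
theorem forcingFamily_eq_fourierInv {f : ℝ → ℂ} (hf : IsSmoothHalfLine f) (hc : HasCompactSupport f)
    {μ : ℝ} (h1 : -1 < μ) (h2 : μ < 1) (x t : ℝ) :
    forcingFamily μ f x t = 𝓕⁻ (profileG μ f t) x := by
  have hB := rapidDecay_lapB hf.contDiff hc one_pos μ
  rw [forcingFamily_eq_lapInv h1 h2 one_pos hf hc, Real.fourierInv_eq', lapInv]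
  have e1 : ∀ τ : ℝ, Complex.exp (linePt 1 τ * t) * (kernelN μ x (linePt 1 τ) *
      (linePt 1 τ ^ (((μ + 1) / 2 : ℝ) : ℂ) * lap f 1 τ)) =
      ∫ ξ : ℝ, (2 * Complex.exp (-(Real.pi / 4 * Complex.I)) * Complex.exp (linePt 1 τ * t) *
        lapB μ f 1 τ) * (Complex.exp (2 * Real.pi * x * ξ * Complex.I) *
        (-(2 * Real.pi * ξ * Complex.I)) ^ ((-μ : ℝ) : ℂ) * (symb (linePt 1 τ) ξ)⁻¹) := by
    intro τ
    rw [integral_const_mul, kernelN, lapB]; ring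
  have e2 : ∀ ξ : ℝ, Complex.exp ((2 * Real.pi * (inner ℝ ξ x) : ℝ) * Complex.I) • profileG μ f t ξ =
      ∫ τ : ℝ, (2 * Complex.exp (-(Real.pi / 4 * Complex.I)) * Complex.exp (linePt 1 τ * t) *
        lapB μ f 1 τ) * (Complex.exp (2 * Real.pi * x * ξ * Complex.I) *
        (-(2 * Real.pi * ξ * Complex.I)) ^ ((-μ : ℝ) : ℂ) * (symb (linePt 1 τ) ξ)⁻¹) := by
    intro ξ
    have e3 : ((2 * Real.pi * (inner ℝ ξ x) : ℝ) : ℂ) * Complex.I = 2 * Real.pi * x * ξ * Complex.I := by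
      simp only [RCLike.inner_apply, conj_trivial]
      push_cast; ring
    rw [e3, profileG, modeS_eq_lapInv hf.contDiff hc one_pos, lapInv, smul_eq_mul, ← integral_const_mul,
      ← integral_const_mul, ← integral_const_mul]
    refine integral_congr_ae (ae_of_all _ fun τ => ?_)
    simp only
    rw [symb_linePt]; ring
  simp_rw [e1, e2]
  rw [integral_integral_swap]
  have hI : Integrable (fun q : ℝ × ℝ => (2 * Real.exp (1 * t) * (1 + (1 + 2 * Real.pi)) *
      ((2 * Real.pi) ^ (-μ) * (2 * (1 + 1 / 1))) * ((1 + |q.1|) ^ (1 : ℝ) * ‖lapB μ f 1 q.1‖)) *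
      (|q.2| ^ (-μ) * (1 + |q.2|) ^ (-2 : ℝ))) (volume.prod volume) :=
    Integrable.mul_prod ((hB.integrable_mul 1).const_mul _)
      (integrable_abs_rpow_mul_one_add_rpow (by linarith) (by linarith))
  have hl := continuous_linePt 1
  have hBc := hB.continuous
  refine hI.mono' ?_ (ae_of_all _ fun q => ?_)
  · have hs : Continuous fun q : ℝ × ℝ => (symb (linePt 1 q.1) q.2)⁻¹ :=
      Continuous.inv₀ (by unfold symb; fun_prop) fun q => symb_ne_zero (by rw [linePt_re]; exact one_pos) _
    have hsm := hs.measurable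
    have h3 : Measurable fun q : ℝ × ℝ => lapB μ f 1 q.1 := (hBc.comp' continuous_fst).measurable
    have h4 : Measurable fun q : ℝ × ℝ => linePt 1 q.1 := (hl.comp' continuous_fst).measurable
    exact Measurable.aestronglyMeasurable (by unfold Function.uncurry; fun_prop)
  · simp only [Function.uncurry]
    have h3 := norm_kernelN_integrand_le (μ := μ) one_pos (p := linePt 1 q.1) (linePt_re _ _).ge x q.2
    have h4 := norm_linePt_le (γ := 1) zero_le_one q.1
    have hpi := Real.pi_pos
    rw [norm_mul, norm_mul, norm_mul, norm_two_exp_quarter, norm_exp_linePt, Real.rpow_one]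
    calc _ ≤ 2 * Real.exp (1 * t) * ‖lapB μ f 1 q.1‖ * ((2 * Real.pi) ^ (-μ) * (2 * (1 + 1 / 1)) *
          (1 + ‖linePt 1 q.1‖) * (|q.2| ^ (-μ) * (1 + |q.2|) ^ (-2 : ℝ))) := by gcongr
      _ ≤ 2 * Real.exp (1 * t) * ‖lapB μ f 1 q.1‖ * ((2 * Real.pi) ^ (-μ) * (2 * (1 + 1 / 1)) *
          ((1 + (1 + 2 * Real.pi)) * (1 + |q.1|)) * (|q.2| ^ (-μ) * (1 + |q.2|) ^ (-2 : ℝ))) := by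
          gcongr
          nlinarith [abs_nonneg q.1]
      _ = _ := by ring

end Modes

/-! ### The substitution η = 2πξ² -/

section ChangeOfVariables

theorem lintegral_Ioi_comp_sq (Φ : ℝ → ℝ≥0∞) :
    ∫⁻ ξ in Ioi (0 : ℝ), ENNReal.ofReal (4 * Real.pi * |ξ|) * Φ (2 * Real.pi * ξ ^ 2) =
      ∫⁻ η in Ioi (0 : ℝ), Φ η := by
  have hpi := Real.pi_pos
  have himg : (fun ξ : ℝ => 2 * Real.pi * ξ ^ 2) '' Ioi 0 = Ioi 0 := by
    ext η
    constructor
    · rintro ⟨ξ, hξ, rfl⟩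
      have : (0 : ℝ) < ξ := hξ
      simp only [mem_Ioi]; positivity
    · intro hη
      have h0 : (0 : ℝ) < η := hη
      refine ⟨Real.sqrt (η / (2 * Real.pi)), Real.sqrt_pos.2 (by positivity), ?_⟩
      simp only
      rw [Real.sq_sqrt (by positivity)]
      field_simp
  conv_rhs => rw [← himg]
  rw [lintegral_image_eq_lintegral_abs_deriv_mul measurableSet_Ioi
    (f' := fun ξ => 4 * Real.pi * ξ)]
  · refine setLIntegral_congr_fun (measurableSet_Ioi (a := (0 : ℝ))) fun ξ _ => ?_
    rw [abs_mul, abs_of_pos (by positivity : 0 < 4 * Real.pi)]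
  · intro ξ _
    have := ((hasDerivAt_pow 2 ξ).const_mul (2 * Real.pi)).hasDerivWithinAt (s := Ioi 0)
    refine this.congr_deriv ?_
    push_cast; ring
  · intro x hx y hy hxy
    have hx0 : (0 : ℝ) < x := hx
    have hy0 : (0 : ℝ) < y := hy
    have : x ^ 2 = y ^ 2 := mul_left_cancel₀ (by positivity : 2 * Real.pi ≠ 0) hxy
    exact (pow_left_inj₀ hx0.le hy0.le two_ne_zero).1 this

/-- Each half line is mapped onto η > 0 with Jacobian 4π|ξ|. The two copies of |ξ| are absorbed
since 2 ≤ 4π, so the constant is 1. -/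
theorem lintegral_comp_sq_le (Φ : ℝ → ℝ≥0∞) :
    ∫⁻ ξ : ℝ, ENNReal.ofReal |ξ| * Φ (2 * Real.pi * ξ ^ 2) ≤ ∫⁻ η, Φ η := by
  have hpi := Real.pi_gt_three
  have hsymm : ∫⁻ ξ in Iic (0 : ℝ), ENNReal.ofReal |ξ| * Φ (2 * Real.pi * ξ ^ 2) =
      ∫⁻ ξ in Ioi (0 : ℝ), ENNReal.ofReal |ξ| * Φ (2 * Real.pi * ξ ^ 2) := by
    have h1 := (Measure.measurePreserving_neg (volume : Measure ℝ)).setLIntegral_comp_preimage_emb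
      (MeasurableEquiv.neg ℝ).measurableEmbedding
      (fun ξ => ENNReal.ofReal |ξ| * Φ (2 * Real.pi * ξ ^ 2)) (Iio 0)
    have h2 : Neg.neg ⁻¹' Iio (0 : ℝ) = Ioi 0 := by ext x; simp
    rw [h2] at h1
    rw [setLIntegral_congr (Iio_ae_eq_Iic (a := (0 : ℝ))).symm, ← h1]
    simp
  have hhalf : 2 * ∫⁻ ξ in Ioi (0 : ℝ), ENNReal.ofReal |ξ| * Φ (2 * Real.pi * ξ ^ 2) ≤ ∫⁻ η, Φ η := by
    rw [← lintegral_const_mul' _ _ (by simp)]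
    refine le_trans (lintegral_mono fun ξ => ?_) ((lintegral_Ioi_comp_sq Φ).le.trans
      (setLIntegral_le_lintegral _ _))
    rw [← mul_assoc]
    gcongr
    rw [← ENNReal.ofReal_ofNat, ← ENNReal.ofReal_mul (by norm_num)]
    refine ENNReal.ofReal_le_ofReal ?_
    nlinarith [abs_nonneg ξ]
  rw [← lintegral_add_compl (fun ξ : ℝ => ENNReal.ofReal |ξ| * Φ (2 * Real.pi * ξ ^ 2))
    (measurableSet_Iic (a := (0 : ℝ))), compl_Iic, hsymm, ← two_mul]
  exact hhalf

end ChangeOfVariables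

/-! ### The space trace estimate for smooth data -/

section SpaceEstimate

theorem rpow_le_of_comparable {A B K : ℝ} (hA : 0 < A) (hB : 0 < B) (hK : 1 ≤ K) (h1 : A ≤ K * B)
    (h2 : B ≤ K * A) (s : ℝ) : A ^ s ≤ K ^ |s| * B ^ s := by
  have hK0 : 0 < K := one_pos.trans_le hK
  rcases le_total 0 s with hs | hs
  · rw [abs_of_nonneg hs, ← Real.mul_rpow hK0.le hB.le]
    exact Real.rpow_le_rpow hA.le h1 hs
  · rw [abs_of_nonpos hs]
    have h3 : B / K ≤ A := by rw [div_le_iff₀ hK0]; linarith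
    calc A ^ s ≤ (B / K) ^ s := Real.rpow_le_rpow_of_nonpos (by positivity) h3 hs
      _ = K ^ (-s) * B ^ s := by
        rw [Real.div_rpow hB.le hK0.le, Real.rpow_neg hK0.le]; field_simp

theorem enorm_sq_eq_ofReal (z : ℂ) : ‖z‖ₑ ^ 2 = ENNReal.ofReal (‖z‖ ^ 2) := by
  rw [← ofReal_norm, ENNReal.ofReal_pow (norm_nonneg _)]

/-- With η = 2πξ² one has ⟨ξ⟩^{2s} comparable to ⟨η⟩^s, and |ξ|^{-2μ} = |ξ| · |ξ|^{-2μ-1}, the last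
factor being a multiple of |η|^{-μ-1/2}. The isolated |ξ| is the Jacobian of the substitution. -/
theorem exists_bracket_mul_rpow_le (s μ : ℝ) : ∃ C : ℝ, 0 ≤ C ∧ ∀ ξ : ℝ, ξ ≠ 0 →
    (1 + |2 * Real.pi * ξ|) ^ (2 * s) * (|ξ| ^ (-μ)) ^ 2 ≤
      C * (|ξ| * powW ((-μ - 1 / 2) / 2) (s / 2) (2 * Real.pi * ξ ^ 2) ^ 2) := by
  have hpi := Real.pi_gt_three
  refine ⟨(4 * Real.pi) ^ |s| * ((2 * Real.pi) ^ (-μ - 1 / 2))⁻¹, by positivity, fun ξ hξ => ?_⟩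
  have hx : 0 < |ξ| := abs_pos.2 hξ
  have e1 : (1 + |2 * Real.pi * ξ|) ^ (2 * s) ≤ (4 * Real.pi) ^ |s| * (1 + |2 * Real.pi * ξ ^ 2|) ^ s := by
    rw [Real.rpow_mul (by positivity), Real.rpow_two]
    have h3 : |2 * Real.pi * ξ| = 2 * Real.pi * |ξ| := by
      rw [abs_mul, abs_of_pos (by positivity : (0:ℝ) < 2 * Real.pi)]
    have h4 : |2 * Real.pi * ξ ^ 2| = 2 * Real.pi * |ξ| ^ 2 := by
      rw [abs_of_nonneg (by positivity), sq_abs]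
    rw [h3, h4]
    have h5 : 0 ≤ (1 - 2 * Real.pi * |ξ|) ^ 2 := sq_nonneg _
    have h6 : 0 ≤ Real.pi * |ξ| ^ 2 := by positivity
    have h7 : 0 ≤ (Real.pi - 3) * (Real.pi * |ξ| ^ 2) := mul_nonneg (by linarith) h6
    have h8 : 0 ≤ Real.pi * |ξ| := by positivity
    refine rpow_le_of_comparable (by positivity) (by positivity) (by linarith) ?_ ?_ s
    · nlinarith
    · have h9 : 1 + 2 * Real.pi * |ξ| ^ 2 ≤ (1 + 2 * Real.pi * |ξ|) ^ 2 := by nlinarith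
      refine h9.trans (le_mul_of_one_le_left (by positivity) (by linarith))
  have e2 : powW ((-μ - 1 / 2) / 2) (s / 2) (2 * Real.pi * ξ ^ 2) ^ 2 =
      (2 * Real.pi) ^ (-μ - 1 / 2) * |ξ| ^ (-2 * μ - 1) * (1 + |2 * Real.pi * ξ ^ 2|) ^ s := by
    have h4 : |2 * Real.pi * ξ ^ 2| = 2 * Real.pi * |ξ| ^ 2 := by
      rw [abs_of_nonneg (by positivity), sq_abs]
    rw [powW_sq, powW, h4, Real.mul_rpow (by positivity) (by positivity),
      ← Real.rpow_natCast |ξ|, ← Real.rpow_mul hx.le]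
    rw [show 2 * (s / 2) = s by ring]
    have e5 : 2 * ((-μ - 1 / 2) / 2) = -μ - 1 / 2 := by ring
    have e6 : ((2 : ℕ) : ℝ) * (-μ - 1 / 2) = -2 * μ - 1 := by push_cast; ring
    rw [e5, e6]
  have e3 : |ξ| * |ξ| ^ (-2 * μ - 1) = (|ξ| ^ (-μ)) ^ 2 := by
    nth_rw 1 [← Real.rpow_one |ξ|]
    rw [← Real.rpow_natCast, ← Real.rpow_mul hx.le, ← Real.rpow_add hx]
    congr 1; push_cast; ring
  rw [e2]
  have hne : (2 * Real.pi) ^ (-μ - 1 / 2) ≠ 0 := (Real.rpow_pos_of_pos (by positivity) _).ne'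
  have e4 : ∀ X Y Z : ℝ, (4 * Real.pi) ^ |s| * ((2 * Real.pi) ^ (-μ - 1 / 2))⁻¹ *
      (X * ((2 * Real.pi) ^ (-μ - 1 / 2) * Y * Z)) = (4 * Real.pi) ^ |s| * Z * (X * Y) := by
    intro X Y Z; field_simp
  rw [e4, e3]
  gcongr

theorem exists_sobolev_profileG_le (s μ : ℝ) : ∃ C : ℝ, 0 ≤ C ∧ ∀ f : ℝ → ℂ, ∀ t ξ : ℝ, ξ ≠ 0 →
    (1 + |2 * Real.pi * ξ|) ^ (2 * s) * ‖profileG μ f t ξ‖ ^ 2 ≤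
      C * (|ξ| * (powW ((-μ - 1 / 2) / 2) (s / 2) (2 * Real.pi * ξ ^ 2) ^ 2 *
        ‖modeS μ f (2 * Real.pi * ξ ^ 2) t‖ ^ 2)) := by
  obtain ⟨C, hC0, hC⟩ := exists_bracket_mul_rpow_le s μ
  have hpi := Real.pi_pos
  refine ⟨4 * ((2 * Real.pi) ^ (-μ)) ^ 2 * C, by positivity, fun f t ξ hξ => ?_⟩
  rw [norm_profileG]
  calc _ = 4 * ((2 * Real.pi) ^ (-μ)) ^ 2 * ((1 + |2 * Real.pi * ξ|) ^ (2 * s) * (|ξ| ^ (-μ)) ^ 2) *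
        ‖modeS μ f (2 * Real.pi * ξ ^ 2) t‖ ^ 2 := by ring
    _ ≤ 4 * ((2 * Real.pi) ^ (-μ)) ^ 2 * (C * (|ξ| * powW ((-μ - 1 / 2) / 2) (s / 2) (2 * Real.pi * ξ ^ 2) ^ 2)) *
        ‖modeS μ f (2 * Real.pi * ξ ^ 2) t‖ ^ 2 :=
        mul_le_mul_of_nonneg_right (mul_le_mul_of_nonneg_left (hC ξ hξ) (by positivity)) (by positivity)
    _ = _ := by ring

/-- Dominated convergence as the line approaches the imaginary axis. The condition a > -1/2 gives
integrability at τ = 0, and μ > -1 makes |p|^{(μ+1)/2} continuous and bounded near p = 0. -/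
theorem tendsto_lintegral_lapB {f : ℝ → ℂ} (hf : IsSmoothHalfLine f) (hc : HasCompactSupport f)
    {a b μ : ℝ} (ha : -(1 / 2) < a) (hμ : -1 < μ) :
    Tendsto (fun γ => ∫⁻ τ, ENNReal.ofReal (powW a b τ ^ 2) * ‖lapB μ f γ τ‖ₑ ^ 2) (𝓝[>] 0)
      (𝓝 (∫⁻ τ, ENNReal.ofReal (powW a b τ ^ 2 * (|2 * Real.pi * τ| ^ ((μ + 1) / 2) * ‖𝓕 f τ‖) ^ 2))) := by
  have hpi := Real.pi_pos
  obtain ⟨N, hN⟩ := exists_nat_gt (2 * a + 2 * b + (μ + 1) + 1)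
  obtain ⟨C, hC⟩ := norm_lap_le_uniform (N + 1) f hf hc
  have hC0 : 0 ≤ C := le_trans (by positivity) (hC 0 le_rfl 0)
  set bd : ℝ → ℝ := fun τ => ((1 + 2 * Real.pi) ^ ((μ + 1) / 2) * C) ^ 2 *
    (|τ| ^ (2 * a) * (1 + |τ|) ^ (2 * b + (μ + 1) - 2 * N)) with hbd
  have hbdi : Integrable bd := by
    refine (integrable_abs_rpow_mul_one_add_rpow (by linarith) ?_).const_mul _
    have : (0 : ℝ) ≤ N := by positivity
    linarith
  simp_rw [enorm_sq_eq_ofReal, ← ENNReal.ofReal_mul (sq_nonneg _)]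
  refine tendsto_lintegral_filter_of_dominated_convergence (fun τ => ENNReal.ofReal (bd τ)) ?_ ?_ ?_ ?_
  · filter_upwards [self_mem_nhdsWithin] with γ hγ
    have := (rapidDecay_lapB hf.contDiff hc hγ μ).continuous.measurable
    have h2 := measurable_powW a b
    fun_prop
  · have : ∀ᶠ γ : ℝ in 𝓝[>] 0, γ < 1 := mem_nhdsWithin_of_mem_nhds (Iio_mem_nhds one_pos)
    filter_upwards [self_mem_nhdsWithin, this] with γ hγ hγ1
    have hγ0 : (0 : ℝ) < γ := hγ
    refine ae_of_all _ fun τ => ENNReal.ofReal_le_ofReal ?_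
    have h0 : 0 < 1 + |τ| := by positivity
    have h3 : ‖lapB μ f γ τ‖ ≤ ((1 + 2 * Real.pi) ^ ((μ + 1) / 2) * C) * (1 + |τ|) ^ ((μ + 1) / 2 - N) := by
      rw [norm_lapB]
      have h4 : ‖linePt γ τ‖ ^ ((μ + 1) / 2) ≤ ((1 + 2 * Real.pi) * (1 + |τ|)) ^ ((μ + 1) / 2) := by
        refine Real.rpow_le_rpow (norm_nonneg _) ((norm_linePt_le hγ0.le τ).trans ?_) (by linarith)
        gcongr
      have h5 : ‖lap f γ τ‖ ≤ C * (1 + |τ|) ^ (-(N : ℝ)) := by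
        have := hC γ hγ0.le τ
        rw [Real.rpow_neg h0.le, Real.rpow_natCast, ← div_eq_mul_inv, le_div_iff₀ (by positivity)]
        refine le_trans ?_ this
        rw [mul_comm]
        gcongr
        · linarith [abs_nonneg τ]
        · omega
      calc _ ≤ ((1 + 2 * Real.pi) * (1 + |τ|)) ^ ((μ + 1) / 2) * (C * (1 + |τ|) ^ (-(N : ℝ))) := by gcongr
        _ = _ := by
          rw [Real.mul_rpow (by positivity) h0.le, sub_eq_add_neg ((μ + 1) / 2), Real.rpow_add h0]; ring
    calc powW a b τ ^ 2 * ‖lapB μ f γ τ‖ ^ 2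
        ≤ powW a b τ ^ 2 * (((1 + 2 * Real.pi) ^ ((μ + 1) / 2) * C) * (1 + |τ|) ^ ((μ + 1) / 2 - N)) ^ 2 := by
          gcongr
      _ = bd τ := by
        rw [hbd, powW_sq, powW]
        simp only
        rw [show 2 * b + (μ + 1) - 2 * N = 2 * b + ((μ + 1) / 2 - N) * (2 : ℕ) by push_cast; ring,
          Real.rpow_add h0, Real.rpow_mul h0.le ((μ + 1) / 2 - N), Real.rpow_natCast]
        ring
  · exact hbdi.lintegral_lt_top.ne
  · refine ae_of_all _ fun τ => ?_
    refine (ENNReal.continuous_ofReal.tendsto _).comp ?_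
    refine Tendsto.const_mul _ (Tendsto.pow ?_ 2)
    simp_rw [norm_lapB]
    rw [← lap_zero]
    refine Tendsto.mul ?_ (tendsto_lap_zero hf hc τ).norm
    have h6 : Continuous fun γ : ℝ => ‖linePt γ τ‖ ^ ((μ + 1) / 2) := by
      refine Continuous.rpow_const (by unfold linePt; fun_prop) fun _ => Or.inr (by linarith)
    have h7 := (h6.tendsto 0).mono_left (nhdsWithin_le_nhds (s := Ioi 0))
    have h8 : ‖linePt 0 τ‖ = |2 * Real.pi * τ| := by
      rw [linePt]
      have : ((0 : ℝ) : ℂ) + 2 * Real.pi * τ * Complex.I = ((2 * Real.pi * τ : ℝ) : ℂ) * Complex.I := by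
        push_cast; ring
      rw [this, norm_mul, Complex.norm_I, mul_one, Complex.norm_real, Real.norm_eq_abs]
    rwa [h8] at h7

/-- For every γ > 0 the weighted Cauchy bound applies to e^{pt} p^{(μ+1)/2} f̃(p) and costs e^{2γt}.
The left side does not depend on γ, so γ → 0 removes this factor and yields a bound independent of
`t`. -/
theorem lintegral_sobolev_profileG_le {s μ : ℝ} (h1 : -1 < μ) (h2 : μ < 1 / 2) (h3 : s - 3 / 2 < μ)
    (h4 : μ < s + 1 / 2) : ∃ C : ℝ≥0, ∀ f : ℝ → ℂ, IsSmoothHalfLine f → HasCompactSupport f → ∀ t : ℝ,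
    ∫⁻ ξ, ENNReal.ofReal ((1 + |2 * Real.pi * ξ|) ^ (2 * s)) * ‖profileG μ f t ξ‖ₑ ^ 2 ≤
      C * ∫⁻ τ, ENNReal.ofReal ((1 + |2 * Real.pi * τ|) ^ (2 * ((2 * s + 1) / 4))) * ‖𝓕 f τ‖ₑ ^ 2 := by
  have hpi := Real.pi_gt_three
  set a : ℝ := (-μ - 1 / 2) / 2 with ha
  set b : ℝ := s / 2 with hb
  have hδ0 : 0 ≤ max |a| |a + b| := le_max_of_le_left (abs_nonneg _)
  -- |a| < 1/2 means -3/2 < μ < 1/2, and |a + b| < 1/2 with a + b = (s - μ - 1/2)/2 means s - 3/2 <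
  -- μ < s + 1/2.
  have hδ1 : max |a| |a + b| < 1 / 2 := by
    rw [max_lt_iff, abs_lt, abs_lt]
    refine ⟨⟨?_, ?_⟩, ?_, ?_⟩ <;> rw [ha] <;> (try rw [hb]) <;> linarith
  obtain ⟨K, hK⟩ := lintegral_powW_cauchyOp_sq_le hδ0 hδ1 (le_max_left _ _) (le_max_right _ _)
  obtain ⟨C, hC0, hC⟩ := exists_sobolev_profileG_le s μ
  set D : ℝ := (2 * Real.pi) ^ (μ + 1) * (2 * Real.pi) ^ |s| with hD
  have hD0 : 0 ≤ D := by positivity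
  refine ⟨C.toNNReal * K * D.toNNReal, fun f hf hc t => ?_⟩
  set J : ℝ → ℝ≥0∞ := fun γ => ∫⁻ τ, ENNReal.ofReal (powW a b τ ^ 2) * ‖lapB μ f γ τ‖ₑ ^ 2 with hJ
  have step : ∀ γ > 0, ∫⁻ ξ, ENNReal.ofReal ((1 + |2 * Real.pi * ξ|) ^ (2 * s)) * ‖profileG μ f t ξ‖ₑ ^ 2 ≤
      ENNReal.ofReal C * (K * (ENNReal.ofReal (Real.exp (2 * γ * t)) * J γ)) := by
    intro γ hγ
    calc _ ≤ ∫⁻ ξ, ENNReal.ofReal C * (ENNReal.ofReal |ξ| *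
            (fun η => ENNReal.ofReal (powW a b η ^ 2) * ‖modeS μ f η t‖ₑ ^ 2) (2 * Real.pi * ξ ^ 2)) := by
          refine lintegral_mono_ae ?_
          have h0 : ∀ᵐ ξ : ℝ, ξ ≠ 0 := by simp [ae_iff]
          filter_upwards [h0] with ξ hξ
          rw [enorm_sq_eq_ofReal, enorm_sq_eq_ofReal, ← ENNReal.ofReal_mul (by positivity),
            ← ENNReal.ofReal_mul (by positivity), ← ENNReal.ofReal_mul (by positivity),
            ← ENNReal.ofReal_mul hC0]
          exact ENNReal.ofReal_le_ofReal (hC f t ξ hξ)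
      _ ≤ ENNReal.ofReal C * ∫⁻ η, ENNReal.ofReal (powW a b η ^ 2) * ‖modeS μ f η t‖ₑ ^ 2 := by
          rw [lintegral_const_mul' _ _ ENNReal.ofReal_ne_top]
          exact mul_le_mul_right (lintegral_comp_sq_le fun η => ENNReal.ofReal (powW a b η ^ 2) * ‖modeS μ f η t‖ₑ ^ 2) _
      _ ≤ ENNReal.ofReal C * (K * ∫⁻ y, ENNReal.ofReal (powW a b y ^ 2) *
            ‖Complex.exp (linePt γ y * t) * lapB μ f γ y‖ₑ ^ 2) := by
          gcongr
          simp_rw [modeS_eq_cauchyOp hf.contDiff hc hγ]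
          exact hK γ hγ _ ((rapidDecay_lapB hf.contDiff hc hγ μ).exp_mul γ t)
      _ = _ := by
          congr 2
          rw [hJ, ← lintegral_const_mul' _ _ ENNReal.ofReal_ne_top]
          refine lintegral_congr fun y => ?_
          rw [enorm_mul, mul_pow, enorm_sq_eq_ofReal (Complex.exp _), norm_exp_linePt, ← Real.exp_nat_mul]
          push_cast
          rw [show 2 * (γ * t) = 2 * γ * t by ring]
          ring
  have hlim := tendsto_lintegral_lapB hf hc (a := a) (b := b) (μ := μ) (by rw [ha]; linarith) h1
  set J0 := ∫⁻ τ, ENNReal.ofReal (powW a b τ ^ 2 * (|2 * Real.pi * τ| ^ ((μ + 1) / 2) * ‖𝓕 f τ‖) ^ 2) with hJ0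
  have hexp : Tendsto (fun γ : ℝ => ENNReal.ofReal (Real.exp (2 * γ * t))) (𝓝[>] 0) (𝓝 1) := by
    have h5 : Continuous fun γ : ℝ => Real.exp (2 * γ * t) := by fun_prop
    have h6 := ENNReal.tendsto_ofReal ((h5.tendsto 0).mono_left (nhdsWithin_le_nhds (s := Ioi 0)))
    simpa using h6
  have hJtop : J0 ≤ ENNReal.ofReal D *
      ∫⁻ τ, ENNReal.ofReal ((1 + |2 * Real.pi * τ|) ^ (2 * ((2 * s + 1) / 4))) * ‖𝓕 f τ‖ₑ ^ 2 := by
    rw [hJ0, ← lintegral_const_mul' _ _ ENNReal.ofReal_ne_top]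
    refine lintegral_mono_ae ?_
    have h0 : ∀ᵐ ξ : ℝ, ξ ≠ 0 := by simp [ae_iff]
    filter_upwards [h0] with τ hτ
    have hx : 0 < |τ| := abs_pos.2 hτ
    rw [enorm_sq_eq_ofReal, ← ENNReal.ofReal_mul (by positivity), ← ENNReal.ofReal_mul hD0]
    refine ENNReal.ofReal_le_ofReal ?_
    have h3' : |2 * Real.pi * τ| = 2 * Real.pi * |τ| := by
      rw [abs_mul, abs_of_pos (by positivity : (0:ℝ) < 2 * Real.pi)]
    rw [powW_sq, h3', Real.mul_rpow (by positivity) hx.le, mul_pow, mul_pow, ← Real.rpow_natCast ((2 * Real.pi) ^ _) 2,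
      ← Real.rpow_natCast (|τ| ^ _) 2, ← Real.rpow_mul (by positivity), ← Real.rpow_mul hx.le, powW]
    -- The exponents 2a = -μ - 1/2 and μ + 1 add to 1/2, so the singularity of the weight at the
    -- origin disappears. With ⟨τ⟩^s the total order is s + 1/2, twice the Sobolev exponent of the
    -- data.
    have e1 : |τ| ^ (2 * a) * |τ| ^ ((μ + 1) / 2 * (2 : ℕ)) = |τ| ^ (1 / 2 : ℝ) := by
      rw [← Real.rpow_add hx]; congr 1; rw [ha]; push_cast; ring
    have e2 : |τ| ^ (1 / 2 : ℝ) ≤ (1 + 2 * Real.pi * |τ|) ^ (1 / 2 : ℝ) := by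
      refine Real.rpow_le_rpow hx.le ?_ (by norm_num)
      nlinarith
    have e3 : (1 + |τ|) ^ (2 * b) ≤ (2 * Real.pi) ^ |s| * (1 + 2 * Real.pi * |τ|) ^ s := by
      rw [hb, show 2 * (s / 2) = s by ring]
      refine rpow_le_of_comparable (by positivity) (by positivity) (by linarith) ?_ ?_ s
      · nlinarith [mul_nonneg (by linarith : 0 ≤ Real.pi - 3) hx.le, mul_nonneg (by positivity : 0 ≤ Real.pi * Real.pi) hx.le,
          mul_nonneg (mul_nonneg Real.pi_pos.le (by linarith : 0 ≤ Real.pi - 3)) hx.le]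
      · nlinarith
    have e4 : (μ + 1) / 2 * ((2 : ℕ) : ℝ) = μ + 1 := by push_cast; ring
    calc _ = (2 * Real.pi) ^ (μ + 1) * (|τ| ^ (2 * a) * |τ| ^ ((μ + 1) / 2 * (2 : ℕ))) *
          (1 + |τ|) ^ (2 * b) * ‖𝓕 f τ‖ ^ 2 := by rw [e4]; ring
      _ ≤ (2 * Real.pi) ^ (μ + 1) * (1 + 2 * Real.pi * |τ|) ^ (1 / 2 : ℝ) *
          ((2 * Real.pi) ^ |s| * (1 + 2 * Real.pi * |τ|) ^ s) * ‖𝓕 f τ‖ ^ 2 := by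
          rw [e1]; gcongr
      _ = _ := by
          rw [show 2 * ((2 * s + 1) / 4) = 1 / 2 + s by ring, Real.rpow_add (by positivity : 0 < 1 + 2 * Real.pi * |τ|), hD]
          ring
  have hfin := ENNReal.Tendsto.const_mul (a := ENNReal.ofReal C) (ENNReal.Tendsto.const_mul (a := (K : ℝ≥0∞))
    (ENNReal.Tendsto.mul hexp (Or.inl one_ne_zero) hlim (Or.inr (by simp)))
    (Or.inr (by simp))) (Or.inr (by simp))
  rw [one_mul] at hfin
  have hle := ge_of_tendsto hfin (eventually_nhdsWithin_of_forall fun γ hγ => step γ hγ)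
  refine hle.trans ?_
  calc _ ≤ ENNReal.ofReal C * (K * (ENNReal.ofReal D *
      ∫⁻ τ, ENNReal.ofReal ((1 + |2 * Real.pi * τ|) ^ (2 * ((2 * s + 1) / 4))) * ‖𝓕 f τ‖ₑ ^ 2)) := by gcongr
    _ = _ := by
      rw [ENNReal.coe_mul, ENNReal.coe_mul, ENNReal.ofReal, ENNReal.ofReal]
      ring

end SpaceEstimate

/-! ### Weighted convolution estimates -/

section WeightedConvolution

/-- The Japanese bracket weight `(1 + |2πτ|)^r`. -/
noncomputable def jap (r τ : ℝ) : ℝ := (1 + |2 * Real.pi * τ|) ^ r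

theorem jap_pos (r τ : ℝ) : 0 < jap r τ := by unfold jap; positivity

theorem continuous_jap (r : ℝ) : Continuous (jap r) := by
  unfold jap
  exact Continuous.rpow_const (by fun_prop) fun x => Or.inl (by positivity)

theorem jap_add (r q τ : ℝ) : jap (r + q) τ = jap r τ * jap q τ := by
  unfold jap; exact Real.rpow_add (by positivity) _ _

theorem jap_two_mul (r τ : ℝ) : jap (2 * r) τ = jap r τ ^ 2 := by
  rw [two_mul, jap_add, sq]

theorem jap_le_jap {r q : ℝ} (h : r ≤ q) (τ : ℝ) : jap r τ ≤ jap q τ :=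
  Real.rpow_le_rpow_of_exponent_le (by simp) h

theorem ofReal_jap_two_mul (r τ : ℝ) : ENNReal.ofReal (jap (2 * r) τ) = ENNReal.ofReal (jap r τ) ^ 2 := by
  rw [jap_two_mul, ENNReal.ofReal_pow (jap_pos _ _).le]

theorem jap_le_one_add_abs (r τ : ℝ) : jap r τ ≤ (2 * Real.pi) ^ |r| * (1 + |τ|) ^ r := by
  have hpi := Real.pi_gt_three
  unfold jap
  rw [abs_mul, abs_of_pos Real.two_pi_pos]
  have := mul_nonneg (by linarith : 0 ≤ 2 * Real.pi - 1) (abs_nonneg τ)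
  refine rpow_le_of_comparable (by positivity) (by positivity) (by linarith) ?_ ?_ r
  · nlinarith
  · have h1 : 1 + |τ| ≤ 1 + 2 * Real.pi * |τ| := by nlinarith
    exact h1.trans (le_mul_of_one_le_left (by positivity) (by linarith))

theorem one_add_abs_le_jap (r τ : ℝ) : (1 + |τ|) ^ r ≤ (2 * Real.pi) ^ |r| * jap r τ := by
  have hpi := Real.pi_gt_three
  unfold jap
  rw [abs_mul, abs_of_pos Real.two_pi_pos]
  have := mul_nonneg (by linarith : 0 ≤ 2 * Real.pi - 1) (abs_nonneg τ)
  refine rpow_le_of_comparable (by positivity) (by positivity) (by linarith) ?_ ?_ r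
  · have h1 : 1 + |τ| ≤ 1 + 2 * Real.pi * |τ| := by nlinarith
    exact h1.trans (le_mul_of_one_le_left (by positivity) (by linarith))
  · nlinarith

/-- Peetre's inequality; it moves a weight of any real order across a convolution, the loss being
absorbed by a rapidly decreasing kernel. -/
theorem jap_le_mul (r x y : ℝ) : jap r x ≤ jap |r| (x - y) * jap r y := by
  unfold jap
  have h1 : ∀ a b : ℝ, 1 + |2 * Real.pi * a| ≤ (1 + |2 * Real.pi * (a - b)|) * (1 + |2 * Real.pi * b|) := by
    intro a b
    have : |2 * Real.pi * a| ≤ |2 * Real.pi * (a - b)| + |2 * Real.pi * b| := by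
      have := abs_add_le (2 * Real.pi * (a - b)) (2 * Real.pi * b)
      rwa [← mul_add, sub_add_cancel] at this
    nlinarith [abs_nonneg (2 * Real.pi * (a - b)), abs_nonneg (2 * Real.pi * b),
      mul_nonneg (abs_nonneg (2 * Real.pi * (a - b))) (abs_nonneg (2 * Real.pi * b))]
  refine rpow_le_of_comparable (by positivity) (by positivity) (by simp) (h1 x y) ?_ r
  have h2 := h1 y x
  rwa [show 2 * Real.pi * (y - x) = -(2 * Real.pi * (x - y)) by ring, abs_neg] at h2

theorem RapidDecay.integrable_jap_mul {k : ℝ → ℂ} (hk : RapidDecay k) (r : ℝ) :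
    Integrable fun τ => jap r τ * ‖k τ‖ := by
  refine ((hk.integrable_mul r).const_mul ((2 * Real.pi) ^ |r|)).mono'
    ((continuous_jap r).mul hk.continuous.norm).aestronglyMeasurable (ae_of_all _ fun τ => ?_)
  have := jap_pos r τ
  rw [Real.norm_of_nonneg (by positivity), ← mul_assoc]
  gcongr
  exact jap_le_one_add_abs r τ

theorem RapidDecay.exists_jap_le {k : ℝ → ℂ} (hk : RapidDecay k) (r : ℝ) :
    ∃ M : ℝ, 0 ≤ M ∧ ∀ τ, jap r τ * ‖k τ‖ ≤ M := by
  obtain ⟨C, hC0, hC⟩ := hk.rpow_bound (-r)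
  have hpi := Real.pi_pos
  refine ⟨(2 * Real.pi) ^ |r| * C, by positivity, fun τ => ?_⟩
  have h0 : 0 < 1 + |τ| := by positivity
  calc _ ≤ ((2 * Real.pi) ^ |r| * (1 + |τ|) ^ r) * (C * (1 + |τ|) ^ (-r)) :=
        mul_le_mul (jap_le_one_add_abs r τ) (hC τ) (norm_nonneg _) (by positivity)
    _ = (2 * Real.pi) ^ |r| * C * ((1 + |τ|) ^ r * (1 + |τ|) ^ (-r)) := by ring
    _ = _ := by rw [← Real.rpow_add h0, add_neg_cancel, Real.rpow_zero, mul_one]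

theorem lintegral_mul_sq_le {f g : ℝ → ℝ≥0∞} (hf : AEMeasurable f volume) (hg : AEMeasurable g volume) :
    (∫⁻ x, f x * g x) ^ 2 ≤ (∫⁻ x, f x ^ 2) * ∫⁻ x, g x ^ 2 := by
  have h := ENNReal.lintegral_mul_le_Lp_mul_Lq volume Real.HolderConjugate.two_two hf hg
  have h2 := pow_le_pow_left' h 2
  refine h2.trans (le_of_eq ?_)
  rw [mul_pow, ← ENNReal.rpow_natCast, ← ENNReal.rpow_natCast, ← ENNReal.rpow_mul, ← ENNReal.rpow_mul]
  norm_num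

/-- After Peetre's inequality, Young's inequality gives the square integral bound and Cauchy–Schwarz
the pointwise one. The pointwise form supplies the dominating functions for continuity in a
parameter. -/
theorem exists_weighted_conv_bound {k : ℝ → ℂ} (hk : RapidDecay k) (r : ℝ) : ∃ C : ℝ≥0,
    ∀ B : ℝ → ℝ≥0∞, AEMeasurable B volume →
    (∫⁻ τ, ENNReal.ofReal (jap (2 * r) τ) * (∫⁻ y, ‖k (τ - y)‖ₑ * B y) ^ 2 ≤
      C * ∫⁻ y, ENNReal.ofReal (jap (2 * r) y) * B y ^ 2) ∧
    ∀ τ, ENNReal.ofReal (jap (2 * r) τ) * (∫⁻ y, ‖k (τ - y)‖ₑ * B y) ^ 2 ≤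
      C * ∫⁻ y, ENNReal.ofReal (jap (2 * r) y) * B y ^ 2 := by
  obtain ⟨M, hM0, hM⟩ := hk.exists_jap_le |r|
  have hmk := (continuous_jap |r|).measurable
  have hmj := (continuous_jap r).measurable
  have hkm := hk.continuous.measurable
  set K : ℝ → ℝ≥0∞ := fun z => ENNReal.ofReal (jap |r| z * ‖k z‖) with hK
  have hKm : Measurable K := by fun_prop
  have hKfin : ∫⁻ z, K z < ⊤ := (hk.integrable_jap_mul |r|).lintegral_lt_top
  have hK2fin : ∫⁻ z, K z ^ 2 < ⊤ := by
    calc ∫⁻ z, K z ^ 2 ≤ ∫⁻ z, ENNReal.ofReal M * K z := by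
          refine lintegral_mono fun z => ?_
          simp only
          rw [sq]
          gcongr
          exact ENNReal.ofReal_le_ofReal (hM z)
      _ = ENNReal.ofReal M * ∫⁻ z, K z := lintegral_const_mul' _ _ ENNReal.ofReal_ne_top
      _ < ⊤ := ENNReal.mul_lt_top ENNReal.ofReal_lt_top hKfin
  have key : ∀ (B : ℝ → ℝ≥0∞) τ, ENNReal.ofReal (jap (2 * r) τ) * (∫⁻ y, ‖k (τ - y)‖ₑ * B y) ^ 2 ≤
      (∫⁻ y, K (τ - y) * (ENNReal.ofReal (jap r y) * B y)) ^ 2 := by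
    intro B τ
    rw [ofReal_jap_two_mul, ← mul_pow, ← lintegral_const_mul' _ _ ENNReal.ofReal_ne_top]
    refine pow_le_pow_left' (lintegral_mono fun y => ?_) 2
    calc ENNReal.ofReal (jap r τ) * (‖k (τ - y)‖ₑ * B y)
        ≤ ENNReal.ofReal (jap |r| (τ - y) * jap r y) * (‖k (τ - y)‖ₑ * B y) := by
          gcongr; exact jap_le_mul r τ y
      _ = _ := by
          simp only [hK]
          rw [ENNReal.ofReal_mul (jap_pos _ _).le, ENNReal.ofReal_mul (jap_pos _ _).le, ofReal_norm]
          ring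
  have hsq : ∀ B : ℝ → ℝ≥0∞, ∫⁻ y, (ENNReal.ofReal (jap r y) * B y) ^ 2 =
      ∫⁻ y, ENNReal.ofReal (jap (2 * r) y) * B y ^ 2 := by
    intro B
    simp_rw [mul_pow, ofReal_jap_two_mul]
  refine ⟨((∫⁻ z, K z) ^ 2).toNNReal + (∫⁻ z, K z ^ 2).toNNReal, fun B hB => ⟨?_, fun τ => ?_⟩⟩
  · refine (lintegral_mono (key B)).trans ?_
    refine (lintegral_conv_sq_le hKm (by fun_prop)).trans ?_
    rw [hsq, ENNReal.coe_add, ENNReal.coe_toNNReal (ENNReal.pow_ne_top hKfin.ne)]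
    gcongr
    exact le_self_add
  · refine (key B τ).trans ((lintegral_mul_sq_le (by fun_prop) (by fun_prop)).trans ?_)
    rw [hsq, ENNReal.coe_add, ENNReal.coe_toNNReal hK2fin.ne, lintegral_sub_left_eq_self (fun z => K z ^ 2)]
    gcongr
    exact le_add_self

end WeightedConvolution

/-! ### Multiplication by smooth cutoffs -/

section FourierCutoff

theorem fourierInv_exp_mul (φ : ℝ → ℂ) (τ y : ℝ) :
    𝓕⁻ (fun t : ℝ => Complex.exp (-(2 * Real.pi * τ * Complex.I) * t) * φ t) y = 𝓕 φ (τ - y) := by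
  rw [Real.fourierInv_eq', Real.fourier_eq']
  refine integral_congr_ae (ae_of_all _ fun t => ?_)
  simp only [smul_eq_mul, ← mul_assoc, ← Complex.exp_add, RCLike.inner_apply, conj_trivial]
  congr 2
  push_cast
  ring

theorem fourier_eq_integral_exp_mul (h : ℝ → ℂ) (τ : ℝ) :
    𝓕 h τ = ∫ t : ℝ, Complex.exp (-(2 * Real.pi * τ * Complex.I) * t) * h t := by
  rw [Real.fourier_eq']
  refine integral_congr_ae (ae_of_all _ fun t => ?_)
  simp only [smul_eq_mul, RCLike.inner_apply, conj_trivial]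
  congr 2
  push_cast
  ring

/-- Testing `F` on the Schwartz function φ(t) e^{-2πiτt} and transferring to the Fourier side gives
the convolution, with no integrability assumed of `f` itself. -/
theorem fourier_mul_eq_conv {φ : ℝ → ℂ} (hφ : ContDiff ℝ ∞ φ) (hc : HasCompactSupport φ)
    {F : 𝓢'(ℝ, ℂ)} {f g : ℝ → ℂ} (hF : IsFunction F f) (hG : IsFunction (𝓕 F) g) (τ : ℝ) :
    𝓕 (fun t => φ t * f t) τ = ∫ y, 𝓕 φ (τ - y) * g y := by
  obtain ⟨Φ, hΦ⟩ := exists_schwartz_exp_mul hφ hc (-(2 * Real.pi * τ * Complex.I))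
  have h1 : F Φ = (𝓕 F) (𝓕⁻ Φ) := by
    rw [TemperedDistribution.fourier_apply, FourierTransform.fourier_fourierInv_eq]
  rw [(hF Φ).2, (hG _).2] at h1
  rw [fourier_eq_integral_exp_mul]
  refine Eq.trans (integral_congr_ae (ae_of_all _ fun t => ?_)) (h1.trans
    (integral_congr_ae (ae_of_all _ fun y => ?_)))
  · simp only; rw [hΦ]; ring
  · simp only
    rw [SchwartzMap.fourierInv_coe, hΦ, fourierInv_exp_mul]

theorem fourier_mul_fourierInv {φ : ℝ → ℂ} (hφ : ContDiff ℝ ∞ φ) (hc : HasCompactSupport φ)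
    {B : ℝ → ℂ} (hB : Integrable B) (τ : ℝ) :
    𝓕 (fun t => φ t * 𝓕⁻ B t) τ = ∫ y, 𝓕 φ (τ - y) * B y := by
  rw [fourier_eq_integral_exp_mul]
  simp_rw [← mul_assoc]
  rw [← integral_fourierInv_mul_eq_flip (integrable_exp_mul hφ.continuous hc _) hB]
  simp_rw [fourierInv_exp_mul]

theorem rapidDecay_fourier {φ : ℝ → ℂ} (hφ : ContDiff ℝ ∞ φ) (hc : HasCompactSupport φ) :
    RapidDecay (𝓕 φ) := by
  rw [← lap_zero]; exact rapidDecay_lap hφ hc 0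

theorem enorm_conv_le (k g : ℝ → ℂ) (τ : ℝ) :
    ‖∫ y, k (τ - y) * g y‖ₑ ≤ ∫⁻ y, ‖k (τ - y)‖ₑ * ‖g y‖ₑ := by
  refine (enorm_integral_le_lintegral_enorm _).trans (le_of_eq ?_)
  simp_rw [enorm_mul]

theorem exists_fourier_cutoff_bound {φ : ℝ → ℂ} (hφ : ContDiff ℝ ∞ φ) (hc : HasCompactSupport φ) (r : ℝ) :
    ∃ C : ℝ≥0, ∀ (F : 𝓢'(ℝ, ℂ)) (f g : ℝ → ℂ), IsFunction F f → IsFunction (𝓕 F) g →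
      ∫⁻ τ, ENNReal.ofReal (jap (2 * r) τ) * ‖𝓕 (fun t => φ t * f t) τ‖ₑ ^ 2 ≤
        C * ∫⁻ τ, ENNReal.ofReal (jap (2 * r) τ) * ‖g τ‖ₑ ^ 2 := by
  obtain ⟨C, hC⟩ := exists_weighted_conv_bound (rapidDecay_fourier hφ hc) r
  refine ⟨C, fun F f g hF hG => ?_⟩
  refine le_trans (lintegral_mono fun τ => ?_) (hC (fun y => ‖g y‖ₑ) hG.aestronglyMeasurable.enorm).1
  rw [fourier_mul_eq_conv hφ hc hF hG]
  gcongr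
  exact enorm_conv_le _ _ _

/-- The factor e^{-γt} is smooth and is absorbed into the compactly supported cutoff, so Laplace
transforms obey the Fourier side bound. -/
theorem exists_lap_cutoff_bound {χ : ℝ → ℂ} (hχ : ContDiff ℝ ∞ χ) (hc : HasCompactSupport χ) (r γ : ℝ) :
    ∃ C : ℝ≥0, ∀ (F : 𝓢'(ℝ, ℂ)) (f g : ℝ → ℂ), IsFunction F f → IsFunction (𝓕 F) g →
      ∫⁻ τ, ENNReal.ofReal (jap (2 * r) τ) * ‖lap (fun t => χ t * f t) γ τ‖ₑ ^ 2 ≤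
        C * ∫⁻ τ, ENNReal.ofReal (jap (2 * r) τ) * ‖g τ‖ₑ ^ 2 := by
  have h1 : ContDiff ℝ ∞ fun t : ℝ => Complex.exp (-(γ : ℂ) * t) * χ t :=
    ((contDiff_const.mul Complex.ofRealCLM.contDiff).cexp).mul hχ
  obtain ⟨C, hC⟩ := exists_fourier_cutoff_bound h1 (hc.mul_left) r
  refine ⟨C, fun F f g hF hG => ?_⟩
  have := hC F f g hF hG
  simp_rw [mul_assoc] at this
  exact this

theorem exists_fourier_mul_fourierInv_bound {φ : ℝ → ℂ} (hφ : ContDiff ℝ ∞ φ) (hc : HasCompactSupport φ)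
    (r : ℝ) : ∃ C : ℝ≥0, ∀ B : ℝ → ℂ, Integrable B →
      (∫⁻ τ, ENNReal.ofReal (jap (2 * r) τ) * ‖𝓕 (fun t => φ t * 𝓕⁻ B t) τ‖ₑ ^ 2 ≤
        C * ∫⁻ τ, ENNReal.ofReal (jap (2 * r) τ) * ‖B τ‖ₑ ^ 2) ∧
      ∀ τ, ENNReal.ofReal (jap (2 * r) τ) * ‖𝓕 (fun t => φ t * 𝓕⁻ B t) τ‖ₑ ^ 2 ≤
        C * ∫⁻ τ, ENNReal.ofReal (jap (2 * r) τ) * ‖B τ‖ₑ ^ 2 := by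
  obtain ⟨C, hC⟩ := exists_weighted_conv_bound (rapidDecay_fourier hφ hc) r
  refine ⟨C, fun B hB => ?_⟩
  have h := hC (fun y => ‖B y‖ₑ) hB.aestronglyMeasurable.enorm
  have hle : ∀ τ, ENNReal.ofReal (jap (2 * r) τ) * ‖𝓕 (fun t => φ t * 𝓕⁻ B t) τ‖ₑ ^ 2 ≤
      ENNReal.ofReal (jap (2 * r) τ) * (∫⁻ y, ‖𝓕 φ (τ - y)‖ₑ * ‖B y‖ₑ) ^ 2 := by
    intro τ
    rw [fourier_mul_fourierInv hφ hc hB]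
    gcongr
    exact enorm_conv_le _ _ _
  exact ⟨(lintegral_mono hle).trans h.1, fun τ => (hle τ).trans (h.2 τ)⟩

/-- Smooth cutoffs of inverse Fourier transforms have integrable Fourier transform. -/
theorem integrable_fourier_mul_fourierInv {φ : ℝ → ℂ} (hφ : ContDiff ℝ ∞ φ) (hc : HasCompactSupport φ)
    {B : ℝ → ℂ} (hB : RapidDecay B) : Integrable (𝓕 fun t => φ t * 𝓕⁻ B t) := by
  have h : (𝓕 fun t => φ t * 𝓕⁻ B t) = fun τ => ∫ y, B y * 𝓕 φ (τ - y) := by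
    ext τ
    rw [fourier_mul_fourierInv hφ hc hB.integrable]
    simp_rw [mul_comm]
  rw [h]
  have := hB.integrable.integrable_convolution (ContinuousLinearMap.mul ℝ ℂ) (rapidDecay_fourier hφ hc).integrable
  exact this

end FourierCutoff

/-! ### Causality -/

section Locality

theorem fracIntegral_congr {f g : ℝ → ℂ} {T : ℝ} (h : ∀ t < T, f t = g t) (α : ℝ) {t : ℝ} (ht : t ≤ T) :
    fracIntegral α f t = fracIntegral α g t := by
  unfold fracIntegral plusPairing
  congr 1
  refine setIntegral_congr_fun measurableSet_Ioi fun u hu => ?_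
  have hu0 : (0 : ℝ) < u := hu
  have h1 : (fun r => f (t - r)) =ᶠ[𝓝 u] fun r => g (t - r) := by
    filter_upwards [Ioi_mem_nhds hu0] with r hr
    have : (0 : ℝ) < r := hr
    exact h _ (by linarith)
  rw [h1.iteratedDeriv_eq]

theorem forcing_congr {f g : ℝ → ℂ} {T : ℝ} (hT : 0 ≤ T) (h : ∀ t < T, f t = g t) (x : ℝ) {t : ℝ}
    (ht : t ≤ T) : forcing f x t = forcing g x t := by
  unfold forcing
  congr 1
  refine intervalIntegral.integral_congr fun r hr => ?_
  have : r ≤ T := by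
    rcases mem_uIcc.1 hr with h1 | h1 <;> linarith [h1.2]
  rw [fracIntegral_congr h _ this]

/-- Causality of the forcing operators. -/
theorem forcingFamily_congr {f g : ℝ → ℂ} {T : ℝ} (hT : 0 ≤ T) (h : ∀ t < T, f t = g t) (μ x : ℝ) {t : ℝ}
    (ht : t ≤ T) : forcingFamily μ f x t = forcingFamily μ g x t := by
  unfold forcingFamily
  congr 1
  ext y
  exact forcing_congr hT (fun r hr => fracIntegral_congr h _ hr.le) y ht

/-- By causality `f` may be replaced by 0, which has compact support and hence a Laplace
representation, although `f` need not. -/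
theorem forcingFamily_eq_zero {f : ℝ → ℂ} (hf : IsSmoothHalfLine f) {μ : ℝ} (h1 : -1 < μ) (h2 : μ < 1)
    (x : ℝ) {t : ℝ} (ht : t ≤ 0) : forcingFamily μ f x t = 0 := by
  have h0 : IsSmoothHalfLine fun _ : ℝ => (0 : ℂ) :=
    ⟨contDiff_const, by simp [tsupport]⟩
  rw [forcingFamily_congr (g := fun _ => 0) le_rfl hf.eq_zero μ x ht,
    forcingFamily_eq_lapInv h1 h2 one_pos h0 HasCompactSupport.zero]
  have : lap (fun _ => 0) 1 = fun _ => 0 := by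
    ext τ; rw [lap_eq_integral]; simp
  simp [this, lapInv]

end Locality

/-! ### Extension from smooth data to distributions -/

section Extension

theorem exists_clm_boundedContinuous_of_graph {X V H : Type*} [TopologicalSpace X]
    [NormedAddCommGroup V] [NormedSpace ℂ V] [CompleteSpace V] [NormedAddCommGroup H]
    [InnerProductSpace ℂ H] [CompleteSpace H] (Γ : Submodule ℂ (H × BoundedContinuousFunction X V))
    (C : ℝ≥0) (hΓ : ∀ p ∈ Γ, ‖p.2‖ ≤ C * ‖p.1‖) :
    ∃ T : H →L[ℂ] BoundedContinuousFunction X V, (∀ p ∈ Γ, T p.1 = p.2) ∧ ∀ h, ‖T h‖ ≤ C * ‖h‖ :=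
  exists_clm_of_graph Γ C hΓ

theorem isFunction_zero {E : Type*} [NormedAddCommGroup E] [NormedSpace ℝ E] [MeasureSpace E] :
    IsFunction (0 : 𝓢'(E, ℂ)) (fun _ => 0) :=
  fun φ => ⟨by simp, by simp⟩

variable {E : Type*} [NormedAddCommGroup E] [InnerProductSpace ℝ E]
  [FiniteDimensional ℝ E] [MeasurableSpace E] [BorelSpace E]

theorem continuous_ofWeightedL2_apply (w : E → ℝ) [Fact (IsTemperedWeight w)] (φ : 𝓢(E, ℂ)) :
    Continuous fun h : Lp ℂ 2 (invMeasure w) => ofWeightedL2 w h φ := by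
  have h1 : ∀ h : Lp ℂ 2 (invMeasure w), ofWeightedL2 w h φ =
      PointwiseConvergenceCLM.evalCLM (RingHom.id ℂ) ℂ (𝓕⁻ φ : 𝓢(E, ℂ))
        (Lp.toTemperedDistributionCLM ℂ (invMeasure w) 2 h) := fun h => rfl
  simp_rw [h1]
  exact (ContinuousLinearMap.continuous _).comp (ContinuousLinearMap.continuous _)

variable {E' : Type*} [NormedAddCommGroup E'] [InnerProductSpace ℝ E']
  [FiniteDimensional ℝ E'] [MeasurableSpace E'] [BorelSpace E']

/-- A linear operator defined on a class of functions, bounded between weighted spaces of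
tempered distributions, extends to all tempered distributions with finite norm. -/
theorem exists_extension {X : Type*} [TopologicalSpace X] (w₁ : E → ℝ) (w₂ : E' → ℝ)
    [Fact (IsTemperedWeight w₁)] [Fact (IsTemperedWeight w₂)] {k₁ k₂ : ℝ≥0∞} (hk₁ : k₁ ≠ 0)
    (hk₁' : k₁ ≠ ⊤) (hk₂ : k₂ ≠ 0) (hk₂' : k₂ ≠ ⊤) (S : Submodule ℂ (𝓢'(E', ℂ)))
    (hS : IsClosed {h | ofWeightedL2 w₂ h ∈ S}) (P : (E → ℂ) → Prop) (Φ : (E → ℂ) → X → E' → ℂ)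
    (hzero : P fun _ => 0)
    (hadd : ∀ f g, P f → P g → (P fun y => f y + g y) ∧
      ∀ x z, Φ (fun y => f y + g y) x z = Φ f x z + Φ g x z)
    (hsmul : ∀ (c : ℂ) f, P f → (P fun y => c * f y) ∧ ∀ x z, Φ (fun y => c * f y) x z = c * Φ f x z)
    (C : ℝ≥0)
    (H : ∀ f (F : 𝓢'(E, ℂ)), P f → IsFunction F f →
      weightedNorm k₁ (fun ξ => ENNReal.ofReal (w₁ ξ)) F < ⊤ → ∃ U : X → 𝓢'(E', ℂ), ∀ x,
        IsFunction (U x) (Φ f x) ∧ U x ∈ S ∧ weightedNorm k₂ (fun ξ => ENNReal.ofReal (w₂ ξ)) (U x) ≤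
          C * weightedNorm k₁ (fun ξ => ENNReal.ofReal (w₁ ξ)) F ∧
        Tendsto (fun y => weightedNorm k₂ (fun ξ => ENNReal.ofReal (w₂ ξ)) (U y - U x)) (𝓝 x) (𝓝 0)) :
    ∃ T : 𝓢'(E, ℂ) →ₗ[ℂ] (X → 𝓢'(E', ℂ)),
      (∀ f F, P f → IsFunction F f → weightedNorm k₁ (fun ξ => ENNReal.ofReal (w₁ ξ)) F < ⊤ →
        ∀ x, IsFunction (T F x) (Φ f x)) ∧
      ∀ F, weightedNorm k₁ (fun ξ => ENNReal.ofReal (w₁ ξ)) F < ⊤ → ∀ x,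
        T F x ∈ S ∧ weightedNorm k₂ (fun ξ => ENNReal.ofReal (w₂ ξ)) (T F x) ≤
          C * weightedNorm k₁ (fun ξ => ENNReal.ofReal (w₁ ξ)) F ∧
        Tendsto (fun y => weightedNorm k₂ (fun ξ => ENNReal.ofReal (w₂ ξ)) (T F y - T F x)) (𝓝 x) (𝓝 0) := by
  -- Values are confined to a closed subspace, so a support condition imposed through `S` survives
  -- the passage to the closure.
  set V : Submodule ℂ (Lp ℂ 2 (invMeasure w₂)) := S.comap (ofWeightedL2 w₂) with hV
  have hVc : IsClosed (V : Set (Lp ℂ 2 (invMeasure w₂))) := hS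
  have : CompleteSpace V := hVc.completeSpace_coe
  have hr₁ : k₁ ^ (1 / 2 : ℝ) ≠ 0 := by simp [ENNReal.rpow_eq_zero_iff, hk₁]
  have hr₁' : k₁ ^ (1 / 2 : ℝ) ≠ ⊤ := ENNReal.rpow_ne_top_of_nonneg (by norm_num) hk₁'
  have hr₂ : k₂ ^ (1 / 2 : ℝ) ≠ 0 := by simp [ENNReal.rpow_eq_zero_iff, hk₂]
  have hr₂' : k₂ ^ (1 / 2 : ℝ) ≠ ⊤ := ENNReal.rpow_ne_top_of_nonneg (by norm_num) hk₂'
  set D : ℝ≥0∞ := (k₂ ^ (1 / 2 : ℝ))⁻¹ * (C * k₁ ^ (1 / 2 : ℝ)) with hD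
  have hDtop : D ≠ ⊤ :=
    ENNReal.mul_ne_top (ENNReal.inv_ne_top.2 hr₂) (ENNReal.mul_ne_top ENNReal.coe_ne_top hr₁')
  have hDle : ∀ a b : ℝ≥0∞, k₂ ^ (1 / 2 : ℝ) * a ≤ C * (k₁ ^ (1 / 2 : ℝ) * b) ↔ a ≤ D * b := by
    intro a b
    rw [hD, mul_assoc, mul_assoc, mul_comm (_ ⁻¹), ← div_eq_mul_inv,
      ENNReal.le_div_iff_mul_le (Or.inl hr₂) (Or.inl hr₂'), mul_comm a]
  -- The graph of the operator on smooth data, with values in bounded continuous functions of the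
  -- parameter: boundedness gives the supremum estimate, and completeness in the sup norm gives
  -- continuity of the extension.
  let Γ : Submodule ℂ (Lp ℂ 2 (invMeasure w₁) × BoundedContinuousFunction X V) :=
    { carrier := {p | ∃ f, P f ∧ IsFunction (ofWeightedL2 w₁ p.1) f ∧
        ∀ x, IsFunction (ofWeightedL2 w₂ (p.2 x)) (Φ f x)}
      add_mem' := by
        rintro p q ⟨f, hf, h1, h2⟩ ⟨g, hg, h3, h4⟩
        refine ⟨_, (hadd f g hf hg).1, ?_, fun x => ?_⟩
        · rw [Prod.fst_add, map_add]; exact h1.add h3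
        · have h5 : Φ (fun y => f y + g y) x = fun z => Φ f x z + Φ g x z :=
            funext fun z => (hadd f g hf hg).2 x z
          rw [h5, Prod.snd_add, BoundedContinuousFunction.add_apply, Submodule.coe_add, map_add]
          exact (h2 x).add (h4 x)
      zero_mem' := by
        have h5 : ∀ x, Φ (fun _ => 0) x = fun _ => 0 := by
          intro x
          ext z
          have := (hsmul 0 _ hzero).2 x z
          simpa using this
        refine ⟨_, hzero, ?_, fun x => ?_⟩
        · rw [Prod.fst_zero, map_zero]; exact isFunction_zero
        · rw [h5, Prod.snd_zero, BoundedContinuousFunction.coe_zero, Pi.zero_apply, Submodule.coe_zero, map_zero]; exact isFunction_zero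
      smul_mem' := by
        rintro c p ⟨f, hf, h1, h2⟩
        refine ⟨_, (hsmul c f hf).1, ?_, fun x => ?_⟩
        · rw [Prod.smul_fst, map_smul]; exact h1.smul c
        · have h5 : Φ (fun y => c * f y) x = fun z => c * Φ f x z := funext fun z => (hsmul c f hf).2 x z
          rw [h5, Prod.smul_snd, BoundedContinuousFunction.smul_apply, Submodule.coe_smul, map_smul]
          exact (h2 x).smul c }
  have hΓ : ∀ p ∈ Γ, ‖p.2‖ ≤ (D.toNNReal : ℝ) * ‖p.1‖ := by
    rintro ⟨h, y⟩ ⟨f, hf, h1, h2⟩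
    refine (BoundedContinuousFunction.norm_le (by positivity)).2 fun x => ?_
    obtain ⟨U, hU⟩ := H f _ hf h1 (by
      rw [weightedNorm_ofWeightedL2]; exact ENNReal.mul_lt_top hr₁'.lt_top enorm_lt_top)
    have h3 := (hU x).2.2.1
    rw [← (h2 x).unique (hU x).1, weightedNorm_ofWeightedL2, weightedNorm_ofWeightedL2, hDle] at h3
    have h4 := ENNReal.toReal_mono (ENNReal.mul_ne_top hDtop enorm_ne_top) h3
    rw [ENNReal.toReal_mul, toReal_enorm, toReal_enorm] at h4
    exact h4
  obtain ⟨T', hT', hT'b⟩ := exists_clm_boundedContinuous_of_graph (V := V) Γ D.toNNReal hΓ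
  -- A purely algebraic left inverse makes the operator linear on all tempered distributions. The
  -- estimates concern only those of finite norm, where `L` recovers the Hilbert space element.
  obtain ⟨L, hL⟩ := (ofWeightedL2 w₁).exists_leftInverse_of_injective
    (LinearMap.ker_eq_bot.2 (ofWeightedL2_injective w₁))
  have hLa : ∀ h, L (ofWeightedL2 w₁ h) = h := fun h => congrArg (fun u => u h) hL
  let T : 𝓢'(E, ℂ) →ₗ[ℂ] (X → 𝓢'(E', ℂ)) :=
    LinearMap.pi fun x => (ofWeightedL2 w₂) ∘ₗ V.subtype ∘ₗ
      ((BoundedContinuousFunction.evalCLM ℂ x : BoundedContinuousFunction X V →L[ℂ] V) :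
        BoundedContinuousFunction X V →ₗ[ℂ] V) ∘ₗ (T' : _ →ₗ[ℂ] _) ∘ₗ L
  have hTa : ∀ h x, T (ofWeightedL2 w₁ h) x = ofWeightedL2 w₂ (T' h x : V) := by
    intro h x
    change ofWeightedL2 w₂ ((T' (L (ofWeightedL2 w₁ h)) x : V)) = _
    rw [hLa]
  refine ⟨T, fun f F hf hF hlt x => ?_, fun F hlt x => ?_⟩
  · obtain ⟨U, hU⟩ := H f F hf hF hlt
    obtain ⟨h, rfl⟩ := exists_ofWeightedL2_eq hk₁ hlt
    have hlt2 : ∀ x, weightedNorm k₂ (fun ξ => ENNReal.ofReal (w₂ ξ)) (U x) < ⊤ := fun x =>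
      lt_of_le_of_lt (hU x).2.2.1 (ENNReal.mul_lt_top ENNReal.coe_lt_top hlt)
    choose u hu using fun x => exists_ofWeightedL2_eq hk₂ (hlt2 x)
    have huV : ∀ x, u x ∈ V := fun x => by
      rw [hV, Submodule.mem_comap, hu]; exact (hU x).2.1
    have hcont : Continuous fun x => (⟨u x, huV x⟩ : V) := by
      refine Continuous.subtype_mk (continuous_iff_continuousAt.2 fun x => ?_) _
      rw [ContinuousAt, tendsto_iff_edist_tendsto_0]
      have h1 := (hU x).2.2.2
      have h2 : ∀ y, weightedNorm k₂ (fun ξ => ENNReal.ofReal (w₂ ξ)) (U y - U x) =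
          k₂ ^ (1 / 2 : ℝ) * edist (u y) (u x) := by
        intro y
        rw [← hu, ← hu, ← map_sub, weightedNorm_ofWeightedL2, edist_eq_enorm_sub]
      simp_rw [h2] at h1
      have h3 := ENNReal.Tendsto.const_mul (a := (k₂ ^ (1 / 2 : ℝ))⁻¹) h1 (Or.inr (ENNReal.inv_ne_top.2 hr₂))
      simp_rw [← mul_assoc, ENNReal.inv_mul_cancel hr₂ hr₂', one_mul, mul_zero] at h3
      exact h3
    let y : BoundedContinuousFunction X V := BoundedContinuousFunction.ofNormedAddCommGroup
      (fun x => (⟨u x, huV x⟩ : V)) hcont (D.toReal * ‖h‖) (fun x => by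
        have h3 := (hU x).2.2.1
        rw [← hu, weightedNorm_ofWeightedL2, weightedNorm_ofWeightedL2, hDle] at h3
        have h4 := ENNReal.toReal_mono (ENNReal.mul_ne_top hDtop enorm_ne_top) h3
        rw [ENNReal.toReal_mul, toReal_enorm, toReal_enorm] at h4
        exact h4)
    have hmem : (h, y) ∈ Γ := ⟨f, hf, hF, fun x => by
      have : ofWeightedL2 w₂ (y x) = U x := hu x
      change IsFunction (ofWeightedL2 w₂ (y x)) _
      rw [this]; exact (hU x).1⟩
    rw [hTa, hT' _ hmem]
    have : ofWeightedL2 w₂ (y x) = U x := hu x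
    rw [this]
    exact (hU x).1
  · obtain ⟨h, rfl⟩ := exists_ofWeightedL2_eq hk₁ hlt
    refine ⟨?_, ?_, ?_⟩
    · rw [hTa]; exact (T' h x).2
    · rw [hTa, weightedNorm_ofWeightedL2, weightedNorm_ofWeightedL2, hDle]
      have h1 : ‖((T' h x : V) : Lp ℂ 2 (invMeasure w₂))‖ ≤ D.toNNReal * ‖h‖ :=
        ((T' h).norm_coe_le_norm x).trans (hT'b h)
      have h2 := ENNReal.ofReal_le_ofReal h1
      rw [ofReal_norm, ENNReal.ofReal_mul NNReal.zero_le_coe, ofReal_norm, ENNReal.ofReal_coe_nnreal,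
        ENNReal.coe_toNNReal hDtop] at h2
      exact h2
    · have h1 : ∀ y, weightedNorm k₂ (fun ξ => ENNReal.ofReal (w₂ ξ))
          (T (ofWeightedL2 w₁ h) y - T (ofWeightedL2 w₁ h) x) = k₂ ^ (1 / 2 : ℝ) * edist (T' h y) (T' h x) := by
        intro y
        rw [hTa, hTa, ← map_sub, weightedNorm_ofWeightedL2, ← edist_eq_enorm_sub]
        rfl
      simp_rw [h1]
      have h2 := tendsto_iff_edist_tendsto_0.1 ((T' h).continuous.tendsto x)
      have h3 := ENNReal.Tendsto.const_mul (a := k₂ ^ (1 / 2 : ℝ)) h2 (Or.inr hr₂')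
      rwa [mul_zero] at h3

end Extension

/-! ### Sobolev norms as weighted norms and continuity criteria -/

section NormTools

theorem isTemperedWeight_jap (r : ℝ) : IsTemperedWeight (jap r) := by
  refine ⟨continuous_jap r, jap_pos r, (2 * Real.pi) ^ |-r|, ⌈-r⌉₊, fun ξ => ?_⟩
  have h1 : (jap r ξ)⁻¹ = jap (-r) ξ := by
    unfold jap; rw [Real.rpow_neg (by positivity)]
  have hpi := Real.pi_pos
  rw [h1, ← Real.rpow_natCast, Real.norm_eq_abs]
  refine (jap_le_one_add_abs _ _).trans ?_
  gcongr
  · simp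
  · exact Nat.le_ceil _

instance fact_isTemperedWeight_jap (r : ℝ) : Fact (IsTemperedWeight (jap r)) := ⟨isTemperedWeight_jap r⟩

theorem sobolevNorm_eq_weightedNorm_jap (s : ℝ) (u : 𝓢'(ℝ, ℂ)) : sobolevNorm s u =
    weightedNorm (ENNReal.ofReal (2 * Real.pi)) (fun ξ => ENNReal.ofReal (jap (2 * s) ξ)) u := rfl

variable {E E' : Type*} [NormedAddCommGroup E] [InnerProductSpace ℝ E]
  [FiniteDimensional ℝ E] [MeasurableSpace E] [BorelSpace E]
  [NormedAddCommGroup E'] [InnerProductSpace ℝ E']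
  [FiniteDimensional ℝ E'] [MeasurableSpace E'] [BorelSpace E']

theorem weightedNorm_le_of_lintegral_le {k k' : ℝ≥0∞} {W : E → ℝ≥0∞} {W' : E' → ℝ≥0∞} {u : 𝓢'(E, ℂ)}
    {v : 𝓢'(E', ℂ)} {g : E → ℂ} {h : E' → ℂ} (hu : IsFunction (𝓕 u) g) (hv : IsFunction (𝓕 v) h) {C : ℝ≥0}
    (hle : k * ∫⁻ ξ, W ξ * ‖g ξ‖ₑ ^ 2 ≤ C * (k' * ∫⁻ ξ, W' ξ * ‖h ξ‖ₑ ^ 2)) :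
    weightedNorm k W u ≤ NNReal.sqrt C * weightedNorm k' W' v := by
  rw [weightedNorm_eq hu, weightedNorm_eq hv]
  refine (ENNReal.rpow_le_rpow hle (by norm_num)).trans (le_of_eq ?_)
  rw [ENNReal.mul_rpow_of_nonneg _ _ (by norm_num), NNReal.sqrt_eq_rpow,
    ENNReal.coe_rpow_of_nonneg _ (by norm_num)]

theorem tendsto_weightedNorm_sub {k : ℝ≥0∞} (hk : k ≠ ⊤) {W : E → ℝ≥0∞} (hW : Measurable W) {U : ℝ → 𝓢'(E, ℂ)}
    {G : ℝ → E → ℂ} (hU : ∀ x, IsFunction (𝓕 (U x)) (G x)) (x : ℝ) {bd : E → ℝ≥0∞} (hbd : ∫⁻ ξ, bd ξ ≠ ⊤)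
    (hle : ∀ᶠ y in 𝓝 x, ∀ᵐ ξ, W ξ * ‖G y ξ - G x ξ‖ₑ ^ 2 ≤ bd ξ)
    (hWt : ∀ ξ, W ξ ≠ ⊤)
    (hlim : ∀ᵐ ξ, Tendsto (fun y => G y ξ) (𝓝 x) (𝓝 (G x ξ))) :
    Tendsto (fun y => weightedNorm k W (U y - U x)) (𝓝 x) (𝓝 0) := by
  have hsub : ∀ y, IsFunction (𝓕 (U y - U x)) (fun ξ => G y ξ - G x ξ) := by
    intro y
    have : 𝓕 (U y - U x) = 𝓕 (U y) - 𝓕 (U x) := map_sub (FourierTransform.fourierₗ ℂ 𝓢'(E, ℂ)) _ _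
    rw [this]
    exact (hU y).sub (hU x)
  simp_rw [fun y => weightedNorm_eq (k := k) (W := W) (hsub y)]
  have h1 : Tendsto (fun y => ∫⁻ ξ, W ξ * ‖G y ξ - G x ξ‖ₑ ^ 2) (𝓝 x) (𝓝 (∫⁻ _ : E, 0)) := by
    refine tendsto_lintegral_filter_of_dominated_convergence' bd ?_ hle hbd ?_
    · refine Eventually.of_forall fun y => ?_
      exact hW.aemeasurable.mul ((((hU y).aestronglyMeasurable.sub (hU x).aestronglyMeasurable).enorm).pow_const 2)
    · filter_upwards [hlim] with ξ hξ
      have h2 : Tendsto (fun y => ‖G y ξ - G x ξ‖ₑ ^ 2) (𝓝 x) (𝓝 0) := by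
        have h3 : Tendsto (fun y => ‖G y ξ - G x ξ‖ₑ) (𝓝 x) (𝓝 0) := by
          have := (hξ.sub_const (G x ξ)).enorm
          simpa using this
        have := ENNReal.Tendsto.pow (n := 2) h3
        simpa using this
      have := ENNReal.Tendsto.const_mul (a := W ξ) h2 (Or.inr (hWt ξ))
      simpa using this
  have h4 := (ENNReal.Tendsto.const_mul (a := k) h1 (Or.inr hk)).ennrpow_const (1 / 2)
  simpa using h4

end NormTools

/-! ### Part (a): space traces -/

section SpaceTraces

theorem fourierInv_fourier_of_compact {f : ℝ → ℂ} (hf : ContDiff ℝ ∞ f) (hc : HasCompactSupport f) :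
    𝓕⁻ (𝓕 f) = f := by
  have := lapInv_lap hf hc 0
  rw [lap_zero] at this
  nth_rw 2 [← this]
  ext t
  rw [lapInv_eq_fourierInv]
  simp

theorem isFunction_fourier_of_compact {f : ℝ → ℂ} (hf : ContDiff ℝ ∞ f) (hc : HasCompactSupport f)
    {F : 𝓢'(ℝ, ℂ)} (hF : IsFunction F f) : IsFunction (𝓕 F) (𝓕 f) :=
  isFunction_fourier_of_integrable (rapidDecay_fourier hf hc).integrable
    (by rwa [fourierInv_fourier_of_compact hf hc])

theorem lintegral_jap_mul_sq_lt_top {k : ℝ → ℂ} (hk : RapidDecay k) (r : ℝ) :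
    ∫⁻ τ, ENNReal.ofReal (jap r τ) * ‖k τ‖ₑ ^ 2 < ⊤ := by
  obtain ⟨M, hM0, hM⟩ := hk.exists_jap_le 0
  have h1 := ((hk.integrable_jap_mul r).const_mul M).lintegral_lt_top
  refine lt_of_le_of_lt (lintegral_mono fun τ => ?_) h1
  rw [enorm_sq_eq_ofReal, ← ENNReal.ofReal_mul (jap_pos _ _).le]
  refine ENNReal.ofReal_le_ofReal ?_
  have h2 := hM τ
  unfold jap at h2
  rw [Real.rpow_zero, one_mul] at h2
  have := jap_pos r τ
  calc jap r τ * ‖k τ‖ ^ 2 = ‖k τ‖ * (jap r τ * ‖k τ‖) := by ring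
    _ ≤ _ := by gcongr

theorem forcingFamily_add {f g : ℝ → ℂ} (hf : IsSmoothHalfLine f) (hfc : HasCompactSupport f)
    (hg : IsSmoothHalfLine g) (hgc : HasCompactSupport g) (hs : IsSmoothHalfLine fun t => f t + g t)
    {μ : ℝ} (h1 : -1 < μ) (h2 : μ < 1) (x t : ℝ) :
    forcingFamily μ (fun t => f t + g t) x t = forcingFamily μ f x t + forcingFamily μ g x t := by
  rw [forcingFamily_eq_lapInv h1 h2 one_pos hf hfc, forcingFamily_eq_lapInv h1 h2 one_pos hg hgc,
    forcingFamily_eq_lapInv h1 h2 one_pos hs (hfc.add hgc)]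
  unfold lapInv
  rw [← integral_add]
  · refine integral_congr_ae (ae_of_all _ fun τ => ?_)
    simp only
    rw [lap_add hf.contDiff.continuous hfc hg.contDiff.continuous hgc]
    ring
  all_goals
    refine (RapidDecay.exp_mul ?_ 1 t).integrable
    obtain ⟨C, hC0, hC⟩ := norm_kernelN_le h1 h2 one_pos
    refine RapidDecay.mul_of_le (C := C) (r := 1) ?_
      (continuous_kernelN_comp h1 h2 one_pos continuous_const continuous_id) fun τ => ?_
    · exact rapidDecay_lapB (by first | exact hf.contDiff | exact hg.contDiff) (by assumption) one_pos μ
    · rw [Real.rpow_one]; exact hC x τ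

theorem forcingFamily_const_mul {f : ℝ → ℂ} (hf : IsSmoothHalfLine f) (hfc : HasCompactSupport f) (c : ℂ)
    (hs : IsSmoothHalfLine fun t => c * f t)
    {μ : ℝ} (h1 : -1 < μ) (h2 : μ < 1) (x t : ℝ) :
    forcingFamily μ (fun t => c * f t) x t = c * forcingFamily μ f x t := by
  rw [forcingFamily_eq_lapInv h1 h2 one_pos hf hfc, forcingFamily_eq_lapInv h1 h2 one_pos hs hfc.mul_left]
  unfold lapInv
  rw [← integral_const_mul]
  refine integral_congr_ae (ae_of_all _ fun τ => ?_)
  simp only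
  rw [lap_const_mul]
  ring

theorem IsSmoothHalfLine.add {f g : ℝ → ℂ} (hf : IsSmoothHalfLine f) (hg : IsSmoothHalfLine g) :
    IsSmoothHalfLine fun t => f t + g t :=
  ⟨hf.contDiff.add hg.contDiff, (tsupport_add f g).trans (union_subset hf.support hg.support)⟩

theorem IsSmoothHalfLine.mul_left {f χ : ℝ → ℂ} (hf : IsSmoothHalfLine f) (hχ : ContDiff ℝ ∞ χ) :
    IsSmoothHalfLine fun t => χ t * f t :=
  ⟨hχ.mul hf.contDiff, (tsupport_mul_subset_right (f := χ) (g := f)).trans hf.support⟩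

theorem isSmoothHalfLine_zero : IsSmoothHalfLine fun _ => 0 :=
  ⟨contDiff_const, by simp [tsupport]⟩

theorem hasCompactSupport_of_tsupport_subset_Icc {f : ℝ → ℂ} {a b : ℝ} (h : tsupport f ⊆ Icc a b) :
    HasCompactSupport f :=
  isCompact_Icc.of_isClosed_subset (isClosed_tsupport f) h

/-- Dominated convergence with the qualitative bound on the profile: its weighted square is of order
|ξ|^{-2μ}⟨ξ⟩^{2s-4}, integrable at the origin because μ < 1/2 and at infinity because s - 3/2 < μ.
-/
theorem tendsto_sobolev_profileG {s μ : ℝ} (h2 : μ < 1 / 2) (h3 : s - 3 / 2 < μ)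
    {f : ℝ → ℂ} (hf : ContDiff ℝ ∞ f) (hc : HasCompactSupport f) {U : ℝ → 𝓢'(ℝ, ℂ)}
    (hU : ∀ t, IsFunction (𝓕 (U t)) (profileG μ f t)) (t : ℝ) :
    Tendsto (fun r => weightedNorm (ENNReal.ofReal (2 * Real.pi)) (fun ξ => ENNReal.ofReal (jap (2 * s) ξ))
      (U r - U t)) (𝓝 t) (𝓝 0) := by
  obtain ⟨C, hC0, hC⟩ := norm_profileG_le hf hc μ
  have hpi := Real.pi_pos
  set bd : ℝ → ℝ := fun ξ => (2 * C * Real.exp (t + 1)) ^ 2 * (2 * Real.pi) ^ |2 * s| *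
    (|ξ| ^ (-2 * μ) * (1 + |ξ|) ^ (2 * s - 4)) with hbd
  have hbdi : Integrable bd :=
    (integrable_abs_rpow_mul_one_add_rpow (by linarith) (by linarith)).const_mul _
  refine tendsto_weightedNorm_sub ENNReal.ofReal_ne_top (by have := (continuous_jap (2 * s)).measurable; fun_prop) hU t
    (bd := fun ξ => ENNReal.ofReal (bd ξ)) hbdi.lintegral_lt_top.ne ?_ (fun ξ => by simp) ?_
  · filter_upwards [Iio_mem_nhds (lt_add_one t)] with r hr
    have hr1 : r < t + 1 := hr
    have hne : ∀ᵐ ξ : ℝ, ξ ≠ 0 := by simp [ae_iff]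
    filter_upwards [hne] with ξ hξ
    have hx : 0 < |ξ| := abs_pos.2 hξ
    have h0 : 0 < 1 + |ξ| := by positivity
    rw [enorm_sq_eq_ofReal, ← ENNReal.ofReal_mul (jap_pos _ _).le]
    refine ENNReal.ofReal_le_ofReal ?_
    have e1 : ‖profileG μ f r ξ - profileG μ f t ξ‖ ≤
        (2 * C * Real.exp (t + 1)) * (|ξ| ^ (-μ) * (1 + |ξ|) ^ (-2 : ℝ)) := by
      refine (norm_sub_le _ _).trans ?_
      have a1 := hC r ξ
      have a2 := hC t ξ
      have a3 : Real.exp r ≤ Real.exp (t + 1) := Real.exp_le_exp.2 hr1.le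
      have a4 : Real.exp t ≤ Real.exp (t + 1) := Real.exp_le_exp.2 (by linarith)
      calc _ ≤ C * Real.exp (t + 1) * (|ξ| ^ (-μ) * (1 + |ξ|) ^ (-2 : ℝ)) +
            C * Real.exp (t + 1) * (|ξ| ^ (-μ) * (1 + |ξ|) ^ (-2 : ℝ)) :=
          add_le_add (a1.trans (by gcongr)) (a2.trans (by gcongr))
        _ = _ := by ring
    calc _ ≤ ((2 * Real.pi) ^ |2 * s| * (1 + |ξ|) ^ (2 * s)) *
          ((2 * C * Real.exp (t + 1)) * (|ξ| ^ (-μ) * (1 + |ξ|) ^ (-2 : ℝ))) ^ 2 := by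
          gcongr; exact jap_le_one_add_abs _ _
      _ = bd ξ := by
          simp only [hbd]
          rw [mul_pow _ (|ξ| ^ (-μ) * _), mul_pow (|ξ| ^ (-μ)), ← Real.rpow_natCast (|ξ| ^ _) 2, ← Real.rpow_mul hx.le,
            ← Real.rpow_natCast ((1 + |ξ|) ^ _) 2, ← Real.rpow_mul h0.le,
            show -μ * (2 : ℕ) = -2 * μ by push_cast; ring,
            show (-2 : ℝ) * (2 : ℕ) = -4 by push_cast; ring, sub_eq_add_neg (2 * s), Real.rpow_add h0]
          ring
  · refine ae_of_all _ fun ξ => ?_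
    have : Continuous fun r : ℝ => profileG μ f r ξ := by
      have h6 : Continuous fun r : ℝ => ((2 * Real.pi * ξ ^ 2 : ℝ), r) := by fun_prop
      have h5 := (continuous_modeS hf hc μ).comp' h6
      unfold profileG
      exact continuous_const.mul (continuous_const.mul h5)
    exact this.tendsto t

theorem exists_space_traces {s μ : ℝ} (h1 : -1 < μ) (h2 : μ < 1 / 2) (h3 : s - 3 / 2 < μ)
    (h4 : μ < s + 1 / 2) : ∃ (c : ℝ≥0) (T : 𝓢'(ℝ, ℂ) →ₗ[ℂ] (ℝ → 𝓢'(ℝ, ℂ))),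
      (∀ (f : ℝ → ℂ) (F : 𝓢'(ℝ, ℂ)), IsSmoothHalfLine f → tsupport f ⊆ Icc 0 1 → IsFunction F f →
        ∀ t : ℝ, IsFunction (T F t) (fun x => forcingFamily μ f x t)) ∧
      ∀ F : 𝓢'(ℝ, ℂ), sobolevNorm ((2 * s + 1) / 4) F < ⊤ → ContinuousIntoSobolev s (T F) ∧
        ∀ t : ℝ, sobolevNorm s (T F t) ≤ c * sobolevNorm ((2 * s + 1) / 4) F := by
  have hμ1 : μ < 1 := by linarith
  have hpi := Real.pi_pos
  obtain ⟨C, hC⟩ := lintegral_sobolev_profileG_le h1 h2 h3 h4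
  have hk : ENNReal.ofReal (2 * Real.pi) ≠ 0 := by simp [hpi]
  have hfin : ∀ (f : ℝ → ℂ) (F : 𝓢'(ℝ, ℂ)), IsSmoothHalfLine f → tsupport f ⊆ Icc 0 1 → IsFunction F f →
      sobolevNorm ((2 * s + 1) / 4) F < ⊤ := by
    intro f F hf hs hF
    have hc := hasCompactSupport_of_tsupport_subset_Icc hs
    rw [sobolevNorm_eq_weightedNorm_jap, weightedNorm_eq (isFunction_fourier_of_compact hf.contDiff hc hF)]
    exact ENNReal.rpow_lt_top_of_nonneg (by norm_num) (ENNReal.mul_lt_top ENNReal.ofReal_lt_top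
      (lintegral_jap_mul_sq_lt_top (rapidDecay_fourier hf.contDiff hc) _)).ne
  obtain ⟨T, hT1, hT2⟩ := exists_extension (X := ℝ) (jap (2 * ((2 * s + 1) / 4))) (jap (2 * s)) hk
    ENNReal.ofReal_ne_top hk ENNReal.ofReal_ne_top (⊤ : Submodule ℂ 𝓢'(ℝ, ℂ)) (by simp)
    (fun f => IsSmoothHalfLine f ∧ tsupport f ⊆ Icc 0 1) (fun f t x => forcingFamily μ f x t)
    ⟨isSmoothHalfLine_zero, by simp [tsupport]⟩
    (fun f g hf hg => by
      have h5 := hf.1.add hg.1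
      refine ⟨⟨h5, (tsupport_add f g).trans (union_subset hf.2 hg.2)⟩, fun t x => ?_⟩
      exact forcingFamily_add hf.1 (hasCompactSupport_of_tsupport_subset_Icc hf.2) hg.1
        (hasCompactSupport_of_tsupport_subset_Icc hg.2) h5 h1 hμ1 x t)
    (fun c f hf => by
      have h5 := hf.1.mul_left (χ := fun _ => c) contDiff_const
      refine ⟨⟨h5, (tsupport_mul_subset_right (f := fun _ => c) (g := f)).trans hf.2⟩, fun t x => ?_⟩
      exact forcingFamily_const_mul hf.1 (hasCompactSupport_of_tsupport_subset_Icc hf.2) c h5 h1 hμ1 x t)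
    (NNReal.sqrt C)
    (fun f F hf hF _ => by
      have hc := hasCompactSupport_of_tsupport_subset_Icc hf.2
      have hF2 := isFunction_fourier_of_compact hf.1.contDiff hc hF
      have hlt : ∀ t, ∫⁻ ξ, ENNReal.ofReal (jap (2 * s) ξ) * ‖profileG μ f t ξ‖ₑ ^ 2 < ⊤ := fun t =>
        lt_of_le_of_lt (hC f hf.1 hc t) (ENNReal.mul_lt_top ENNReal.coe_lt_top
          (lintegral_jap_mul_sq_lt_top (rapidDecay_fourier hf.1.contDiff hc) _))
      choose u hu using fun t => exists_isFunction_fourier (w := jap (2 * s))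
        (integrable_profileG hf.1.contDiff hc h1 hμ1 t).aestronglyMeasurable (hlt t)
      refine ⟨fun t => ofWeightedL2 (jap (2 * s)) (u t), fun t => ⟨?_, trivial, ?_, ?_⟩⟩
      · have h6 := isFunction_of_isFunction_fourier (integrable_profileG hf.1.contDiff hc h1 hμ1 t) (hu t)
        have h7 : (fun x => forcingFamily μ f x t) = 𝓕⁻ (profileG μ f t) := by
          ext x; exact forcingFamily_eq_fourierInv hf.1 hc h1 hμ1 x t
        rwa [h7]
      · refine weightedNorm_le_of_lintegral_le (hu t) hF2 ?_
        rw [mul_left_comm]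
        gcongr
        exact hC f hf.1 hc t
      · exact tendsto_sobolev_profileG h2 h3 hf.1.contDiff hc hu t)
  refine ⟨NNReal.sqrt C, T, fun f F hf hs hF t => hT1 f F ⟨hf, hs⟩ hF (hfin f F hf hs hF) t, fun F hF => ?_⟩
  have h5 := hT2 F hF
  refine ⟨⟨fun t => lt_of_le_of_lt (h5 t).2.1 (ENNReal.mul_lt_top ENNReal.coe_lt_top hF), fun t => (h5 t).2.2⟩,
    fun t => (h5 t).2.1⟩

end SpaceTraces

/-! ### Reduction to compactly supported data -/

section WideCutoff

/-- A cutoff which equals `1` on `[-3, 3]`. -/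
noncomputable def wideCutoff (ψ : ℝ → ℝ) (t : ℝ) : ℂ := (ψ (t / 3) : ℂ)

theorem IsCutoff.contDiff_complex {ψ : ℝ → ℝ} (hψ : IsCutoff ψ) : ContDiff ℝ ∞ fun t => (ψ t : ℂ) :=
  Complex.ofRealCLM.contDiff.comp hψ.contDiff

theorem IsCutoff.eq_zero {ψ : ℝ → ℝ} (hψ : IsCutoff ψ) {t : ℝ} (ht : t ∉ Icc (-2 : ℝ) 2) : ψ t = 0 := by
  by_contra h
  exact ht (hψ.support (subset_tsupport ψ h))

theorem IsCutoff.hasCompactSupport {ψ : ℝ → ℝ} (hψ : IsCutoff ψ) : HasCompactSupport fun t => (ψ t : ℂ) :=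
  HasCompactSupport.comp_left (g := fun x : ℝ => (x : ℂ)) (f := ψ)
    (isCompact_Icc.of_isClosed_subset (isClosed_tsupport ψ) hψ.support) rfl

theorem contDiff_wideCutoff {ψ : ℝ → ℝ} (hψ : IsCutoff ψ) : ContDiff ℝ ∞ (wideCutoff ψ) := by
  unfold wideCutoff
  exact hψ.contDiff_complex.comp (contDiff_id.div_const 3)

theorem hasCompactSupport_wideCutoff {ψ : ℝ → ℝ} (hψ : IsCutoff ψ) : HasCompactSupport (wideCutoff ψ) := by
  refine HasCompactSupport.intro (isCompact_Icc (a := (-6 : ℝ)) (b := 6)) fun t ht => ?_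
  unfold wideCutoff
  rw [hψ.eq_zero, Complex.ofReal_zero]
  contrapose! ht
  constructor <;> linarith [ht.1, ht.2]

theorem wideCutoff_mul {ψ : ℝ → ℝ} (hψ : IsCutoff ψ) {f : ℝ → ℂ} (hf : IsSmoothHalfLine f) {t : ℝ} (ht : t < 3) :
    f t = wideCutoff ψ t * f t := by
  rcases lt_or_ge t 0 with h | h
  · rw [hf.eq_zero t h, mul_zero]
  · unfold wideCutoff
    rw [hψ.eq_one _ ⟨by linarith, by linarith⟩, Complex.ofReal_one, one_mul]

/-- Where ψ is nonzero the time is at most 2, and by causality only the values of `f` before time 3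
matter; there the wide cutoff changes nothing, as `f` vanishes for negative times. -/
theorem cutoff_mul_forcingFamily {ψ : ℝ → ℝ} (hψ : IsCutoff ψ) {f : ℝ → ℂ} (hf : IsSmoothHalfLine f) (μ x t : ℝ) :
    (ψ t : ℂ) * forcingFamily μ f x t =
      ψ t * forcingFamily μ (fun r => wideCutoff ψ r * f r) x t := by
  by_cases ht : t ∈ Icc (-2 : ℝ) 2
  · rw [forcingFamily_congr (T := 3) (by norm_num) (fun r hr => wideCutoff_mul hψ hf hr) μ x
      (by linarith [ht.2])]
  · rw [hψ.eq_zero ht]; simp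

theorem cutoff_forcingFamily_add {ψ : ℝ → ℝ} (hψ : IsCutoff ψ) {f g : ℝ → ℂ} (hf : IsSmoothHalfLine f) (hg : IsSmoothHalfLine g) {μ : ℝ}
    (h1 : -1 < μ) (h2 : μ < 1) (x t : ℝ) : (ψ t : ℂ) * forcingFamily μ (fun r => f r + g r) x t =
      ψ t * forcingFamily μ f x t + ψ t * forcingFamily μ g x t := by
  have hχ := contDiff_wideCutoff hψ
  have hχc := hasCompactSupport_wideCutoff hψ
  rw [cutoff_mul_forcingFamily hψ (hf.add hg), cutoff_mul_forcingFamily hψ hf, cutoff_mul_forcingFamily hψ hg,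
    ← mul_add, ← forcingFamily_add (hf.mul_left hχ) hχc.mul_right (hg.mul_left hχ) hχc.mul_right
      ((hf.mul_left hχ).add (hg.mul_left hχ)) h1 h2]
  simp_rw [mul_add]

theorem cutoff_forcingFamily_const_mul {ψ : ℝ → ℝ} (hψ : IsCutoff ψ) {f : ℝ → ℂ} (hf : IsSmoothHalfLine f) (c : ℂ) {μ : ℝ}
    (h1 : -1 < μ) (h2 : μ < 1) (x t : ℝ) : (ψ t : ℂ) * forcingFamily μ (fun r => c * f r) x t =
      c * (ψ t * forcingFamily μ f x t) := by
  have hχ := contDiff_wideCutoff hψ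
  have hχc := hasCompactSupport_wideCutoff hψ
  rw [cutoff_mul_forcingFamily hψ (hf.mul_left contDiff_const), cutoff_mul_forcingFamily hψ hf,
    mul_left_comm, ← forcingFamily_const_mul (hf.mul_left hχ) hχc.mul_right c
      ((hf.mul_left hχ).mul_left contDiff_const) h1 h2]
  simp_rw [mul_left_comm]

theorem contDiff_cutoff_mul_exp {ψ : ℝ → ℝ} (hψ : IsCutoff ψ) : ContDiff ℝ ∞ fun t : ℝ => (ψ t : ℂ) * Complex.exp t :=
  hψ.contDiff_complex.mul Complex.ofRealCLM.contDiff.cexp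

theorem hasCompactSupport_cutoff_mul_exp {ψ : ℝ → ℝ} (hψ : IsCutoff ψ) : HasCompactSupport fun t : ℝ => (ψ t : ℂ) * Complex.exp t :=
  hψ.hasCompactSupport.mul_right

end WideCutoff

/-! ### The Laplace transform of the traces at fixed x -/

section TimeTraces

/-- The Laplace transform in time of the forcing family at the point `x`. -/
noncomputable def traceB (μ : ℝ) (f : ℝ → ℂ) (x τ : ℝ) : ℂ :=
  kernelN μ x (linePt 1 τ) * lapB μ f 1 τ

theorem rapidDecay_traceB {μ : ℝ} (h1 : -1 < μ) (h2 : μ < 1) {f : ℝ → ℂ} (hf : ContDiff ℝ ∞ f) (hc : HasCompactSupport f) (x : ℝ) :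
    RapidDecay (traceB μ f x) := by
  obtain ⟨C, hC0, hC⟩ := norm_kernelN_le h1 h2 one_pos
  refine (rapidDecay_lapB hf hc one_pos μ).mul_of_le (C := C) (r := 1)
      (continuous_kernelN_comp h1 h2 one_pos continuous_const continuous_id) fun τ => ?_
  rw [Real.rpow_one]; exact hC x τ

/-- The scale invariant bound of the profile cancels the factor p^{(μ+1)/2} exactly, with a constant
independent of `x`. -/
theorem exists_norm_traceB_le {μ : ℝ} (h1 : -1 < μ) (h2 : μ < 1) : ∃ K : ℝ, 0 ≤ K ∧ ∀ f x τ, ‖traceB μ f x τ‖ ≤ K * ‖lap f 1 τ‖ := by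
  obtain ⟨K, hK0, hK⟩ := norm_kernelN_le_scale h1 h2 one_pos
  refine ⟨K, hK0, fun f x τ => ?_⟩
  rw [traceB, norm_mul, norm_lapB]
  calc _ = ‖linePt 1 τ‖ ^ ((μ + 1) / 2) * ‖kernelN μ x (linePt 1 τ)‖ * ‖lap f 1 τ‖ := by ring
    _ ≤ _ := by gcongr; exact hK x τ

theorem exists_lintegral_traceB_le {μ : ℝ} (h1 : -1 < μ) (h2 : μ < 1) (r : ℝ) : ∃ K : ℝ≥0, ∀ f x,
    ∫⁻ τ, ENNReal.ofReal (jap r τ) * ‖traceB μ f x τ‖ₑ ^ 2 ≤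
      K * ∫⁻ τ, ENNReal.ofReal (jap r τ) * ‖lap f 1 τ‖ₑ ^ 2 := by
  obtain ⟨K, hK0, hK⟩ := exists_norm_traceB_le h1 h2
  refine ⟨(K ^ 2).toNNReal, fun f x => ?_⟩
  rw [← lintegral_const_mul' _ _ ENNReal.coe_ne_top]
  refine lintegral_mono fun τ => ?_
  rw [enorm_sq_eq_ofReal, enorm_sq_eq_ofReal, mul_left_comm]
  gcongr
  change _ ≤ ENNReal.ofReal (K ^ 2) * _
  rw [← ENNReal.ofReal_mul (by positivity), ← mul_pow]
  exact ENNReal.ofReal_le_ofReal (pow_le_pow_left₀ (norm_nonneg _) (hK f x τ) 2)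

theorem forcingFamily_eq_fourierInv_traceB {μ : ℝ} (h1 : -1 < μ) (h2 : μ < 1) {f : ℝ → ℂ} (hf : IsSmoothHalfLine f) (hc : HasCompactSupport f)
    (x t : ℝ) : forcingFamily μ f x t = Complex.exp t * 𝓕⁻ (traceB μ f x) t := by
  rw [forcingFamily_eq_lapInv h1 h2 one_pos hf hc, lapInv_eq_fourierInv]
  simp only [Complex.ofReal_one, one_mul]
  rfl

theorem continuous_fourier_mul_fourierInv_traceB {μ : ℝ} (h1 : -1 < μ) (h2 : μ < 1) {φ : ℝ → ℂ} (hφ : ContDiff ℝ ∞ φ) (hφc : HasCompactSupport φ)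
    {f : ℝ → ℂ} (hf : ContDiff ℝ ∞ f) (hc : HasCompactSupport f) (τ : ℝ) :
    Continuous fun x => 𝓕 (fun t => φ t * 𝓕⁻ (traceB μ f x) t) τ := by
  simp_rw [fun x => fourier_mul_fourierInv hφ hφc (rapidDecay_traceB h1 h2 hf hc x).integrable τ]
  obtain ⟨K, hK0, hK⟩ := exists_norm_traceB_le h1 h2
  obtain ⟨M, hM0, hM⟩ := (rapidDecay_fourier hφ hφc).rpow_bound 0
  have hl := rapidDecay_lap hf hc 1
  have hcφ := (rapidDecay_fourier hφ hφc).continuous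
  refine continuous_of_dominated (bound := fun y => M * (K * ‖lap f 1 y‖)) (fun x => ?_) (fun x => ?_)
    ((hl.integrable.norm.const_mul K).const_mul M) (ae_of_all _ fun y => ?_)
  · have := (rapidDecay_traceB h1 h2 hf hc x).continuous
    exact Continuous.aestronglyMeasurable (by fun_prop)
  · refine ae_of_all _ fun y => ?_
    rw [norm_mul]
    have := hM (τ - y)
    rw [Real.rpow_zero, mul_one] at this
    exact mul_le_mul this (hK f x y) (norm_nonneg _) hM0
  · have h3 : Continuous fun x => kernelN μ x (linePt 1 y) :=
      continuous_kernelN_comp h1 h2 one_pos continuous_id continuous_const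
    unfold traceB
    exact continuous_const.mul (h3.mul continuous_const)

/-- The distributions which vanish on the open negative half line. -/
def vanishingNeg : Submodule ℂ 𝓢'(ℝ, ℂ) where
  carrier := {u | ∀ φ : 𝓢(ℝ, ℂ), tsupport φ ⊆ Iio 0 → u φ = 0}
  add_mem' := fun {u v} hu hv φ hφ => by
    change u φ + v φ = 0
    rw [hu φ hφ, hv φ hφ, add_zero]
  zero_mem' := fun φ _ => rfl
  smul_mem' := fun c u hu φ hφ => by
    change c • u φ = 0
    rw [hu φ hφ, smul_zero]

end TimeTraces

/-! ### Part (b): supports in the half line and the time trace estimate -/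

theorem isClosed_vanishingNeg (w : ℝ → ℝ) [Fact (IsTemperedWeight w)] :
    IsClosed {h | ofWeightedL2 w h ∈ vanishingNeg} := by
  have : {h | ofWeightedL2 w h ∈ vanishingNeg} =
      ⋂ (φ : 𝓢(ℝ, ℂ)) (_ : tsupport φ ⊆ Iio 0), {h | ofWeightedL2 w h φ = 0} := by
    ext h
    simp only [mem_iInter]
    exact Iff.rfl
  rw [this]
  exact isClosed_iInter fun φ => isClosed_iInter fun _ =>
    isClosed_eq (continuous_ofWeightedL2_apply w φ) continuous_const

theorem dsupport_subset_of_mem_vanishingNeg {u : 𝓢'(ℝ, ℂ)} (hu : u ∈ vanishingNeg) :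
    Distribution.dsupport u ⊆ Ici 0 := by
  refine sInter_subset_of_mem ⟨?_, isClosed_Ici⟩
  intro φ hφ
  rw [compl_Ici] at hφ
  exact hu φ hφ

theorem IsFunction.mem_vanishingNeg {u : 𝓢'(ℝ, ℂ)} {v : ℝ → ℂ} (hu : IsFunction u v)
    (hv : ∀ t < 0, v t = 0) : u ∈ vanishingNeg := by
  intro φ hφ
  rw [(hu φ).2]
  refine integral_eq_zero_of_ae (ae_of_all _ fun t => ?_)
  rcases lt_or_ge t 0 with ht | ht
  · simp [hv t ht]
  · have : φ t = 0 := by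
      by_contra h
      have : t < 0 := hφ (subset_tsupport _ h)
      linarith
    simp [this]

/-- The trace is the smooth cutoff ψ(t)e^t times the inverse Fourier transform of a function
dominated by the Laplace transform of the cut off data at abscissa 1. Multiplication by a smooth
cutoff is bounded for every real order, so σ is unrestricted. -/
theorem exists_time_traces {σ μ : ℝ} (h1 : -1 < μ) (h2 : μ < 1) {ψ : ℝ → ℝ} (hψ : IsCutoff ψ) :
    ∃ (c : ℝ≥0) (T : 𝓢'(ℝ, ℂ) →ₗ[ℂ] (ℝ → 𝓢'(ℝ, ℂ))),
      (∀ (f : ℝ → ℂ) (F : 𝓢'(ℝ, ℂ)), IsSmoothHalfLine f → IsFunction F f → sobolevNorm σ F < ⊤ →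
        ∀ x : ℝ, IsFunction (T F x) (fun t => (ψ t : ℂ) * forcingFamily μ f x t)) ∧
      ∀ F : 𝓢'(ℝ, ℂ), sobolevNorm σ F < ⊤ → ContinuousIntoHZero σ (T F) ∧
        ∀ x : ℝ, sobolevNorm σ (T F x) ≤ c * sobolevNorm σ F := by
  have hpi := Real.pi_pos
  have hk : ENNReal.ofReal (2 * Real.pi) ≠ 0 := by simp [hpi]
  have hφ := contDiff_cutoff_mul_exp hψ
  have hφc := hasCompactSupport_cutoff_mul_exp hψ
  set φ : ℝ → ℂ := fun t : ℝ => (ψ t : ℂ) * Complex.exp t with hφdef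
  have hχ := contDiff_wideCutoff hψ
  have hχc := hasCompactSupport_wideCutoff hψ
  obtain ⟨C1, hC1⟩ := exists_fourier_mul_fourierInv_bound hφ hφc σ
  -- The pointwise bound of order σ + 1 is for continuity in `x` only: it dominates the density of
  -- order σ by ⟨τ⟩^{-2} times a constant, uniformly in `x`.
  obtain ⟨C2, hC2⟩ := exists_fourier_mul_fourierInv_bound hφ hφc (σ + 1)
  obtain ⟨K1, hK1⟩ := exists_lintegral_traceB_le h1 h2 (2 * σ)
  obtain ⟨K2, hK2⟩ := exists_lintegral_traceB_le h1 h2 (2 * (σ + 1))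
  obtain ⟨L, hL⟩ := exists_lap_cutoff_bound hχ hχc σ 1
  obtain ⟨T, hT1, hT2⟩ := exists_extension (X := ℝ) (jap (2 * σ)) (jap (2 * σ)) hk
    ENNReal.ofReal_ne_top hk ENNReal.ofReal_ne_top vanishingNeg (isClosed_vanishingNeg _)
    IsSmoothHalfLine (fun f x t => (ψ t : ℂ) * forcingFamily μ f x t)
    isSmoothHalfLine_zero
    (fun f g hf hg => ⟨hf.add hg, fun x t => cutoff_forcingFamily_add hψ hf hg h1 h2 x t⟩)
    (fun c f hf => ⟨hf.mul_left contDiff_const, fun x t => cutoff_forcingFamily_const_mul hψ hf c h1 h2 x t⟩)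
    (NNReal.sqrt (C1 * K1 * L))
    (fun f F hf hF hlt => by
      obtain ⟨g, hg, hlt'⟩ := exists_of_weightedNorm_lt_top hk hlt
      set f₁ : ℝ → ℂ := fun r => wideCutoff ψ r * f r with hf₁
      have hs : IsSmoothHalfLine f₁ := hf.mul_left hχ
      have hc : HasCompactSupport f₁ := hχc.mul_right
      have hB := fun x => rapidDecay_traceB h1 h2 hs.contDiff hc x
      have hv : ∀ x, (fun t => (ψ t : ℂ) * forcingFamily μ f x t) = fun t => φ t * 𝓕⁻ (traceB μ f₁ x) t := by
        intro x
        ext t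
        rw [cutoff_mul_forcingFamily hψ hf, forcingFamily_eq_fourierInv_traceB h1 h2 hs hc, hφdef, mul_assoc]
      set v : ℝ → ℝ → ℂ := fun x t => φ t * 𝓕⁻ (traceB μ f₁ x) t with hvdef
      have hvc : ∀ x, Continuous (v x) := fun x =>
        hφ.continuous.mul (continuous_fourierInv (hB x).integrable)
      have hvi : ∀ x, Integrable (v x) := fun x =>
        (hvc x).integrable_of_hasCompactSupport hφc.mul_right
      have hFi : ∀ x, Integrable (𝓕 (v x)) := fun x => integrable_fourier_mul_fourierInv hφ hφc (hB x)
      have hbound : ∀ x, ∫⁻ τ, ENNReal.ofReal (jap (2 * σ) τ) * ‖𝓕 (v x) τ‖ₑ ^ 2 ≤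
          (C1 * K1 * L : ℝ≥0) * ∫⁻ τ, ENNReal.ofReal (jap (2 * σ) τ) * ‖g τ‖ₑ ^ 2 := by
        intro x
        refine ((hC1 _ (hB x).integrable).1).trans ?_
        push_cast
        rw [mul_assoc, mul_assoc]
        gcongr
        refine (hK1 f₁ x).trans ?_
        gcongr
        exact hL F f g hF hg
      choose u hu using fun x => exists_isFunction_fourier (w := jap (2 * σ)) (hFi x).aestronglyMeasurable
        (lt_of_le_of_lt (hbound x) (ENNReal.mul_lt_top ENNReal.coe_lt_top hlt'))
      have hU : ∀ x, IsFunction (ofWeightedL2 (jap (2 * σ)) (u x))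
          (fun t => (ψ t : ℂ) * forcingFamily μ f x t) := by
        intro x
        rw [hv]
        have := isFunction_of_isFunction_fourier (hFi x) (hu x)
        rwa [(hvc x).fourierInv_fourier_eq (hvi x) (hFi x)] at this
      refine ⟨fun x => ofWeightedL2 (jap (2 * σ)) (u x), fun x => ⟨hU x, ?_, ?_, ?_⟩⟩
      · exact (hU x).mem_vanishingNeg fun t ht => by
          rw [forcingFamily_eq_zero hf h1 h2 x ht.le, mul_zero]
      · refine weightedNorm_le_of_lintegral_le (hu x) hg ?_
        rw [mul_left_comm]
        gcongr
        exact hbound x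
      · set M : ℝ≥0∞ := C2 * (K2 * ∫⁻ τ, ENNReal.ofReal (jap (2 * (σ + 1)) τ) * ‖lap f₁ 1 τ‖ₑ ^ 2) with hM
        have hMt : M ≠ ⊤ := ENNReal.mul_ne_top ENNReal.coe_ne_top (ENNReal.mul_ne_top ENNReal.coe_ne_top
          (lintegral_jap_mul_sq_lt_top (rapidDecay_lap hs.contDiff hc 1) _).ne)
        have hsup : ∀ y τ, ENNReal.ofReal (jap (2 * σ) τ) * ‖𝓕 (v y) τ‖ₑ ^ 2 ≤
            ENNReal.ofReal (jap (-2) τ) * M := by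
          intro y τ
          have h5 := (hC2 _ (hB y).integrable).2 τ
          have h6 := h5.trans (mul_le_mul_right (hK2 f₁ y) _)
          have h7 : jap (2 * σ) τ = jap (-2) τ * jap (2 * (σ + 1)) τ := by
            rw [← jap_add]; congr 1; ring
          rw [h7, ENNReal.ofReal_mul (jap_pos _ _).le, mul_assoc]
          gcongr
        refine tendsto_weightedNorm_sub ENNReal.ofReal_ne_top
          (by have := (continuous_jap (2 * σ)).measurable; fun_prop) hu x
          (bd := fun τ => ENNReal.ofReal (jap (-2) τ) * (8 * M)) ?_ ?_ (fun ξ => ENNReal.ofReal_ne_top) ?_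
        · rw [lintegral_mul_const' _ _ (ENNReal.mul_ne_top (by simp) hMt)]
          refine ENNReal.mul_ne_top (Integrable.lintegral_lt_top ?_).ne (ENNReal.mul_ne_top (by simp) hMt)
          refine ((integrable_one_add_abs_rpow (r := -2) (by norm_num)).const_mul ((2 * Real.pi) ^ |(-2 : ℝ)|)).mono'
            (continuous_jap _).aestronglyMeasurable (ae_of_all _ fun τ => ?_)
          rw [Real.norm_of_nonneg (jap_pos _ _).le]
          exact jap_le_one_add_abs _ _
        · refine Eventually.of_forall fun y => ae_of_all _ fun τ => ?_
          have h8 : ‖𝓕 (v y) τ - 𝓕 (v x) τ‖ₑ ^ 2 ≤ 4 * ‖𝓕 (v y) τ‖ₑ ^ 2 + 4 * ‖𝓕 (v x) τ‖ₑ ^ 2 :=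
            (pow_le_pow_left' enorm_sub_le 2).trans (ennreal_add_sq_le _ _)
          calc _ ≤ ENNReal.ofReal (jap (2 * σ) τ) * (4 * ‖𝓕 (v y) τ‖ₑ ^ 2 + 4 * ‖𝓕 (v x) τ‖ₑ ^ 2) := by
                gcongr
            _ = 4 * (ENNReal.ofReal (jap (2 * σ) τ) * ‖𝓕 (v y) τ‖ₑ ^ 2) +
                4 * (ENNReal.ofReal (jap (2 * σ) τ) * ‖𝓕 (v x) τ‖ₑ ^ 2) := by ring
            _ ≤ 4 * (ENNReal.ofReal (jap (-2) τ) * M) + 4 * (ENNReal.ofReal (jap (-2) τ) * M) := by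
                exact add_le_add (mul_le_mul_right (hsup y τ) _) (mul_le_mul_right (hsup x τ) _)
            _ = _ := by ring
        · exact ae_of_all _ fun τ =>
            (continuous_fourier_mul_fourierInv_traceB h1 h2 hφ hφc hs.contDiff hc τ).tendsto x)
  refine ⟨NNReal.sqrt (C1 * K1 * L), T, hT1, fun F hF => ?_⟩
  have h5 := hT2 F hF
  refine ⟨⟨fun x => ⟨lt_of_le_of_lt (h5 x).2.1 (ENNReal.mul_lt_top ENNReal.coe_lt_top hF),
    dsupport_subset_of_mem_vanishingNeg (h5 x).1⟩, fun x => (h5 x).2.2⟩, fun x => (h5 x).2.1⟩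

/-! ### Convolution of a singular weight with a decaying kernel -/

section KernelBound

/-- A pointwise bound behind the convolution estimate for weights which are singular at the origin. -/
theorem powW_mul_one_add_abs_rpow_le {p e c : ℝ} (he : -1 < e) (he0 : e < 0) (hc : 1 < c) (τ η : ℝ) :
    powW p (e - p) η * (1 + |τ - η|) ^ (-c) ≤ (2 ^ |p| * 2 ^ (-e) + 2 ^ (e + c) * 3 ^ (-e)) * (1 + |τ|) ^ e *
      (powW p (-p - c) η + (1 + |τ - η|) ^ (-c)) := by
  have ht0 : 0 < 1 + |τ| := by positivity
  have hn0 : 0 < 1 + |η| := by positivity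
  have hd0 : 0 < 1 + |τ - η| := by positivity
  have hw := powW_nonneg p (-p - c) η
  have hA : (0 : ℝ) ≤ 2 ^ |p| * 2 ^ (-e) := by positivity
  have hB : (0 : ℝ) ≤ 2 ^ (e + c) * 3 ^ (-e) := by positivity
  have hdiv : ∀ {x : ℝ}, (1 + |τ|) / 2 ≤ x → x ^ e ≤ 2 ^ (-e) * (1 + |τ|) ^ e := by
    intro x hx
    refine (Real.rpow_le_rpow_of_nonpos (by positivity) hx he0.le).trans (le_of_eq ?_)
    rw [Real.div_rpow ht0.le (by norm_num), Real.rpow_neg (by norm_num)]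
    field_simp
  rcases le_or_gt |τ| (2 * |η|) with h | h
  · rcases le_or_gt 1 |η| with h1 | h1
    -- Here |η| ≥ 1, so the weight is of order ⟨η⟩^e; as e < 0 and |η| ≥ |τ|/2, this is at most a
    -- multiple of ⟨τ⟩^e.
    · have e1 : powW p (e - p) η ≤ 2 ^ |p| * 2 ^ (-e) * (1 + |τ|) ^ e := by
        have e2 : |η| ^ p ≤ 2 ^ |p| * (1 + |η|) ^ p :=
          rpow_le_of_comparable (by linarith) hn0 (by norm_num) (by linarith) (by linarith) p
        calc powW p (e - p) η ≤ 2 ^ |p| * (1 + |η|) ^ p * (1 + |η|) ^ (e - p) := by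
              unfold powW; gcongr
          _ = 2 ^ |p| * (1 + |η|) ^ e := by
              rw [mul_assoc, ← Real.rpow_add hn0]; congr 2; ring
          _ ≤ 2 ^ |p| * (2 ^ (-e) * (1 + |τ|) ^ e) := by
              gcongr; exact hdiv (by linarith)
          _ = _ := by ring
      calc _ ≤ 2 ^ |p| * 2 ^ (-e) * (1 + |τ|) ^ e * (1 + |τ - η|) ^ (-c) := by gcongr
        _ ≤ _ := by
          gcongr
          · exact le_add_of_nonneg_right hB
          · exact le_add_of_nonneg_left hw
    -- Here |η| < 1, hence |τ| ≤ 2 and ⟨τ⟩^e is bounded below by 3^e; the singular weight is kept,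
    -- being integrable at the origin when p > -1.
    · have e1 : powW p (e - p) η ≤ 2 ^ (e + c) * powW p (-p - c) η := by
        unfold powW
        rw [mul_left_comm]
        gcongr
        rw [show e - p = (e + c) + (-p - c) by ring, Real.rpow_add hn0]
        gcongr
        · linarith
        · linarith
      have e2 : (1 + |τ - η|) ^ (-c) ≤ 1 :=
        Real.rpow_le_one_of_one_le_of_nonpos (by simp) (by linarith)
      have e3 : 1 ≤ 3 ^ (-e) * (1 + |τ|) ^ e := by
        rw [Real.rpow_neg (by norm_num), ← div_eq_inv_mul, ← Real.div_rpow ht0.le (by norm_num)]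
        exact Real.one_le_rpow_of_pos_of_le_one_of_nonpos (by positivity) (by linarith) he0.le
      calc _ ≤ 2 ^ (e + c) * powW p (-p - c) η * 1 := by gcongr
        _ ≤ 2 ^ (e + c) * powW p (-p - c) η * (3 ^ (-e) * (1 + |τ|) ^ e) := by gcongr
        _ = 2 ^ (e + c) * 3 ^ (-e) * (1 + |τ|) ^ e * powW p (-p - c) η := by ring
        _ ≤ _ := by
          gcongr
          · exact le_add_of_nonneg_left hA
          · exact le_add_of_nonneg_right (by positivity)
  -- Here |η| < |τ|/2, so |τ - η| exceeds both |τ|/2 and |η|. The kernel is shared as ⟨τ⟩^e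
  -- ⟨η⟩^{-c-e}, where -c - e < 0 because c > 1 and e > -1.
  · have hsub : |τ| - |η| ≤ |τ - η| := abs_sub_abs_le_abs_sub _ _
    have e1 : (1 + |τ - η|) ^ (-c) ≤ 2 ^ (-e) * (1 + |τ|) ^ e * (1 + |η|) ^ (-c - e) := by
      rw [show -c = e + (-c - e) by ring, Real.rpow_add hd0]
      refine mul_le_mul (hdiv (by linarith [abs_nonneg τ])) ?_ (by positivity) (by positivity)
      rw [show e + (-c - e) - e = -c - e by ring]
      exact Real.rpow_le_rpow_of_nonpos hn0 (by linarith) (by linarith)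
    have e2 : powW p (e - p) η * (1 + |η|) ^ (-c - e) = powW p (-p - c) η := by
      unfold powW
      rw [mul_assoc, ← Real.rpow_add hn0]; congr 2; ring
    have e3 : (1 : ℝ) ≤ 2 ^ |p| := Real.one_le_rpow (by norm_num) (abs_nonneg p)
    have hw' := powW_nonneg p (e - p) η
    calc _ ≤ powW p (e - p) η * (2 ^ (-e) * (1 + |τ|) ^ e * (1 + |η|) ^ (-c - e)) := by gcongr
      _ = 1 * 2 ^ (-e) * (1 + |τ|) ^ e * powW p (-p - c) η := by rw [← e2]; ring
      _ ≤ 2 ^ |p| * 2 ^ (-e) * (1 + |τ|) ^ e * powW p (-p - c) η := by gcongr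
      _ ≤ _ := by
        gcongr
        · exact le_add_of_nonneg_right hB
        · exact le_add_of_nonneg_right (by positivity)

theorem exists_lintegral_powW_conv_le {p e c : ℝ} (hp : -1 < p) (he : -1 < e) (he0 : e < 0) (hc : 1 < c) :
    ∃ C : ℝ≥0, ∀ τ : ℝ, ∫⁻ η, ENNReal.ofReal (powW p (e - p) η * (1 + |τ - η|) ^ (-c)) ≤
      C * ENNReal.ofReal ((1 + |τ|) ^ e) := by
  set K : ℝ := 2 ^ |p| * 2 ^ (-e) + 2 ^ (e + c) * 3 ^ (-e) with hK
  have hK0 : 0 ≤ K := by positivity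
  have i1 : ∫⁻ η, ENNReal.ofReal (powW p (-p - c) η) < ⊤ :=
    (integrable_abs_rpow_mul_one_add_rpow (a := p) (b := -p - c) hp (by linarith)).lintegral_lt_top
  have i2 : ∫⁻ η : ℝ, ENNReal.ofReal ((1 + |η|) ^ (-c)) < ⊤ :=
    (integrable_one_add_abs_rpow (r := -c) (by linarith)).lintegral_lt_top
  refine ⟨K.toNNReal * ((∫⁻ η, ENNReal.ofReal (powW p (-p - c) η)).toNNReal +
    (∫⁻ η : ℝ, ENNReal.ofReal ((1 + |η|) ^ (-c))).toNNReal), fun τ => ?_⟩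
  have hm := measurable_powW p (-p - c)
  calc _ ≤ ∫⁻ η, ENNReal.ofReal (K * (1 + |τ|) ^ e) *
        (ENNReal.ofReal (powW p (-p - c) η) + ENNReal.ofReal ((1 + |τ - η|) ^ (-c))) := by
        refine lintegral_mono fun η => ?_
        rw [← ENNReal.ofReal_add (powW_nonneg _ _ _) (by positivity), ← ENNReal.ofReal_mul (by positivity)]
        exact ENNReal.ofReal_le_ofReal (powW_mul_one_add_abs_rpow_le he he0 hc τ η)
    _ = _ := by
        rw [lintegral_const_mul' _ _ ENNReal.ofReal_ne_top, lintegral_add_left (by fun_prop),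
          lintegral_sub_left_eq_self (fun η => ENNReal.ofReal ((1 + |η|) ^ (-c))), ENNReal.ofReal_mul hK0]
        push_cast
        rw [ENNReal.coe_toNNReal i1.ne, ENNReal.coe_toNNReal i2.ne, ENNReal.ofReal]
        ring

end KernelBound

/-! ### The equation of a mode and its cut off Fourier transform -/

section ModeFourier

theorem rapidDecay_linePt_inv_mul {A : ℝ → ℂ} (hA : RapidDecay A) {γ : ℝ} (hγ : 0 < γ) (η : ℝ) :
    RapidDecay fun τ => (linePt γ (τ - η))⁻¹ * A τ := by
  have hl := continuous_linePt γ
  refine hA.mul_of_le (C := 1 / γ) (r := 0) (Continuous.inv₀ (by fun_prop) fun τ => linePt_ne_zero hγ _)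
    fun τ => ?_
  rw [Real.rpow_zero, mul_one]
  exact norm_linePt_inv_le hγ _

/-- On the Laplace side p/(p - 2πiη) = 1 + 2πiη/(p - 2πiη); the first term is the forcing, the
second the free oscillation. -/
theorem hasDerivAt_modeS {f : ℝ → ℂ} (hf : ContDiff ℝ ∞ f) (hc : HasCompactSupport f) (μ η t : ℝ) :
    HasDerivAt (modeS μ f η) (fracIntegral (-((μ + 1) / 2)) f t + 2 * Real.pi * η * Complex.I * modeS μ f η t) t := by
  have hB := rapidDecay_lapB hf hc one_pos μ
  have hA := rapidDecay_linePt_inv_mul hB one_pos η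
  have h1 : modeS μ f η = lapInv 1 (fun τ => (linePt 1 (τ - η))⁻¹ * lapB μ f 1 τ) :=
    funext fun t => modeS_eq_lapInv hf hc one_pos μ η t
  rw [h1, fracIntegral_eq_lapInv_lapB hf hc one_pos]
  refine (hasDerivAt_lapInv hA one_pos t).congr_deriv ?_
  unfold lapInv
  rw [← integral_const_mul, ← integral_add (lapInv_integrable hB.integrable 1 t)
    ((lapInv_integrable hA.integrable 1 t).const_mul _)]
  refine integral_congr_ae (ae_of_all _ fun τ => ?_)
  simp only
  have h2 := linePt_ne_zero one_pos (τ - η)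
  have h3 : linePt 1 τ = linePt 1 (τ - η) + 2 * Real.pi * η * Complex.I := by rw [linePt_sub]; ring
  rw [h3]
  field_simp

/-- The Fourier transform in time of a cut off mode. -/
noncomputable def modeF (μ : ℝ) (f φ : ℝ → ℂ) (η τ : ℝ) : ℂ := 𝓕 (fun t => φ t * modeS μ f η t) τ

theorem continuous_modeS_right {f : ℝ → ℂ} (hf : ContDiff ℝ ∞ f) (hc : HasCompactSupport f) (μ η : ℝ) :
    Continuous (modeS μ f η) :=
  continuous_iff_continuousAt.2 fun t => (hasDerivAt_modeS hf hc μ η t).continuousAt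

theorem fracIntegral_eq_exp_mul {f : ℝ → ℂ} (hf : ContDiff ℝ ∞ f) (hc : HasCompactSupport f) (μ t : ℝ) :
    fracIntegral (-((μ + 1) / 2)) f t = Complex.exp t * 𝓕⁻ (lapB μ f 1) t := by
  rw [fracIntegral_eq_lapInv_lapB hf hc one_pos, lapInv_eq_fourierInv]
  simp

/-- The Fourier transform of the equation for the cut off mode gives the factor 2πi(τ - η). Adding
the cut off mode to both sides replaces it by 1 + 2πi(τ - η), which is never small and can be
divided out. -/
theorem modeF_identity {f φ : ℝ → ℂ} (hf : ContDiff ℝ ∞ f) (hc : HasCompactSupport f) (hφ : ContDiff ℝ ∞ φ)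
    (hφc : HasCompactSupport φ) (μ η τ : ℝ) :
    (1 + 2 * Real.pi * (τ - η) * Complex.I) * modeF μ f φ η τ =
      modeF μ f (fun t => φ t + deriv φ t) η τ + 𝓕 (fun t => φ t * fracIntegral (-((μ + 1) / 2)) f t) τ := by
  set g := fracIntegral (-((μ + 1) / 2)) f with hg
  have hS := continuous_modeS_right hf hc μ η
  have hgc : Continuous g := by
    rw [hg, fracIntegral_eq_lapInv_lapB hf hc one_pos]
    exact continuous_iff_continuousAt.2 fun t =>
      (hasDerivAt_lapInv (rapidDecay_lapB hf hc one_pos μ) one_pos t).continuousAt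
  have hφd : ∀ t, HasDerivAt φ (deriv φ t) t := fun t => ((hφ.differentiable (by simp)) t).hasDerivAt
  have hdc : Continuous (deriv φ) := hφ.continuous_deriv (by simp)
  have hφ0 := hφ.continuous
  have hd : ∀ t, HasDerivAt (fun t => φ t * modeS μ f η t)
      (deriv φ t * modeS μ f η t + φ t * (g t + 2 * Real.pi * η * Complex.I * modeS μ f η t)) t :=
    fun t => (hφd t).mul (hasDerivAt_modeS hf hc μ η t)
  have i0 : Integrable fun t => φ t * modeS μ f η t :=
    (by fun_prop : Continuous _).integrable_of_hasCompactSupport hφc.mul_right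
  have i1 : Integrable fun t => deriv φ t * modeS μ f η t :=
    (by fun_prop : Continuous _).integrable_of_hasCompactSupport hφc.deriv.mul_right
  have i2 : Integrable fun t => φ t * g t :=
    (by fun_prop : Continuous _).integrable_of_hasCompactSupport hφc.mul_right
  have hderiv : deriv (fun t => φ t * modeS μ f η t) = fun t => deriv φ t * modeS μ f η t + φ t * g t +
      2 * Real.pi * η * Complex.I * (φ t * modeS μ f η t) := by
    ext t; rw [(hd t).deriv]; ring
  have i3 : Integrable (deriv fun t => φ t * modeS μ f η t) := by
    rw [hderiv]; exact (i1.add i2).add (i0.const_mul _)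
  have key := congrFun (Real.fourier_deriv i0 (fun t => (hd t).differentiableAt) i3) τ
  have hexp : ∀ h : ℝ → ℂ, Integrable h →
      Integrable fun t : ℝ => Complex.exp (-(2 * Real.pi * τ * Complex.I) * t) * h t := by
    intro h hh
    refine hh.bdd_mul (c := 1) (Continuous.aestronglyMeasurable (by fun_prop)) (ae_of_all _ fun t => ?_)
    rw [Complex.norm_exp]; simp
  have e1 : 𝓕 (deriv fun t => φ t * modeS μ f η t) τ = 𝓕 (fun t => deriv φ t * modeS μ f η t) τ +
      𝓕 (fun t => φ t * g t) τ + 2 * Real.pi * η * Complex.I * modeF μ f φ η τ := by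
    rw [hderiv, modeF]
    simp_rw [fourier_eq_integral_exp_mul]
    rw [← integral_add (hexp _ i1) (hexp _ i2), ← integral_const_mul, ← integral_add]
    · refine integral_congr_ae (ae_of_all _ fun t => ?_)
      simp only
      ring
    · exact (hexp _ i1).add (hexp _ i2)
    · exact (hexp _ i0).const_mul _
  have e2 : modeF μ f (fun t => φ t + deriv φ t) η τ = modeF μ f φ η τ +
      𝓕 (fun t => deriv φ t * modeS μ f η t) τ := by
    unfold modeF
    simp_rw [fourier_eq_integral_exp_mul]
    rw [← integral_add (hexp _ i0) (hexp _ i1)]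
    refine integral_congr_ae (ae_of_all _ fun t => ?_)
    simp only
    ring
  rw [e1] at key
  rw [e2]
  simp only [smul_eq_mul] at key
  change _ = _ * modeF μ f φ η τ at key
  linear_combination -key

theorem jap_one_le_norm (y : ℝ) : jap 1 y ≤ 2 * ‖1 + 2 * Real.pi * (y : ℂ) * Complex.I‖ := by
  have e : (1 + 2 * Real.pi * (y : ℂ) * Complex.I) = ((1 : ℝ) : ℂ) + ((2 * Real.pi * y : ℝ) : ℂ) * Complex.I := by
    push_cast; ring
  have h1 := Complex.abs_re_le_norm (1 + 2 * Real.pi * (y : ℂ) * Complex.I)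
  have h2 := Complex.abs_im_le_norm (1 + 2 * Real.pi * (y : ℂ) * Complex.I)
  rw [e] at h1 h2 ⊢
  simp only [Complex.add_re, Complex.ofReal_re, Complex.mul_re, Complex.I_re, mul_zero, Complex.ofReal_im,
    Complex.I_im, mul_one, Complex.add_im, Complex.mul_im, add_zero, zero_add, abs_one, sub_self] at h1 h2
  unfold jap
  rw [Real.rpow_one]
  linarith

theorem norm_modeF_le {f φ : ℝ → ℂ} (hf : ContDiff ℝ ∞ f) (hc : HasCompactSupport f) (hφ : ContDiff ℝ ∞ φ)
    (hφc : HasCompactSupport φ) (μ η τ : ℝ) :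
    ‖modeF μ f φ η τ‖ ≤ 2 * jap (-1) (τ - η) * (‖modeF μ f (fun t => φ t + deriv φ t) η τ‖ +
      ‖𝓕 (fun t => φ t * fracIntegral (-((μ + 1) / 2)) f t) τ‖) := by
  have h1 := congrArg norm (modeF_identity hf hc hφ hφc μ η τ)
  rw [norm_mul] at h1
  have h2 := h1.le.trans (norm_add_le _ _)
  have h3 := jap_one_le_norm (τ - η)
  rw [Complex.ofReal_sub] at h3
  have h4 := jap_pos (-1) (τ - η)
  have h5 : jap (-1) (τ - η) * jap 1 (τ - η) = 1 := by
    rw [← jap_add]; simp [jap]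
  calc ‖modeF μ f φ η τ‖ = jap (-1) (τ - η) * (jap 1 (τ - η) * ‖modeF μ f φ η τ‖) := by
        rw [← mul_assoc, h5, one_mul]
    _ ≤ jap (-1) (τ - η) * (2 * ‖1 + 2 * Real.pi * ((τ : ℂ) - η) * Complex.I‖ * ‖modeF μ f φ η τ‖) := by
        gcongr
    _ = 2 * jap (-1) (τ - η) * (‖1 + 2 * Real.pi * ((τ : ℂ) - η) * Complex.I‖ * ‖modeF μ f φ η τ‖) := by ring
    _ ≤ _ := by gcongr

end ModeFourier

/-! ### Fourier inversion in the plane by iterated integrals -/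

section PlaneFourier

theorem measurePreserving_coords :
    MeasurePreserving (fun q : EuclideanSpace ℝ (Fin 2) => (q 0, q 1)) volume (volume.prod volume) :=
  (volume_preserving_finTwoArrow ℝ).comp (PiLp.volume_preserving_ofLp (Fin 2))

theorem measurableEmbedding_coords :
    MeasurableEmbedding (fun q : EuclideanSpace ℝ (Fin 2) => (q 0, q 1)) :=
  (MeasurableEquiv.finTwoArrow (α := ℝ)).measurableEmbedding.comp
    (MeasurableEquiv.toLp 2 (Fin 2 → ℝ)).symm.measurableEmbedding

theorem fourierInv_coords {G : ℝ → ℝ → ℂ} (hG : Integrable (Function.uncurry G) (volume.prod volume))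
    (p : EuclideanSpace ℝ (Fin 2)) :
    𝓕⁻ (fun q : EuclideanSpace ℝ (Fin 2) => G (q 0) (q 1)) p =
      ∫ ξ : ℝ, Complex.exp (2 * Real.pi * ξ * p 0 * Complex.I) * 𝓕⁻ (G ξ) (p 1) := by
  rw [Real.fourierInv_eq']
  have h1 : ∀ q : EuclideanSpace ℝ (Fin 2),
      Complex.exp (((2 * Real.pi * inner ℝ q p : ℝ) : ℂ) * Complex.I) • G (q 0) (q 1) =
      (fun r : ℝ × ℝ => Complex.exp (2 * Real.pi * (r.1 * p 0 + r.2 * p 1) * Complex.I) *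
        Function.uncurry G r) (q 0, q 1) := by
    intro q
    simp only [PiLp.inner_apply, Fin.sum_univ_two, RCLike.inner_apply, conj_trivial, smul_eq_mul,
      Function.uncurry]
    congr 2
    push_cast
    ring
  refine (integral_congr_ae (ae_of_all _ h1)).trans
    ((measurePreserving_coords.integral_comp measurableEmbedding_coords
      (fun r : ℝ × ℝ => Complex.exp (2 * Real.pi * (r.1 * p 0 + r.2 * p 1) * Complex.I) *
        Function.uncurry G r)).trans ?_)
  rw [integral_prod]
  · refine integral_congr_ae (ae_of_all _ fun ξ => ?_)
    simp only [Function.uncurry]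
    rw [Real.fourierInv_eq', ← integral_const_mul]
    refine integral_congr_ae (ae_of_all _ fun τ => ?_)
    simp only [RCLike.inner_apply, conj_trivial, smul_eq_mul, ← mul_assoc, ← Complex.exp_add]
    congr 2
    push_cast
    ring
  · refine hG.bdd_mul (c := 1) (Continuous.aestronglyMeasurable (by fun_prop)) (ae_of_all _ fun r => ?_)
    rw [Complex.norm_exp]
    simp

end PlaneFourier

/-! ### The space-time Fourier transform of the cut off family -/

section ProfileFourier

theorem jap_neg (r x : ℝ) : jap r (-x) = jap r x := by
  unfold jap; rw [mul_neg, abs_neg]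

theorem exists_norm_modeF_le_jap {f φ : ℝ → ℂ} (hf : ContDiff ℝ ∞ f) (hc : HasCompactSupport f)
    (hφ : Continuous φ) (hφc : HasCompactSupport φ) (μ : ℝ) :
    ∃ C : ℝ, 0 ≤ C ∧ ∀ η τ, ‖modeF μ f φ η τ‖ ≤ C * jap (-1) η := by
  obtain ⟨C, hC0, hC⟩ := norm_modeS_le hf hc μ
  refine ⟨∫ t, ‖φ t‖ * (C * Real.exp t), integral_nonneg fun t => by positivity, fun η τ => ?_⟩
  refine (norm_fourier_le _ _).trans ?_
  rw [← integral_mul_const]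
  have h1 : Integrable fun t => ‖φ t‖ * (C * Real.exp t) * jap (-1) η :=
    (by fun_prop : Continuous _).integrable_of_hasCompactSupport hφc.norm.mul_right.mul_right
  refine integral_mono_of_nonneg (ae_of_all _ fun t => norm_nonneg _) h1 (ae_of_all _ fun t => ?_)
  have h2 := hC η t
  simp only
  rw [norm_mul, mul_assoc]
  gcongr
  unfold jap
  rw [Real.rpow_neg_one]
  exact h2

theorem exists_norm_fourier_cutoff_fracIntegral_le {f φ : ℝ → ℂ} (hf : ContDiff ℝ ∞ f) (hc : HasCompactSupport f)
    (hφ : ContDiff ℝ ∞ φ) (hφc : HasCompactSupport φ) (μ r : ℝ) :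
    ∃ C : ℝ, 0 ≤ C ∧ ∀ τ, ‖𝓕 (fun t => φ t * fracIntegral (-((μ + 1) / 2)) f t) τ‖ ≤ C * jap (-r) τ := by
  have h1 : ContDiff ℝ ∞ fun t : ℝ => φ t * Complex.exp t := hφ.mul Complex.ofRealCLM.contDiff.cexp
  have hB := rapidDecay_lapB hf hc one_pos μ
  obtain ⟨C, hC⟩ := exists_fourier_mul_fourierInv_bound h1 hφc.mul_right r
  have h2 := (hC _ hB.integrable).2
  have h3 : (fun t => φ t * fracIntegral (-((μ + 1) / 2)) f t) =
      fun t => φ t * Complex.exp t * 𝓕⁻ (lapB μ f 1) t := by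
    ext t; rw [fracIntegral_eq_exp_mul hf hc, mul_assoc]
  set N : ℝ≥0∞ := C * ∫⁻ τ, ENNReal.ofReal (jap (2 * r) τ) * ‖lapB μ f 1 τ‖ₑ ^ 2 with hN
  have hNt : N ≠ ⊤ := ENNReal.mul_ne_top ENNReal.coe_ne_top (lintegral_jap_mul_sq_lt_top hB _).ne
  refine ⟨Real.sqrt N.toReal, Real.sqrt_nonneg _, fun τ => ?_⟩
  rw [h3]
  have h4 := ENNReal.toReal_mono hNt (h2 τ)
  rw [enorm_sq_eq_ofReal, ← ENNReal.ofReal_mul (jap_pos _ _).le, ENNReal.toReal_ofReal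
    (mul_nonneg (jap_pos _ _).le (sq_nonneg _)), jap_two_mul, ← mul_pow] at h4
  have h5 := Real.le_sqrt_of_sq_le h4
  have h6 : jap (-r) τ * jap r τ = 1 := by rw [← jap_add]; simp [jap]
  calc _ = jap (-r) τ * (jap r τ * ‖𝓕 (fun t => φ t * Complex.exp t * 𝓕⁻ (lapB μ f 1) t) τ‖) := by
        rw [← mul_assoc, h6, one_mul]
    _ ≤ jap (-r) τ * Real.sqrt N.toReal := by
        have := jap_pos (-r) τ
        gcongr
    _ = _ := mul_comm _ _

/-- Applying `norm_modeF_le` twice gains two powers of ⟨τ - η⟩, which makes the space-time transform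
integrable and justifies Fourier inversion in the plane. The constant depends on `f`; the bound is
qualitative. -/
theorem exists_norm_modeF_le_integrable {f φ : ℝ → ℂ} (hf : ContDiff ℝ ∞ f) (hc : HasCompactSupport f)
    (hφ : ContDiff ℝ ∞ φ) (hφc : HasCompactSupport φ) (μ : ℝ) :
    ∃ C : ℝ, 0 ≤ C ∧ ∀ η τ, ‖modeF μ f φ η τ‖ ≤ C * jap (-1) η * (jap (-2) (τ - η) + jap (-2) τ) := by
  have hφ' : ContDiff ℝ ∞ fun t => φ t + deriv φ t := hφ.add (contDiff_infty_iff_deriv.1 hφ).2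
  have hφc' : HasCompactSupport fun t => φ t + deriv φ t := hφc.add hφc.deriv
  have hφ'' : Continuous fun t => φ t + deriv φ t + deriv (fun t => φ t + deriv φ t) t :=
    hφ'.continuous.add (hφ'.continuous_deriv (by simp))
  obtain ⟨C0, h00, h0⟩ := exists_norm_modeF_le_jap hf hc hφ'' (hφc'.add hφc'.deriv) μ
  obtain ⟨C1, h10, h1⟩ := exists_norm_fourier_cutoff_fracIntegral_le hf hc hφ hφc μ 3
  obtain ⟨C2, h20, h2⟩ := exists_norm_fourier_cutoff_fracIntegral_le hf hc hφ' hφc' μ 3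
  refine ⟨4 * C0 + 4 * C2 + 2 * C1, by positivity, fun η τ => ?_⟩
  have a1 := norm_modeF_le hf hc hφ hφc μ η τ
  have a2 := norm_modeF_le hf hc hφ' hφc' μ η τ
  have p1 := jap_pos (-1) (τ - η)
  have p2 := jap_pos (-1) η
  have p3 := jap_pos (-2) τ
  have p4 := jap_pos (-3) τ
  have p5 := jap_pos (-2) (τ - η)
  have e1 : jap (-1) (τ - η) * jap (-1) (τ - η) = jap (-2) (τ - η) := by rw [← jap_add]; norm_num
  -- Peetre's inequality trades ⟨τ - η⟩^{-1} for ⟨η⟩^{-1} at the cost of one power of ⟨τ⟩. Starting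
  -- from order 3 leaves ⟨τ⟩^{-2}, still integrable.
  have e2 : jap (-1) (τ - η) * jap (-3) τ ≤ jap (-1) η * jap (-2) τ := by
    have b1 := jap_le_mul (-1) (τ - η) (-η)
    rw [sub_neg_eq_add, sub_add_cancel, jap_neg, abs_neg, abs_one] at b1
    calc _ ≤ jap 1 τ * jap (-1) η * jap (-3) τ := by gcongr
      _ = jap (-1) η * (jap 1 τ * jap (-3) τ) := by ring
      _ = _ := by rw [← jap_add]; norm_num
  have e3 : jap (-1) (τ - η) ≤ 1 := by
    have := jap_le_jap (r := -1) (q := 0) (by norm_num) (τ - η)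
    simpa [jap] using this
  calc _ ≤ 2 * jap (-1) (τ - η) * (2 * jap (-1) (τ - η) * (C0 * jap (-1) η + C2 * jap (-3) τ) + C1 * jap (-3) τ) := by
        refine a1.trans ?_
        gcongr
        · refine a2.trans ?_
          gcongr
          · exact h0 η τ
          · exact h2 τ
        · exact h1 τ
    _ = 4 * C0 * jap (-1) η * (jap (-1) (τ - η) * jap (-1) (τ - η)) +
        4 * C2 * jap (-1) (τ - η) * (jap (-1) (τ - η) * jap (-3) τ) +
        2 * C1 * (jap (-1) (τ - η) * jap (-3) τ) := by ring
    _ ≤ 4 * C0 * jap (-1) η * jap (-2) (τ - η) + 4 * C2 * 1 * (jap (-1) η * jap (-2) τ) +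
        2 * C1 * (jap (-1) η * jap (-2) τ) := by rw [e1]; gcongr
    _ ≤ _ := by
        have q1 : 0 ≤ C0 * jap (-1) η * jap (-2) τ := by positivity
        have q2 : 0 ≤ C2 * jap (-1) η * jap (-2) (τ - η) := by positivity
        have q3 : 0 ≤ C1 * jap (-1) η * jap (-2) (τ - η) := by positivity
        nlinarith

/-- The space-time Fourier transform of the cut off forcing family. -/
noncomputable def profileF (μ : ℝ) (f φ : ℝ → ℂ) (ξ τ : ℝ) : ℂ := 𝓕 (fun t => φ t * profileG μ f t ξ) τ

/-- The spatial symbol of the forcing family. -/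
noncomputable def profileK (μ ξ : ℝ) : ℂ :=
  2 * Complex.exp (-(Real.pi / 4 * Complex.I)) * (-(2 * Real.pi * ξ * Complex.I)) ^ ((-μ : ℝ) : ℂ)

theorem profileG_eq (μ : ℝ) (f : ℝ → ℂ) (t ξ : ℝ) :
    profileG μ f t ξ = profileK μ ξ * modeS μ f (2 * Real.pi * ξ ^ 2) t := by
  rw [profileG, profileK]
  exact (mul_assoc _ _ _).symm

theorem norm_profileK (μ ξ : ℝ) : ‖profileK μ ξ‖ = 2 * (2 * Real.pi) ^ (-μ) * |ξ| ^ (-μ) := by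
  rw [profileK, norm_mul, norm_two_exp_quarter, Complex.norm_cpow_real, norm_two_pi_mul_I,
    Real.mul_rpow Real.two_pi_pos.le (abs_nonneg _), mul_assoc]

theorem profileF_eq (μ : ℝ) (f φ : ℝ → ℂ) (ξ τ : ℝ) :
    profileF μ f φ ξ τ = profileK μ ξ * modeF μ f φ (2 * Real.pi * ξ ^ 2) τ := by
  unfold profileF modeF
  rw [fourier_eq_integral_exp_mul, fourier_eq_integral_exp_mul, ← integral_const_mul]
  refine integral_congr_ae (ae_of_all _ fun t => ?_)
  simp only
  rw [profileG_eq]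
  ring

theorem measurable_profileF {f φ : ℝ → ℂ} (hf : ContDiff ℝ ∞ f) (hc : HasCompactSupport f) (hφ : Continuous φ)
    (μ : ℝ) : Measurable (Function.uncurry (profileF μ f φ)) := by
  have h1 := measurable_profileG hf hc μ
  have hm : Measurable fun r : (ℝ × ℝ) × ℝ => (r.2, r.1.1) := by fun_prop
  have h2 := h1.comp hm
  have hφm := hφ.measurable
  have h3 : Measurable fun r : (ℝ × ℝ) × ℝ =>
      Complex.exp (-(2 * Real.pi * r.1.2 * Complex.I) * r.2) * (φ r.2 * profileG μ f r.2 r.1.1) := by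
    refine Measurable.mul (by fun_prop) (Measurable.mul (by fun_prop) ?_)
    exact h2
  have h4 := (StronglyMeasurable.integral_prod_right (ν := volume)
    (f := fun (q : ℝ × ℝ) (t : ℝ) => Complex.exp (-(2 * Real.pi * q.2 * Complex.I) * t) *
      (φ t * profileG μ f t q.1)) h3.stronglyMeasurable).measurable
  convert h4 using 1
  ext q
  unfold Function.uncurry profileF
  rw [fourier_eq_integral_exp_mul]

theorem integrable_jap {r : ℝ} (hr : r < -1) : Integrable (jap r) := by
  refine ((integrable_one_add_abs_rpow hr).const_mul ((2 * Real.pi) ^ |r|)).mono'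
    (continuous_jap _).aestronglyMeasurable (ae_of_all _ fun τ => ?_)
  rw [Real.norm_of_nonneg (jap_pos _ _).le]
  exact jap_le_one_add_abs _ _

theorem exists_norm_profileF_le {f φ : ℝ → ℂ} (hf : ContDiff ℝ ∞ f) (hc : HasCompactSupport f)
    (hφ : ContDiff ℝ ∞ φ) (hφc : HasCompactSupport φ) (μ : ℝ) :
    ∃ C : ℝ, 0 ≤ C ∧ ∀ ξ τ, ‖profileF μ f φ ξ τ‖ ≤ C * (|ξ| ^ (-μ) * (1 + |ξ|) ^ (-2 : ℝ) *
      (jap (-2) (τ - 2 * Real.pi * ξ ^ 2) + jap (-2) τ)) := by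
  obtain ⟨C, hC0, hC⟩ := exists_norm_modeF_le_integrable hf hc hφ hφc μ
  have hpi := Real.pi_pos
  refine ⟨2 * (2 * Real.pi) ^ (-μ) * C * 2, by positivity, fun ξ τ => ?_⟩
  have h1 : jap (-1) (2 * Real.pi * ξ ^ 2) ≤ 2 * (1 + |ξ|) ^ (-2 : ℝ) := by
    unfold jap
    rw [Real.rpow_neg_one, show 2 * Real.pi * (2 * Real.pi * ξ ^ 2) = 4 * Real.pi ^ 2 * ξ ^ 2 by ring]
    exact one_add_sq_inv_le ξ
  have p1 := jap_pos (-2) (τ - 2 * Real.pi * ξ ^ 2)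
  have p2 := jap_pos (-2) τ
  rw [profileF_eq, norm_mul, norm_profileK]
  calc _ ≤ 2 * (2 * Real.pi) ^ (-μ) * |ξ| ^ (-μ) * (C * (2 * (1 + |ξ|) ^ (-2 : ℝ)) *
        (jap (-2) (τ - 2 * Real.pi * ξ ^ 2) + jap (-2) τ)) := by
        refine mul_le_mul_of_nonneg_left ((hC _ τ).trans ?_) (by positivity)
        gcongr
    _ = _ := by ring

theorem integrable_profileF_right {f φ : ℝ → ℂ} (hf : ContDiff ℝ ∞ f) (hc : HasCompactSupport f)
    (hφ : ContDiff ℝ ∞ φ) (hφc : HasCompactSupport φ) (μ ξ : ℝ) : Integrable (profileF μ f φ ξ) := by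
  obtain ⟨C, hC0, hC⟩ := exists_norm_profileF_le hf hc hφ hφc μ
  have i1 := integrable_jap (r := -2) (by norm_num)
  exact (((((i1.comp_sub_right (2 * Real.pi * ξ ^ 2)).add i1).const_mul _).const_mul C)).mono'
    ((measurable_profileF hf hc hφ.continuous μ).comp measurable_prodMk_left).aestronglyMeasurable
    (ae_of_all _ fun τ => hC ξ τ)

theorem integrable_profileF {f φ : ℝ → ℂ} (hf : ContDiff ℝ ∞ f) (hc : HasCompactSupport f)
    (hφ : ContDiff ℝ ∞ φ) (hφc : HasCompactSupport φ) {μ : ℝ} (h1 : -1 < μ) (h2 : μ < 1) :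
    Integrable (Function.uncurry (profileF μ f φ)) (volume.prod volume) := by
  obtain ⟨C, hC0, hC⟩ := exists_norm_profileF_le hf hc hφ hφc μ
  have hq : Integrable fun ξ : ℝ => |ξ| ^ (-μ) * (1 + |ξ|) ^ (-2 : ℝ) :=
    integrable_abs_rpow_mul_one_add_rpow (by linarith) (by linarith)
  have i1 := integrable_jap (r := -2) (by norm_num)
  have hj := (continuous_jap (-2)).measurable
  have hI1 : Integrable (fun r : ℝ × ℝ => (|r.1| ^ (-μ) * (1 + |r.1|) ^ (-2 : ℝ)) * jap (-2) r.2)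
      (volume.prod volume) := hq.mul_prod i1
  have hI2 : Integrable (fun r : ℝ × ℝ => (|r.1| ^ (-μ) * (1 + |r.1|) ^ (-2 : ℝ)) *
      jap (-2) (r.2 - 2 * Real.pi * r.1 ^ 2)) (volume.prod volume) := by
    rw [integrable_prod_iff (Measurable.aestronglyMeasurable (by fun_prop))]
    refine ⟨ae_of_all _ fun ξ => (i1.comp_sub_right (2 * Real.pi * ξ ^ 2)).const_mul (|ξ| ^ (-μ) * (1 + |ξ|) ^ (-2 : ℝ)), ?_⟩
    have : ∀ ξ : ℝ, ∫ τ : ℝ, ‖(|ξ| ^ (-μ) * (1 + |ξ|) ^ (-2 : ℝ)) * jap (-2) (τ - 2 * Real.pi * ξ ^ 2)‖ =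
        (|ξ| ^ (-μ) * (1 + |ξ|) ^ (-2 : ℝ)) * ∫ τ, jap (-2) τ := by
      intro ξ
      rw [← integral_sub_right_eq_self (jap (-2)) (2 * Real.pi * ξ ^ 2), ← integral_const_mul]
      refine integral_congr_ae (ae_of_all _ fun τ => ?_)
      have := jap_pos (-2) (τ - 2 * Real.pi * ξ ^ 2)
      simp only
      rw [Real.norm_of_nonneg (by positivity)]
    simp only
    simp_rw [this]
    exact hq.mul_const _
  refine ((hI2.add hI1).const_mul C).mono' (measurable_profileF hf hc hφ.continuous μ).aestronglyMeasurable
    (ae_of_all _ fun r => ?_)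
  refine (hC r.1 r.2).trans (le_of_eq ?_)
  simp only [Pi.add_apply]
  ring

theorem fourierInv_profileF {f φ : ℝ → ℂ} (hf : IsSmoothHalfLine f) (hc : HasCompactSupport f)
    (hφ : ContDiff ℝ ∞ φ) (hφc : HasCompactSupport φ) {μ : ℝ} (h1 : -1 < μ) (h2 : μ < 1)
    (p : EuclideanSpace ℝ (Fin 2)) :
    𝓕⁻ (fun q : EuclideanSpace ℝ (Fin 2) => profileF μ f φ (q 0) (q 1)) p =
      φ (p 1) * forcingFamily μ f (p 0) (p 1) := by
  rw [fourierInv_coords (integrable_profileF hf.contDiff hc hφ hφc h1 h2),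
    forcingFamily_eq_fourierInv hf hc h1 h2, Real.fourierInv_eq', ← integral_const_mul]
  refine integral_congr_ae (ae_of_all _ fun ξ => ?_)
  have hcont : Continuous fun t => φ t * profileG μ f t ξ := by
    have h3 := continuous_modeS_right hf.contDiff hc μ (2 * Real.pi * ξ ^ 2)
    have h4 := hφ.continuous
    simp_rw [profileG_eq]
    fun_prop
  have hinv : 𝓕⁻ (profileF μ f φ ξ) = fun t => φ t * profileG μ f t ξ :=
    hcont.fourierInv_fourier_eq (hcont.integrable_of_hasCompactSupport hφc.mul_right)
      (integrable_profileF_right hf.contDiff hc hφ hφc μ ξ)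
  simp only [hinv, RCLike.inner_apply, conj_trivial, smul_eq_mul]
  rw [show ((2 * Real.pi * (p 0 * ξ) : ℝ) : ℂ) * Complex.I = 2 * Real.pi * ξ * p 0 * Complex.I by
    push_cast; ring]
  ring

end ProfileFourier

/-! ### The Bourgain weight in iterated coordinates -/

section BourgainWeight

/-- The weight of the Bourgain space `X^{s,b}`. -/
noncomputable def bourgainWeight (s b : ℝ) (q : EuclideanSpace ℝ (Fin 2)) : ℝ :=
  (1 + |2 * Real.pi * q 0|) ^ (2 * s) * (1 + |2 * Real.pi * q 1 - (2 * Real.pi * q 0) ^ 2|) ^ (2 * b)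

theorem bourgainWeight_eq (s b : ℝ) (q : EuclideanSpace ℝ (Fin 2)) :
    bourgainWeight s b q = jap (2 * s) (q 0) * jap (2 * b) (q 1 - 2 * Real.pi * q 0 ^ 2) := by
  unfold bourgainWeight jap
  rw [show 2 * Real.pi * q 1 - (2 * Real.pi * q 0) ^ 2 = 2 * Real.pi * (q 1 - 2 * Real.pi * q 0 ^ 2) by ring]

theorem isTemperedWeight_bourgainWeight (s b : ℝ) : IsTemperedWeight (bourgainWeight s b) := by
  have hb : bourgainWeight s b = fun q => jap (2 * s) (q 0) * jap (2 * b) (q 1 - 2 * Real.pi * q 0 ^ 2) :=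
    funext (bourgainWeight_eq s b)
  obtain ⟨C1, n1, h1⟩ := (isTemperedWeight_jap (2 * s)).inv_le
  obtain ⟨C2, n2, h2⟩ := (isTemperedWeight_jap (2 * b)).inv_le
  rw [hb]
  refine ⟨?_, fun q => mul_pos (jap_pos _ _) (jap_pos _ _), C1 * (C2 * 8 ^ n2), n1 + 2 * n2, fun q => ?_⟩
  · have a1 := continuous_jap (2 * s)
    have a2 := continuous_jap (2 * b)
    fun_prop
  have hq : 0 ≤ ‖q‖ := norm_nonneg q
  have q0 : |q 0| ≤ ‖q‖ := PiLp.norm_apply_le q 0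
  have q1 : |q 1| ≤ ‖q‖ := PiLp.norm_apply_le q 1
  have hC1 : 0 < C1 := by
    have := (inv_pos.2 (jap_pos (2 * s) 0)).trans_le (h1 0)
    simpa using this
  have hC2 : 0 < C2 := by
    have := (inv_pos.2 (jap_pos (2 * b) 0)).trans_le (h2 0)
    simpa using this
  have hlt := Real.pi_lt_d2
  have hpi := Real.pi_pos
  have e2 : 1 + |q 1 - 2 * Real.pi * q 0 ^ 2| ≤ 8 * (1 + ‖q‖) ^ 2 := by
    have b1 : |q 1 - 2 * Real.pi * q 0 ^ 2| ≤ |q 1| + 2 * Real.pi * |q 0| ^ 2 := by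
      refine (abs_sub _ _).trans ?_
      rw [abs_of_nonneg (by positivity : 0 ≤ 2 * Real.pi * q 0 ^ 2), sq_abs]
    have b2 : |q 0| ^ 2 ≤ ‖q‖ ^ 2 := by gcongr
    nlinarith [sq_nonneg (‖q‖)]
  rw [mul_inv]
  have c1 := h1 (q 0)
  have c2 := h2 (q 1 - 2 * Real.pi * q 0 ^ 2)
  rw [Real.norm_eq_abs] at c1 c2
  calc _ ≤ (C1 * (1 + ‖q‖) ^ n1) * (C2 * (8 * (1 + ‖q‖) ^ 2) ^ n2) := by
        refine mul_le_mul (c1.trans ?_) (c2.trans ?_) (inv_pos.2 (jap_pos _ _)).le (by positivity)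
        · gcongr
        · gcongr
    _ = _ := by rw [mul_pow, ← pow_mul, pow_add]; ring

instance fact_isTemperedWeight_bourgainWeight (s b : ℝ) : Fact (IsTemperedWeight (bourgainWeight s b)) :=
  ⟨isTemperedWeight_bourgainWeight s b⟩

theorem lintegral_bourgainWeight_mul {G : ℝ → ℝ → ℝ≥0∞} (hG : Measurable (Function.uncurry G)) (s b : ℝ) :
    ∫⁻ q : EuclideanSpace ℝ (Fin 2), ENNReal.ofReal (bourgainWeight s b q) * G (q 0) (q 1) =
      ∫⁻ ξ, ∫⁻ τ, ENNReal.ofReal (jap (2 * s) ξ) *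
        (ENNReal.ofReal (jap (2 * b) (τ - 2 * Real.pi * ξ ^ 2)) * G ξ τ) := by
  have a1 := (continuous_jap (2 * s)).measurable
  have a2 := (continuous_jap (2 * b)).measurable
  have hm : Measurable fun r : ℝ × ℝ => ENNReal.ofReal (jap (2 * s) r.1) *
        (ENNReal.ofReal (jap (2 * b) (r.2 - 2 * Real.pi * r.1 ^ 2)) * Function.uncurry G r) := by
    fun_prop
  refine Eq.trans ?_ ((measurePreserving_coords.lintegral_comp hm).trans (lintegral_prod _ hm.aemeasurable))
  refine lintegral_congr fun q => ?_
  rw [bourgainWeight_eq, ENNReal.ofReal_mul (jap_pos _ _).le, mul_assoc]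
  rfl

end BourgainWeight

/-! ### The two terms of the Bourgain estimate -/

section BourgainEstimate

/-- The substitution η = 2πξ² reduces to the convolution bound with p = -μ - 1/2, e = s - μ - 1/2
and c = 2 - 2β. Its conditions p > -1, -1 < e < 0 and c > 1 read μ < 1/2, s - 1/2 < μ < s + 1/2 and
β < 1/2. -/
theorem exists_lintegral_profileK_conv_le {s μ β : ℝ} (h1 : μ < 1 / 2) (h2 : s - 1 / 2 < μ)
    (h3 : μ < s + 1 / 2) (hβ : β < 1 / 2) : ∃ C : ℝ≥0, ∀ τ, ∫⁻ ξ, ENNReal.ofReal (jap (2 * s) ξ) *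
      (‖profileK μ ξ‖ₑ ^ 2 * ENNReal.ofReal (jap (2 * β - 2) (τ - 2 * Real.pi * ξ ^ 2))) ≤
      C * ENNReal.ofReal (jap (s - μ - 1 / 2) τ) := by
  obtain ⟨C1, hC1, hb⟩ := exists_bracket_mul_rpow_le s μ
  obtain ⟨C2, hC2⟩ := exists_lintegral_powW_conv_le (p := -μ - 1 / 2) (e := s - μ - 1 / 2) (c := 2 - 2 * β)
    (by linarith) (by linarith) (by linarith) (by linarith)
  have hpi := Real.pi_pos
  set K : ℝ := (2 * (2 * Real.pi) ^ (-μ)) ^ 2 * C1 * (2 * Real.pi) ^ |2 * β - 2| with hK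
  set M : ℝ := (2 * Real.pi) ^ |s - μ - 1 / 2| with hM
  refine ⟨K.toNNReal * (C2 * M.toNNReal), fun τ => ?_⟩
  have hp : ∀ ξ : ℝ, ξ ≠ 0 → ENNReal.ofReal (jap (2 * s) ξ) *
      (‖profileK μ ξ‖ₑ ^ 2 * ENNReal.ofReal (jap (2 * β - 2) (τ - 2 * Real.pi * ξ ^ 2))) ≤
      ENNReal.ofReal K * (ENNReal.ofReal |ξ| * (fun η => ENNReal.ofReal (powW (-μ - 1 / 2) (s - μ - 1 / 2 - (-μ - 1 / 2)) η *
        (1 + |τ - η|) ^ (-(2 - 2 * β)))) (2 * Real.pi * ξ ^ 2)) := by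
    intro ξ hξ
    simp only
    set η := 2 * Real.pi * ξ ^ 2 with hη
    have hw := powW_nonneg (-μ - 1 / 2) s η
    rw [enorm_sq_eq_ofReal, ← ENNReal.ofReal_mul (by positivity), ← ENNReal.ofReal_mul (jap_pos _ _).le,
      ← ENNReal.ofReal_mul (abs_nonneg _), ← ENNReal.ofReal_mul (by positivity)]
    refine ENNReal.ofReal_le_ofReal ?_
    have b1 := hb ξ hξ
    rw [powW_sq, ← hη, show 2 * ((-μ - 1 / 2) / 2) = -μ - 1 / 2 by ring, show 2 * (s / 2) = s by ring] at b1
    have b2 := jap_le_one_add_abs (2 * β - 2) (τ - η)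
    have b3 := jap_pos (2 * β - 2) (τ - η)
    rw [norm_profileK, show s - μ - 1 / 2 - (-μ - 1 / 2) = s by ring, show -(2 - 2 * β) = 2 * β - 2 by ring]
    calc _ = (2 * (2 * Real.pi) ^ (-μ)) ^ 2 * ((1 + |2 * Real.pi * ξ|) ^ (2 * s) * (|ξ| ^ (-μ)) ^ 2) *
          jap (2 * β - 2) (τ - η) := by
          simp only [jap]; ring
      _ ≤ (2 * (2 * Real.pi) ^ (-μ)) ^ 2 * (C1 * (|ξ| * powW (-μ - 1 / 2) s η)) *
          ((2 * Real.pi) ^ |2 * β - 2| * (1 + |τ - η|) ^ (2 * β - 2)) := by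
          gcongr
      _ = _ := by rw [hK]; ring
  calc _ ≤ ∫⁻ ξ, ENNReal.ofReal K * (ENNReal.ofReal |ξ| * (fun η => ENNReal.ofReal (powW (-μ - 1 / 2) (s - μ - 1 / 2 - (-μ - 1 / 2)) η *
        (1 + |τ - η|) ^ (-(2 - 2 * β)))) (2 * Real.pi * ξ ^ 2)) := by
        refine lintegral_mono_ae ?_
        filter_upwards [compl_mem_ae_iff.2 (measure_singleton (0 : ℝ))] with ξ hξ
        exact hp ξ hξ
    _ ≤ ENNReal.ofReal K * (C2 * ENNReal.ofReal ((1 + |τ|) ^ (s - μ - 1 / 2))) := by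
        rw [lintegral_const_mul' _ _ ENNReal.ofReal_ne_top]
        exact mul_le_mul_right ((lintegral_comp_sq_le _).trans (hC2 τ)) _
    _ ≤ ENNReal.ofReal K * (C2 * ENNReal.ofReal (M * jap (s - μ - 1 / 2) τ)) := by
        refine mul_le_mul_right (mul_le_mul_right (ENNReal.ofReal_le_ofReal ?_) _) _
        exact one_add_abs_le_jap _ _
    _ = _ := by
        rw [ENNReal.ofReal_mul (p := M) (by positivity)]
        push_cast
        simp only [ENNReal.ofReal, mul_assoc]

/-- The cut off fractional derivative is a smooth cutoff times the inverse Fourier transform of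
p^{(μ+1)/2} f̃ at abscissa 1; the factor |p|^{μ+1} raises the order of the weight by μ + 1. -/
theorem exists_lintegral_fourier_cutoff_fracIntegral_le {φ : ℝ → ℂ} (hφ : ContDiff ℝ ∞ φ)
    (hφc : HasCompactSupport φ) {μ : ℝ} (h1 : -1 < μ) (e : ℝ) : ∃ C : ℝ≥0, ∀ f : ℝ → ℂ, ContDiff ℝ ∞ f →
      HasCompactSupport f →
      ∫⁻ τ, ENNReal.ofReal (jap e τ) * ‖𝓕 (fun t => φ t * fracIntegral (-((μ + 1) / 2)) f t) τ‖ₑ ^ 2 ≤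
        C * ∫⁻ τ, ENNReal.ofReal (jap (e + (μ + 1)) τ) * ‖lap f 1 τ‖ₑ ^ 2 := by
  have h1' : ContDiff ℝ ∞ fun t : ℝ => φ t * Complex.exp t := hφ.mul Complex.ofRealCLM.contDiff.cexp
  obtain ⟨C, hC⟩ := exists_fourier_mul_fourierInv_bound h1' hφc.mul_right (e / 2)
  have hpi := Real.pi_pos
  set L : ℝ := (1 + 2 * Real.pi) ^ (μ + 1) * (2 * Real.pi) ^ |μ + 1| with hL
  refine ⟨C * L.toNNReal, fun f hf hc => ?_⟩
  have h3 : (fun t => φ t * fracIntegral (-((μ + 1) / 2)) f t) =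
      fun t => φ t * Complex.exp t * 𝓕⁻ (lapB μ f 1) t := by
    ext t; rw [fracIntegral_eq_exp_mul hf hc, mul_assoc]
  have h4 := (hC _ (rapidDecay_lapB hf hc one_pos μ).integrable).1
  rw [show 2 * (e / 2) = e by ring] at h4
  rw [h3]
  refine h4.trans ?_
  push_cast
  rw [mul_assoc]
  refine mul_le_mul_right ?_ _
  rw [← lintegral_const_mul' _ _ ENNReal.coe_ne_top]
  refine lintegral_mono fun τ => ?_
  rw [enorm_sq_eq_ofReal, enorm_sq_eq_ofReal, ← ENNReal.ofReal_mul (jap_pos _ _).le,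
    ← ENNReal.ofReal_mul (jap_pos _ _).le, show ((L.toNNReal : ℝ≥0) : ℝ≥0∞) = ENNReal.ofReal L from rfl,
    ← ENNReal.ofReal_mul (by positivity)]
  refine ENNReal.ofReal_le_ofReal ?_
  have p0 := jap_pos e τ
  have b1 : (‖linePt 1 τ‖ ^ ((μ + 1) / 2)) ^ 2 ≤ L * jap (μ + 1) τ := by
    rw [← Real.rpow_natCast, ← Real.rpow_mul (norm_nonneg _), show (μ + 1) / 2 * ((2 : ℕ) : ℝ) = μ + 1 by
      push_cast; ring]
    calc _ ≤ ((1 + 2 * Real.pi) * (1 + |τ|)) ^ (μ + 1) := by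
          refine Real.rpow_le_rpow (norm_nonneg _) (norm_linePt_le zero_le_one τ) (by linarith)
      _ = (1 + 2 * Real.pi) ^ (μ + 1) * (1 + |τ|) ^ (μ + 1) := Real.mul_rpow (by positivity) (by positivity)
      _ ≤ (1 + 2 * Real.pi) ^ (μ + 1) * ((2 * Real.pi) ^ |μ + 1| * jap (μ + 1) τ) := by
          gcongr
          exact one_add_abs_le_jap _ _
      _ = _ := by rw [hL, mul_assoc]
  rw [norm_lapB, mul_pow, jap_add]
  calc _ ≤ jap e τ * (L * jap (μ + 1) τ * ‖lap f 1 τ‖ ^ 2) := by gcongr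
    _ = _ := by ring

/-- Plancherel in time and Fubini reduce to the space estimate at each fixed time, which is uniform
in `t` and so integrates against |φ(t)|². -/
theorem exists_lintegral_profileF_le {s μ : ℝ} (h1 : -1 < μ) (h2 : μ < 1 / 2) (h3 : s - 3 / 2 < μ)
    (h4 : μ < s + 1 / 2) {φ : ℝ → ℂ} (hφ : Continuous φ) (hφc : HasCompactSupport φ) :
    ∃ C : ℝ≥0, ∀ f : ℝ → ℂ, IsSmoothHalfLine f → HasCompactSupport f →
      ∫⁻ ξ, ∫⁻ τ, ENNReal.ofReal (jap (2 * s) ξ) * ‖profileF μ f φ ξ τ‖ₑ ^ 2 ≤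
        C * ∫⁻ τ, ENNReal.ofReal (jap (2 * ((2 * s + 1) / 4)) τ) * ‖𝓕 f τ‖ₑ ^ 2 := by
  obtain ⟨C, hC⟩ := lintegral_sobolev_profileG_le h1 h2 h3 h4
  have hint : ∫⁻ t, ‖φ t‖ₑ ^ 2 < ⊤ := by
    have : Integrable fun t => ‖φ t‖ ^ 2 :=
      (by fun_prop : Continuous _).integrable_of_hasCompactSupport
        (hφc.comp_left (g := fun z : ℂ => ‖z‖ ^ 2) (by simp))
    refine lt_of_eq_of_lt (lintegral_congr fun t => ?_) this.lintegral_lt_top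
    rw [enorm_sq_eq_ofReal]
  refine ⟨(∫⁻ t, ‖φ t‖ₑ ^ 2).toNNReal * C, fun f hf hc => ?_⟩
  have hpl : ∀ ξ, ∫⁻ τ, ‖profileF μ f φ ξ τ‖ₑ ^ 2 = ∫⁻ t, ‖φ t * profileG μ f t ξ‖ₑ ^ 2 := by
    intro ξ
    have hcont : Continuous fun t => φ t * profileG μ f t ξ := by
      have h3 := continuous_modeS_right hf.contDiff hc μ (2 * Real.pi * ξ ^ 2)
      simp_rw [profileG_eq]
      fun_prop
    exact lintegral_fourier_sq (hcont.integrable_of_hasCompactSupport hφc.mul_right)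
      (hcont.memLp_of_hasCompactSupport hφc.mul_right)
  have hm := measurable_profileG hf.contDiff hc μ
  have hj := (continuous_jap (2 * s)).measurable
  have hφm := hφ.measurable
  calc _ = ∫⁻ ξ, ∫⁻ t, ENNReal.ofReal (jap (2 * s) ξ) * ‖φ t * profileG μ f t ξ‖ₑ ^ 2 := by
        refine lintegral_congr fun ξ => ?_
        rw [lintegral_const_mul' _ _ ENNReal.ofReal_ne_top, hpl, lintegral_const_mul' _ _ ENNReal.ofReal_ne_top]
    _ = ∫⁻ t, ∫⁻ ξ, ENNReal.ofReal (jap (2 * s) ξ) * ‖φ t * profileG μ f t ξ‖ₑ ^ 2 := by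
        refine lintegral_lintegral_swap (Measurable.aemeasurable ?_)
        have hm' := hm.comp measurable_swap
        have : Measurable fun r : ℝ × ℝ => profileG μ f r.2 r.1 := hm'
        unfold Function.uncurry
        fun_prop
    _ ≤ ∫⁻ t, ‖φ t‖ₑ ^ 2 * (C * ∫⁻ τ, ENNReal.ofReal (jap (2 * ((2 * s + 1) / 4)) τ) * ‖𝓕 f τ‖ₑ ^ 2) := by
        refine lintegral_mono fun t => ?_
        simp only
        refine le_trans (le_of_eq ?_) (mul_le_mul_right (hC f hf hc t) _)
        rw [← lintegral_const_mul' _ _ (by simp)]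
        refine lintegral_congr fun ξ => ?_
        rw [enorm_mul, mul_pow, mul_left_comm]
        rfl
    _ = _ := by
        rw [lintegral_mul_const _ (by fun_prop)]
        push_cast
        rw [ENNReal.coe_toNNReal hint.ne, mul_assoc]

end BourgainEstimate

/-! ### Part (c): the Bourgain estimate and its extension -/

theorem lintegral_lintegral_const_mul_add {c : ℝ≥0∞} (hc : c ≠ ⊤) {G₁ G₂ : ℝ → ℝ → ℝ≥0∞}
    (h : Measurable (Function.uncurry G₁)) : ∫⁻ ξ, ∫⁻ τ, (c * G₁ ξ τ + c * G₂ ξ τ) =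
      c * (∫⁻ ξ, ∫⁻ τ, G₁ ξ τ) + c * ∫⁻ ξ, ∫⁻ τ, G₂ ξ τ := by
  have h1 : ∀ ξ, ∫⁻ τ, (c * G₁ ξ τ + c * G₂ ξ τ) = c * (∫⁻ τ, G₁ ξ τ) + c * ∫⁻ τ, G₂ ξ τ := by
    intro ξ
    have h2 : Measurable (G₁ ξ) := h.comp (measurable_prodMk_left (x := ξ))
    rw [lintegral_add_left (h2.const_mul c), lintegral_const_mul' _ _ hc, lintegral_const_mul' _ _ hc]
  have h3 : Measurable fun ξ => ∫⁻ τ, G₁ ξ τ := h.lintegral_prod_right'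
  simp_rw [h1]
  rw [lintegral_add_left (h3.const_mul c), lintegral_const_mul' _ _ hc, lintegral_const_mul' _ _ hc]

/-- Dividing the mode identity by 1 + 2πi(τ - η) turns the modulation weight of order 2b into one of
order 2b - 2 < 0. On the mode term it is bounded by 1; on the forcing term it is integrated in ξ,
leaving order s - μ - 1/2 in τ, which the μ + 1 of the fractional derivative completes to s + 1/2.
-/
theorem exists_lintegral_bourgainWeight_profileF_le {s μ b : ℝ} (hb : b < 1 / 2) (h1 : -1 < μ) (h2 : μ < 1 / 2)
    (h3 : s - 1 / 2 < μ) (h4 : μ < s + 1 / 2) {φ : ℝ → ℂ} (hφ : ContDiff ℝ ∞ φ) (hφc : HasCompactSupport φ) :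
    ∃ C : ℝ≥0, ∀ f : ℝ → ℂ, IsSmoothHalfLine f → HasCompactSupport f →
      ∫⁻ q : EuclideanSpace ℝ (Fin 2), ENNReal.ofReal (bourgainWeight s b q) * ‖profileF μ f φ (q 0) (q 1)‖ₑ ^ 2 ≤
        C * ((∫⁻ τ, ENNReal.ofReal (jap (2 * ((2 * s + 1) / 4)) τ) * ‖𝓕 f τ‖ₑ ^ 2) +
          ∫⁻ τ, ENNReal.ofReal (jap (2 * ((2 * s + 1) / 4)) τ) * ‖lap f 1 τ‖ₑ ^ 2) := by
  have hφ' : ContDiff ℝ ∞ fun t => φ t + deriv φ t := hφ.add (contDiff_infty_iff_deriv.1 hφ).2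
  have hφc' : HasCompactSupport fun t => φ t + deriv φ t := hφc.add hφc.deriv
  obtain ⟨C1, hC1⟩ := exists_lintegral_profileF_le h1 h2 (by linarith) h4 hφ'.continuous hφc'
  -- Replacing `b` by `max b 0` only enlarges the weight and keeps it below 1/2.
  obtain ⟨C2, hC2⟩ := exists_lintegral_profileK_conv_le h2 h3 h4 (β := max b 0)
    (max_lt hb (by norm_num))
  obtain ⟨C3, hC3⟩ := exists_lintegral_fourier_cutoff_fracIntegral_le hφ hφc h1 (s - μ - 1 / 2)
  rw [show s - μ - 1 / 2 + (μ + 1) = 2 * ((2 * s + 1) / 4) by ring] at hC3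
  refine ⟨16 * (C1 + C2 * C3), fun f hf hc => ?_⟩
  have hF := measurable_profileF hf.contDiff hc hφ.continuous μ
  have hF' := measurable_profileF hf.contDiff hc hφ'.continuous μ
  set Q : ℝ → ℂ := 𝓕 (fun t => φ t * fracIntegral (-((μ + 1) / 2)) f t) with hQ
  have hQm : Measurable Q := by
    have : Integrable fun t => φ t * fracIntegral (-((μ + 1) / 2)) f t := by
      have h5 : Continuous (𝓕⁻ (lapB μ f 1)) :=
        continuous_fourierInv (rapidDecay_lapB hf.contDiff hc one_pos μ).integrable
      have h6 := hφ.continuous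
      simp_rw [fracIntegral_eq_exp_mul hf.contDiff hc]
      exact (by fun_prop : Continuous _).integrable_of_hasCompactSupport hφc.mul_right
    exact (continuous_fourier this).measurable
  have hj := (continuous_jap (2 * s)).measurable
  have hj' := (continuous_jap (2 * max b 0 - 2)).measurable
  have hKm : Measurable (profileK μ) := by unfold profileK; fun_prop
  rw [lintegral_bourgainWeight_mul (G := fun ξ τ => ‖profileF μ f φ ξ τ‖ₑ ^ 2) (hF.enorm.pow_const 2)]
  have hpt : ∀ ξ τ, ENNReal.ofReal (jap (2 * s) ξ) * (ENNReal.ofReal (jap (2 * b) (τ - 2 * Real.pi * ξ ^ 2)) *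
      ‖profileF μ f φ ξ τ‖ₑ ^ 2) ≤
      16 * (ENNReal.ofReal (jap (2 * s) ξ) * ‖profileF μ f (fun t => φ t + deriv φ t) ξ τ‖ₑ ^ 2) +
      16 * (ENNReal.ofReal (jap (2 * s) ξ) * (‖profileK μ ξ‖ₑ ^ 2 *
        ENNReal.ofReal (jap (2 * max b 0 - 2) (τ - 2 * Real.pi * ξ ^ 2))) * ‖Q τ‖ₑ ^ 2) := by
    intro ξ τ
    set y := τ - 2 * Real.pi * ξ ^ 2 with hy
    have hn : ‖profileF μ f φ ξ τ‖ ≤ 2 * jap (-1) y *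
        (‖profileF μ f (fun t => φ t + deriv φ t) ξ τ‖ + ‖profileK μ ξ‖ * ‖Q τ‖) := by
      rw [profileF_eq, profileF_eq, norm_mul, norm_mul, ← mul_add]
      refine (mul_le_mul_of_nonneg_left (norm_modeF_le hf.contDiff hc hφ hφc μ (2 * Real.pi * ξ ^ 2) τ)
        (norm_nonneg _)).trans (le_of_eq ?_)
      ring
    have hw : jap (2 * b) y * jap (-1) y ^ 2 ≤ jap (2 * max b 0 - 2) y := by
      rw [← jap_two_mul, ← jap_add]
      exact jap_le_jap (by have := le_max_left b 0; linarith) y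
    have hw1 : jap (2 * max b 0 - 2) y ≤ 1 := by
      have := jap_le_jap (r := 2 * max b 0 - 2) (q := 0) (by
        have : max b 0 ≤ 1 := max_le (by linarith) zero_le_one
        linarith) y
      simpa [jap] using this
    have p1 := jap_pos (2 * s) ξ
    have p2 := jap_pos (2 * b) y
    have p3 := jap_pos (2 * max b 0 - 2) y
    have p4 := jap_pos (-1) y
    simp only [enorm_sq_eq_ofReal]
    rw [← ENNReal.ofReal_mul p2.le, ← ENNReal.ofReal_mul p1.le, ← ENNReal.ofReal_mul p1.le,
      ← ENNReal.ofReal_mul (by positivity), ← ENNReal.ofReal_mul (by positivity),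
      ← ENNReal.ofReal_mul (by positivity), show (16 : ℝ≥0∞) = ENNReal.ofReal 16 by simp,
      ← ENNReal.ofReal_mul (by positivity), ← ENNReal.ofReal_mul (by positivity),
      ← ENNReal.ofReal_add (by positivity) (by positivity)]
    refine ENNReal.ofReal_le_ofReal ?_
    set A := ‖profileF μ f (fun t => φ t + deriv φ t) ξ τ‖
    set B := ‖profileK μ ξ‖ * ‖Q τ‖ with hB
    have hAB : (A + B) ^ 2 ≤ 2 * A ^ 2 + 2 * B ^ 2 := by nlinarith [sq_nonneg (A - B)]
    calc _ ≤ jap (2 * s) ξ * (jap (2 * b) y * (2 * jap (-1) y * (A + B)) ^ 2) := by gcongr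
      _ = 4 * jap (2 * s) ξ * (jap (2 * b) y * jap (-1) y ^ 2) * (A + B) ^ 2 := by ring
      _ ≤ 4 * jap (2 * s) ξ * jap (2 * max b 0 - 2) y * (2 * A ^ 2 + 2 * B ^ 2) := by gcongr
      _ = 8 * (jap (2 * s) ξ * (A ^ 2 * jap (2 * max b 0 - 2) y)) +
          8 * (jap (2 * s) ξ * (‖profileK μ ξ‖ ^ 2 * jap (2 * max b 0 - 2) y) * ‖Q τ‖ ^ 2) := by rw [hB]; ring
      _ ≤ 16 * (jap (2 * s) ξ * (A ^ 2 * 1)) +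
          16 * (jap (2 * s) ξ * (‖profileK μ ξ‖ ^ 2 * jap (2 * max b 0 - 2) y) * ‖Q τ‖ ^ 2) := by
          gcongr <;> norm_num
      _ = _ := by rw [mul_one]
  have hm1 : Measurable (Function.uncurry fun ξ τ => ENNReal.ofReal (jap (2 * s) ξ) *
      ‖profileF μ f (fun t => φ t + deriv φ t) ξ τ‖ₑ ^ 2) := by
    have h5 := hF'.enorm.pow_const 2
    unfold Function.uncurry at h5 ⊢
    fun_prop
  have hm2 : Measurable (Function.uncurry fun ξ τ => ENNReal.ofReal (jap (2 * s) ξ) * (‖profileK μ ξ‖ₑ ^ 2 *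
      ENNReal.ofReal (jap (2 * max b 0 - 2) (τ - 2 * Real.pi * ξ ^ 2))) * ‖Q τ‖ₑ ^ 2) := by
    unfold Function.uncurry
    fun_prop
  have hterm2 : ∫⁻ ξ, ∫⁻ τ, ENNReal.ofReal (jap (2 * s) ξ) * (‖profileK μ ξ‖ₑ ^ 2 *
      ENNReal.ofReal (jap (2 * max b 0 - 2) (τ - 2 * Real.pi * ξ ^ 2))) * ‖Q τ‖ₑ ^ 2 ≤
      C2 * (C3 * ∫⁻ τ, ENNReal.ofReal (jap (2 * ((2 * s + 1) / 4)) τ) * ‖lap f 1 τ‖ₑ ^ 2) := by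
    rw [lintegral_lintegral_swap hm2.aemeasurable]
    calc _ ≤ ∫⁻ τ, C2 * (ENNReal.ofReal (jap (s - μ - 1 / 2) τ) * ‖Q τ‖ₑ ^ 2) := by
          refine lintegral_mono fun τ => ?_
          simp only
          rw [lintegral_mul_const' _ _ (by simp), ← mul_assoc]
          exact mul_le_mul_left (hC2 τ) _
      _ ≤ _ := by
          rw [lintegral_const_mul' _ _ ENNReal.coe_ne_top]
          exact mul_le_mul_right (hC3 f hf.contDiff hc) _
  have hterm1 := hC1 f hf hc
  set N1 := ∫⁻ τ, ENNReal.ofReal (jap (2 * ((2 * s + 1) / 4)) τ) * ‖𝓕 f τ‖ₑ ^ 2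
  set N2 := ∫⁻ τ, ENNReal.ofReal (jap (2 * ((2 * s + 1) / 4)) τ) * ‖lap f 1 τ‖ₑ ^ 2
  refine (lintegral_mono fun ξ => lintegral_mono fun τ => hpt ξ τ).trans ?_
  rw [lintegral_lintegral_const_mul_add (by simp) hm1]
  calc _ ≤ 16 * (C1 * N1) + 16 * (C2 * (C3 * N2)) := by
        exact add_le_add (mul_le_mul_right hterm1 _) (mul_le_mul_right hterm2 _)
    _ = 16 * ((C1 : ℝ≥0∞) * N1 + (C2 * C3) * N2) := by ring
    _ ≤ 16 * (((C1 : ℝ≥0∞) + C2 * C3) * N1 + ((C1 : ℝ≥0∞) + C2 * C3) * N2) := by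
        refine mul_le_mul_right (add_le_add (mul_le_mul_left ?_ _) (mul_le_mul_left ?_ _)) _
        · exact le_self_add
        · exact le_add_self
    _ = _ := by push_cast; ring

theorem exists_bourgain_extension {s μ b : ℝ} (hb : b < 1 / 2) (h1 : -1 < μ) (h2 : μ < 1 / 2)
    (h3 : s - 1 / 2 < μ) (h4 : μ < s + 1 / 2) {ψ : ℝ → ℝ} (hψ : IsCutoff ψ) :
    ∃ (c : ℝ≥0) (T : 𝓢'(ℝ, ℂ) →ₗ[ℂ] 𝓢'(EuclideanSpace ℝ (Fin 2), ℂ)),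
      (∀ (f : ℝ → ℂ) (F : 𝓢'(ℝ, ℂ)), IsSmoothHalfLine f → IsFunction F f → sobolevNorm ((2 * s + 1) / 4) F < ⊤ →
        IsFunction (T F) (fun p => (ψ (p 1) : ℂ) * forcingFamily μ f (p 0) (p 1))) ∧
      ∀ F : 𝓢'(ℝ, ℂ), sobolevNorm ((2 * s + 1) / 4) F < ⊤ →
        bourgainNorm s b (T F) ≤ c * sobolevNorm ((2 * s + 1) / 4) F := by
  have hpi := Real.pi_pos
  have h2' : μ < 1 := by linarith
  have hk : ENNReal.ofReal (2 * Real.pi) ≠ 0 := by simp [hpi]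
  have hk2 : ENNReal.ofReal ((2 * Real.pi) ^ 2) ≠ 0 := by simp
  have hφ := hψ.contDiff_complex
  have hφc := hψ.hasCompactSupport
  have hχ := contDiff_wideCutoff hψ
  have hχc := hasCompactSupport_wideCutoff hψ
  set σ : ℝ := (2 * s + 1) / 4 with hσ
  obtain ⟨C, hC⟩ := exists_lintegral_bourgainWeight_profileF_le hb h1 h2 h3 h4 hφ hφc
  rw [← hσ] at hC
  obtain ⟨L1, hL1⟩ := exists_fourier_cutoff_bound hχ hχc σ
  obtain ⟨L2, hL2⟩ := exists_lap_cutoff_bound hχ hχc σ 1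
  set D : ℝ≥0 := (2 * Real.pi).toNNReal * (C * (L1 + L2)) with hD
  -- The parameter space is a single point, so the continuity requirement is that the zero
  -- distribution has zero norm.
  obtain ⟨T, hT1, hT2⟩ := exists_extension (X := Unit) (jap (2 * σ)) (bourgainWeight s b) hk
    ENNReal.ofReal_ne_top hk2 ENNReal.ofReal_ne_top ⊤ (by simp)
    IsSmoothHalfLine (fun f _ p => (ψ (p 1) : ℂ) * forcingFamily μ f (p 0) (p 1))
    isSmoothHalfLine_zero
    (fun f g hf hg => ⟨hf.add hg, fun _ p => cutoff_forcingFamily_add hψ hf hg h1 h2' (p 0) (p 1)⟩)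
    (fun c f hf => ⟨hf.mul_left contDiff_const, fun _ p => cutoff_forcingFamily_const_mul hψ hf c h1 h2' (p 0) (p 1)⟩)
    (NNReal.sqrt D)
    (fun f F hf hF hlt => by
      obtain ⟨g, hg, hlt'⟩ := exists_of_weightedNorm_lt_top hk hlt
      set f₁ : ℝ → ℂ := fun r => wideCutoff ψ r * f r with hf₁
      have hs : IsSmoothHalfLine f₁ := hf.mul_left hχ
      have hc : HasCompactSupport f₁ := hχc.mul_right
      set G : EuclideanSpace ℝ (Fin 2) → ℂ := fun q => profileF μ f₁ (fun t => (ψ t : ℂ)) (q 0) (q 1) with hG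
      have hGi : Integrable G := by
        have h5 := integrable_profileF hs.contDiff hc hφ hφc h1 h2'
        exact (measurePreserving_coords.integrable_comp_emb measurableEmbedding_coords).2 h5
      have hbound : ∫⁻ q, ENNReal.ofReal (bourgainWeight s b q) * ‖G q‖ₑ ^ 2 ≤
          (C * (L1 + L2) : ℝ≥0) * ∫⁻ τ, ENNReal.ofReal (jap (2 * σ) τ) * ‖g τ‖ₑ ^ 2 := by
        refine (hC f₁ hs hc).trans ?_
        push_cast
        rw [mul_assoc, add_mul]
        exact mul_le_mul_right (add_le_add (hL1 F f g hF hg) (hL2 F f g hF hg)) _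
      obtain ⟨u, hu⟩ := exists_isFunction_fourier (w := bourgainWeight s b) hGi.aestronglyMeasurable
        (lt_of_le_of_lt hbound (ENNReal.mul_lt_top ENNReal.coe_lt_top hlt'))
      refine ⟨fun _ => ofWeightedL2 (bourgainWeight s b) u, fun _ => ⟨?_, trivial, ?_, ?_⟩⟩
      · have h5 := isFunction_of_isFunction_fourier hGi hu
        have h6 : 𝓕⁻ G = fun p => (ψ (p 1) : ℂ) * forcingFamily μ f (p 0) (p 1) := by
          ext p
          rw [hG, fourierInv_profileF hs hc hφ hφc h1 h2', cutoff_mul_forcingFamily hψ hf]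
        rwa [h6] at h5
      · refine weightedNorm_le_of_lintegral_le hu hg ?_
        calc _ ≤ ENNReal.ofReal ((2 * Real.pi) ^ 2) * ((C * (L1 + L2) : ℝ≥0) *
              ∫⁻ τ, ENNReal.ofReal (jap (2 * σ) τ) * ‖g τ‖ₑ ^ 2) := mul_le_mul_right hbound _
          _ = _ := by
              rw [hD, sq, ENNReal.ofReal_mul (by positivity), ENNReal.coe_mul (Real.toNNReal _)]
              generalize ∫⁻ τ, ENNReal.ofReal (jap (2 * σ) τ) * ‖g τ‖ₑ ^ 2 = N
              rw [show (((2 * Real.pi).toNNReal : ℝ≥0) : ℝ≥0∞) = ENNReal.ofReal (2 * Real.pi) from rfl]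
              generalize C * (L1 + L2) = M
              ring
      · have h5 : weightedNorm (ENNReal.ofReal ((2 * Real.pi) ^ 2))
            (fun q => ENNReal.ofReal (bourgainWeight s b q)) (0 : 𝓢'(EuclideanSpace ℝ (Fin 2), ℂ)) = 0 := by
          rw [weightedNorm_eq (g := fun _ => 0) (by simpa using isFunction_zero)]
          simp
        simp only [sub_self, h5]
        exact tendsto_const_nhds)
  refine ⟨NNReal.sqrt D, (LinearMap.proj ()).comp T, fun f F hf hF hlt => hT1 f F hf hF hlt (), fun F hlt => ?_⟩
  exact (hT2 F hlt ()).2.1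

end HalfLine

/-! ### The three assertions together -/

theorem lemma6p2 (s μ : ℝ) (ψ : ℝ → ℝ) (hψ : HalfLine.IsCutoff ψ) :
    -- (a) space traces
    (s - 3 / 2 < μ → μ < s + 1 / 2 → -1 < μ → μ < 1 / 2 →
      ∃ (c : ℝ≥0) (T : 𝓢'(ℝ, ℂ) →ₗ[ℂ] (ℝ → 𝓢'(ℝ, ℂ))),
        (∀ (f : ℝ → ℂ) (F : 𝓢'(ℝ, ℂ)), HalfLine.IsSmoothHalfLine f → tsupport f ⊆ Icc 0 1 →
          HalfLine.IsFunction F f →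
          ∀ t : ℝ, HalfLine.IsFunction (T F t) (fun x => HalfLine.forcingFamily μ f x t)) ∧
        ∀ F : 𝓢'(ℝ, ℂ), HalfLine.MemHZero ((2 * s + 1) / 4) F →
          Distribution.dsupport F ⊆ Icc 0 1 →
          HalfLine.ContinuousIntoSobolev s (T F) ∧
          ∀ t : ℝ, HalfLine.sobolevNorm s (T F t) ≤
            c * HalfLine.sobolevNorm ((2 * s + 1) / 4) F) ∧
    -- (b) time traces
    (-1 < μ → μ < 1 →
      ∃ (c : ℝ≥0) (T : 𝓢'(ℝ, ℂ) →ₗ[ℂ] (ℝ → 𝓢'(ℝ, ℂ))),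
        (∀ (f : ℝ → ℂ) (F : 𝓢'(ℝ, ℂ)), HalfLine.IsSmoothHalfLine f →
          HalfLine.IsFunction F f → HalfLine.MemHZero ((2 * s + 1) / 4) F →
          ∀ x : ℝ, HalfLine.IsFunction (T F x)
            (fun t => (ψ t : ℂ) * HalfLine.forcingFamily μ f x t)) ∧
        ∀ F : 𝓢'(ℝ, ℂ), HalfLine.MemHZero ((2 * s + 1) / 4) F →
          HalfLine.ContinuousIntoHZero ((2 * s + 1) / 4) (T F) ∧
          ∀ x : ℝ, HalfLine.sobolevNorm ((2 * s + 1) / 4) (T F x) ≤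
            c * HalfLine.sobolevNorm ((2 * s + 1) / 4) F) ∧
    -- (c) Bourgain spaces
    (∀ b : ℝ, b < 1 / 2 → s - 1 / 2 < μ → μ < s + 1 / 2 → -1 < μ → μ < 1 / 2 →
      ∃ (c : ℝ≥0) (T : 𝓢'(ℝ, ℂ) →ₗ[ℂ] 𝓢'(EuclideanSpace ℝ (Fin 2), ℂ)),
        (∀ (f : ℝ → ℂ) (F : 𝓢'(ℝ, ℂ)), HalfLine.IsSmoothHalfLine f →
          HalfLine.IsFunction F f → HalfLine.MemHZero ((2 * s + 1) / 4) F →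
          HalfLine.IsFunction (T F)
            (fun p => (ψ (p 1) : ℂ) * HalfLine.forcingFamily μ f (p 0) (p 1))) ∧
        ∀ F : 𝓢'(ℝ, ℂ), HalfLine.MemHZero ((2 * s + 1) / 4) F →
          HalfLine.bourgainNorm s b (T F) ≤
            c * HalfLine.sobolevNorm ((2 * s + 1) / 4) F) := by
  refine ⟨fun h1 h2 h3 h4 => ?_, fun h1 h2 => ?_, fun b hb h1 h2 h3 h4 => ?_⟩
  · obtain ⟨c, T, hT, hc⟩ := HalfLine.exists_space_traces h3 h4 h1 h2
    exact ⟨c, T, hT, fun F hF _ => hc F hF.1⟩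
  · obtain ⟨c, T, hT, hc⟩ := HalfLine.exists_time_traces (σ := (2 * s + 1) / 4) h1 h2 hψ
    exact ⟨c, T, fun f F hf hF hm => hT f F hf hF hm.1, fun F hF => hc F hF.1⟩
  · obtain ⟨c, T, hT, hc⟩ := HalfLine.exists_bourgain_extension hb h3 h4 h1 h2 hψ
    exact ⟨c, T, fun f F hf hF hm => hT f F hf hF hm.1, fun F hF => hc F hF.1⟩
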